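/- **Setting.** Let $V$ be a two-sided Banach space over the quaternions $\mathbb H$ (with $\|av\|=\|va\|=|a|\|v\|$), $e_0=1,e_1,e_2,e_3$ the quaternionic units and $\mathbb S=\{J\in\mathbb H:\operatorname{Re}J=0,\ |J|=1\}$. Operators in $V$ are partially defined and right linear; sums, products, powers and inverses carry their natural domains, and $A\subseteq B$ means that $B$ extends $A$. An operator $T$ with two-sided linear domain has components $T_i=\frac{e_i}{4}\big(e_iTe_i-\sum_{j\ne i}e_jTe_j\big)$, so that $T=\sum_i e_iT_i$; put $\overline T=T_0-\sum_{i=1}^3e_iT_i$ and $|T|^2=\sum_iT_i^2$. We write $T\in\mathcal{KC}(V)$ if $T$ is closed and $T_iT_j=T_jT_i$ on $\operatorname{dom}|T|^2$ for all $i,j$. Let $T,\overline T\in\mathcal{KC}(V)$, and let $D\subseteq\operatorname{dom}|T|^2$ be a dense two-sided linear subspace such that $T_iv\in D$ for every $i$ and every $v\in D$ with $|T|^2v\in\operatorname{dom}T$, and such that $Q_{c,s}(T)=s^2-2sT_0+|T|^2$ with domain $D$ is closed for every $s\in\mathbb H$. Let $\rho_F(T)$ be the set of $s$ for which $Q_{c,s}(T):D\to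 V$ is bijective, $\sigma_F(T)=\mathbb H\setminus\rho_F(T)$, and $$S_L^{-1}(s,T)=(s-\overline T)Q_{c,s}^{-1}(T),\quad P_2^L(s,T)=2S_L^{-1}(s,T)\big(S_L^{-1}(s,T)+S_L^{-1}(s,\overline T)\big),\quad F_L(s,T)=-4S_L^{-1}(s,T)Q_{c,s}^{-1}(T).$$ Let $S_\theta=\{s\in\mathbb H\setminus\{0\}:|\operatorname{Arg}s|<\theta\}$. The pair $(T,D)$ is of type $(\alpha,\beta,\omega)$ if $\sigma_F(T)\subseteq\overline{S_\omega}$ and for every $\varphi\in(\omega,\pi)$ there is $C_\varphi\ge0$ with $\|S_L^{-1}(s,T)\|\le C_\varphi|s|^{-\alpha}$ for $|s|\le1$ and $\|S_L^{-1}(s,T)\|\le C_\varphi|s|^{-\beta}$ for $|s|\ge1$, for all $0\ne s\notin S_\varphi$. A function $f$ on $S_\theta$ is left slice hyperholomorphic if $f(x+Jy)=a(x,y)+Jb(x,y)$ for all $J\in\mathbb S$, with $a,b$ of class $C^1$, $a$ even and $b$ odd in $y$, $\partial_xa=\partial_yb$ and $\partial_ya=-\partial_xb$; it is intrinsic if $a,b$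 can be chosen real valued. $\Psi_L^{\alpha,\beta}(S_\theta)$ (resp. $\Psi^{\alpha,\beta}(S_\theta)$) is the set of left slice hyperholomorphic (resp. intrinsic) $f$ on $S_\theta$ such that for some $\delta>0$, $C\ge0$ one has $|f(s)|\le C|s|^{\alpha-1+\delta}$ for $|s|\le1$ and $|f(s)|\le C|s|^{\beta-1-\delta}$ for $|s|\ge1$. $\mathcal F_L(S_\theta)$ is the set of left slice hyperholomorphic $f$ with $|f(s)|\le C(|s|^k+|s|^{-k})$ for some $k>0$, $C\ge0$. For $\varphi\in(\omega,\theta)$ and $J\in\mathbb S$, integrals over $\partial(S_\varphi\cap\mathbb C_J)$ are taken along $\gamma(t)=-te^{J\varphi}$ ($t<0$), $\gamma(t)=te^{-J\varphi}$ ($t>0$), with $ds_J=\frac{\gamma'(t)}{J}dt$. Put $$f(T)=\tfrac1{2\pi}\!\int\! S_L^{-1}(s,T)\,ds_Jf(s),\quad \mathcal Df(T)=\tfrac{-1}{\pi}\!\int\! Q_{c,s}^{-1}(T)\,ds_Jf(s),\quad \overline{\mathcal D}f(T)=\tfrac1{2\pi}\!\int\! P_2^L(s,T)\,ds_Jf(s),\quad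 \Delta f(T)=\tfrac1{2\pi}\!\int\! F_L(s,T)\,ds_Jf(s).$$ A regularizer of $f$ (with respect to $\theta$, $\varphi$, $J$) is a function $e\in\Psi^{3\alpha,3\beta}(S_\theta)$ with $ef\in\Psi_L^{3\alpha,3\beta}(S_\theta)$ for which the integrals defining $e(T),e(\overline T),(ef)(T),(ef)(\overline T)$ converge absolutely and $e(T),e(\overline T)$ are injective. The $H^\infty$-functional calculi of $f\in\mathcal F_L(S_\theta)$ are $$f(T)=e(T)^{-1}(ef)(T),\qquad \mathcal Df(T)=\big(e(T)e(\overline T)\big)^{-1}\big(e(T)\mathcal D(ef)(T)-\mathcal De(T)(ef)(T)\big),$$ $$\overline{\mathcal D}f(T)=\big(e(T)^2e(\overline T)\big)^{-1}\big(e(T)e(\overline T)\overline{\mathcal D}(ef)(T)-e(\overline T)\overline{\mathcal D}e(T)(ef)(T)+e(T)\mathcal De(T)(ef)(\overline T)-e(\overline T)\mathcal De(T)(ef)(T)\big),$$ $$\Delta f(T)=\big(e(T)^2e(\overline T)\big)^{-1}\big(e(T)e(\overline T)\Delta(ef)(T)-e(\overline T)\Delta e(T)(ef)(T)+e(T)\mathcal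 De(T)\mathcal D(ef)(T)-(\mathcal De(T))^2(ef)(T)\big).$$ **Proposition.** Let $\alpha\ge\frac13$, $\beta\in(0,\frac13]$, $\omega\in(0,\pi)$, let $(T,D)$ be of type $(\alpha,\beta,\omega)$ with $T$ and $\overline T$ injective, and let $n\in\mathbb N=\{0,1,2,\dots\}$, $\theta\in(\omega,\pi)$. Then $s^n\in\mathcal F_L(S_\theta)$, and there is a function $e$ that is a regularizer of $s^n$ for all $\varphi\in(\omega,\theta)$, $J\in\mathbb S$. For all $\varphi\in(\omega,\theta)$, $J\in\mathbb S$ and every regularizer $e$ of $s^n$ with respect to $\theta,\varphi,J$, all integrals that occur in the four calculi of $s^n$ converge absolutely, and i) $(s^n)(T)=T^n$; ii) $\mathcal D(s^n)(T)\supseteq-2\sum_{k=0}^{n-1}\overline T^{\,n-1-k}T^k$; iii) $\overline{\mathcal D}(s^n)(T)\supseteq2nT^{n-1}+2\sum_{k=0}^{n-1}\overline T^{\,n-1-k}T^k$; iv) $\Delta(s^n)(T)\supseteq-4\sum_{k=1}^{n-1}k\,\overline T^{\,n-1-k}T^{k-1}$. (An empty sum is the zero operator with domain $V$, and so is $2nT^{n-1}$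 for $n=0$.) -/

import Mathlib

open scoped Quaternion
open MeasureTheory

namespace FineStructure

noncomputable section

section Functions

/-! ### Quaternions and slice hyperholomorphic functions -/

/-- The basis `e₀ = 1, e₁, e₂, e₃` of the quaternions. -/
def basisUnit : Fin 4 → ℍ[ℝ] := ![1, ⟨0, 1, 0, 0⟩, ⟨0, 0, 1, 0⟩, ⟨0, 0, 0, 1⟩]

/-- The sphere `𝕊` of purely imaginary quaternions of modulus one. -/
def imSphere : Set ℍ[ℝ] := {J | J.re = 0 ∧ ‖J‖ = 1}

/-- The point `x + J y`. -/
def slicePoint (J : ℍ[ℝ]) (p : ℝ × ℝ) : ℍ[ℝ] := (p.1 : ℍ[ℝ]) + J * (p.2 : ℍ[ℝ])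

/-- The pairs `(x, y)` with `x + 𝕊 y ⊆ U`. -/
def reducedSet (U : Set ℍ[ℝ]) : Set (ℝ × ℝ) := {p | ∀ J ∈ imSphere, slicePoint J p ∈ U}

/-- Even-odd conditions and Cauchy-Riemann equations for a pair of continuously differentiable
functions on a set of pairs `(x, y)`. -/
structure IsSlicePair {E : Type*} [NormedAddCommGroup E] [NormedSpace ℝ E]
    (W : Set (ℝ × ℝ)) (a b : ℝ × ℝ → E) : Prop where
  contDiff_left : ContDiffOn ℝ 1 a W
  contDiff_right : ContDiffOn ℝ 1 b W
  even : ∀ p ∈ W, a (p.1, -p.2) = a p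
  odd : ∀ p ∈ W, b (p.1, -p.2) = -b p
  cauchyRiemann_left : ∀ p ∈ W, fderiv ℝ a p (1, 0) = fderiv ℝ b p (0, 1)
  cauchyRiemann_right : ∀ p ∈ W, fderiv ℝ a p (0, 1) = -fderiv ℝ b p (1, 0)

/-- Left slice hyperholomorphic functions on an axially symmetric open set. -/
def IsLeftSliceHyperholomorphic (U : Set ℍ[ℝ]) (f : ℍ[ℝ] → ℍ[ℝ]) : Prop :=
  ∃ a b : ℝ × ℝ → ℍ[ℝ], IsSlicePair (reducedSet U) a b ∧
    ∀ p ∈ reducedSet U, ∀ J ∈ imSphere, f (slicePoint J p) = a p + J * b p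

/-- Intrinsic slice hyperholomorphic functions: the two component functions are real valued. -/
def IsIntrinsic (U : Set ℍ[ℝ]) (f : ℍ[ℝ] → ℍ[ℝ]) : Prop :=
  ∃ a b : ℝ × ℝ → ℝ, IsSlicePair (reducedSet U) a b ∧
    ∀ p ∈ reducedSet U, ∀ J ∈ imSphere, f (slicePoint J p) = (a p : ℍ[ℝ]) + J * (b p : ℍ[ℝ])

/-- The open sector `{s ≠ 0 : |Arg s| < θ}`. -/
def sector (θ : ℝ) : Set ℍ[ℝ] := {s | s ≠ 0 ∧ Real.arccos (s.re / ‖s‖) < θ}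

/-- The decay condition `|f(s)| ≤ C |s|^(α-1+δ)` for `|s| ≤ 1` and
`|f(s)| ≤ C |s|^(β-1-δ)` for `|s| ≥ 1`. -/
def HasDecay (α β θ : ℝ) (f : ℍ[ℝ] → ℍ[ℝ]) : Prop :=
  ∃ δ > 0, ∃ C ≥ 0, ∀ s ∈ sector θ,
    (‖s‖ ≤ 1 → ‖f s‖ ≤ C * ‖s‖ ^ (α - 1 + δ)) ∧ (1 ≤ ‖s‖ → ‖f s‖ ≤ C * ‖s‖ ^ (β - 1 - δ))

/-- The class `Ψ_L^{α,β}(S_θ)` of decaying left slice hyperholomorphic functions. -/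
def PsiL (α β θ : ℝ) : Set (ℍ[ℝ] → ℍ[ℝ]) :=
  {f | IsLeftSliceHyperholomorphic (sector θ) f ∧ HasDecay α β θ f}

/-- The class `Ψ^{α,β}(S_θ)` of decaying intrinsic functions. -/
def Psi (α β θ : ℝ) : Set (ℍ[ℝ] → ℍ[ℝ]) := {f | IsIntrinsic (sector θ) f ∧ HasDecay α β θ f}

/-- The class `𝓕_L(S_θ)` of polynomially growing left slice hyperholomorphic functions. -/
def GrowL (θ : ℝ) : Set (ℍ[ℝ] → ℍ[ℝ]) :=
  {f | IsLeftSliceHyperholomorphic (sector θ) f ∧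
    ∃ k > (0 : ℝ), ∃ C ≥ 0, ∀ s ∈ sector θ, ‖f s‖ ≤ C * (‖s‖ ^ k + 1 / ‖s‖ ^ k)}

/-- `e^{Jφ}` for an imaginary unit `J`. -/
def expJ (J : ℍ[ℝ]) (φ : ℝ) : ℍ[ℝ] := slicePoint J (Real.cos φ, Real.sin φ)

/-- The positively oriented boundary of the sector `S_φ` in the plane `ℂ_J`. -/
def gamma (J : ℍ[ℝ]) (φ t : ℝ) : ℍ[ℝ] := if t < 0 then (-t) • expJ J φ else t • expJ J (-φ)

end Functions

section Operators

set_option linter.unusedSectionVars false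

/-! ### Partially defined operators on a two-sided quaternionic Banach space

Right multiplication is the action of the opposite algebra. Sums and scalar multiples of partially
defined operators have their natural domains. -/

variable {V : Type*} [NormedAddCommGroup V] [NormedSpace ℝ V] [CompleteSpace V]
  [Module ℍ[ℝ] V] [Module ℍ[ℝ]ᵐᵒᵖ V] [SMulCommClass ℍ[ℝ] ℍ[ℝ]ᵐᵒᵖ V]
  [IsScalarTower ℝ ℍ[ℝ] V] [IsScalarTower ℝ ℍ[ℝ]ᵐᵒᵖ V]
  [NormSMulClass ℍ[ℝ] V] [NormSMulClass ℍ[ℝ]ᵐᵒᵖ V]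

/-- An everywhere defined bounded operator, seen as a partially defined one. -/
def total (B : V →L[ℝ] V) : V →ₗ.[ℝ] V := (B : V →ₗ[ℝ] V).toPMap ⊤

/-- The composition `A B` with domain `{v ∈ dom B | B v ∈ dom A}`. -/
def opComp (A B : V →ₗ.[ℝ] V) : V →ₗ.[ℝ] V where
  domain := (A.domain.comap B.toFun).map B.domain.subtype
  toFun := A.toFun.comp
    ((B.toFun.comp (Submodule.inclusion (Submodule.map_subtype_le B.domain _))).codRestrict
      A.domain (by
        rintro ⟨_, v, hv, rfl⟩
        exact hv))

/-- The powers `A^n` with their natural domains. -/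
def opPow (A : V →ₗ.[ℝ] V) : ℕ → (V →ₗ.[ℝ] V)
  | 0 => total (ContinuousLinearMap.id ℝ V)
  | n + 1 => opComp A (opPow A n)

/-- Left multiplication by a quaternion. -/
def leftMul (a : ℍ[ℝ]) : V →L[ℝ] V := ContinuousLinearMap.lsmul ℝ ℍ[ℝ] a

/-- The component `T_i = (e_i / 4) (e_i T e_i - ∑_{j ≠ i} e_j T e_j)` of a right linear operator
`T = T₀ + e₁ T₁ + e₂ T₂ + e₃ T₃` with two-sided linear domain. -/
def component (T : V →ₗ.[ℝ] V) (i : Fin 4) : V →ₗ.[ℝ] V :=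
  (4⁻¹ : ℝ) • basisUnit i •
    (basisUnit i • opComp T (total (leftMul (basisUnit i))) -
      ∑ j ∈ Finset.univ.erase i, basisUnit j • opComp T (total (leftMul (basisUnit j))))

/-- The conjugate operator `T₀ - e₁ T₁ - e₂ T₂ - e₃ T₃`. -/
def conj (T : V →ₗ.[ℝ] V) : V →ₗ.[ℝ] V :=
  component T 0 - ∑ i ∈ Finset.univ.erase 0, basisUnit i • component T i

/-- The operator `|T|² = T₀² + T₁² + T₂² + T₃²`. -/
def modSq (T : V →ₗ.[ℝ] V) : V →ₗ.[ℝ] V := ∑ i, opComp (component T i) (component T i)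

/-- Two-sided linear subspaces. -/
def IsTwoSided (S : Submodule ℝ V) : Prop :=
  ∀ v ∈ S, ∀ a : ℍ[ℝ], a • v ∈ S ∧ MulOpposite.op a • v ∈ S

/-- Closed right linear operators with two-sided linear domain whose components commute on
`dom |T|²`. -/
structure IsKC (T : V →ₗ.[ℝ] V) : Prop where
  twoSided : IsTwoSided T.domain
  rightLinear : ∀ (a : ℍ[ℝ]) (v w : V), (v, w) ∈ T.graph →
    (MulOpposite.op a • v, MulOpposite.op a • w) ∈ T.graph
  commute : ∀ i j, (opComp (component T i) (component T j)).domRestrict (modSq T).domain =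
    (opComp (component T j) (component T i)).domRestrict (modSq T).domain
  closed : T.IsClosed

/-- The operator `Q_{c,s}(T) = s² - 2 s T₀ + |T|²` with domain `D`. -/
def Qc (T : V →ₗ.[ℝ] V) (D : Submodule ℝ V) (s : ℍ[ℝ]) : V →ₗ.[ℝ] V :=
  (total (leftMul (s ^ 2)) - (2 * s) • component T 0 + modSq T).domRestrict D

/-- The standing assumptions on an operator `T` and a subspace `D`. -/
structure IsAdmissible (T : V →ₗ.[ℝ] V) (D : Submodule ℝ V) : Prop where
  kc : IsKC T
  kc_conj : IsKC (conj T)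
  twoSided : IsTwoSided D
  dense : Dense (D : Set V)
  le_domain : D ≤ (modSq T).domain
  component_mem : ∀ v ∈ D, v ∈ (opComp T (modSq T)).domain →
    ∀ (i : Fin 4) (w : V), (v, w) ∈ (component T i).graph → w ∈ D
  closed : ∀ s, (Qc T D s).IsClosed

/-- The `F`-resolvent set. -/
def rhoF (T : V →ₗ.[ℝ] V) (D : Submodule ℝ V) : Set ℍ[ℝ] :=
  {s | Function.Bijective fun v : (Qc T D s).domain => Qc T D s v}

/-- The `F`-spectrum. -/
def sigmaF (T : V →ₗ.[ℝ] V) (D : Submodule ℝ V) : Set ℍ[ℝ] := (rhoF T D)ᶜ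

open Classical in
/-- A partially defined operator that is everywhere defined and bounded, as an element of the
Banach algebra of bounded operators (and `0` for all other operators). -/
def bdd (A : V →ₗ.[ℝ] V) : V →L[ℝ] V :=
  if h : ∃ B : V →L[ℝ] V, A = total B then h.choose else 0

/-- By the closed graph theorem, `bdd A` is `A` for all closed, everywhere defined operators. -/
theorem total_bdd {A : V →ₗ.[ℝ] V} (hA : A.IsClosed) (hd : A.domain = ⊤) :
    total (bdd A) = A := by
  have h : ∃ B : V →L[ℝ] V, A = total B := by
    let g : V →ₗ[ℝ] V := A.toFun.comp (LinearMap.id.codRestrict A.domain fun v => by simp [hd])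
    have hg : (g.graph : Set (V × V)) = A.graph := by
      ext ⟨v, w⟩
      simp only [SetLike.mem_coe, LinearMap.mem_graph_iff, LinearPMap.mem_graph_iff]
      constructor
      · rintro rfl
        exact ⟨⟨v, by simp [hd]⟩, rfl, rfl⟩
      · rintro ⟨y, rfl, rfl⟩
        rfl
    refine ⟨ContinuousLinearMap.ofIsClosedGraph (g := g) (by rw [hg]; exact hA), ?_⟩
    refine LinearPMap.ext (by simp [total, hd]) fun x hx hx' => ?_
    rfl
  rw [bdd, dif_pos h]
  exact h.choose_spec.symm

/-- The `Q`-resolvent `Q_{c,s}(T)⁻¹`. -/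
def Qinv (T : V →ₗ.[ℝ] V) (D : Submodule ℝ V) (s : ℍ[ℝ]) : V →L[ℝ] V := bdd (Qc T D s).inverse

/-- The left `S`-resolvent `S_L⁻¹(s, T) = (s - T̄) Q_{c,s}(T)⁻¹`. -/
def SL (T : V →ₗ.[ℝ] V) (D : Submodule ℝ V) (s : ℍ[ℝ]) : V →L[ℝ] V :=
  bdd (opComp (total (leftMul s) - conj T) (total (Qinv T D s)))

/-- On the resolvent set, `Qinv` is the inverse operator. -/
theorem total_Qinv {T : V →ₗ.[ℝ] V} {D : Submodule ℝ V} (hT : IsAdmissible T D) {s : ℍ[ℝ]}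
    (hs : s ∈ rhoF T D) : total (Qinv T D s) = (Qc T D s).inverse := by
  have hker : LinearMap.ker (Qc T D s).toFun = ⊥ := LinearMap.ker_eq_bot.2 hs.1
  refine total_bdd ((LinearPMap.inverse_closed_iff hker).2 (hT.closed s)) ?_
  rw [LinearPMap.inverse_domain]
  exact LinearMap.range_eq_top.2 hs.2

/-- On the resolvent set, `SL` is the operator `(s - T̄) Q_{c,s}(T)⁻¹`. -/
theorem total_SL {T : V →ₗ.[ℝ] V} {D : Submodule ℝ V} (hT : IsAdmissible T D) {s : ℍ[ℝ]}
    (hs : s ∈ rhoF T D) :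
    total (SL T D s) = opComp (total (leftMul s) - conj T) (Qc T D s).inverse := by
  rw [← total_Qinv hT hs]
  have hker : LinearMap.ker (Qc T D s).toFun = ⊥ := LinearMap.ker_eq_bot.2 hs.1
  have hmem : ∀ v, Qinv T D s v ∈ (conj T).domain := by
    intro v
    have h1 : (v, Qinv T D s v) ∈ (Qc T D s).inverse.graph := by
      rw [← total_Qinv hT hs]
      exact LinearPMap.mem_graph (total (Qinv T D s)) ⟨v, trivial⟩
    rw [LinearPMap.inverse_graph hker] at h1
    have h2 : (Qinv T D s v, v) ∈ (Qc T D s).graph := by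
      obtain ⟨⟨a, b⟩, hab, h⟩ := h1
      have e1 : b = v := congrArg Prod.fst h
      have e2 : a = Qinv T D s v := congrArg Prod.snd h
      rw [← e2, ← e1]
      exact hab
    have h3 := hT.le_domain (LinearPMap.mem_domain_of_mem_graph h2).1
    have h4 : ∀ i, (opComp (component T i) (component T i)).domain ≤ (component T i).domain :=
      fun i => Submodule.map_subtype_le _ _
    have h5 : (Finset.univ.erase (0 : Fin 4)) = {1, 2, 3} := by decide
    simp only [modSq, Fin.sum_univ_four] at h3
    simp only [conj, h5]
    rw [Finset.sum_insert (by decide), Finset.sum_insert (by decide), Finset.sum_singleton]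
    exact ⟨h4 0 h3.1.1.1, h4 1 h3.1.1.2, h4 2 h3.1.2, h4 3 h3.2⟩
  refine total_bdd ?_ ?_
  · have : ((opComp (total (leftMul s) - conj T) (total (Qinv T D s))).graph : Set (V × V)) =
        (fun p : V × V => (Qinv T D s p.1, s • Qinv T D s p.1 - p.2)) ⁻¹'
          ((conj T).graph : Set (V × V)) := by
      ext ⟨v, w⟩
      simp only [SetLike.mem_coe, Set.mem_preimage, LinearPMap.mem_graph_iff]
      constructor
      · rintro ⟨⟨y, x, hx, rfl⟩, rfl, rfl⟩
        refine ⟨⟨_, hx.2⟩, rfl, ?_⟩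
        exact (sub_sub_cancel _ _).symm
      · rintro ⟨y, h1, h2⟩
        refine ⟨⟨v, ⟨v, trivial⟩, ⟨trivial, hmem v⟩, rfl⟩, rfl, ?_⟩
        have : y = ⟨Qinv T D s v, hmem v⟩ := Subtype.ext h1
        subst this
        rw [eq_sub_iff_add_eq, ← eq_sub_iff_add_eq'] at h2
        exact h2.symm
    rw [LinearPMap.IsClosed, this]
    refine IsClosed.preimage ?_ hT.kc_conj.closed
    exact (Qinv T D s).continuous.comp continuous_fst |>.prodMk
      (((leftMul s).continuous.comp ((Qinv T D s).continuous.comp continuous_fst)).sub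
        continuous_snd)
  · rw [eq_top_iff]
    intro v _
    exact ⟨⟨v, trivial⟩, ⟨trivial, hmem v⟩, rfl⟩

/-- The left `P₂`-resolvent. -/
def P2L (T : V →ₗ.[ℝ] V) (D : Submodule ℝ V) (s : ℍ[ℝ]) : V →L[ℝ] V :=
  (2 : ℝ) • (SL T D s * (SL T D s + SL (conj T) D s))

/-- The left `F`-resolvent. -/
def FL (T : V →ₗ.[ℝ] V) (D : Submodule ℝ V) (s : ℍ[ℝ]) : V →L[ℝ] V :=
  (-4 : ℝ) • (SL T D s * Qinv T D s)

/-- Operators `T` (together with `D`) of type `(α, β, ω)`. -/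
structure IsOfType (T : V →ₗ.[ℝ] V) (D : Submodule ℝ V) (α β ω : ℝ) : Prop where
  admissible : IsAdmissible T D
  spectrum_subset : sigmaF T D ⊆ closure (sector ω)
  resolvent_bound : ∀ φ ∈ Set.Ioo ω Real.pi, ∃ C ≥ 0, ∀ s ∉ sector φ, s ≠ 0 →
    (‖s‖ ≤ 1 → ‖SL T D s‖ ≤ C * ‖s‖ ^ (-α)) ∧ (1 ≤ ‖s‖ → ‖SL T D s‖ ≤ C * ‖s‖ ^ (-β))

/-! ### The functional calculi for decaying functions -/

/-- The integrand of `∫_{∂(S_φ ∩ ℂ_J)} K(s) ds_J f(s)`, where `ds_J = γ'(t) / J dt`. -/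
def pathIntegrand (K : ℍ[ℝ] → V →L[ℝ] V) (φ : ℝ) (J : ℍ[ℝ]) (f : ℍ[ℝ] → ℍ[ℝ]) (t : ℝ) :
    V →L[ℝ] V :=
  K (gamma J φ t) * leftMul (deriv (gamma J φ) t * J⁻¹ * f (gamma J φ t))

/-- Absolute convergence of `∫_{∂(S_φ ∩ ℂ_J)} K(s) ds_J f(s)`. -/
def Converges (K : ℍ[ℝ] → V →L[ℝ] V) (φ : ℝ) (J : ℍ[ℝ]) (f : ℍ[ℝ] → ℍ[ℝ]) : Prop :=
  Integrable (pathIntegrand K φ J f)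

/-- The integral `∫_{∂(S_φ ∩ ℂ_J)} K(s) ds_J f(s)`. -/
def pathIntegral (K : ℍ[ℝ] → V →L[ℝ] V) (φ : ℝ) (J : ℍ[ℝ]) (f : ℍ[ℝ] → ℍ[ℝ]) : V →L[ℝ] V :=
  ∫ t, pathIntegrand K φ J f t

variable (T : V →ₗ.[ℝ] V) (D : Submodule ℝ V) (φ : ℝ) (J : ℍ[ℝ])

/-- The `S`-functional calculus `f(T)`. -/
def calcS (f : ℍ[ℝ] → ℍ[ℝ]) : V →L[ℝ] V := (1 / (2 * Real.pi)) • pathIntegral (SL T D) φ J f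

/-- The `Q`-functional calculus `𝒟f(T)`. -/
def calcQ (f : ℍ[ℝ] → ℍ[ℝ]) : V →L[ℝ] V := (-1 / Real.pi) • pathIntegral (Qinv T D) φ J f

/-- The `P₂`-functional calculus `𝒟̄f(T)`. -/
def calcP (f : ℍ[ℝ] → ℍ[ℝ]) : V →L[ℝ] V := (1 / (2 * Real.pi)) • pathIntegral (P2L T D) φ J f

/-- The `F`-functional calculus `Δf(T)`. -/
def calcF (f : ℍ[ℝ] → ℍ[ℝ]) : V →L[ℝ] V := (1 / (2 * Real.pi)) • pathIntegral (FL T D) φ J f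

/-! ### The `H^∞`-functional calculi -/

/-- `e` is a regularizer of `f`: `e ∈ Ψ^{3α,3β}(S_θ)`, `ef ∈ Ψ_L^{3α,3β}(S_θ)`, the integrals
defining `e(T)`, `e(T̄)`, `(ef)(T)`, `(ef)(T̄)` converge absolutely, and `e(T)`, `e(T̄)` are
injective. -/
structure IsRegularizer (α β θ : ℝ) (e f : ℍ[ℝ] → ℍ[ℝ]) : Prop where
  mem_psi : e ∈ Psi (3 * α) (3 * β) θ
  mul_mem_psiL : e * f ∈ PsiL (3 * α) (3 * β) θ
  converges : Converges (SL T D) φ J e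
  converges_conj : Converges (SL (conj T) D) φ J e
  converges_mul : Converges (SL T D) φ J (e * f)
  converges_mul_conj : Converges (SL (conj T) D) φ J (e * f)
  injective : Function.Injective (calcS T D φ J e)
  injective_conj : Function.Injective (calcS (conj T) D φ J e)

/-- The `S`-functional calculus `e(T)⁻¹ (ef)(T)`. -/
def hinfS (e f : ℍ[ℝ] → ℍ[ℝ]) : V →ₗ.[ℝ] V :=
  opComp (total (calcS T D φ J e)).inverse (total (calcS T D φ J (e * f)))

/-- The `Q`-functional calculus
`(e(T) e(T̄))⁻¹ (e(T) 𝒟(ef)(T) - 𝒟e(T) (ef)(T))`. -/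
def hinfQ (e f : ℍ[ℝ] → ℍ[ℝ]) : V →ₗ.[ℝ] V :=
  opComp (total (calcS T D φ J e * calcS (conj T) D φ J e)).inverse
    (total (calcS T D φ J e * calcQ T D φ J (e * f) - calcQ T D φ J e * calcS T D φ J (e * f)))

/-- The `P₂`-functional calculus
`(e(T)² e(T̄))⁻¹ (e(T) e(T̄) 𝒟̄(ef)(T) - e(T̄) 𝒟̄e(T) (ef)(T) + e(T) 𝒟e(T) (ef)(T̄)
- e(T̄) 𝒟e(T) (ef)(T))`. -/
def hinfP (e f : ℍ[ℝ] → ℍ[ℝ]) : V →ₗ.[ℝ] V :=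
  opComp (total (calcS T D φ J e ^ 2 * calcS (conj T) D φ J e)).inverse
    (total (calcS T D φ J e * calcS (conj T) D φ J e * calcP T D φ J (e * f) -
      calcS (conj T) D φ J e * calcP T D φ J e * calcS T D φ J (e * f) +
      calcS T D φ J e * calcQ T D φ J e * calcS (conj T) D φ J (e * f) -
      calcS (conj T) D φ J e * calcQ T D φ J e * calcS T D φ J (e * f)))

/-- The `F`-functional calculus
`(e(T)² e(T̄))⁻¹ (e(T) e(T̄) Δ(ef)(T) - e(T̄) Δe(T) (ef)(T) + e(T) 𝒟e(T) 𝒟(ef)(T)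
- (𝒟e(T))² (ef)(T))`. -/
def hinfF (e f : ℍ[ℝ] → ℍ[ℝ]) : V →ₗ.[ℝ] V :=
  opComp (total (calcS T D φ J e ^ 2 * calcS (conj T) D φ J e)).inverse
    (total (calcS T D φ J e * calcS (conj T) D φ J e * calcF T D φ J (e * f) -
      calcS (conj T) D φ J e * calcF T D φ J e * calcS T D φ J (e * f) +
      calcS T D φ J e * calcQ T D φ J e * calcQ T D φ J (e * f) -
      calcQ T D φ J e ^ 2 * calcS T D φ J (e * f)))

end Operators

end

end FineStructure

open scoped Quaternion
open MeasureTheory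

namespace FineStructure

noncomputable section

set_option linter.unusedSectionVars false

variable {V : Type*} [NormedAddCommGroup V] [NormedSpace ℝ V] [CompleteSpace V]
  [Module ℍ[ℝ] V] [Module ℍ[ℝ]ᵐᵒᵖ V] [SMulCommClass ℍ[ℝ] ℍ[ℝ]ᵐᵒᵖ V]
  [IsScalarTower ℝ ℍ[ℝ] V] [IsScalarTower ℝ ℍ[ℝ]ᵐᵒᵖ V]
  [NormSMulClass ℍ[ℝ] V] [NormSMulClass ℍ[ℝ]ᵐᵒᵖ V]


/-! ### Partially defined operators, evaluated through a map on the whole space. -/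

section PartialOperators

/-! Fix a regularizer `e`, and let `F_k`, `G_k`, `Y_k`, `U_k`, `W_k` (`k ≤ n`) be the normalized
contour integrals of `e(s) s^k` against `S_L⁻¹(s, T)`, `S_L⁻¹(s, T̄)`, `Q_{c,s}(T)⁻¹`, `P₂^L(s, T)`
and `S_L⁻¹(s, T) Q_{c,s}(T)⁻¹`. The resolvent equation `T S_L⁻¹ = S_L⁻¹ s - 1`, the definition
`S_L⁻¹ = (s - T̄) Q⁻¹` and Cauchy's theorem `∫ e(s) s^k ds = 0` for `k < n` give, formally, `F_{k+1}
= T F_k`, `G_{k+1} = T̄ G_k`, `Y_{k+1} = F_k + T̄ Y_k`, `U_{k+1} = T U_k + 2 F_k + 2 G_k`, `W_{k+1}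
= T W_k + Y_k` and `G_0 - F_0 = (T̄ - T) Y_0`. If all these operators commute, the rest is algebra
in a commutative ring (`recurrence_identities`): the solved recurrences, inserted into the
numerators of the calculi, leave `F_0`, `F_0 G_0` or `F_0² G_0` times the asserted polynomial in `T`
and `T̄`. Four things make this legitimate.

Unboundedness. The point `-1` is outside the sector, so `R = (1 + T)⁻¹` and `R' = (1 + T̄)⁻¹` are
bounded (`negOneRes`). All relations are multiplied by powers of `R` and `R'`, so that `T` is
replaced by the fraction `(1 - R)/R`; see `cleared_identities`. The way back to operators with their
domains is `IsRes.inverse_comp_eq_opPow`, which gives equality for the `S`-calculus, and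
`le_inverse_comp`, which gives the inclusions.

Estimates. Only `S_L⁻¹(s, T)` is assumed to be bounded. Averaging over the rotations `s ↦ e_k s
e_k⁻¹` separates the components, and bounds for `S_L⁻¹(s, T̄)`, for `T_k Q⁻¹` and, quadratically,
for `Q⁻¹` follow (`HasBound.boundedBy`). Near zero the class `Ψ^{3α,3β}` absorbs three resolvents.
At infinity its decay alone does not ensure convergence, and the integrals are dominated by those
that a regularizer is required to have (`RegData.conv_of_bound`).

Commutation. `S_L⁻¹` contains the units `e_k`, which do not commute with `s`. Integrals of kernels
without the `e_k` lie in a commutative algebra `commAlg`, by the symmetry of the contour under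
conjugation. The others are written over this algebra with `e_k T_k` as extra generators, in the
forms `IsStrong` and `IsWeak`; cancellation of the injective operator `Q_{c,-1}(T)⁻¹` and the
recurrence for `W_k` then give pairwise commutation (`RegData.calcSet_commute`).

Existence. For `e(s) = s^j (1 + s)^(-j-n-2)` with `j ≥ 3α`, Cauchy's formula at `-1` yields `e(T) =
R^(n+2) (1 - R)^j` (`HasBound.lineInt_regularizer`), and `1 - R = T R` is injective because `T` is.
-/

open Classical in
/-- A partially defined operator, extended by zero outside its domain. -/
def ap (A : V →ₗ.[ℝ] V) (v : V) : V := if h : v ∈ A.domain then A ⟨v, h⟩ else 0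

theorem ap_of_mem {A : V →ₗ.[ℝ] V} {v : V} (h : v ∈ A.domain) : ap A v = A ⟨v, h⟩ := dif_pos h

theorem mem_graph_iff_ap {A : V →ₗ.[ℝ] V} {v w : V} :
    (v, w) ∈ A.graph ↔ v ∈ A.domain ∧ ap A v = w := by
  rw [LinearPMap.mem_graph_iff]
  constructor
  · rintro ⟨y, rfl, rfl⟩
    exact ⟨y.2, ap_of_mem y.2⟩
  · rintro ⟨h, rfl⟩
    exact ⟨⟨v, h⟩, rfl, (ap_of_mem h).symm⟩

theorem ap_add_vec {A : V →ₗ.[ℝ] V} {v w : V} (hv : v ∈ A.domain) (hw : w ∈ A.domain) :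
    ap A (v + w) = ap A v + ap A w := by
  rw [ap_of_mem hv, ap_of_mem hw, ap_of_mem (add_mem hv hw), ← LinearPMap.map_add]
  rfl

theorem ap_smul_vec {A : V →ₗ.[ℝ] V} {v : V} (r : ℝ) (hv : v ∈ A.domain) :
    ap A (r • v) = r • ap A v := by
  rw [ap_of_mem hv, ap_of_mem (A.domain.smul_mem r hv), ← LinearPMap.map_smul]
  rfl

theorem ap_neg_vec {A : V →ₗ.[ℝ] V} {v : V} (hv : v ∈ A.domain) : ap A (-v) = -ap A v := by
  rw [ap_of_mem hv, ap_of_mem (neg_mem hv), ← LinearPMap.map_neg]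
  rfl

theorem ap_sub_vec {A : V →ₗ.[ℝ] V} {v w : V} (hv : v ∈ A.domain) (hw : w ∈ A.domain) :
    ap A (v - w) = ap A v - ap A w := by
  rw [ap_of_mem hv, ap_of_mem hw, ap_of_mem (sub_mem hv hw), ← LinearPMap.map_sub]
  rfl

theorem ap_zero_vec {A : V →ₗ.[ℝ] V} : ap A 0 = 0 := by
  rw [ap_of_mem A.domain.zero_mem]
  exact A.map_zero

theorem ap_sum_vec {A : V →ₗ.[ℝ] V} {ι : Type*} (s : Finset ι) (f : ι → V)
    (hf : ∀ i ∈ s, f i ∈ A.domain) : ap A (∑ i ∈ s, f i) = ∑ i ∈ s, ap A (f i) := by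
  classical
  induction s using Finset.induction_on with
  | empty => simp [ap_zero_vec]
  | insert i s hi ih =>
    rw [Finset.sum_insert hi, Finset.sum_insert hi,
      ap_add_vec (hf i (by simp)) (sum_mem fun j hj => hf j (by simp [hj])),
      ih fun j hj => hf j (by simp [hj])]

theorem ext_ap {A B : V →ₗ.[ℝ] V} (h : A.domain = B.domain)
    (h' : ∀ v ∈ A.domain, ap A v = ap B v) : A = B :=
  LinearPMap.ext h fun x hx hx' => by rw [← ap_of_mem hx, ← ap_of_mem hx', h' x hx]

theorem le_of_ap {A B : V →ₗ.[ℝ] V}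
    (h : ∀ v ∈ A.domain, v ∈ B.domain ∧ ap A v = ap B v) : A ≤ B :=
  ⟨fun v hv => (h v hv).1, fun x y hxy => by
    rw [← ap_of_mem x.2, (h x x.2).2, hxy, ap_of_mem y.2]⟩

@[simp] theorem total_domain (B : V →L[ℝ] V) : (total B).domain = ⊤ := rfl

@[simp] theorem ap_total (B : V →L[ℝ] V) (v : V) : ap (total B) v = B v := by
  rw [ap_of_mem (Submodule.mem_top)]
  rfl

theorem mem_opComp {A B : V →ₗ.[ℝ] V} {v : V} :
    v ∈ (opComp A B).domain ↔ v ∈ B.domain ∧ ap B v ∈ A.domain := by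
  constructor
  · rintro ⟨y, hy, rfl⟩
    refine ⟨y.2, ?_⟩
    rw [Submodule.subtype_apply, ap_of_mem y.2]
    exact hy
  · rintro ⟨h, h'⟩
    rw [ap_of_mem h] at h'
    exact ⟨⟨v, h⟩, h', rfl⟩

theorem ap_opComp {A B : V →ₗ.[ℝ] V} {v : V} (h : v ∈ (opComp A B).domain) :
    ap (opComp A B) v = ap A (ap B v) := by
  obtain ⟨h1, h2⟩ := mem_opComp.1 h
  rw [ap_of_mem h2, ap_of_mem h]
  have : ap B v = B ⟨v, h1⟩ := ap_of_mem h1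
  simp only [this]
  rfl

@[simp] theorem smul_domain {M : Type*} [Monoid M] [DistribMulAction M V] [SMulCommClass ℝ M V]
    (a : M) (A : V →ₗ.[ℝ] V) : (a • A).domain = A.domain := rfl

theorem ap_smul {M : Type*} [Monoid M] [DistribMulAction M V] [SMulCommClass ℝ M V]
    (a : M) (A : V →ₗ.[ℝ] V) (v : V) : ap (a • A) v = a • ap A v := by
  by_cases h : v ∈ A.domain
  · rw [ap_of_mem h, ap_of_mem (A := a • A) h, LinearPMap.smul_apply]
  · rw [ap, ap, dif_neg h, dif_neg (by exact h), smul_zero]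

@[simp] theorem mem_add_domain {A B : V →ₗ.[ℝ] V} {v : V} :
    v ∈ (A + B).domain ↔ v ∈ A.domain ∧ v ∈ B.domain := Iff.rfl

@[simp] theorem mem_sub_domain {A B : V →ₗ.[ℝ] V} {v : V} :
    v ∈ (A - B).domain ↔ v ∈ A.domain ∧ v ∈ B.domain := Iff.rfl

theorem ap_add {A B : V →ₗ.[ℝ] V} {v : V} (h : v ∈ A.domain) (h' : v ∈ B.domain) :
    ap (A + B) v = ap A v + ap B v := by
  rw [ap_of_mem h, ap_of_mem h', ap_of_mem (A := A + B) ⟨h, h'⟩]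
  rfl

theorem ap_sub {A B : V →ₗ.[ℝ] V} {v : V} (h : v ∈ A.domain) (h' : v ∈ B.domain) :
    ap (A - B) v = ap A v - ap B v := by
  rw [ap_of_mem h, ap_of_mem h', ap_of_mem (A := A - B) ⟨h, h'⟩]
  rfl

theorem mem_sum_domain {ι : Type*} {s : Finset ι} {A : ι → (V →ₗ.[ℝ] V)} {v : V} :
    v ∈ (∑ i ∈ s, A i).domain ↔ ∀ i ∈ s, v ∈ (A i).domain := by
  classical
  induction s using Finset.induction_on with
  | empty => simp
  | insert i s hi ih => simp [Finset.sum_insert hi, ih]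

theorem ap_sum {ι : Type*} {s : Finset ι} {A : ι → (V →ₗ.[ℝ] V)} {v : V}
    (h : ∀ i ∈ s, v ∈ (A i).domain) : ap (∑ i ∈ s, A i) v = ∑ i ∈ s, ap (A i) v := by
  classical
  induction s using Finset.induction_on with
  | empty =>
    rw [Finset.sum_empty, Finset.sum_empty, ap_of_mem (by simp)]
    rfl
  | insert i s hi ih =>
    rw [Finset.sum_insert hi, Finset.sum_insert hi,
      ap_add (h i (by simp)) (mem_sum_domain.2 fun j hj => h j (by simp [hj])),
      ih fun j hj => h j (by simp [hj])]

theorem mem_domRestrict {A : V →ₗ.[ℝ] V} {S : Submodule ℝ V} {v : V} :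
    v ∈ (A.domRestrict S).domain ↔ v ∈ S ∧ v ∈ A.domain := by
  rw [LinearPMap.domRestrict_domain, Submodule.mem_inf]

theorem ap_domRestrict {A : V →ₗ.[ℝ] V} {S : Submodule ℝ V} {v : V} (h : v ∈ S)
    (h' : v ∈ A.domain) : ap (A.domRestrict S) v = ap A v := by
  rw [ap_of_mem h', ap_of_mem (mem_domRestrict.2 ⟨h, h'⟩)]
  exact LinearPMap.domRestrict_apply rfl

theorem mem_inverse_domain {A : V →ₗ.[ℝ] V} {w : V} :
    w ∈ A.inverse.domain ↔ ∃ v ∈ A.domain, ap A v = w := by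
  rw [LinearPMap.inverse_domain]
  constructor
  · rintro ⟨y, rfl⟩
    exact ⟨y, y.2, ap_of_mem y.2⟩
  · rintro ⟨v, hv, rfl⟩
    exact ⟨⟨v, hv⟩, (ap_of_mem hv).symm⟩

theorem ap_inverse {A : V →ₗ.[ℝ] V} (hA : LinearMap.ker A.toFun = ⊥) {v : V}
    (hv : v ∈ A.domain) : ap A.inverse (ap A v) = v := by
  have h : (ap A v, v) ∈ A.inverse.graph := by
    rw [LinearPMap.inverse_graph hA]
    exact ⟨(v, ap A v), mem_graph_iff_ap.2 ⟨hv, rfl⟩, rfl⟩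
  exact (mem_graph_iff_ap.1 h).2

end PartialOperators

/-! ### Components of an operator and conjugation. -/

section Components

theorem leftMul_apply (a : ℍ[ℝ]) (v : V) : leftMul a v = a • v := rfl

theorem basisUnit_zero : basisUnit 0 = 1 := rfl

theorem basisUnit_one : (basisUnit 1).re = 0 ∧ (basisUnit 1).imI = 1 ∧ (basisUnit 1).imJ = 0 ∧
    (basisUnit 1).imK = 0 := ⟨rfl, rfl, rfl, rfl⟩
theorem basisUnit_two : (basisUnit 2).re = 0 ∧ (basisUnit 2).imI = 0 ∧ (basisUnit 2).imJ = 1 ∧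
    (basisUnit 2).imK = 0 := ⟨rfl, rfl, rfl, rfl⟩
theorem basisUnit_three : (basisUnit 3).re = 0 ∧ (basisUnit 3).imI = 0 ∧ (basisUnit 3).imJ = 0 ∧
    (basisUnit 3).imK = 1 := ⟨rfl, rfl, rfl, rfl⟩

theorem basisUnit_table :
    basisUnit 1 * basisUnit 1 = -1 ∧ basisUnit 2 * basisUnit 2 = -1 ∧
    basisUnit 3 * basisUnit 3 = -1 ∧ basisUnit 1 * basisUnit 2 = basisUnit 3 ∧
    basisUnit 2 * basisUnit 1 = -basisUnit 3 ∧ basisUnit 2 * basisUnit 3 = basisUnit 1 ∧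
    basisUnit 3 * basisUnit 2 = -basisUnit 1 ∧ basisUnit 3 * basisUnit 1 = basisUnit 2 ∧
    basisUnit 1 * basisUnit 3 = -basisUnit 2 := by
  refine ⟨?_, ?_, ?_, ?_, ?_, ?_, ?_, ?_, ?_⟩ <;>
    rw [Quaternion.ext_iff] <;>
    simp [basisUnit_one, basisUnit_two, basisUnit_three, Quaternion.re_mul, Quaternion.imI_mul,
      Quaternion.imJ_mul, Quaternion.imK_mul]

theorem eq_sum_basisUnit (a : ℍ[ℝ]) :
    a = (a.re : ℍ[ℝ]) + (a.imI : ℍ[ℝ]) * basisUnit 1 + (a.imJ : ℍ[ℝ]) * basisUnit 2 +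
      (a.imK : ℍ[ℝ]) * basisUnit 3 := by
  rw [Quaternion.ext_iff]
  simp [basisUnit_one, basisUnit_two, basisUnit_three, Quaternion.re_mul, Quaternion.imI_mul,
    Quaternion.imJ_mul, Quaternion.imK_mul]

theorem basisUnit_smul_table (v : V) :
    basisUnit 1 • basisUnit 1 • v = -v ∧ basisUnit 2 • basisUnit 2 • v = -v ∧
    basisUnit 3 • basisUnit 3 • v = -v ∧ basisUnit 1 • basisUnit 2 • v = basisUnit 3 • v ∧
    basisUnit 2 • basisUnit 1 • v = -(basisUnit 3 • v) ∧
    basisUnit 2 • basisUnit 3 • v = basisUnit 1 • v ∧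
    basisUnit 3 • basisUnit 2 • v = -(basisUnit 1 • v) ∧
    basisUnit 3 • basisUnit 1 • v = basisUnit 2 • v ∧
    basisUnit 1 • basisUnit 3 • v = -(basisUnit 2 • v) := by
  obtain ⟨h1, h2, h3, h4, h5, h6, h7, h8, h9⟩ := basisUnit_table
  simp only [smul_smul, h1, h2, h3, h4, h5, h6, h7, h8, h9, neg_smul, one_smul, and_self]

theorem coe_smul (r : ℝ) (v : V) : (r : ℍ[ℝ]) • v = r • v := by
  rw [← Quaternion.algebraMap_def, algebraMap_smul]

theorem smul_real_comm (a : ℍ[ℝ]) (r : ℝ) (v : V) : a • r • v = r • a • v := by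
  rw [← coe_smul, ← coe_smul, smul_smul, smul_smul, Quaternion.coe_commutes]

theorem smul_mem_of_twoSided {S : Submodule ℝ V} (h : IsTwoSided S) (a : ℍ[ℝ]) {v : V}
    (hv : v ∈ S) : a • v ∈ S := (h v hv a).1

theorem univ_erase_zero : (Finset.univ.erase (0 : Fin 4)) = {1, 2, 3} := by decide
theorem univ_erase_one : (Finset.univ.erase (1 : Fin 4)) = {0, 2, 3} := by decide
theorem univ_erase_two : (Finset.univ.erase (2 : Fin 4)) = {0, 1, 3} := by decide
theorem univ_erase_three : (Finset.univ.erase (3 : Fin 4)) = {0, 1, 2} := by decide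

theorem sum_triple {M : Type*} [AddCommMonoid M] (f : Fin 4 → M) {i j k : Fin 4} (hij : i ≠ j)
    (hik : i ≠ k) (hjk : j ≠ k) : ∑ l ∈ {i, j, k}, f l = f i + f j + f k := by
  rw [Finset.sum_insert (by simp [hij, hik]), Finset.sum_insert (by simp [hjk]),
    Finset.sum_singleton, add_assoc]

variable {T : V →ₗ.[ℝ] V}

/-- The summand with `e₀ = 1` already forces the vector into `dom T`; the other summands add no
condition, because the domain is stable under left multiplication. -/
theorem mem_component_domain (h : IsTwoSided T.domain) {i : Fin 4} {v : V} :
    v ∈ (component T i).domain ↔ v ∈ T.domain := by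
  have h' : ∀ j, v ∈ (basisUnit j • opComp T (total (leftMul (basisUnit j)))).domain ↔
      basisUnit j • v ∈ T.domain := by
    intro j
    rw [smul_domain, mem_opComp]
    simp [leftMul]
  rw [component, smul_domain, smul_domain, mem_sub_domain, h', mem_sum_domain]
  constructor
  · rintro ⟨h1, h2⟩
    by_cases hi : i = 0
    · subst hi
      simpa [basisUnit_zero] using h1
    · have := (h' 0).1 (h2 0 (by simp [Ne.symm hi]))
      simpa [basisUnit_zero] using this
  · intro hv
    exact ⟨smul_mem_of_twoSided h _ hv, fun j _ => (h' j).2 (smul_mem_of_twoSided h _ hv)⟩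

theorem component_domain (h : IsTwoSided T.domain) (i : Fin 4) :
    (component T i).domain = T.domain :=
  Submodule.ext fun _ => mem_component_domain h

theorem ap_component (h : IsTwoSided T.domain) (i : Fin 4) {v : V} (hv : v ∈ T.domain) :
    ap (component T i) v = (4⁻¹ : ℝ) • basisUnit i • (basisUnit i • ap T (basisUnit i • v) -
      ∑ j ∈ Finset.univ.erase i, basisUnit j • ap T (basisUnit j • v)) := by
  have h' : ∀ j, v ∈ (opComp T (total (leftMul (basisUnit j)))).domain := by
    intro j
    rw [mem_opComp]
    exact ⟨trivial, by simpa [leftMul] using smul_mem_of_twoSided h _ hv⟩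
  rw [component, ap_smul, ap_smul, ap_sub (by exact h' i)
    (mem_sum_domain.2 fun j _ => by exact h' j), ap_sum fun j _ => by exact h' j]
  simp only [ap_smul, ap_opComp (h' _), ap_total, leftMul_apply]

theorem component_eq (h : IsTwoSided T.domain) {v : V} (hv : v ∈ T.domain) :
    ap (component T 0) v = (4⁻¹ : ℝ) • (ap T v - basisUnit 1 • ap T (basisUnit 1 • v) -
      basisUnit 2 • ap T (basisUnit 2 • v) - basisUnit 3 • ap T (basisUnit 3 • v)) ∧
    ap (component T 1) v = (4⁻¹ : ℝ) • (-ap T (basisUnit 1 • v) - basisUnit 1 • ap T v -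
      basisUnit 3 • ap T (basisUnit 2 • v) + basisUnit 2 • ap T (basisUnit 3 • v)) ∧
    ap (component T 2) v = (4⁻¹ : ℝ) • (-ap T (basisUnit 2 • v) - basisUnit 2 • ap T v +
      basisUnit 3 • ap T (basisUnit 1 • v) - basisUnit 1 • ap T (basisUnit 3 • v)) ∧
    ap (component T 3) v = (4⁻¹ : ℝ) • (-ap T (basisUnit 3 • v) - basisUnit 3 • ap T v -
      basisUnit 2 • ap T (basisUnit 1 • v) + basisUnit 1 • ap T (basisUnit 2 • v)) := by
  have tab := basisUnit_smul_table (V := V)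
  refine ⟨?_, ?_, ?_, ?_⟩
  · rw [ap_component h 0 hv, univ_erase_zero, sum_triple _ (by decide) (by decide) (by decide)]
    simp only [basisUnit_zero, one_smul]
    congr 1
    abel
  · rw [ap_component h 1 hv, univ_erase_one, sum_triple _ (by decide) (by decide) (by decide)]
    simp only [basisUnit_zero, one_smul, smul_sub, smul_add, tab, smul_neg]
    congr 1
    abel
  · rw [ap_component h 2 hv, univ_erase_two, sum_triple _ (by decide) (by decide) (by decide)]
    simp only [basisUnit_zero, one_smul, smul_sub, smul_add, tab, smul_neg]
    abel
  · rw [ap_component h 3 hv, univ_erase_three, sum_triple _ (by decide) (by decide) (by decide)]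
    simp only [basisUnit_zero, one_smul, smul_sub, smul_add, tab, smul_neg]
    abel

theorem ap_eq_sum_components (h : IsTwoSided T.domain) {v : V} (hv : v ∈ T.domain) :
    ap T v = ap (component T 0) v + basisUnit 1 • ap (component T 1) v +
      basisUnit 2 • ap (component T 2) v + basisUnit 3 • ap (component T 3) v := by
  have tab := basisUnit_smul_table (V := V)
  obtain ⟨h0, h1, h2, h3⟩ := component_eq h hv
  rw [h0, h1, h2, h3]
  simp only [smul_real_comm, smul_sub, smul_add, tab, smul_neg]
  simp only [← leftMul_apply]
  module

/-- Replacing `v` by `e_k v` turns the four vectors `T v`, `T (e_j v)` into each other up to sign,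
and the signs in the components are such that exactly the factor `e_k` comes out. So the components
are left linear on the domain, although `T` need not be. -/
theorem component_basisUnit_smul (h : IsTwoSided T.domain) (i k : Fin 4) {v : V}
    (hv : v ∈ T.domain) :
    ap (component T i) (basisUnit k • v) = basisUnit k • ap (component T i) v := by
  have tab := basisUnit_smul_table (V := V)
  have hm : ∀ k, basisUnit k • v ∈ T.domain := fun k => smul_mem_of_twoSided h _ hv
  obtain ⟨h0, h1, h2, h3⟩ := component_eq h hv
  obtain ⟨h0', h1', h2', h3'⟩ := component_eq h (hm k)
  fin_cases k
  · simp [basisUnit_zero]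
  all_goals
    fin_cases i <;>
    simp only [Fin.mk_zero, Fin.mk_one, Fin.reduceFinMk, Fin.isValue] at * <;>
    simp only [h0, h1, h2, h3, h0', h1', h2', h3', smul_real_comm, smul_sub, smul_add, tab,
      smul_neg, ap_neg_vec hv, ap_neg_vec (hm 1), ap_neg_vec (hm 2), ap_neg_vec (hm 3)] <;>
    abel

theorem component_smul (h : IsTwoSided T.domain) (i : Fin 4) (a : ℍ[ℝ]) {v : V}
    (hv : v ∈ T.domain) : ap (component T i) (a • v) = a • ap (component T i) v := by
  have hm : ∀ k (r : ℝ), r • basisUnit k • v ∈ (component T i).domain := fun k r =>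
    Submodule.smul_mem _ _ ((mem_component_domain h).2 (smul_mem_of_twoSided h _ hv))
  have hm' : ∀ k, basisUnit k • v ∈ (component T i).domain := fun k => by simpa using hm k 1
  have hv' : v ∈ (component T i).domain := (mem_component_domain h).2 hv
  have hd : ∀ w : V, a • w = a.re • w + a.imI • basisUnit 1 • w + a.imJ • basisUnit 2 • w +
      a.imK • basisUnit 3 • w := by
    intro w
    conv_lhs => rw [eq_sum_basisUnit a]
    simp only [add_smul, mul_smul, coe_smul]
  have hr : a.re • v ∈ (component T i).domain := Submodule.smul_mem _ _ hv'
  rw [hd, hd, ap_add_vec (add_mem (add_mem hr (hm 1 _)) (hm 2 _)) (hm 3 _),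
    ap_add_vec (add_mem hr (hm 1 _)) (hm 2 _), ap_add_vec hr (hm 1 _), ap_smul_vec _ hv',
    ap_smul_vec _ (hm' 1), ap_smul_vec _ (hm' 2), ap_smul_vec _ (hm' 3),
    component_basisUnit_smul h i 1 hv, component_basisUnit_smul h i 2 hv,
    component_basisUnit_smul h i 3 hv]

/-- The components of an operator `s₀ + e₁ s₁ + e₂ s₂ + e₃ s₃` with left linear `s_i`. -/
theorem ap_component_of_eq {A : V →ₗ.[ℝ] V} (h : IsTwoSided A.domain) (s : Fin 4 → V → V)
    (hs : ∀ i (k : Fin 4), ∀ v ∈ A.domain, s i (basisUnit k • v) = basisUnit k • s i v)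
    (hA : ∀ v ∈ A.domain, ap A v = s 0 v + basisUnit 1 • s 1 v + basisUnit 2 • s 2 v +
      basisUnit 3 • s 3 v) (i : Fin 4) {v : V} (hv : v ∈ A.domain) :
    ap (component A i) v = s i v := by
  have tab := basisUnit_smul_table (V := V)
  have hm : ∀ k, basisUnit k • v ∈ A.domain := fun k => smul_mem_of_twoSided h _ hv
  obtain ⟨h0, h1, h2, h3⟩ := component_eq h hv
  fin_cases i <;>
  simp only [Fin.mk_zero, Fin.mk_one, Fin.reduceFinMk, Fin.isValue] at * <;>
  simp only [h0, h1, h2, h3, hA _ hv, hA _ (hm _), hs _ _ _ hv, smul_sub, smul_add, tab,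
    smul_neg] <;>
  simp only [← leftMul_apply] <;>
  module

theorem mem_conj_domain (h : IsTwoSided T.domain) {v : V} :
    v ∈ (conj T).domain ↔ v ∈ T.domain := by
  rw [conj, mem_sub_domain, mem_sum_domain, mem_component_domain h]
  constructor
  · exact fun h => h.1
  · exact fun hv => ⟨hv, fun i _ => (mem_component_domain h).2 hv⟩

theorem conj_domain (h : IsTwoSided T.domain) : (conj T).domain = T.domain :=
  Submodule.ext fun _ => mem_conj_domain h

theorem ap_conj (h : IsTwoSided T.domain) {v : V} (hv : v ∈ T.domain) :
    ap (conj T) v = ap (component T 0) v - (basisUnit 1 • ap (component T 1) v +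
      basisUnit 2 • ap (component T 2) v + basisUnit 3 • ap (component T 3) v) := by
  have h' : ∀ i, v ∈ (component T i).domain := fun i => (mem_component_domain h).2 hv
  rw [conj, ap_sub (h' 0) (mem_sum_domain (A := fun i => basisUnit i • component T i) |>.2 fun i _ => h' i),
    ap_sum (A := fun i => basisUnit i • component T i) fun i _ => h' i,
    univ_erase_zero, sum_triple _ (by decide) (by decide) (by decide)]
  simp only [ap_smul]

/-- The signs `+, -, -, -` of the conjugation. -/
def conjSign : Fin 4 → ℝ := ![1, -1, -1, -1]

theorem conjSign_mul_self (i : Fin 4) : conjSign i * conjSign i = 1 := by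
  fin_cases i <;> simp [conjSign]

/-- The decomposition with left linear components is unique, and the components of `T` with changed
signs provide one for the conjugate operator. -/
theorem component_conj (h : IsTwoSided T.domain) (i : Fin 4) :
    component (conj T) i = conjSign i • component T i := by
  have h' : IsTwoSided (conj T).domain := by rwa [conj_domain h]
  refine ext_ap ?_ fun v hv => ?_
  · rw [smul_domain, component_domain h', conj_domain h, component_domain h]
  · rw [component_domain h'] at hv
    rw [ap_smul]
    refine ap_component_of_eq h' (fun i v => conjSign i • ap (component T i) v) ?_ ?_ i hv
    · intro i k v hv
      simp only [component_smul h i _ ((mem_conj_domain h).1 hv), smul_real_comm]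
    · intro v hv
      rw [ap_conj h ((mem_conj_domain h).1 hv)]
      simp only [conjSign, Matrix.cons_val_zero, Matrix.cons_val_one, Matrix.cons_val,
        one_smul, neg_smul, smul_neg]
      abel

theorem conj_conj (h : IsTwoSided T.domain) : conj (conj T) = T := by
  have h' : IsTwoSided (conj T).domain := by rwa [conj_domain h]
  refine ext_ap (by rw [conj_domain h', conj_domain h]) fun v hv => ?_
  rw [conj_domain h'] at hv
  rw [ap_conj h' hv, ap_eq_sum_components h ((mem_conj_domain h).1 hv)]
  simp only [component_conj h, ap_smul, conjSign, Matrix.cons_val_zero, Matrix.cons_val_one,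
    Matrix.cons_val, one_smul, neg_smul, smul_neg]
  abel

theorem opComp_smul_smul (i : Fin 4) {r : ℝ} (hr : r * r = 1) :
    opComp (r • component T i) (r • component T i) = opComp (component T i) (component T i) := by
  have hr0 : r ≠ 0 := by
    rintro rfl
    simp at hr
  refine ext_ap (Submodule.ext fun v => ?_) fun v hv => ?_
  · rw [mem_opComp, mem_opComp, smul_domain, ap_smul]
    exact and_congr_right fun _ => Submodule.smul_mem_iff _ hr0
  · have hv1 := mem_opComp.1 hv
    rw [smul_domain, ap_smul, Submodule.smul_mem_iff _ hr0] at hv1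
    rw [ap_opComp hv, ap_opComp (mem_opComp.2 hv1), ap_smul, ap_smul, ap_smul_vec _ hv1.2,
      smul_smul, hr, one_smul]

theorem modSq_conj (h : IsTwoSided T.domain) : modSq (conj T) = modSq T := by
  simp only [modSq, component_conj h, opComp_smul_smul _ (conjSign_mul_self _)]

theorem Qc_conj (h : IsTwoSided T.domain) (D : Submodule ℝ V) (s : ℍ[ℝ]) :
    Qc (conj T) D s = Qc T D s := by
  rw [Qc, Qc, modSq_conj h, component_conj h]
  simp [conjSign]

theorem Qinv_conj (h : IsTwoSided T.domain) (D : Submodule ℝ V) (s : ℍ[ℝ]) :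
    Qinv (conj T) D s = Qinv T D s := by
  rw [Qinv, Qinv, Qc_conj h]

theorem rhoF_conj (h : IsTwoSided T.domain) (D : Submodule ℝ V) :
    rhoF (conj T) D = rhoF T D := by
  ext s
  simp only [rhoF, Set.mem_ofPred_eq]
  rw [Qc_conj h]

/-- Conjugation changes neither `|T|²` nor `Q_{c,s}`, so the hypotheses are symmetric. Every later
result for `T` can be used for `conj T` with the same `D`. -/
theorem IsAdmissible.admissible_conj {D : Submodule ℝ V} (h : IsAdmissible T D) :
    IsAdmissible (conj T) D where
  kc := h.kc_conj
  kc_conj := by rw [conj_conj h.kc.twoSided]; exact h.kc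
  twoSided := h.twoSided
  dense := h.dense
  le_domain := by rw [modSq_conj h.kc.twoSided]; exact h.le_domain
  component_mem := by
    intro v hv hv' i w hw
    rw [mem_opComp, modSq_conj h.kc.twoSided, conj_domain h.kc.twoSided, ← mem_opComp] at hv'
    rw [component_conj h.kc.twoSided, mem_graph_iff_ap, smul_domain, ap_smul] at hw
    have := h.component_mem v hv hv' i _ (mem_graph_iff_ap.2 ⟨hw.1, rfl⟩)
    rw [← hw.2]
    exact D.smul_mem _ this
  closed := by simpa only [Qc_conj h.kc.twoSided] using h.closed

end Components

/-! ### The `Q`-resolvent and its commutation rules. -/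

section Resolvents

variable {T : V →ₗ.[ℝ] V} {D : Submodule ℝ V}

/-- `s² v - 2 s T₀ v + |T|² v`. -/
def quad (T : V →ₗ.[ℝ] V) (s : ℍ[ℝ]) (v : V) : V :=
  s ^ 2 • v - (2 * s) • ap (component T 0) v + ∑ i, ap (component T i) (ap (component T i) v)

theorem IsAdmissible.mem_modSq (hT : IsAdmissible T D) {v : V} :
    v ∈ (modSq T).domain ↔ v ∈ T.domain ∧ ∀ i, ap (component T i) v ∈ T.domain := by
  simp only [modSq, mem_sum_domain, mem_opComp, mem_component_domain hT.kc.twoSided,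
    Finset.mem_univ, forall_const]
  exact ⟨fun h => ⟨(h 0).1, fun i => (h i).2⟩, fun h i => ⟨h.1, h.2 i⟩⟩

theorem IsAdmissible.mem_dom (hT : IsAdmissible T D) {v : V} (hv : v ∈ D) : v ∈ T.domain :=
  (hT.mem_modSq.1 (hT.le_domain hv)).1

theorem IsAdmissible.component_mem_dom (hT : IsAdmissible T D) {v : V} (hv : v ∈ D) (i : Fin 4) :
    ap (component T i) v ∈ T.domain :=
  (hT.mem_modSq.1 (hT.le_domain hv)).2 i

theorem IsAdmissible.component_comm (hT : IsAdmissible T D) {v : V} (hv : v ∈ D) (i j : Fin 4) :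
    ap (component T i) (ap (component T j) v) = ap (component T j) (ap (component T i) v) := by
  have hm : ∀ i j, v ∈ (opComp (component T i) (component T j)).domain := fun i j =>
    mem_opComp.2 ⟨(mem_component_domain hT.kc.twoSided).2 (hT.mem_dom hv),
      (mem_component_domain hT.kc.twoSided).2 (hT.component_mem_dom hv j)⟩
  have h := congrArg (fun A => ap A v) (hT.kc.commute i j)
  simp only [ap_domRestrict (hT.le_domain hv) (hm _ _), ap_opComp (hm _ _)] at h
  exact h

theorem IsAdmissible.ap_modSq (hT : IsAdmissible T D) {v : V} (hv : v ∈ D) :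
    ap (modSq T) v = ∑ i, ap (component T i) (ap (component T i) v) := by
  have hm : ∀ i, v ∈ (opComp (component T i) (component T i)).domain := fun i =>
    mem_opComp.2 ⟨(mem_component_domain hT.kc.twoSided).2 (hT.mem_dom hv),
      (mem_component_domain hT.kc.twoSided).2 (hT.component_mem_dom hv i)⟩
  rw [modSq, ap_sum fun i _ => hm i]
  simp only [ap_opComp (hm _)]

theorem IsAdmissible.mem_Qc (hT : IsAdmissible T D) {s : ℍ[ℝ]} {v : V} :
    v ∈ (Qc T D s).domain ↔ v ∈ D := by
  rw [Qc, mem_domRestrict]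
  refine ⟨fun h => h.1, fun h => ⟨h, ⟨⟨trivial, ?_⟩, hT.le_domain h⟩⟩⟩
  exact (mem_component_domain hT.kc.twoSided).2 (hT.mem_dom h)

theorem IsAdmissible.ap_Qc (hT : IsAdmissible T D) {s : ℍ[ℝ]} {v : V} (hv : v ∈ D) :
    ap (Qc T D s) v = quad T s v := by
  have h0 : v ∈ ((2 * s) • component T 0).domain := by
    rw [smul_domain, mem_component_domain hT.kc.twoSided]
    exact hT.mem_dom hv
  have h1 : v ∈ (total (leftMul (s ^ 2)) - (2 * s) • component T 0).domain := ⟨trivial, h0⟩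
  rw [Qc, ap_domRestrict hv (mem_add_domain.2 ⟨h1, hT.le_domain hv⟩),
    ap_add h1 (hT.le_domain hv), ap_sub (by trivial) h0, hT.ap_modSq hv, ap_smul,
    ap_total, leftMul_apply, quad]

theorem IsAdmissible.ker_Qc (_hT : IsAdmissible T D) {s : ℍ[ℝ]} (hs : s ∈ rhoF T D) :
    LinearMap.ker (Qc T D s).toFun = ⊥ := LinearMap.ker_eq_bot.2 hs.1

theorem IsAdmissible.Qinv_quad (hT : IsAdmissible T D) {s : ℍ[ℝ]} (hs : s ∈ rhoF T D) {u : V}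
    (hu : u ∈ D) : Qinv T D s (quad T s u) = u := by
  rw [← ap_total, total_Qinv hT hs, ← hT.ap_Qc hu, ap_inverse (hT.ker_Qc hs) (hT.mem_Qc.2 hu)]

theorem IsAdmissible.exists_quad (hT : IsAdmissible T D) {s : ℍ[ℝ]} (hs : s ∈ rhoF T D) (v : V) :
    ∃ u ∈ D, quad T s u = v := by
  obtain ⟨u, hu⟩ := hs.2 v
  refine ⟨u, hT.mem_Qc.1 u.2, ?_⟩
  rw [← hT.ap_Qc (hT.mem_Qc.1 u.2), ap_of_mem u.2]
  exact hu

theorem IsAdmissible.Qinv_mem (hT : IsAdmissible T D) {s : ℍ[ℝ]} (hs : s ∈ rhoF T D) (v : V) :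
    Qinv T D s v ∈ D := by
  obtain ⟨u, hu, rfl⟩ := hT.exists_quad hs v
  rwa [hT.Qinv_quad hs hu]

theorem IsAdmissible.quad_Qinv (hT : IsAdmissible T D) {s : ℍ[ℝ]} (hs : s ∈ rhoF T D) (v : V) :
    quad T s (Qinv T D s v) = v := by
  obtain ⟨u, hu, rfl⟩ := hT.exists_quad hs v
  rw [hT.Qinv_quad hs hu]

/-- Linearity of a component on its domain. -/
theorem IsAdmissible.component_add (hT : IsAdmissible T D) (i : Fin 4) {v w : V}
    (hv : v ∈ T.domain) (hw : w ∈ T.domain) :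
    ap (component T i) (v + w) = ap (component T i) v + ap (component T i) w :=
  ap_add_vec ((mem_component_domain hT.kc.twoSided).2 hv)
    ((mem_component_domain hT.kc.twoSided).2 hw)

theorem IsAdmissible.component_sub (hT : IsAdmissible T D) (i : Fin 4) {v w : V}
    (hv : v ∈ T.domain) (hw : w ∈ T.domain) :
    ap (component T i) (v - w) = ap (component T i) v - ap (component T i) w :=
  ap_sub_vec ((mem_component_domain hT.kc.twoSided).2 hv)
    ((mem_component_domain hT.kc.twoSided).2 hw)

theorem IsAdmissible.component_sum (hT : IsAdmissible T D) (i : Fin 4) {ι : Type*} (s : Finset ι)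
    (f : ι → V) (hf : ∀ j ∈ s, f j ∈ T.domain) :
    ap (component T i) (∑ j ∈ s, f j) = ∑ j ∈ s, ap (component T i) (f j) :=
  ap_sum_vec s f fun j hj => (mem_component_domain hT.kc.twoSided).2 (hf j hj)

theorem IsAdmissible.smul_mem (hT : IsAdmissible T D) (a : ℍ[ℝ]) {v : V} (hv : v ∈ T.domain) :
    a • v ∈ T.domain := smul_mem_of_twoSided hT.kc.twoSided a hv

/-- This is where the invariance assumption on `D` does its work: it puts `T_i u` into `D` for `u =
Q_{c,s}(T)⁻¹ v`. Once that is known, commuting components give `Q_{c,s}(T) T_i u = T_i v`, and the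
inverse can be applied. -/
theorem IsAdmissible.component_Qinv (hT : IsAdmissible T D) {s : ℍ[ℝ]} (hs : s ∈ rhoF T D)
    (i : Fin 4) {v : V} (hv : v ∈ T.domain) :
    ap (component T i) (Qinv T D s v) ∈ D ∧
      ap (component T i) (Qinv T D s v) = Qinv T D s (ap (component T i) v) := by
  set u := Qinv T D s v with hu
  have hD : u ∈ D := hT.Qinv_mem hs v
  have hq : quad T s u = v := hT.quad_Qinv hs v
  have h1 : ∀ j, ap (component T j) u ∈ T.domain := fun j => hT.component_mem_dom hD j
  -- Solving `Q_{c,s}(T) u = v` for `|T|² u` shows that it lies in `dom T`, which is the premise of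
  -- the invariance assumption.
  have hsum : ∑ i, ap (component T i) (ap (component T i) u) ∈ T.domain := by
    have : ∑ i, ap (component T i) (ap (component T i) u) =
        v - s ^ 2 • u + (2 * s) • ap (component T 0) u := by
      rw [← hq, quad]
      abel
    rw [this]
    exact add_mem (sub_mem hv (hT.smul_mem _ (hT.mem_dom hD))) (hT.smul_mem _ (h1 0))
  have hmem : ∀ j, ap (component T j) u ∈ D := by
    intro j
    refine hT.component_mem u hD (mem_opComp.2 ⟨hT.le_domain hD, ?_⟩) j _
      (mem_graph_iff_ap.2 ⟨(mem_component_domain hT.kc.twoSided).2 (hT.mem_dom hD), rfl⟩)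
    rwa [hT.ap_modSq hD]
  refine ⟨hmem i, ?_⟩
  have hq' : quad T s (ap (component T i) u) = ap (component T i) v := by
    rw [← hq, quad, quad, hT.component_add i (sub_mem (hT.smul_mem _ (hT.mem_dom hD))
      (hT.smul_mem _ (h1 0))) hsum, hT.component_sub i (hT.smul_mem _ (hT.mem_dom hD))
      (hT.smul_mem _ (h1 0)), component_smul hT.kc.twoSided i _ (hT.mem_dom hD),
      component_smul hT.kc.twoSided i _ (h1 0),
      hT.component_sum i _ _ fun j _ => hT.component_mem_dom (hmem j) j,
      hT.component_comm hD i 0]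
    congr 1
    refine Finset.sum_congr rfl fun j _ => ?_
    rw [hT.component_comm (hmem j) i j, hT.component_comm hD i j]
  rw [← hq', hT.Qinv_quad hs (hmem i)]

/-- Both operators are bijections from `D` onto the space, so an intertwining relation needs to be
checked on `D` only. -/
theorem IsAdmissible.Qinv_intertwine (hT : IsAdmissible T D) {s p : ℍ[ℝ]} (hs : s ∈ rhoF T D)
    (hp : p ∈ rhoF T D) {B : V →L[ℝ] V} (hB : ∀ u ∈ D, B u ∈ D)
    (hBq : ∀ u ∈ D, B (quad T s u) = quad T p (B u)) : B * Qinv T D s = Qinv T D p * B := by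
  ext v
  simp only [mul_apply_eq_comp]
  have hD := hT.Qinv_mem hs v
  rw [← hT.Qinv_quad hp (hB _ hD), ← hBq _ hD, hT.quad_Qinv hs]

/-- The components are left linear, so `a` only meets the coefficients `s²` and `2s`. With `p = s`
this is commutation within a slice, with `p` the conjugate of `s` it covers the quaternions
anticommuting with the slice, and with `a = e_k` it covers the rotations. -/
theorem IsAdmissible.leftMul_Qinv (hT : IsAdmissible T D) {s p : ℍ[ℝ]} (hs : s ∈ rhoF T D)
    (hp : p ∈ rhoF T D) {a : ℍ[ℝ]} (h : a * s = p * a) :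
    leftMul a * Qinv T D s = Qinv T D p * leftMul a := by
  refine hT.Qinv_intertwine hs hp (fun u hu => (hT.twoSided u hu a).1) fun u hu => ?_
  have h2 : a * s ^ 2 = p ^ 2 * a := by
    rw [pow_two, pow_two, ← mul_assoc, h, mul_assoc, h, mul_assoc]
  have h3 : a * (2 * s) = 2 * p * a := by
    rw [two_mul, two_mul, mul_add, h, add_mul]
  simp only [leftMul_apply, quad, smul_add, smul_sub, Finset.smul_sum, smul_smul, h2, h3]
  simp only [component_smul hT.kc.twoSided _ _ (hT.mem_dom hu),
    component_smul hT.kc.twoSided _ _ (hT.component_mem_dom hu _), smul_smul]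

theorem IsAdmissible.Qinv_comm (hT : IsAdmissible T D) {s p : ℍ[ℝ]} (hs : s ∈ rhoF T D)
    (hp : p ∈ rhoF T D) (h : Commute s p) :
    Qinv T D s * Qinv T D p = Qinv T D p * Qinv T D s := by
  refine hT.Qinv_intertwine hp hp (fun u _ => hT.Qinv_mem hs u) fun u hu => ?_
  have hc : ∀ a : ℍ[ℝ], Commute s a → ∀ v, Qinv T D s (a • v) = a • Qinv T D s v := by
    intro a ha v
    have := congrArg (fun B : V →L[ℝ] V => B v) (hT.leftMul_Qinv hs hs (a := a) ha.symm)
    simpa [leftMul_apply] using this.symm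
  simp only [quad, map_add, map_sub, map_sum, hc _ (h.pow_right 2),
    hc _ ((Commute.ofNat_right s 2).mul_right h)]
  rw [(hT.component_Qinv hs 0 (hT.mem_dom hu)).2]
  congr 1
  refine Finset.sum_congr rfl fun i _ => ?_
  rw [(hT.component_Qinv hs i (hT.mem_dom hu)).2,
    (hT.component_Qinv hs i (hT.component_mem_dom hu i)).2]

/-- The vector part `e₁ T₁ v + e₂ T₂ v + e₃ T₃ v`. -/
def vec (T : V →ₗ.[ℝ] V) (v : V) : V :=
  basisUnit 1 • ap (component T 1) v + basisUnit 2 • ap (component T 2) v +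
    basisUnit 3 • ap (component T 3) v

theorem IsAdmissible.ap_T (hT : IsAdmissible T D) {v : V} (hv : v ∈ T.domain) :
    ap T v = ap (component T 0) v + vec T v := by
  rw [ap_eq_sum_components hT.kc.twoSided hv, vec]
  abel

theorem IsAdmissible.SL_apply (hT : IsAdmissible T D) {s : ℍ[ℝ]} (hs : s ∈ rhoF T D) (v : V) :
    SL T D s v = s • Qinv T D s v - ap (component T 0) (Qinv T D s v) +
      vec T (Qinv T D s v) := by
  have hd := hT.mem_dom (hT.Qinv_mem hs v)
  have hd' := (mem_conj_domain hT.kc.twoSided).2 hd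
  rw [← ap_total (SL T D s), total_SL hT hs, ← total_Qinv hT hs, ap_opComp, ap_total,
    ap_sub (by trivial) hd', ap_total, leftMul_apply, ap_conj hT.kc.twoSided hd, vec]
  · abel
  · rw [mem_opComp, ap_total]
    exact ⟨trivial, trivial, hd'⟩

theorem vec_conj (h : IsTwoSided T.domain) (v : V) : vec (conj T) v = -vec T v := by
  simp only [vec, component_conj h, ap_smul, conjSign, Matrix.cons_val_one, Matrix.cons_val,
    neg_smul, one_smul, smul_neg]
  abel

theorem component_conj_zero (h : IsTwoSided T.domain) : component (conj T) 0 = component T 0 := by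
  simp [component_conj h, conjSign]

theorem IsAdmissible.SL_conj_apply (hT : IsAdmissible T D) {s : ℍ[ℝ]} (hs : s ∈ rhoF T D)
    (v : V) : SL (conj T) D s v =
      s • Qinv T D s v - ap (component T 0) (Qinv T D s v) - vec T (Qinv T D s v) := by
  rw [hT.admissible_conj.SL_apply (by rwa [rhoF_conj hT.kc.twoSided]), vec_conj hT.kc.twoSided,
    component_conj_zero hT.kc.twoSided, Qinv_conj hT.kc.twoSided, sub_eq_add_neg _ (vec _ _)]

end Resolvents

/-! ### Left multiplications as bounded operators. -/

section LeftMul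

theorem leftMul_mul (a b : ℍ[ℝ]) : (leftMul (a * b) : V →L[ℝ] V) = leftMul a * leftMul b := by
  ext v
  simp [leftMul_apply, mul_smul]

theorem leftMul_one : (leftMul 1 : V →L[ℝ] V) = 1 := by
  ext v
  simp [leftMul_apply]

theorem leftMul_add (a b : ℍ[ℝ]) : (leftMul (a + b) : V →L[ℝ] V) = leftMul a + leftMul b := by
  ext v
  simp [leftMul_apply, add_smul]

theorem leftMul_sub (a b : ℍ[ℝ]) : (leftMul (a - b) : V →L[ℝ] V) = leftMul a - leftMul b := by
  ext v
  simp [leftMul_apply, sub_smul]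

theorem leftMul_neg (a : ℍ[ℝ]) : (leftMul (-a) : V →L[ℝ] V) = -leftMul a := by
  ext v
  simp [leftMul_apply]

theorem leftMul_coe (r : ℝ) : (leftMul (r : ℍ[ℝ]) : V →L[ℝ] V) = r • 1 := by
  ext v
  simp [leftMul_apply, coe_smul]

theorem norm_leftMul_le (a : ℍ[ℝ]) : ‖(leftMul a : V →L[ℝ] V)‖ ≤ ‖a‖ :=
  ContinuousLinearMap.opNorm_le_bound _ (norm_nonneg a) fun v => (norm_smul a v).le

/-- Multiplication by `a⁻¹` undoes multiplication by `a`, so the obvious estimate is an equality.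
Norms of integrands can then be computed exactly, which is needed to infer convergence of one
integral from that of another. -/
theorem norm_mul_leftMul (B : V →L[ℝ] V) (a : ℍ[ℝ]) : ‖B * leftMul a‖ = ‖B‖ * ‖a‖ := by
  refine le_antisymm ((norm_mul_le _ _).trans (by gcongr; exact norm_leftMul_le a)) ?_
  by_cases ha : a = 0
  · simp [ha]
  have h : B = B * leftMul a * leftMul a⁻¹ := by
    rw [mul_assoc, ← leftMul_mul, mul_inv_cancel₀ ha, leftMul_one, mul_one]
  have hb : ‖B‖ ≤ ‖B * leftMul a‖ * ‖a‖⁻¹ := by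
    conv_lhs => rw [h]
    refine (norm_mul_le _ _).trans ?_
    gcongr
    exact (norm_leftMul_le _).trans (norm_inv a).le
  rwa [← div_eq_mul_inv, le_div_iff₀ (norm_pos_iff.2 ha)] at hb

theorem norm_basisUnit (k : Fin 4) : ‖basisUnit k‖ = 1 := by
  have h : ‖basisUnit k‖ * ‖basisUnit k‖ = 1 := by
    have := basisUnit_table
    fin_cases k <;>
    simp only [Fin.mk_zero, Fin.mk_one, Fin.reduceFinMk, Fin.isValue, ← norm_mul, this,
      basisUnit_zero, norm_neg, norm_one, mul_one]
  nlinarith [norm_nonneg (basisUnit k)]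

theorem norm_leftMul_basisUnit_le (k : Fin 4) :
    ‖(leftMul (basisUnit k) : V →L[ℝ] V)‖ ≤ 1 :=
  (norm_leftMul_le _).trans (norm_basisUnit k).le

end LeftMul

/-! ### Recovering all first order resolvents, and the `Q`-resolvent, from `S_L⁻¹(s, T)`. -/

section ResolventIdentities

variable {T : V →ₗ.[ℝ] V} {D : Submodule ℝ V}

/-- The operator `(s - T₀) Q_{c,s}(T)⁻¹`. -/
def scalarQ (T : V →ₗ.[ℝ] V) (D : Submodule ℝ V) (s : ℍ[ℝ]) : V →L[ℝ] V :=
  (2⁻¹ : ℝ) • (SL T D s + SL (conj T) D s)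

/-- The operator `(e₁ T₁ + e₂ T₂ + e₃ T₃) Q_{c,s}(T)⁻¹`. -/
def vectorQ (T : V →ₗ.[ℝ] V) (D : Submodule ℝ V) (s : ℍ[ℝ]) : V →L[ℝ] V :=
  (2⁻¹ : ℝ) • (SL T D s - SL (conj T) D s)

/-- The operator `e_k⁻¹ S_L⁻¹(e_k s e_k⁻¹, T) e_k`. -/
def rotSL (T : V →ₗ.[ℝ] V) (D : Submodule ℝ V) (k : Fin 4) (s : ℍ[ℝ]) : V →L[ℝ] V :=
  -(leftMul (basisUnit k) * SL T D (-(basisUnit k * s * basisUnit k)) * leftMul (basisUnit k))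

/-- The operator `T_k Q_{c,s}(T)⁻¹` for `k ≠ 0`. -/
def compQ (T : V →ₗ.[ℝ] V) (D : Submodule ℝ V) (k : Fin 4) (s : ℍ[ℝ]) : V →L[ℝ] V :=
  -(leftMul (basisUnit k) * ((2⁻¹ : ℝ) • (SL T D s + rotSL T D k s) -
    (4⁻¹ : ℝ) • (SL T D s + rotSL T D 1 s + rotSL T D 2 s + rotSL T D 3 s)))

variable (hT : IsAdmissible T D) {s : ℍ[ℝ]} (hs : s ∈ rhoF T D)
include hT hs

theorem IsAdmissible.scalarQ_apply (v : V) :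
    scalarQ T D s v = s • Qinv T D s v - ap (component T 0) (Qinv T D s v) := by
  simp only [scalarQ, smul_apply, add_apply,
    hT.SL_apply hs, hT.SL_conj_apply hs, ← leftMul_apply]
  module

theorem IsAdmissible.vectorQ_apply (v : V) : vectorQ T D s v = vec T (Qinv T D s v) := by
  simp only [vectorQ, smul_apply, sub_apply,
    hT.SL_apply hs, hT.SL_conj_apply hs, ← leftMul_apply]
  module

omit hT hs in
theorem SL_eq_add : SL T D s = scalarQ T D s + vectorQ T D s := by
  rw [scalarQ, vectorQ]
  module

omit hT hs in
theorem SL_conj_eq_sub : SL (conj T) D s = scalarQ T D s - vectorQ T D s := by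
  rw [scalarQ, vectorQ]
  module

theorem IsAdmissible.smul_Qinv {a : ℍ[ℝ]} (ha : Commute a s) (v : V) :
    Qinv T D s (a • v) = a • Qinv T D s v := by
  have := congrArg (fun B : V →L[ℝ] V => B v) (hT.leftMul_Qinv hs hs (a := a) ha)
  simpa [leftMul_apply] using this.symm

/-- The intertwining rule moves the inner resolvent back to the point `s`. What remains is
conjugation by `e_k`, which fixes the scalar part and the `e_k` part and reverses the two other
vector parts. -/
theorem IsAdmissible.rotSL_apply (k : Fin 4)
    (hk : basisUnit k * basisUnit k = -1)
    (hks : -(basisUnit k * s * basisUnit k) ∈ rhoF T D) (v : V) :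
    rotSL T D k s v = s • Qinv T D s v - ap (component T 0) (Qinv T D s v) -
      basisUnit k • vec T (basisUnit k • Qinv T D s v) := by
  have h1 : basisUnit k * s = -(basisUnit k * s * basisUnit k) * basisUnit k := by
    rw [neg_mul, mul_assoc _ (basisUnit k) (basisUnit k), hk]
    simp
  have h2 : Qinv T D (-(basisUnit k * s * basisUnit k)) (basisUnit k • v) =
      basisUnit k • Qinv T D s v := by
    have := congrArg (fun B : V →L[ℝ] V => B v) (hT.leftMul_Qinv hs hks h1)
    simpa [leftMul_apply] using this.symm
  have hd := hT.mem_dom (hT.Qinv_mem hs v)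
  simp only [rotSL, neg_apply, mul_apply_eq_comp, leftMul_apply,
    hT.SL_apply hks, h2, component_smul hT.kc.twoSided _ _ hd, smul_add, smul_sub]
  simp only [smul_smul, hk, ← mul_assoc, ← neg_mul]
  simp only [mul_assoc, hk]
  simp only [neg_smul, one_smul, mul_neg, neg_mul, hk, ← mul_assoc, mul_one, one_mul, neg_neg]
  abel

theorem IsAdmissible.basisUnit_vec {v : V} (hv : v ∈ T.domain) :
    basisUnit 1 • vec T (basisUnit 1 • v) = -(basisUnit 1 • ap (component T 1) v) +
      basisUnit 2 • ap (component T 2) v + basisUnit 3 • ap (component T 3) v ∧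
    basisUnit 2 • vec T (basisUnit 2 • v) = basisUnit 1 • ap (component T 1) v -
      basisUnit 2 • ap (component T 2) v + basisUnit 3 • ap (component T 3) v ∧
    basisUnit 3 • vec T (basisUnit 3 • v) = basisUnit 1 • ap (component T 1) v +
      basisUnit 2 • ap (component T 2) v - basisUnit 3 • ap (component T 3) v := by
  have tab := basisUnit_smul_table (V := V)
  simp only [vec, component_smul hT.kc.twoSided _ _ hv, smul_add, tab, smul_neg]
  refine ⟨?_, ?_, ?_⟩ <;> abel

variable (hs1 : -(basisUnit 1 * s * basisUnit 1) ∈ rhoF T D)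
  (hs2 : -(basisUnit 2 * s * basisUnit 2) ∈ rhoF T D)
  (hs3 : -(basisUnit 3 * s * basisUnit 3) ∈ rhoF T D)
include hs1 hs2 hs3

/-- In the average over the identity and three rotations every vector part occurs twice with each
sign. So `(s - T₀) Q⁻¹` is expressed by `S_L⁻¹` of `T` alone, without any knowledge about `T̄`. -/
theorem IsAdmissible.scalarQ_eq : scalarQ T D s =
    (4⁻¹ : ℝ) • (SL T D s + rotSL T D 1 s + rotSL T D 2 s + rotSL T D 3 s) := by
  ext v
  obtain ⟨t1, t2, t3, -⟩ := basisUnit_table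
  obtain ⟨h1, h2, h3⟩ := hT.basisUnit_vec hs (hT.mem_dom (hT.Qinv_mem hs v))
  simp only [hT.scalarQ_apply hs, smul_apply, add_apply,
    hT.SL_apply hs, hT.rotSL_apply hs 1 t1 hs1, hT.rotSL_apply hs 2 t2 hs2,
    hT.rotSL_apply hs 3 t3 hs3, h1, h2, h3]
  simp only [vec, ← leftMul_apply]
  module

/-- The mean of `S_L⁻¹` and one rotation keeps the scalar part and one vector part; subtracting the
full average isolates that vector part. -/
theorem IsAdmissible.compQ_apply {k : Fin 4} (hk : k ≠ 0) (v : V) :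
    compQ T D k s v = ap (component T k) (Qinv T D s v) := by
  have tab := basisUnit_smul_table (V := V)
  obtain ⟨t1, t2, t3, -⟩ := basisUnit_table
  obtain ⟨h1, h2, h3⟩ := hT.basisUnit_vec hs (hT.mem_dom (hT.Qinv_mem hs v))
  have key : ((2⁻¹ : ℝ) • (SL T D s + rotSL T D k s) - scalarQ T D s) v =
      basisUnit k • ap (component T k) (Qinv T D s v) := by
    simp only [hT.scalarQ_apply hs, smul_apply,
      add_apply, sub_apply, hT.SL_apply hs]
    fin_cases k
    · exact absurd rfl hk
    · simp only [Fin.mk_one, hT.rotSL_apply hs 1 t1 hs1, h1]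
      simp only [vec, ← leftMul_apply]
      module
    · simp only [Fin.reduceFinMk, hT.rotSL_apply hs 2 t2 hs2, h2]
      simp only [vec, ← leftMul_apply]
      module
    · simp only [Fin.reduceFinMk, hT.rotSL_apply hs 3 t3 hs3, h3]
      simp only [vec, ← leftMul_apply]
      module
  rw [compQ, ← hT.scalarQ_eq hs hs1 hs2 hs3, neg_apply, mul_apply_eq_comp,
    key, leftMul_apply]
  fin_cases k
  · exact absurd rfl hk
  all_goals simp only [Fin.mk_one, Fin.reduceFinMk, tab, neg_neg]

/-- Completing the square, `Q_{c,s}(T) = (s - T₀)² + T₁² + T₂² + T₃²`, where the sum of the last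
three squares is minus the square of the vector part. Applied to `Q⁻¹ Q⁻¹` this writes `Q⁻¹` through
products of two first order operators, hence the quadratic bound. -/
theorem IsAdmissible.Qinv_eq : Qinv T D s = scalarQ T D s * scalarQ T D s -
    (compQ T D 1 s * leftMul (basisUnit 1) + compQ T D 2 s * leftMul (basisUnit 2) +
      compQ T D 3 s * leftMul (basisUnit 3)) * vectorQ T D s := by
  ext v
  have tab := basisUnit_smul_table (V := V)
  have h2 := hT.kc.twoSided
  set w := Qinv T D s v with hw
  set u := Qinv T D s w with hu
  have hwD : w ∈ D := hT.Qinv_mem hs v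
  have huD : u ∈ D := hT.Qinv_mem hs w
  have hwd := hT.mem_dom hwD
  have hud := hT.mem_dom huD
  have htw := hT.component_mem_dom hwD
  have htu := hT.component_mem_dom huD
  have hQt : ∀ i, Qinv T D s (ap (component T i) w) = ap (component T i) u := fun i =>
    (hT.component_Qinv hs i hwd).2.symm
  have hA : scalarQ T D s (scalarQ T D s v) =
      s ^ 2 • u - (2 * s) • ap (component T 0) u + ap (component T 0) (ap (component T 0) u) := by
    rw [hT.scalarQ_apply hs v, hT.scalarQ_apply hs, ← hw, map_sub, hQt,
      hT.smul_Qinv hs (Commute.refl s), ← hu, hT.component_sub 0 (hT.smul_mem _ hud) (htu 0),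
      component_smul h2 _ _ hud, two_mul, add_smul, pow_two, mul_smul, smul_sub]
    abel
  have hvec : vectorQ T D s v = vec T w := hT.vectorQ_apply hs v
  have hvd : vec T w ∈ T.domain := by
    rw [vec]
    exact add_mem (add_mem (hT.smul_mem _ (htw 1)) (hT.smul_mem _ (htw 2)))
      (hT.smul_mem _ (htw 3))
  have hc : ∀ k : Fin 4, k ≠ 0 → compQ T D k s (basisUnit k • vec T w) =
      Qinv T D s (basisUnit k • (basisUnit 1 • ap (component T k) (ap (component T 1) w) +
        basisUnit 2 • ap (component T k) (ap (component T 2) w) +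
        basisUnit 3 • ap (component T k) (ap (component T 3) w))) := by
    intro k hk
    rw [hT.compQ_apply hs hs1 hs2 hs3 hk, (hT.component_Qinv hs k (hT.smul_mem _ hvd)).2,
      component_smul h2 _ _ hvd, vec, hT.component_add k (add_mem (hT.smul_mem _ (htw 1))
      (hT.smul_mem _ (htw 2))) (hT.smul_mem _ (htw 3)), hT.component_add k
      (hT.smul_mem _ (htw 1)) (hT.smul_mem _ (htw 2)), component_smul h2 _ _ (htw 1),
      component_smul h2 _ _ (htw 2), component_smul h2 _ _ (htw 3)]
  have hB : compQ T D 1 s (basisUnit 1 • vec T w) + compQ T D 2 s (basisUnit 2 • vec T w) +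
      compQ T D 3 s (basisUnit 3 • vec T w) = -(ap (component T 1) (ap (component T 1) u) +
        ap (component T 2) (ap (component T 2) u) + ap (component T 3) (ap (component T 3) u)) := by
    have hQtt : ∀ i, Qinv T D s (ap (component T i) (ap (component T i) w)) =
        ap (component T i) (ap (component T i) u) := fun i => by
      rw [← hQt, ← (hT.component_Qinv hs i (htw i)).2]
    rw [hc 1 (by decide), hc 2 (by decide), hc 3 (by decide), ← map_add, ← map_add, ← hQtt 1,
      ← hQtt 2, ← hQtt 3, ← map_add, ← map_add, ← map_neg]
    congr 1
    -- The mixed terms cancel in pairs, since the components commute while different `e_k`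
    -- anticommute; only `e_k² = -1` survives.
    rw [hT.component_comm hwD 2 1, hT.component_comm hwD 3 1, hT.component_comm hwD 3 2]
    simp only [smul_add, tab]
    abel
  have hq : quad T s u = w := hT.quad_Qinv hs w
  simp only [sub_apply, mul_apply_eq_comp, add_apply,
    leftMul_apply, hvec, hA, hB]
  rw [← hq, quad, Fin.sum_univ_four]
  abel

end ResolventIdentities

/-! ### Resolvent equations and the bounded inverse of `1 + T`. -/

section ResolventEquations

variable {T : V →ₗ.[ℝ] V} {D : Submodule ℝ V} (hT : IsAdmissible T D)
include hT

theorem IsAdmissible.quad_sub {s p : ℍ[ℝ]} (hsp : Commute s p) (u : V) :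
    quad T p u = quad T s u +
      (p - s) • ((p + s) • u - (2 : ℝ) • ap (component T 0) u) := by
  have h2 : (p - s) * (p + s) = p ^ 2 - s ^ 2 := by
    rw [sub_mul, mul_add, mul_add, hsp.eq]
    noncomm_ring
  have h3 : ∀ a : ℍ[ℝ], (2 * a) • ap (component T 0) u = (2 : ℝ) • a • ap (component T 0) u := by
    intro a
    rw [two_mul, add_smul, two_smul]
  rw [quad, quad, smul_sub, smul_smul, h2, sub_smul, h3, h3, smul_real_comm, sub_smul, smul_sub]
  abel

/-- The difference of the two quadratic polynomials has the factor `p - s`. It is kept on the right,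
so that the identity serves as a difference quotient for the Cauchy-Riemann equation with right
multiplication by `J`. -/
theorem IsAdmissible.Qinv_sub {s p : ℍ[ℝ]} (hs : s ∈ rhoF T D) (hp : p ∈ rhoF T D)
    (hsp : Commute s p) : Qinv T D p - Qinv T D s =
      -(Qinv T D p * ((2 : ℝ) • scalarQ T D s + Qinv T D s * leftMul (p - s))) *
        leftMul (p - s) := by
  ext v
  have hc : Commute (p - s) s := (hsp.symm.sub_left (Commute.refl s))
  set u := Qinv T D s v with hu
  have hud : u ∈ D := hT.Qinv_mem hs v
  have h0 : ap (component T 0) ((p - s) • u) = (p - s) • ap (component T 0) u :=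
    component_smul hT.kc.twoSided 0 _ (hT.mem_dom hud)
  have h1 : Qinv T D p v = u - Qinv T D p ((p - s) • ((p + s) • u -
      (2 : ℝ) • ap (component T 0) u)) := by
    rw [eq_sub_iff_add_eq, ← map_add]
    conv_lhs => rw [← hT.quad_Qinv hs v]
    rw [← hu, ← hT.quad_sub hsp, hT.Qinv_quad hp hud]
  simp only [sub_apply, mul_apply_eq_comp, neg_apply, add_apply, smul_apply, leftMul_apply, h1,
    hT.scalarQ_apply hs, hT.smul_Qinv hs hc, ← hu, h0]
  rw [sub_sub_cancel_left]
  congr 2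
  rw [smul_smul s, ← hc.eq, two_smul, two_smul]
  simp only [smul_sub, add_smul, sub_smul, smul_smul, sub_mul, hsp.eq, smul_add]
  abel

theorem IsAdmissible.SL_sub {s p : ℍ[ℝ]} (hs : s ∈ rhoF T D) (hp : p ∈ rhoF T D)
    (hsp : Commute s p) : SL T D p - SL T D s =
      (Qinv T D s - SL T D p * ((2 : ℝ) • scalarQ T D s + Qinv T D s * leftMul (p - s))) *
        leftMul (p - s) := by
  ext v
  have h2 := hT.kc.twoSided
  have hc : Commute (p - s) s := (hsp.symm.sub_left (Commute.refl s))
  set z := ((2 : ℝ) • scalarQ T D s + Qinv T D s * leftMul (p - s) : V →L[ℝ] V) ((p - s) • v)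
    with hz
  have h1 : Qinv T D p v = Qinv T D s v - Qinv T D p z := by
    have := congrArg (fun B : V →L[ℝ] V => B v) (hT.Qinv_sub hs hp hsp)
    simp only [sub_apply, mul_apply_eq_comp, neg_apply, leftMul_apply, ← hz] at this
    rw [sub_eq_iff_eq_add] at this
    rw [this]
    abel
  have hu := hT.mem_dom (hT.Qinv_mem hs v)
  have hpz := hT.mem_dom (hT.Qinv_mem hp z)
  have hcs : ∀ i, ap (component T i) (Qinv T D s v - Qinv T D p z) =
      ap (component T i) (Qinv T D s v) - ap (component T i) (Qinv T D p z) := fun i =>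
    hT.component_sub i hu hpz
  simp only [sub_apply, mul_apply_eq_comp, leftMul_apply, ← hz]
  rw [hT.SL_apply hp, hT.SL_apply hs, hT.SL_apply hp, h1, hcs, hT.smul_Qinv hs hc, vec, vec, vec,
    hcs, hcs, hcs]
  simp only [smul_sub, sub_smul]
  abel

theorem IsAdmissible.SL_mem_dom {s : ℍ[ℝ]} (hs : s ∈ rhoF T D) (v : V) :
    SL T D s v ∈ T.domain := by
  have hw := hT.Qinv_mem hs v
  have hd := hT.mem_dom hw
  have ht := hT.component_mem_dom hw
  rw [hT.SL_apply hs, vec]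
  exact add_mem (sub_mem (hT.smul_mem _ hd) (ht 0)) (add_mem (add_mem (hT.smul_mem _ (ht 1))
    (hT.smul_mem _ (ht 2))) (hT.smul_mem _ (ht 3)))

/-- With `w = Q_{c,s}(T)⁻¹ v`, both `T S_L⁻¹ v` and `S_L⁻¹ s v` are second order expressions in the
components of `T` at `w`, and they differ by `Q_{c,s}(T) w = v`. -/
theorem IsAdmissible.ap_SL {s : ℍ[ℝ]} (hs : s ∈ rhoF T D) (v : V) :
    ap T (SL T D s v) = SL T D s (s • v) - v := by
  have tab := basisUnit_smul_table (V := V)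
  have h2 := hT.kc.twoSided
  set w := Qinv T D s v with hwdef
  have hw : w ∈ D := hT.Qinv_mem hs v
  have hd := hT.mem_dom hw
  have ht := hT.component_mem_dom hw
  have hcomp : ∀ i, ap (component T i) (s • w - ap (component T 0) w + vec T w) =
      s • ap (component T i) w - ap (component T 0) (ap (component T i) w) +
      (basisUnit 1 • ap (component T i) (ap (component T 1) w) +
        basisUnit 2 • ap (component T i) (ap (component T 2) w) +
        basisUnit 3 • ap (component T i) (ap (component T 3) w)) := by
    intro i
    have m1 := hT.smul_mem (basisUnit 1) (ht 1)
    have m2 := hT.smul_mem (basisUnit 2) (ht 2)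
    have m3 := hT.smul_mem (basisUnit 3) (ht 3)
    rw [vec, hT.component_add i (sub_mem (hT.smul_mem _ hd) (ht 0)) (add_mem (add_mem m1 m2) m3),
      hT.component_add i (add_mem m1 m2) m3, hT.component_add i m1 m2,
      hT.component_sub i (hT.smul_mem _ hd) (ht 0), component_smul h2 _ _ hd,
      component_smul h2 _ _ (ht 1), component_smul h2 _ _ (ht 2), component_smul h2 _ _ (ht 3),
      hT.component_comm hw i 0]
  have hq : quad T s w = v := hT.quad_Qinv hs v
  have hvecs : vec T (s • w) = basisUnit 1 • s • ap (component T 1) w +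
      basisUnit 2 • s • ap (component T 2) w + basisUnit 3 • s • ap (component T 3) w := by
    rw [vec, component_smul h2 _ _ hd, component_smul h2 _ _ hd, component_smul h2 _ _ hd]
  rw [hT.ap_T (hT.SL_mem_dom hs v), hT.SL_apply hs, hT.SL_apply hs,
    hT.smul_Qinv hs (Commute.refl s), ← hwdef, hcomp, vec, hcomp, hcomp, hcomp, hvecs,
    component_smul h2 _ _ hd]
  conv_rhs => rw [← hq]
  rw [quad, Fin.sum_univ_four, two_mul, add_smul,
    pow_two, mul_smul, hT.component_comm hw 2 1, hT.component_comm hw 3 1,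
    hT.component_comm hw 3 2]
  simp only [smul_add, smul_sub, tab]
  abel

/-- The resolvent `(1 + T)⁻¹`. -/
def negOneRes (T : V →ₗ.[ℝ] V) (D : Submodule ℝ V) : V →L[ℝ] V := -SL T D (-1)

variable (h1 : (-1 : ℍ[ℝ]) ∈ rhoF T D)
include h1

theorem IsAdmissible.negOneRes_mem (v : V) : negOneRes T D v ∈ T.domain := by
  rw [negOneRes, neg_apply]
  exact neg_mem (hT.SL_mem_dom h1 v)

theorem IsAdmissible.ap_negOneRes (v : V) : ap T (negOneRes T D v) = v - negOneRes T D v := by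
  rw [negOneRes, neg_apply, ap_neg_vec (hT.SL_mem_dom h1 v), hT.ap_SL h1, neg_one_smul, map_neg]
  abel

theorem IsAdmissible.negOneRes_apply (v : V) : negOneRes T D v = Qinv T D (-1) v +
    ap (component T 0) (Qinv T D (-1) v) - vec T (Qinv T D (-1) v) := by
  rw [negOneRes, neg_apply, hT.SL_apply h1, neg_one_smul]
  abel

theorem IsAdmissible.Qinv_negOne_smul (a : ℍ[ℝ]) (v : V) :
    Qinv T D (-1) (a • v) = a • Qinv T D (-1) v :=
  hT.smul_Qinv h1 (Commute.neg_one_right a) v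

theorem IsAdmissible.Qinv_negOne_vec {v : V} (hv : v ∈ T.domain) :
    Qinv T D (-1) (vec T v) = vec T (Qinv T D (-1) v) := by
  simp only [vec, map_add, hT.Qinv_negOne_smul h1, (hT.component_Qinv h1 _ hv).2]

/-- The previous identities only make `negOneRes` a right inverse of `1 + T`. It is also a left
inverse because `-1` is real: then `Q_{c,-1}(T)⁻¹` commutes with all left multiplications and with
the components, hence with `T`. -/
theorem IsAdmissible.negOneRes_ap {v : V} (hv : v ∈ T.domain) :
    negOneRes T D (ap T v) = v - negOneRes T D v := by
  have tab := basisUnit_smul_table (V := V)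
  have h2 := hT.kc.twoSided
  set w := Qinv T D (-1) v with hwdef
  have hw : w ∈ D := hT.Qinv_mem h1 v
  have hd := hT.mem_dom hw
  have ht := hT.component_mem_dom hw
  have hQ : Qinv T D (-1) (ap T v) = ap T w := by
    rw [hT.ap_T hv, map_add, hT.Qinv_negOne_vec h1 hv, ← (hT.component_Qinv h1 0 hv).2,
      hT.ap_T hd]
  have hq : quad T (-1) w = v := hT.quad_Qinv h1 v
  have hTw : ∀ i, ap (component T i) (ap T w) = ap (component T 0) (ap (component T i) w) +
      (basisUnit 1 • ap (component T i) (ap (component T 1) w) +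
        basisUnit 2 • ap (component T i) (ap (component T 2) w) +
        basisUnit 3 • ap (component T i) (ap (component T 3) w)) := by
    intro i
    have m1 := hT.smul_mem (basisUnit 1) (ht 1)
    have m2 := hT.smul_mem (basisUnit 2) (ht 2)
    have m3 := hT.smul_mem (basisUnit 3) (ht 3)
    rw [hT.ap_T hd, vec, hT.component_add i (ht 0) (add_mem (add_mem m1 m2) m3),
      hT.component_add i (add_mem m1 m2) m3, hT.component_add i m1 m2,
      component_smul h2 _ _ (ht 1), component_smul h2 _ _ (ht 2), component_smul h2 _ _ (ht 3),
      hT.component_comm hw i 0]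
  rw [hT.negOneRes_apply h1, hT.negOneRes_apply h1, hQ, ← hwdef, vec, hTw, hTw, hTw, hTw,
    hT.ap_T hd]
  conv_rhs => rw [← hq]
  rw [quad, Fin.sum_univ_four, hT.component_comm hw 2 1, hT.component_comm hw 3 1,
    hT.component_comm hw 3 2, vec]
  simp only [smul_add, tab, two_mul, add_smul, neg_smul, one_smul, neg_one_sq]
  abel

theorem IsAdmissible.negOneRes_injective : Function.Injective (negOneRes T D) := by
  refine (injective_iff_map_eq_zero _).2 fun v hv => ?_
  have := hT.ap_negOneRes h1 v
  rwa [hv, ap_zero_vec, sub_zero, eq_comm] at this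

/-- The bounded form of `T S_L⁻¹(s, T) = S_L⁻¹(s, T) s - 1`. -/
theorem IsAdmissible.resolvent_equation {s : ℍ[ℝ]} (hs : s ∈ rhoF T D) :
    (1 - negOneRes T D) * SL T D s = negOneRes T D * (SL T D s * leftMul s - 1) := by
  ext v
  simp only [mul_apply_eq_comp, sub_apply, one_apply_eq_self, leftMul_apply]
  rw [← hT.ap_SL hs, hT.negOneRes_ap h1 (hT.SL_mem_dom hs v)]

theorem IsAdmissible.conj_negOne_mem : (-1 : ℍ[ℝ]) ∈ rhoF (conj T) D := by
  rwa [rhoF_conj hT.kc.twoSided]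

theorem IsAdmissible.negOneRes_conj_SL {s : ℍ[ℝ]} (hs : s ∈ rhoF T D) :
    negOneRes (conj T) D * SL T D s = negOneRes (conj T) D * (leftMul s * Qinv T D s) -
      (1 - negOneRes (conj T) D) * Qinv T D s := by
  ext v
  have hd := hT.mem_dom (hT.Qinv_mem hs v)
  have hd' := (mem_conj_domain hT.kc.twoSided).2 hd
  simp only [mul_apply_eq_comp, sub_apply, one_apply_eq_self, leftMul_apply]
  rw [← hT.admissible_conj.negOneRes_ap (hT.conj_negOne_mem h1) hd', ← map_sub, hT.SL_apply hs,
    hT.admissible_conj.ap_T hd', vec_conj hT.kc.twoSided, component_conj_zero hT.kc.twoSided]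
  congr 1
  abel

/-- Bounded form of `S_L⁻¹(s, T̄) - S_L⁻¹(s, T) = (T̄ - T) Q⁻¹`. The factor `(1 + T)⁻¹` has to act
first on one term and `(1 + T̄)⁻¹` on the other, whence the commutation hypothesis. -/
theorem IsAdmissible.SL_conj_sub {s : ℍ[ℝ]} (hs : s ∈ rhoF T D)
    (hc : negOneRes (conj T) D * negOneRes T D = negOneRes T D * negOneRes (conj T) D) :
    negOneRes T D * negOneRes (conj T) D * (SL (conj T) D s - SL T D s) =
      (negOneRes T D * (1 - negOneRes (conj T) D) -
        negOneRes (conj T) D * (1 - negOneRes T D)) * Qinv T D s := by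
  ext v
  have hd := hT.mem_dom (hT.Qinv_mem hs v)
  have hd' := (mem_conj_domain hT.kc.twoSided).2 hd
  have e : (SL (conj T) D s - SL T D s) v = ap (conj T) (Qinv T D s v) - ap T (Qinv T D s v) := by
    rw [sub_apply, hT.SL_apply hs, hT.SL_conj_apply hs, hT.ap_T hd, hT.admissible_conj.ap_T hd',
      vec_conj hT.kc.twoSided, component_conj_zero hT.kc.twoSided]
    abel
  rw [sub_mul, mul_assoc _ _ (Qinv T D s), mul_assoc _ _ (Qinv T D s), mul_apply_eq_comp, e,
    map_sub]
  conv_lhs => rw [← hc]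
  simp only [mul_apply_eq_comp, sub_apply, one_apply_eq_self]
  rw [hT.negOneRes_ap h1 hd]
  congr 1
  have := congrArg (fun B : V →L[ℝ] V => B (ap (conj T) (Qinv T D s v))) hc
  simp only [mul_apply_eq_comp] at this
  rw [this, hT.admissible_conj.negOneRes_ap (hT.conj_negOne_mem h1) hd']

end ResolventEquations

/-! ### Cauchy's theorem in strips and sectors. -/

section SectorCauchy

open Set Filter Topology

variable {E : Type*} [NormedAddCommGroup E] [NormedSpace ℝ E]

theorem integrable_exp_neg_mul_abs {δ : ℝ} (hδ : 0 < δ) :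
    Integrable fun x : ℝ => Real.exp (-δ * |x|) := by
  rw [← integrableOn_univ, ← Iic_union_Ioi (a := (0 : ℝ))]
  refine IntegrableOn.union ?_ ?_
  · refine (integrableOn_exp_mul_Iic hδ 0).congr_fun (fun x hx => ?_) measurableSet_Iic
    simp only [abs_of_nonpos (mem_Iic.1 hx), neg_mul_neg]
  · refine (integrableOn_exp_mul_Ioi (neg_lt_zero.2 hδ) 0).congr_fun (fun x hx => ?_)
      measurableSet_Ioi
    simp only [abs_of_pos (mem_Ioi.1 hx)]

/-- Cauchy's theorem in a strip, for a function `U` with `∂_y U = JJ ∂_x U`. -/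
theorem integral_strip_eq {JJ : E →L[ℝ] E} {U : ℝ × ℝ → E}
    {U' : ℝ × ℝ → ℝ × ℝ →L[ℝ] E} {y₁ y₂ C δ : ℝ} (hy : y₁ ≤ y₂) (hδ : 0 < δ)
    (hU : ∀ x, ∀ y ∈ Icc y₁ y₂, HasFDerivAt U (U' (x, y)) (x, y))
    (hCR : ∀ x, ∀ y ∈ Icc y₁ y₂, U' (x, y) (0, 1) = JJ (U' (x, y) (1, 0)))
    (hdecay : ∀ x, ∀ y ∈ Icc y₁ y₂, ‖U (x, y)‖ ≤ C * Real.exp (-δ * |x|)) :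
    ∫ x, U (x, y₁) = ∫ x, U (x, y₂) := by
  have hcont : ∀ y ∈ Icc y₁ y₂, Continuous fun x => U (x, y) := fun y hy =>
    continuous_iff_continuousAt.2 fun x => (hU x y hy).continuousAt.comp (f := fun x => (x, y))
      (by fun_prop)
  have hint : ∀ y ∈ Icc y₁ y₂, Integrable fun x => U (x, y) := fun y hy =>
    ((integrable_exp_neg_mul_abs hδ).const_mul C).mono' (hcont y hy).aestronglyMeasurable
      (Eventually.of_forall fun x => hdecay x y hy)
  have hm₁ : y₁ ∈ Icc y₁ y₂ := left_mem_Icc.2 hy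
  have hm₂ : y₂ ∈ Icc y₁ y₂ := right_mem_Icc.2 hy
  have hlim : ∀ y ∈ Icc y₁ y₂,
      Tendsto (fun X : ℝ => ∫ x in -X..X, U (x, y)) atTop (𝓝 (∫ x, U (x, y))) := fun y hy =>
    intervalIntegral_tendsto_integral (hint y hy) tendsto_neg_atTop_atBot tendsto_id
  have hside : ∀ σ : ℝ, |σ| = 1 →
      Tendsto (fun X : ℝ => ∫ y in y₁..y₂, JJ (U (σ * X, y))) atTop (𝓝 0) := by
    intro σ hσ
    have hb : Tendsto (fun X : ℝ => ‖JJ‖ * (C * Real.exp (-δ * X)) * |y₂ - y₁|) atTop (𝓝 0) := by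
      have h : Tendsto (fun X : ℝ => Real.exp (-δ * X)) atTop (𝓝 0) := by
        refine Real.tendsto_exp_atBot.comp ?_
        exact tendsto_id.const_mul_atTop_of_neg (neg_lt_zero.2 hδ)
      simpa using ((h.const_mul C).const_mul ‖JJ‖).mul_const |y₂ - y₁|
    refine squeeze_zero_norm' ?_ hb
    filter_upwards [eventually_ge_atTop 0] with X hX
    refine intervalIntegral.norm_integral_le_of_norm_le_const fun y hy' => ?_
    rw [uIoc_of_le hy] at hy'
    refine (JJ.le_opNorm _).trans ?_
    gcongr
    refine (hdecay _ y ⟨hy'.1.le, hy'.2⟩).trans_eq ?_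
    rw [abs_mul, hσ, one_mul, abs_of_nonneg hX]
  -- The divergence theorem is applied to the field `(JJ U, -U)`, whose divergence `JJ ∂_x U - ∂_y
  -- U` vanishes by the Cauchy-Riemann equation.
  have hrect : ∀ X : ℝ, (∫ x in -X..X, U (x, y₂)) - ∫ x in -X..X, U (x, y₁) =
      (∫ y in y₁..y₂, JJ (U (1 * X, y))) - ∫ y in y₁..y₂, JJ (U (-1 * X, y)) := by
    intro X
    have hmem : ∀ p ∈ uIcc (-X) X ×ˢ uIcc y₁ y₂, HasFDerivAt U (U' p) p := by
      intro p hp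
      rw [uIcc_of_le hy] at hp
      exact hU p.1 p.2 hp.2
    have hc : ContinuousOn U (uIcc (-X) X ×ˢ uIcc y₁ y₂) := fun p hp =>
      (hmem p hp).continuousAt.continuousWithinAt
    have hsub : Ioo (min (-X) X) (max (-X) X) ×ˢ Ioo (min y₁ y₂) (max y₁ y₂) ⊆
        uIcc (-X) X ×ˢ uIcc y₁ y₂ := prod_mono Ioo_subset_Icc_self Ioo_subset_Icc_self
    have hzero : ∀ p ∈ uIcc (-X) X ×ˢ uIcc y₁ y₂,
        (JJ.comp (U' p)) (1, 0) + (-U' p) (0, 1) = 0 := by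
      intro p hp
      rw [uIcc_of_le hy] at hp
      simp [hCR p.1 p.2 hp.2]
    have key := integral2_divergence_prod_of_hasFDerivAt (fun p => JJ (U p)) (fun p => -U p)
      (fun p => JJ.comp (U' p)) (fun p => -U' p) (-X) y₁ X y₂
      (JJ.continuous.comp_continuousOn hc) hc.neg
      (fun p hp => JJ.hasFDerivAt.comp p (hmem p (hsub hp)))
      (fun p hp => (hmem p (hsub hp)).neg)
      (integrableOn_zero.congr_fun (fun p hp => (hzero p hp).symm)
        (measurableSet_uIcc.prod measurableSet_uIcc))
    have hl : (∫ x in -X..X, ∫ y in y₁..y₂, (JJ.comp (U' (x, y))) (1, 0) +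
        (-U' (x, y)) (0, 1)) = 0 := by
      rw [intervalIntegral.integral_congr (g := fun _ => 0) fun x hx => ?_]
      · simp
      · rw [intervalIntegral.integral_congr (g := fun _ => 0) fun y hy => hzero (x, y) ⟨hx, hy⟩]
        simp
    rw [hl, intervalIntegral.integral_neg, intervalIntegral.integral_neg] at key
    have key' := sub_eq_zero.1 key.symm
    rw [one_mul, neg_one_mul, ← key']
    abel
  have h0 := (hlim y₂ hm₂).sub (hlim y₁ hm₁)
  simp only [hrect] at h0
  have h1 := (hside 1 (by simp)).sub (hside (-1) (by simp))
  have := tendsto_nhds_unique h0 h1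
  rw [sub_zero, sub_eq_zero] at this
  exact this.symm

/-- The point with polar coordinates `(r, ψ)`. -/
def polarPt (r ψ : ℝ) : ℝ × ℝ := (r * Real.cos ψ, r * Real.sin ψ)

theorem integral_Ioi_eq_integral_exp (g : ℝ → E) :
    ∫ r in Ioi 0, g r = ∫ x, Real.exp x • g (Real.exp x) := by
  have := integral_image_eq_integral_abs_deriv_smul MeasurableSet.univ
    (fun x _ => (Real.hasDerivAt_exp x).hasDerivWithinAt) (Real.exp_injective.injOn) g
  rw [image_univ, Real.range_exp] at this
  simpa [abs_of_pos (Real.exp_pos _)] using this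

/-- Cauchy's theorem in a sector: rotation of a ray of integration. -/
theorem integral_ray_eq [CompleteSpace E] {JJ : E →L[ℝ] E} (hJJ : ∀ x, JJ (JJ x) = -x)
    {G : ℝ × ℝ → E}
    {G' : ℝ × ℝ → ℝ × ℝ →L[ℝ] E} {ψ₁ ψ₂ C δ : ℝ} (hψ : ψ₁ ≤ ψ₂) (hδ : 0 < δ)
    (hG : ∀ r > 0, ∀ ψ ∈ Icc ψ₁ ψ₂, HasFDerivAt G (G' (polarPt r ψ)) (polarPt r ψ))
    (hCR : ∀ r > 0, ∀ ψ ∈ Icc ψ₁ ψ₂, G' (polarPt r ψ) (0, 1) = JJ (G' (polarPt r ψ) (1, 0)))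
    (hsmall : ∀ r > 0, r ≤ 1 → ∀ ψ ∈ Icc ψ₁ ψ₂, ‖G (polarPt r ψ)‖ ≤ C * r ^ (-1 + δ))
    (hlarge : ∀ r > 0, 1 ≤ r → ∀ ψ ∈ Icc ψ₁ ψ₂, ‖G (polarPt r ψ)‖ ≤ C * r ^ (-1 - δ)) :
    Real.cos ψ₁ • (∫ r in Ioi 0, G (polarPt r ψ₁)) +
      Real.sin ψ₁ • JJ (∫ r in Ioi 0, G (polarPt r ψ₁)) =
    Real.cos ψ₂ • (∫ r in Ioi 0, G (polarPt r ψ₂)) +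
      Real.sin ψ₂ • JJ (∫ r in Ioi 0, G (polarPt r ψ₂)) := by
  set P : ℝ × ℝ → ℝ × ℝ := fun q => polarPt (Real.exp q.1) q.2 with hP
  have hbound : ∀ x, ∀ ψ ∈ Icc ψ₁ ψ₂,
      Real.exp x * ‖G (polarPt (Real.exp x) ψ)‖ ≤ C * Real.exp (-δ * |x|) := by
    intro x ψ hψ
    have hpow : ∀ a : ℝ, Real.exp x * Real.exp x ^ (-1 + a) = Real.exp (a * x) := by
      intro a
      rw [← Real.exp_mul, ← Real.exp_add]
      congr 1
      ring
    rcases le_total x 0 with hx | hx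
    · have h := hsmall _ (Real.exp_pos x) (Real.exp_le_one_iff.2 hx) ψ hψ
      calc _ ≤ Real.exp x * (C * Real.exp x ^ (-1 + δ)) := by gcongr
        _ = _ := by rw [mul_left_comm, hpow, abs_of_nonpos hx, neg_mul_neg]
    · have h := hlarge _ (Real.exp_pos x) (Real.one_le_exp hx) ψ hψ
      calc _ ≤ Real.exp x * (C * Real.exp x ^ (-1 - δ)) := by gcongr
        _ = _ := by rw [mul_left_comm, sub_eq_add_neg, hpow, abs_of_nonneg hx]
  -- The form `G dz` is pulled back by `z = exp(x + iψ)`. Since `dz = z d(x + iψ)`, the new function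
  -- is `z G(z)`, with `JJ` in the role of `i`; power decay of `G` becomes exponential decay in `x`.
  set U : ℝ × ℝ → E := fun q => (P q).1 • G (P q) + (P q).2 • JJ (G (P q)) with hU
  set A' : ℝ × ℝ → ℝ × ℝ →L[ℝ] ℝ := fun q =>
    (P q).1 • ContinuousLinearMap.fst ℝ ℝ ℝ - (P q).2 • ContinuousLinearMap.snd ℝ ℝ ℝ with hA'
  set B' : ℝ × ℝ → ℝ × ℝ →L[ℝ] ℝ := fun q =>
    (P q).2 • ContinuousLinearMap.fst ℝ ℝ ℝ + (P q).1 • ContinuousLinearMap.snd ℝ ℝ ℝ with hB'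
  have hA : ∀ q, HasFDerivAt (fun q => (P q).1) (A' q) q := by
    intro q
    refine (((hasFDerivAt_fst (𝕜 := ℝ) (p := q)).exp).mul
      ((hasFDerivAt_snd (𝕜 := ℝ) (p := q)).cos)).congr_fderiv ?_
    ext <;> simp [hA', hP, polarPt, mul_comm]
  have hB : ∀ q, HasFDerivAt (fun q => (P q).2) (B' q) q := by
    intro q
    refine (((hasFDerivAt_fst (𝕜 := ℝ) (p := q)).exp).mul
      ((hasFDerivAt_snd (𝕜 := ℝ) (p := q)).sin)).congr_fderiv ?_
    ext <;> simp [hB', hP, polarPt, mul_comm]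
  have hPd : ∀ q, HasFDerivAt P ((A' q).prod (B' q)) q := fun q => (hA q).prodMk (hB q)
  set W : ℝ × ℝ → ℝ × ℝ →L[ℝ] E := fun q => (G' (P q)).comp ((A' q).prod (B' q)) with hW
  set U' : ℝ × ℝ → ℝ × ℝ →L[ℝ] E := fun q =>
    ((P q).1 • W q + (A' q).smulRight (G (P q))) +
      ((P q).2 • JJ.comp (W q) + (B' q).smulRight (JJ (G (P q)))) with hU'
  have hGP : ∀ x, ∀ y ∈ Icc ψ₁ ψ₂, HasFDerivAt (fun q => G (P q)) (W (x, y)) (x, y) :=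
    fun x y hy => (hG _ (Real.exp_pos x) y hy).comp (x, y) (hPd (x, y))
  have hUd : ∀ x, ∀ y ∈ Icc ψ₁ ψ₂, HasFDerivAt U (U' (x, y)) (x, y) := fun x y hy =>
    ((hA (x, y)).smul (hGP x y hy)).add
      ((hB (x, y)).smul (JJ.hasFDerivAt.comp (x, y) (hGP x y hy)))
  have hUCR : ∀ x, ∀ y ∈ Icc ψ₁ ψ₂, U' (x, y) (0, 1) = JJ (U' (x, y) (1, 0)) := by
    intro x y hy
    have h := hCR _ (Real.exp_pos x) y hy
    have hlin : ∀ a b : ℝ, G' (P (x, y)) (a, b) =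
        a • G' (P (x, y)) (1, 0) + b • JJ (G' (P (x, y)) (1, 0)) := by
      intro a b
      rw [← h, ← map_smul, ← map_smul, ← map_add]
      simp
    have e1 : W (x, y) (1, 0) = (P (x, y)).1 • G' (P (x, y)) (1, 0) +
        (P (x, y)).2 • JJ (G' (P (x, y)) (1, 0)) := by
      rw [← hlin]
      simp [hW, hA', hB']
    have e2 : W (x, y) (0, 1) = (-(P (x, y)).2) • G' (P (x, y)) (1, 0) +
        (P (x, y)).1 • JJ (G' (P (x, y)) (1, 0)) := by
      rw [← hlin]
      simp [hW, hA', hB']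
    simp only [hU', add_apply, smul_apply, ContinuousLinearMap.comp_apply,
      ContinuousLinearMap.smulRight_apply, e1, e2]
    simp only [hA', hB', add_apply, smul_apply, sub_apply, ContinuousLinearMap.coe_fst',
      ContinuousLinearMap.coe_snd', smul_eq_mul, mul_zero, mul_one, zero_sub, zero_add, sub_zero,
      add_zero, map_add, map_smul, map_neg, hJJ]
    module
  have hUn : ∀ x, ∀ y ∈ Icc ψ₁ ψ₂, ‖U (x, y)‖ ≤ ((1 + ‖JJ‖) * C) * Real.exp (-δ * |x|) := by
    intro x y hy
    have hx := (Real.exp_pos x).le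
    have h1 : |(P (x, y)).1| ≤ Real.exp x := by
      simp only [hP, polarPt, abs_mul, abs_of_nonneg hx]
      exact mul_le_of_le_one_right hx (Real.abs_cos_le_one y)
    have h2 : |(P (x, y)).2| ≤ Real.exp x := by
      simp only [hP, polarPt, abs_mul, abs_of_nonneg hx]
      exact mul_le_of_le_one_right hx (Real.abs_sin_le_one y)
    have hb := hbound x y hy
    calc ‖U (x, y)‖ ≤ |(P (x, y)).1| * ‖G (P (x, y))‖ + |(P (x, y)).2| * ‖JJ (G (P (x, y)))‖ := by
          refine (norm_add_le _ _).trans_eq ?_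
          rw [norm_smul, norm_smul, Real.norm_eq_abs, Real.norm_eq_abs]
      _ ≤ Real.exp x * ‖G (P (x, y))‖ + Real.exp x * (‖JJ‖ * ‖G (P (x, y))‖) := by
          gcongr
          exact JJ.le_opNorm _
      _ = (1 + ‖JJ‖) * (Real.exp x * ‖G (P (x, y))‖) := by ring
      _ ≤ (1 + ‖JJ‖) * (C * Real.exp (-δ * |x|)) := by gcongr
      _ = _ := by ring
  have key := integral_strip_eq hψ hδ hUd hUCR hUn
  have hfin : ∀ ψ ∈ Icc ψ₁ ψ₂, ∫ x, U (x, ψ) = Real.cos ψ • (∫ r in Ioi 0, G (polarPt r ψ)) +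
      Real.sin ψ • JJ (∫ r in Ioi 0, G (polarPt r ψ)) := by
    intro ψ hψ
    have hcont : Continuous fun x => Real.exp x • G (polarPt (Real.exp x) ψ) :=
      Real.continuous_exp.smul (continuous_iff_continuousAt.2 fun x =>
        (hGP x ψ hψ).continuousAt.comp (f := fun x => (x, ψ)) (by fun_prop))
    have hint : Integrable fun x => Real.exp x • G (polarPt (Real.exp x) ψ) := by
      refine ((integrable_exp_neg_mul_abs hδ).const_mul C).mono' hcont.aestronglyMeasurable
        (Eventually.of_forall fun x => ?_)
      rw [norm_smul, Real.norm_of_nonneg (Real.exp_pos x).le]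
      exact hbound x ψ hψ
    rw [integral_Ioi_eq_integral_exp, ← JJ.integral_comp_comm hint, ← integral_smul,
      ← integral_smul]
    refine Eq.trans ?_ (integral_add (hint.smul (Real.cos ψ))
      ((JJ.integrable_comp hint).smul (Real.sin ψ)))
    refine integral_congr_ae (Eventually.of_forall fun x => ?_)
    simp only [hU, hP, polarPt, map_smul]
    module
  rw [← hfin ψ₁ (left_mem_Icc.2 hψ), ← hfin ψ₂ (right_mem_Icc.2 hψ), key]

end SectorCauchy

/-! ### The slice `ℂ_J` as a copy of the complex plane, and the contour in it. -/

section SlicePlane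

open Complex ComplexConjugate

variable {J : ℍ[ℝ]}

theorem imSphere_mul_self (hJ : J ∈ imSphere) : J * J = -1 := by
  have h1 : star J = -J := by
    rw [Quaternion.star_eq_neg]
    exact hJ.1
  have h2 : J * star J = 1 := by
    rw [Quaternion.self_mul_star, Quaternion.normSq_eq_norm_mul_self, hJ.2]
    simp
  rw [h1, mul_neg] at h2
  rw [← h2, neg_neg]

theorem imSphere_star (hJ : J ∈ imSphere) : star J = -J := by
  rw [Quaternion.star_eq_neg]
  exact hJ.1

theorem imSphere_inv (hJ : J ∈ imSphere) : J⁻¹ = -J := by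
  refine inv_eq_of_mul_eq_one_right ?_
  rw [mul_neg, imSphere_mul_self hJ, neg_neg]

theorem basisUnit_one_mem_imSphere : basisUnit 1 ∈ imSphere :=
  ⟨basisUnit_one.1, norm_basisUnit 1⟩

/-- The embedding `x + i y ↦ x + J y` of the complex numbers. -/
def sl (hJ : J ∈ imSphere) : ℂ →ₐ[ℝ] ℍ[ℝ] := Complex.liftAux J (imSphere_mul_self hJ)

theorem sl_eq (hJ : J ∈ imSphere) (z : ℂ) : sl hJ z = slicePoint J (z.re, z.im) := by
  rw [sl, Complex.liftAux_apply, slicePoint, Quaternion.algebraMap_def,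
    ← Quaternion.coe_commutes, Quaternion.coe_mul_eq_smul]

theorem slicePoint_eq (hJ : J ∈ imSphere) (p : ℝ × ℝ) : slicePoint J p = sl hJ ⟨p.1, p.2⟩ :=
  (sl_eq hJ ⟨p.1, p.2⟩).symm

theorem sl_I (hJ : J ∈ imSphere) : sl hJ I = J := by
  simp [sl_eq, slicePoint]

theorem sl_ofReal (hJ : J ∈ imSphere) (r : ℝ) : sl hJ r = (r : ℍ[ℝ]) := by
  simp [sl_eq, slicePoint]

theorem sl_re (hJ : J ∈ imSphere) (z : ℂ) : (sl hJ z).re = z.re := by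
  rw [sl_eq, slicePoint, Quaternion.re_add, Quaternion.re_coe, ← Quaternion.coe_commutes,
    Quaternion.coe_mul_eq_smul, Quaternion.re_smul, hJ.1]
  simp

theorem star_sl (hJ : J ∈ imSphere) (z : ℂ) : star (sl hJ z) = sl hJ (conj z) := by
  rw [sl_eq, sl_eq, slicePoint, slicePoint, star_add, star_mul, imSphere_star hJ,
    Quaternion.star_coe, Quaternion.star_coe, conj_re, conj_im, Quaternion.coe_neg, mul_neg,
    mul_neg, Quaternion.coe_commutes]

theorem norm_sl (hJ : J ∈ imSphere) (z : ℂ) : ‖sl hJ z‖ = ‖z‖ := by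
  have h : ((‖sl hJ z‖ * ‖sl hJ z‖ : ℝ) : ℍ[ℝ]) = ((‖z‖ * ‖z‖ : ℝ) : ℍ[ℝ]) := by
    rw [← Quaternion.normSq_eq_norm_mul_self, ← Quaternion.self_mul_star, star_sl, ← map_mul,
      mul_conj, sl_ofReal, normSq_eq_norm_sq, pow_two]
  have h' := Quaternion.coe_injective h
  nlinarith [norm_nonneg (sl hJ z), norm_nonneg z, abs_eq_abs.1 (by
    rw [← abs_mul_abs_self, ← abs_mul_abs_self ‖z‖] at h'
    exact mul_self_inj_of_nonneg (abs_nonneg _) (abs_nonneg _) |>.1 h' : |‖sl hJ z‖| = |‖z‖|)]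

theorem sl_injective (hJ : J ∈ imSphere) : Function.Injective (sl hJ) :=
  (sl hJ).toRingHom.injective

theorem commute_sl (hJ : J ∈ imSphere) (z w : ℂ) : Commute (sl hJ z) (sl hJ w) := by
  rw [Commute, SemiconjBy, ← map_mul, mul_comm, map_mul]

/-- The embedding as a continuous linear map. -/
def slL (hJ : J ∈ imSphere) : ℂ →L[ℝ] ℍ[ℝ] := (sl hJ).toLinearMap.toContinuousLinearMap

theorem continuous_sl (hJ : J ∈ imSphere) : Continuous (sl hJ) := (slL hJ).continuous

theorem anticomm_sl (hJ : J ∈ imSphere) {a : ℍ[ℝ]} (ha : a * J = -(J * a)) (z : ℂ) :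
    a * sl hJ z = sl hJ (conj z) * a := by
  rw [sl_eq, sl_eq, slicePoint, slicePoint, mul_add, add_mul, ← mul_assoc, ha, conj_re, conj_im,
    Quaternion.coe_neg, mul_neg, neg_mul, neg_mul, Quaternion.coe_commutes, mul_assoc, mul_assoc,
    Quaternion.coe_commutes]

/-- The quaternions are spanned by those that commute and those that anticommute with `J`. -/
theorem exists_comm_add_anticomm (hJ : J ∈ imSphere) (a : ℍ[ℝ]) :
    ∃ z : ℂ, ∃ b, b * J = -(J * b) ∧ a = sl hJ z + b := by
  have h0 : J.re = 0 := hJ.1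
  have h1 : J.imI ^ 2 + J.imJ ^ 2 + J.imK ^ 2 = 1 := by
    have h := Quaternion.normSq_def' (a := J)
    rw [Quaternion.normSq_eq_norm_mul_self, hJ.2, h0] at h
    linarith
  -- The imaginary part is the inner product of the vector part of `a` with `J`, so that the
  -- remainder is a purely imaginary quaternion orthogonal to `J` and therefore anticommutes with
  -- it.
  set z : ℂ := ⟨a.re, a.imI * J.imI + a.imJ * J.imJ + a.imK * J.imK⟩ with hz
  have hsl : sl hJ z = (z.re : ℍ[ℝ]) + z.im • J := by
    rw [sl, Complex.liftAux_apply]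
    rfl
  refine ⟨z, a - sl hJ z, ?_, by abel⟩
  rw [hsl, Quaternion.ext_iff]
  simp only [Quaternion.re_mul, Quaternion.imI_mul, Quaternion.imJ_mul, Quaternion.imK_mul,
    Quaternion.re_neg, Quaternion.imI_neg, Quaternion.imJ_neg, Quaternion.imK_neg,
    Quaternion.re_sub, Quaternion.imI_sub, Quaternion.imJ_sub, Quaternion.imK_sub,
    Quaternion.re_add, Quaternion.imI_add, Quaternion.imJ_add, Quaternion.imK_add,
    Quaternion.re_smul, Quaternion.imI_smul, Quaternion.imJ_smul, Quaternion.imK_smul,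
    Quaternion.re_coe, Quaternion.imI_coe, Quaternion.imJ_coe, Quaternion.imK_coe, h0, hz,
    smul_eq_mul]
  refine ⟨?_, ?_, ?_, ?_⟩
  · linear_combination 2 * (a.imI * J.imI + a.imJ * J.imJ + a.imK * J.imK) * h1
  all_goals ring

/-- The boundary of a sector in the complex plane. -/
def gammaC (φ t : ℝ) : ℂ := if t < 0 then (-t : ℝ) * exp (φ * I) else t * exp (-(φ * I))

/-- The factor `γ'(t) / i`. -/
def dsC (φ t : ℝ) : ℂ := if t < 0 then I * exp (φ * I) else -I * exp (-(φ * I))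

theorem sl_exp (hJ : J ∈ imSphere) (φ : ℝ) : sl hJ (exp (φ * I)) = expJ J φ := by
  rw [sl_eq, expJ, exp_ofReal_mul_I_re, exp_ofReal_mul_I_im]

theorem sl_exp_neg (hJ : J ∈ imSphere) (φ : ℝ) : sl hJ (exp (-(φ * I))) = expJ J (-φ) := by
  rw [← sl_exp hJ, ofReal_neg, neg_mul]

theorem gamma_eq (hJ : J ∈ imSphere) (φ t : ℝ) : gamma J φ t = sl hJ (gammaC φ t) := by
  rw [gamma, gammaC]
  split_ifs
  · rw [map_mul, sl_ofReal, sl_exp, Quaternion.coe_mul_eq_smul]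
  · rw [map_mul, sl_ofReal, sl_exp_neg, Quaternion.coe_mul_eq_smul]

theorem deriv_gamma (hJ : J ∈ imSphere) (φ : ℝ) {t : ℝ} (ht : t ≠ 0) :
    deriv (gamma J φ) t * J⁻¹ = sl hJ (dsC φ t) := by
  have hc : ∀ z, J * sl hJ z = sl hJ z * J := fun z => by
    have h := (commute_sl hJ I z).eq
    rwa [sl_I] at h
  rw [imSphere_inv hJ, dsC]
  rcases lt_or_gt_of_ne ht with h | h
  · have hd : HasDerivAt (gamma J φ) (-(1 : ℝ) • expJ J φ) t := by
      refine ((hasDerivAt_id t).neg.smul_const (expJ J φ)).congr_of_eventuallyEq ?_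
      filter_upwards [gt_mem_nhds h] with x hx
      rw [gamma, if_pos hx]
      rfl
    rw [hd.deriv, if_pos h, map_mul, sl_I, sl_exp hJ, neg_smul, one_smul, neg_mul_neg,
      ← sl_exp hJ, hc]
  · have hd : HasDerivAt (gamma J φ) ((1 : ℝ) • expJ J (-φ)) t := by
      refine ((hasDerivAt_id t).smul_const (expJ J (-φ))).congr_of_eventuallyEq ?_
      filter_upwards [lt_mem_nhds h] with x hx
      rw [gamma, if_neg (not_lt.2 hx.le)]
      rfl
    rw [hd.deriv, if_neg (not_lt.2 h.le), map_mul, map_neg, sl_I, sl_exp_neg hJ, one_smul,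
      ← sl_exp hJ, mul_neg, neg_mul, hc]

theorem conj_exp_mul_I (φ : ℝ) : conj (exp (φ * I)) = exp (-(φ * I)) := by
  rw [← exp_conj, map_mul, conj_I, conj_ofReal, mul_neg]

theorem gammaC_neg (φ : ℝ) {t : ℝ} (ht : t ≠ 0) : gammaC φ (-t) = conj (gammaC φ t) := by
  rw [gammaC, gammaC]
  rcases lt_or_gt_of_ne ht with h | h
  · rw [if_neg (by linarith), if_pos h, map_mul, conj_ofReal, conj_exp_mul_I]
  · rw [if_pos (by linarith), if_neg (by linarith), map_mul, conj_ofReal, ← conj_exp_mul_I,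
      Complex.conj_conj, neg_neg]

theorem dsC_neg (φ : ℝ) {t : ℝ} (ht : t ≠ 0) : dsC φ (-t) = conj (dsC φ t) := by
  rw [dsC, dsC]
  rcases lt_or_gt_of_ne ht with h | h
  · rw [if_neg (by linarith), if_pos h, map_mul, conj_I, conj_exp_mul_I]
  · rw [if_pos (by linarith), if_neg (by linarith), map_mul, map_neg, conj_I, ← conj_exp_mul_I,
      Complex.conj_conj, neg_neg]

theorem norm_gammaC (φ t : ℝ) : ‖gammaC φ t‖ = |t| := by
  rw [gammaC]
  split_ifs with h
  · rw [norm_mul, norm_exp_ofReal_mul_I, norm_real, mul_one, norm_neg, Real.norm_eq_abs]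
  · rw [norm_mul, ← conj_exp_mul_I, norm_conj, norm_exp_ofReal_mul_I, norm_real, mul_one,
      Real.norm_eq_abs]

theorem norm_dsC (φ t : ℝ) : ‖dsC φ t‖ = 1 := by
  rw [dsC]
  split_ifs with h
  · rw [norm_mul, norm_exp_ofReal_mul_I, norm_I, mul_one]
  · rw [norm_mul, ← conj_exp_mul_I, norm_conj, norm_exp_ofReal_mul_I, norm_neg, norm_I, mul_one]

theorem gammaC_of_pos (φ : ℝ) {t : ℝ} (ht : 0 < t) :
    gammaC φ t = ⟨(polarPt t (-φ)).1, (polarPt t (-φ)).2⟩ := by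
  rw [gammaC, if_neg (not_lt.2 ht.le), ← neg_mul, ← ofReal_neg, exp_mul_I, ← ofReal_cos,
    ← ofReal_sin]
  apply Complex.ext <;> simp [polarPt, Complex.cos_ofReal_re, Complex.sin_ofReal_re]

theorem gammaC_of_neg (φ : ℝ) {t : ℝ} (ht : t < 0) :
    gammaC φ t = ⟨(polarPt (-t) φ).1, (polarPt (-t) φ).2⟩ := by
  rw [gammaC, if_pos ht, exp_mul_I, ← ofReal_cos, ← ofReal_sin]
  apply Complex.ext <;> simp [polarPt, Complex.cos_ofReal_re, Complex.sin_ofReal_re]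

theorem gammaC_re (φ t : ℝ) : (gammaC φ t).re = |t| * Real.cos φ := by
  rcases lt_or_ge t 0 with h | h
  · rw [gammaC_of_neg φ h, abs_of_neg h]
    rfl
  · rcases h.eq_or_lt with rfl | h
    · simp [gammaC]
    · rw [gammaC_of_pos φ h, abs_of_pos h, polarPt, Real.cos_neg]

theorem continuousOn_gammaC (φ : ℝ) : ContinuousOn (gammaC φ) {0}ᶜ := by
  intro t ht
  refine ContinuousAt.continuousWithinAt ?_
  rcases lt_or_gt_of_ne ht with h | h
  · refine ContinuousAt.congr (f := fun t : ℝ => (-t : ℝ) * exp (φ * I)) (by fun_prop) ?_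
    filter_upwards [gt_mem_nhds h] with x hx
    rw [gammaC, if_pos hx]
  · refine ContinuousAt.congr (f := fun t : ℝ => t * exp (-(φ * I))) (by fun_prop) ?_
    filter_upwards [lt_mem_nhds h] with x hx
    rw [gammaC, if_neg (not_lt.2 hx.le)]

theorem continuousOn_dsC (φ : ℝ) : ContinuousOn (dsC φ) {0}ᶜ := by
  intro t ht
  refine ContinuousAt.continuousWithinAt ?_
  rcases lt_or_gt_of_ne ht with h | h
  · refine ContinuousAt.congr (f := fun _ : ℝ => I * exp (φ * I)) (by fun_prop) ?_
    filter_upwards [gt_mem_nhds h] with x hx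
    rw [dsC, if_pos hx]
  · refine ContinuousAt.congr (f := fun _ : ℝ => -I * exp (-(φ * I))) (by fun_prop) ?_
    filter_upwards [lt_mem_nhds h] with x hx
    rw [dsC, if_neg (not_lt.2 hx.le)]

end SlicePlane

/-! ### Intrinsic functions as conjugation symmetric holomorphic functions. -/

section Intrinsic

open Complex ComplexConjugate

/-- The open sector in the complex plane. -/
def csec (θ : ℝ) : Set ℂ := {z | z ≠ 0 ∧ Real.arccos (z.re / ‖z‖) < θ}

variable {J : ℍ[ℝ]} {θ : ℝ}

theorem sl_mem_sector (hJ : J ∈ imSphere) {z : ℂ} : sl hJ z ∈ sector θ ↔ z ∈ csec θ := by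
  rw [sector, csec, Set.mem_ofPred_eq, Set.mem_ofPred_eq, sl_re, norm_sl, Ne,
    map_eq_zero_iff _ (sl_injective hJ)]

theorem mem_reducedSet_sector {p : ℝ × ℝ} :
    p ∈ reducedSet (sector θ) ↔ (⟨p.1, p.2⟩ : ℂ) ∈ csec θ := by
  constructor
  · intro h
    have := h _ basisUnit_one_mem_imSphere
    rwa [slicePoint_eq basisUnit_one_mem_imSphere, sl_mem_sector] at this
  · intro h J hJ
    rwa [slicePoint_eq hJ, sl_mem_sector]

theorem isOpen_csec (θ : ℝ) : IsOpen (csec θ) := by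
  have h : ContinuousOn (fun z : ℂ => Real.arccos (z.re / ‖z‖)) {0}ᶜ := by
    refine Real.continuous_arccos.comp_continuousOn ?_
    refine continuous_re.continuousOn.div continuous_norm.continuousOn fun z hz => ?_
    exact norm_ne_zero_iff.2 hz
  exact h.isOpen_inter_preimage isOpen_compl_singleton isOpen_Iio

theorem isOpen_reducedSet_sector (θ : ℝ) : IsOpen (reducedSet (sector θ)) := by
  have : reducedSet (sector θ) = equivRealProdCLM.symm ⁻¹' csec θ := by
    ext p
    rw [mem_reducedSet_sector]
    rfl
  rw [this]
  exact (isOpen_csec θ).preimage equivRealProdCLM.symm.continuous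

theorem gammaC_mem_csec {φ t : ℝ} (hφ : 0 ≤ φ) (hφ' : φ ≤ Real.pi) (h : φ < θ) (ht : t ≠ 0) :
    gammaC φ t ∈ csec θ := by
  have h0 := abs_pos.2 ht
  refine ⟨?_, ?_⟩
  · rw [← norm_pos_iff, norm_gammaC]
    exact h0
  · rwa [norm_gammaC, gammaC_re, mul_div_cancel_left₀ _ h0.ne', Real.arccos_cos hφ hφ']

theorem norm_polarPt {r ψ : ℝ} (hr : 0 < r) :
    ‖(⟨(polarPt r ψ).1, (polarPt r ψ).2⟩ : ℂ)‖ = r := by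
  have : (⟨(polarPt r ψ).1, (polarPt r ψ).2⟩ : ℂ) = r * exp (ψ * I) := by
    rw [exp_mul_I, ← ofReal_cos, ← ofReal_sin]
    apply Complex.ext <;> simp [polarPt, Complex.cos_ofReal_re, Complex.sin_ofReal_re]
  rw [this, norm_mul, norm_exp_ofReal_mul_I, norm_real, Real.norm_of_nonneg hr.le, mul_one]

theorem polarPt_mem_csec {r ψ : ℝ} (hr : 0 < r) (hθ : θ ≤ Real.pi) (hψ : |ψ| < θ) :
    (⟨(polarPt r ψ).1, (polarPt r ψ).2⟩ : ℂ) ∈ csec θ := by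
  have hn := norm_polarPt hr (ψ := ψ)
  refine ⟨?_, ?_⟩
  · rw [← norm_pos_iff, hn]
    exact hr
  · rw [hn]
    simp only [polarPt]
    rwa [mul_div_cancel_left₀ _ hr.ne', ← Real.cos_abs, Real.arccos_cos (abs_nonneg _)
      (hψ.le.trans hθ)]

/-- A complex function `g` represents an intrinsic function `f` on a sector. -/
structure Represents (θ : ℝ) (f : ℍ[ℝ] → ℍ[ℝ]) (g : ℂ → ℂ) : Prop where
  diff : ∀ z ∈ csec θ, DifferentiableAt ℂ g z
  map_conj : ∀ z ∈ csec θ, g (conj z) = conj (g z)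
  eq : ∀ J, ∀ hJ : J ∈ imSphere, ∀ z ∈ csec θ, f (sl hJ z) = sl hJ (g z)

theorem Represents.mul {f₁ f₂ : ℍ[ℝ] → ℍ[ℝ]} {g₁ g₂ : ℂ → ℂ} (h₁ : Represents θ f₁ g₁)
    (h₂ : Represents θ f₂ g₂) : Represents θ (f₁ * f₂) (g₁ * g₂) where
  diff z hz := (h₁.diff z hz).mul (h₂.diff z hz)
  map_conj z hz := by simp only [Pi.mul_apply, h₁.map_conj z hz, h₂.map_conj z hz, map_mul]
  eq J hJ z hz := by simp only [Pi.mul_apply, h₁.eq J hJ z hz, h₂.eq J hJ z hz, map_mul]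

theorem represents_pow (θ : ℝ) (n : ℕ) :
    Represents θ (fun s => s ^ n) (fun z => z ^ n) where
  diff z _ := (differentiableAt_id.pow n)
  map_conj z _ := (map_pow _ _ _).symm
  eq J hJ z _ := (map_pow _ _ _).symm

/-- For real valued components the function `a + i b` makes sense in `ℂ`. The equations for the pair
are the Cauchy-Riemann equations, and the parity conditions say that it commutes with conjugation.
-/
theorem exists_represents {f : ℍ[ℝ] → ℍ[ℝ]} (hf : IsIntrinsic (sector θ) f) :
    ∃ g, Represents θ f g := by
  obtain ⟨a, b, hab, hf⟩ := hf
  have hW : ∀ z ∈ csec θ, equivRealProdCLM z ∈ reducedSet (sector θ) := fun z hz =>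
    mem_reducedSet_sector.2 hz
  refine ⟨fun z => a (equivRealProdCLM z) + b (equivRealProdCLM z) * I, ?_, ?_, ?_⟩
  · intro z hz
    have hnhds := (isOpen_reducedSet_sector θ).mem_nhds (hW z hz)
    have ha := ((hab.contDiff_left.contDiffAt hnhds).differentiableAt one_ne_zero).hasFDerivAt
    have hb := ((hab.contDiff_right.contDiffAt hnhds).differentiableAt one_ne_zero).hasFDerivAt
    have ha' := ofRealCLM.hasFDerivAt.comp z (ha.comp z equivRealProdCLM.hasFDerivAt)
    have hb' := ofRealCLM.hasFDerivAt.comp z (hb.comp z equivRealProdCLM.hasFDerivAt)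
    have h := ha'.add (hb'.mul_const I)
    rw [differentiableAt_complex_iff_differentiableAt_real]
    refine ⟨h.differentiableAt, ?_⟩
    have h' : fderiv ℝ (fun z => (a (equivRealProdCLM z) : ℂ) + b (equivRealProdCLM z) * I) z = _ :=
      h.fderiv
    rw [h']
    have e1 : equivRealProdCLM (1 : ℂ) = (1, 0) := rfl
    have e2 : equivRealProdCLM I = (0, 1) := rfl
    have c1 := hab.cauchyRiemann_left _ (hW z hz)
    have c2 := hab.cauchyRiemann_right _ (hW z hz)
    simp only [add_apply, ContinuousLinearMap.comp_apply, smul_apply, ofRealCLM_apply,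
      smul_eq_mul, ContinuousLinearEquiv.coe_coe, e1, e2, c1, c2, ofReal_neg]
    linear_combination (-((fderiv ℝ b (equivRealProdCLM z) (1, 0) : ℝ) : ℂ)) * I_mul_I
  · intro z hz
    have h1 := hab.even _ (hW z hz)
    have h2 := hab.odd _ (hW z hz)
    have e : equivRealProdCLM (conj z) = ((equivRealProdCLM z).1, -(equivRealProdCLM z).2) := rfl
    simp only [e, h1, h2, map_add, map_mul, conj_ofReal, conj_I, ofReal_neg]
    ring
  · intro J hJ z hz
    have := hf _ (hW z hz) J hJ
    rw [map_add, map_mul, sl_ofReal, sl_ofReal, sl_I, Quaternion.coe_commutes, ← this,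
      slicePoint_eq hJ]
    rfl

theorem Represents.isIntrinsic {f : ℍ[ℝ] → ℍ[ℝ]} {g : ℂ → ℂ} (h : Represents θ f g) :
    IsIntrinsic (sector θ) f := by
  have hW : ∀ p ∈ reducedSet (sector θ), equivRealProdCLM.symm p ∈ csec θ := fun p hp =>
    mem_reducedSet_sector.1 hp
  have hg : ContDiffOn ℝ 1 g (csec θ) :=
    (DifferentiableOn.contDiffOn (fun z hz => (h.diff z hz).differentiableWithinAt)
      (isOpen_csec θ)).restrict_scalars ℝ
  have hge : ContDiffOn ℝ 1 (fun p : ℝ × ℝ => g (equivRealProdCLM.symm p))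
      (reducedSet (sector θ)) :=
    hg.comp equivRealProdCLM.symm.contDiff.contDiffOn hW
  have hd : ∀ p ∈ reducedSet (sector θ), ∃ c : ℂ,
      fderiv ℝ (fun p : ℝ × ℝ => (g (equivRealProdCLM.symm p)).re) p (1, 0) = c.re ∧
      fderiv ℝ (fun p : ℝ × ℝ => (g (equivRealProdCLM.symm p)).re) p (0, 1) = -c.im ∧
      fderiv ℝ (fun p : ℝ × ℝ => (g (equivRealProdCLM.symm p)).im) p (1, 0) = c.im ∧
      fderiv ℝ (fun p : ℝ × ℝ => (g (equivRealProdCLM.symm p)).im) p (0, 1) = c.re := by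
    intro p hp
    have h1 := ((h.diff _ (hW p hp)).hasFDerivAt.restrictScalars ℝ).comp p
      equivRealProdCLM.symm.hasFDerivAt
    have hre : fderiv ℝ (fun p : ℝ × ℝ => (g (equivRealProdCLM.symm p)).re) p = _ :=
      (reCLM.hasFDerivAt.comp p h1).fderiv
    have him : fderiv ℝ (fun p : ℝ × ℝ => (g (equivRealProdCLM.symm p)).im) p = _ :=
      (imCLM.hasFDerivAt.comp p h1).fderiv
    have e1 : equivRealProdCLM.symm ((1, 0) : ℝ × ℝ) = 1 := rfl
    have e2 : equivRealProdCLM.symm ((0, 1) : ℝ × ℝ) = I := rfl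
    have e3 : fderiv ℂ g (equivRealProdCLM.symm p) I =
        I * fderiv ℂ g (equivRealProdCLM.symm p) 1 := by
      rw [← smul_eq_mul, ← map_smul, smul_eq_mul, mul_one]
    refine ⟨fderiv ℂ g (equivRealProdCLM.symm p) 1, ?_⟩
    rw [hre, him]
    simp only [ContinuousLinearMap.comp_apply, ContinuousLinearMap.coe_restrictScalars',
      ContinuousLinearEquiv.coe_coe, e1, e2, e3, reCLM_apply, imCLM_apply]
    simp
  refine ⟨fun p => (g (equivRealProdCLM.symm p)).re, fun p => (g (equivRealProdCLM.symm p)).im,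
    ⟨?_, ?_, ?_, ?_, ?_, ?_⟩, ?_⟩
  · exact reCLM.contDiff.comp_contDiffOn hge
  · exact imCLM.contDiff.comp_contDiffOn hge
  · intro p hp
    have := h.map_conj _ (hW p hp)
    have e : equivRealProdCLM.symm (p.1, -p.2) = conj (equivRealProdCLM.symm p) := rfl
    simp only [e, this, conj_re]
  · intro p hp
    have := h.map_conj _ (hW p hp)
    have e : equivRealProdCLM.symm (p.1, -p.2) = conj (equivRealProdCLM.symm p) := rfl
    simp only [e, this, conj_im]
  · intro p hp
    obtain ⟨c, h1, h2, h3, h4⟩ := hd p hp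
    rw [h1, h4]
  · intro p hp
    obtain ⟨c, h1, h2, h3, h4⟩ := hd p hp
    rw [h2, h3]
  · intro p hp J hJ
    rw [slicePoint_eq hJ, h.eq J hJ _ (mem_reducedSet_sector.1 hp), sl_eq, slicePoint]
    rfl

theorem IsIntrinsic.isLeftSliceHyperholomorphic {f : ℍ[ℝ] → ℍ[ℝ]}
    (hf : IsIntrinsic (sector θ) f) : IsLeftSliceHyperholomorphic (sector θ) f := by
  obtain ⟨a, b, hab, hf⟩ := hf
  set c : ℝ →L[ℝ] ℍ[ℝ] := algebraMapCLM ℝ ℍ[ℝ] with hc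
  have hd : ∀ u : ℝ × ℝ → ℝ, ContDiffOn ℝ 1 u (reducedSet (sector θ)) →
      ∀ p ∈ reducedSet (sector θ), fderiv ℝ (fun p => c (u p)) p = c.comp (fderiv ℝ u p) := by
    intro u hu p hp
    have hnhds := (isOpen_reducedSet_sector θ).mem_nhds hp
    exact (c.hasFDerivAt.comp p
      ((hu.contDiffAt hnhds).differentiableAt one_ne_zero).hasFDerivAt).fderiv
  refine ⟨fun p => c (a p), fun p => c (b p), ⟨c.contDiff.comp_contDiffOn hab.contDiff_left,
    c.contDiff.comp_contDiffOn hab.contDiff_right, fun p hp => ?_, fun p hp => ?_, fun p hp => ?_,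
    fun p hp => ?_⟩, hf⟩
  · simp only [hab.even p hp]
  · simp only [hab.odd p hp, map_neg]
  · rw [hd a hab.contDiff_left p hp, hd b hab.contDiff_right p hp,
      ContinuousLinearMap.comp_apply, ContinuousLinearMap.comp_apply,
      hab.cauchyRiemann_left p hp]
  · rw [hd a hab.contDiff_left p hp, hd b hab.contDiff_right p hp,
      ContinuousLinearMap.comp_apply, ContinuousLinearMap.comp_apply,
      hab.cauchyRiemann_right p hp, map_neg]

theorem pow_mem_growL (θ : ℝ) (n : ℕ) : (fun s => s ^ n) ∈ GrowL θ := by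
  -- The exponent in the definition of the class must be positive, so `n + 1` is taken instead of
  -- `n`, which covers `n = 0`.
  refine ⟨(represents_pow θ n).isIntrinsic.isLeftSliceHyperholomorphic, n + 1, by positivity, 1,
    zero_le_one, fun s hs => ?_⟩
  have h0 : 0 < ‖s‖ := norm_pos_iff.2 hs.1
  have e : ‖s‖ ^ ((n : ℝ) + 1) = ‖s‖ ^ (n + 1) := by
    rw [← Real.rpow_natCast]
    norm_cast
  rw [norm_pow, e, one_mul]
  rcases le_total ‖s‖ 1 with h | h
  · have h1 : ‖s‖ ^ n ≤ 1 := pow_le_one₀ h0.le h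
    have h2 : ‖s‖ ^ (n + 1) ≤ 1 := pow_le_one₀ h0.le h
    have h3 : 1 ≤ 1 / ‖s‖ ^ (n + 1) := by
      rw [le_div_iff₀ (by positivity), one_mul]
      exact h2
    have h4 : 0 ≤ ‖s‖ ^ (n + 1) := by positivity
    linarith
  · have h1 : ‖s‖ ^ n ≤ ‖s‖ ^ (n + 1) := pow_le_pow_right₀ h (Nat.le_succ n)
    have h2 : 0 ≤ 1 / ‖s‖ ^ (n + 1) := by positivity
    linarith

end Intrinsic

/-! ### Operator valued integrals over the boundary of a sector. -/

section LineIntegrals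

open Complex ComplexConjugate Set

variable {J : ℍ[ℝ]} {θ φ : ℝ} {K : ℍ[ℝ] → V →L[ℝ] V} {f : ℍ[ℝ] → ℍ[ℝ]} {g : ℂ → ℂ}
  {F F₁ F₂ : ℂ → V →L[ℝ] V}

/-- The integrand of `∫ F(z) dz_J` over the boundary of a sector. -/
def lineIntegrand (hJ : J ∈ imSphere) (φ : ℝ) (F : ℂ → V →L[ℝ] V) (t : ℝ) : V →L[ℝ] V :=
  F (gammaC φ t) * leftMul (sl hJ (dsC φ t))

/-- The integral `∫ F(z) dz_J` over the boundary of a sector. -/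
def lineInt (hJ : J ∈ imSphere) (φ : ℝ) (F : ℂ → V →L[ℝ] V) : V →L[ℝ] V :=
  ∫ t, lineIntegrand hJ φ F t

/-- Absolute convergence of `∫ F(z) dz_J` over the boundary of a sector. -/
def LineConv (hJ : J ∈ imSphere) (φ : ℝ) (F : ℂ → V →L[ℝ] V) : Prop :=
  Integrable (lineIntegrand hJ φ F)

/-- The function `K(z) g(z)` with values in the bounded operators. -/
def mulFun (hJ : J ∈ imSphere) (K : ℍ[ℝ] → V →L[ℝ] V) (g : ℂ → ℂ) (z : ℂ) : V →L[ℝ] V :=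
  K (sl hJ z) * leftMul (sl hJ (g z))

theorem ae_ne_zero : ∀ᵐ t : ℝ, t ≠ 0 := by
  rw [ae_iff]
  simp

/-- The corner `t = 0` is discarded as a null set. Elsewhere `ds_J` and the value of an intrinsic
function lie in the same plane `ℂ_J` and can be exchanged. -/
theorem pathIntegrand_ae_eq (hJ : J ∈ imSphere) (hφ : φ ∈ Ioo 0 θ) (hθ : θ ≤ Real.pi)
    (hg : Represents θ f g) :
    pathIntegrand K φ J f =ᵐ[volume] lineIntegrand hJ φ (mulFun hJ K g) := by
  filter_upwards [ae_ne_zero] with t ht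
  rw [pathIntegrand, gamma_eq hJ, deriv_gamma hJ φ ht,
    hg.eq J hJ _ (gammaC_mem_csec hφ.1.le (hφ.2.le.trans hθ) hφ.2 ht), lineIntegrand, mulFun,
    (commute_sl hJ _ _).eq, leftMul_mul, mul_assoc]

theorem pathIntegral_eq (hJ : J ∈ imSphere) (hφ : φ ∈ Ioo 0 θ) (hθ : θ ≤ Real.pi)
    (hg : Represents θ f g) : pathIntegral K φ J f = lineInt hJ φ (mulFun hJ K g) :=
  integral_congr_ae (pathIntegrand_ae_eq hJ hφ hθ hg)

theorem converges_iff (hJ : J ∈ imSphere) (hφ : φ ∈ Ioo 0 θ) (hθ : θ ≤ Real.pi)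
    (hg : Represents θ f g) : Converges K φ J f ↔ LineConv hJ φ (mulFun hJ K g) :=
  integrable_congr (pathIntegrand_ae_eq hJ hφ hθ hg)

theorem norm_lineIntegrand (hJ : J ∈ imSphere) (t : ℝ) :
    ‖lineIntegrand hJ φ F t‖ = ‖F (gammaC φ t)‖ := by
  rw [lineIntegrand, norm_mul_leftMul, norm_sl, norm_dsC, mul_one]

theorem norm_mulFun (hJ : J ∈ imSphere) (z : ℂ) :
    ‖mulFun hJ K g z‖ = ‖K (sl hJ z)‖ * ‖g z‖ := by
  rw [mulFun, norm_mul_leftMul, norm_sl]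

theorem aestronglyMeasurable_of_continuousOn_compl {E : Type*} [NormedAddCommGroup E] {h : ℝ → E}
    (hh : ContinuousOn h {0}ᶜ) : AEStronglyMeasurable h := by
  have h1 := hh.aestronglyMeasurable (μ := volume) (measurableSet_singleton (0 : ℝ)).compl
  rwa [restrict_compl_singleton] at h1

theorem continuous_leftMul : Continuous (leftMul : ℍ[ℝ] → V →L[ℝ] V) :=
  (ContinuousLinearMap.lsmul ℝ ℍ[ℝ]).continuous

theorem aestronglyMeasurable_lineIntegrand (hJ : J ∈ imSphere)
    (hF : ∀ t ≠ 0, ContinuousAt F (gammaC φ t)) :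
    AEStronglyMeasurable (lineIntegrand hJ φ F) := by
  refine aestronglyMeasurable_of_continuousOn_compl ?_
  refine ContinuousOn.mul ?_ ?_
  · intro t ht
    exact (hF t ht).comp_continuousWithinAt (continuousOn_gammaC φ t ht)
  · exact (continuous_leftMul.comp (continuous_sl hJ)).comp_continuousOn (continuousOn_dsC φ)

theorem lineConv_of_le (hJ : J ∈ imSphere) (hF : ∀ t ≠ 0, ContinuousAt F (gammaC φ t))
    {h : ℝ → ℝ} (hh : Integrable h) (hle : ∀ t ≠ 0, ‖F (gammaC φ t)‖ ≤ h t) :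
    LineConv hJ φ F := by
  refine hh.mono' (aestronglyMeasurable_lineIntegrand hJ hF) ?_
  filter_upwards [ae_ne_zero] with t ht
  rw [norm_lineIntegrand]
  exact hle t ht

theorem lineConv_of_norm_le (hJ : J ∈ imSphere) (hF : ∀ t ≠ 0, ContinuousAt F (gammaC φ t))
    (h₁ : LineConv hJ φ F₁) (h₂ : LineConv hJ φ F₂) {C : ℝ}
    (hle : ∀ t ≠ 0, ‖F (gammaC φ t)‖ ≤ C * (‖F₁ (gammaC φ t)‖ + ‖F₂ (gammaC φ t)‖)) :
    LineConv hJ φ F := by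
  refine lineConv_of_le hJ hF ((h₁.norm.add h₂.norm).const_mul C) fun t ht => ?_
  simpa only [Pi.add_apply, norm_lineIntegrand] using hle t ht

/-- The function `|t|^(-1+δ)` for `|t| ≤ 1`, and `|t|^(-1-δ)` for `|t| > 1`. -/
def decayFun (δ t : ℝ) : ℝ := if |t| ≤ 1 then |t| ^ (-1 + δ) else |t| ^ (-1 - δ)

theorem integrable_decayFun {δ : ℝ} (hδ : 0 < δ) : Integrable (decayFun δ) := by
  have h : IntegrableOn (decayFun δ) (Ioi 0) := by
    rw [← Ioc_union_Ioi_eq_Ioi (zero_le_one (α := ℝ))]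
    refine IntegrableOn.union ?_ ?_
    · have := intervalIntegral.intervalIntegrable_rpow' (a := 0) (b := 1)
        (show -1 < -1 + δ by linarith)
      rw [intervalIntegrable_iff_integrableOn_Ioc_of_le zero_le_one] at this
      refine this.congr_fun (fun t ht => ?_) measurableSet_Ioc
      rw [decayFun, abs_of_pos ht.1, if_pos ht.2]
    · refine (integrableOn_Ioi_rpow_of_lt (show -1 - δ < -1 by linarith) one_pos).congr_fun
        (fun t ht => ?_) measurableSet_Ioi
      have h0 : (0 : ℝ) < t := one_pos.trans ht
      rw [decayFun, abs_of_pos h0, if_neg (not_le.2 ht)]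
  have h' : IntegrableOn (decayFun δ) (Iic 0) := by
    rw [integrableOn_Iic_iff_integrableOn_Iio]
    have h2 := h.comp_neg
    rw [neg_Ioi, neg_zero] at h2
    refine h2.congr_fun (fun t _ => ?_) measurableSet_Iio
    simp only [decayFun, abs_neg]
  rw [← integrableOn_univ, ← Iic_union_Ioi (a := (0 : ℝ))]
  exact h'.union h

theorem LineConv.add (hJ : J ∈ imSphere) (h₁ : LineConv hJ φ F₁) (h₂ : LineConv hJ φ F₂) :
    LineConv hJ φ (F₁ + F₂) := by
  have key : ∀ {E : Type _} [NormedAddCommGroup E] {u v : ℝ → E}, Integrable u → Integrable v →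
    Integrable (u + v) := fun hu hv => hu.add hv
  refine (key h₁ h₂).congr (Filter.Eventually.of_forall fun t => ?_)
  simp only [Pi.add_apply, lineIntegrand, add_mul]

theorem lineInt_add (hJ : J ∈ imSphere) (h₁ : LineConv hJ φ F₁) (h₂ : LineConv hJ φ F₂) :
    lineInt hJ φ (F₁ + F₂) = lineInt hJ φ F₁ + lineInt hJ φ F₂ := by
  refine Eq.trans (integral_congr_ae (Filter.Eventually.of_forall fun t => ?_))
    (integral_add h₁ h₂)
  simp only [Pi.add_apply, lineIntegrand, add_mul]

theorem LineConv.const_mul (hJ : J ∈ imSphere) (A : V →L[ℝ] V) (h : LineConv hJ φ F) :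
    LineConv hJ φ (fun z => A * F z) := by
  refine (Integrable.const_mul h A).congr (Filter.Eventually.of_forall fun t => ?_)
  simp only [lineIntegrand, mul_assoc]

theorem lineInt_const_mul (hJ : J ∈ imSphere) (A : V →L[ℝ] V) (h : LineConv hJ φ F) :
    lineInt hJ φ (fun z => A * F z) = A * lineInt hJ φ F := by
  refine Eq.trans (integral_congr_ae (Filter.Eventually.of_forall fun t => ?_))
    (integral_const_mul_of_integrable h)
  simp only [lineIntegrand, mul_assoc]

theorem lineInt_smul (hJ : J ∈ imSphere) (c : ℝ) :
    lineInt hJ φ (fun z => c • F z) = c • lineInt hJ φ F := by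
  refine Eq.trans (integral_congr_ae (Filter.Eventually.of_forall fun t => ?_))
    (integral_smul c _)
  simp only [lineIntegrand, smul_mul_assoc]

theorem LineConv.congr (hJ : J ∈ imSphere) (h : LineConv hJ φ F₁)
    (he : ∀ t ≠ 0, F₁ (gammaC φ t) = F₂ (gammaC φ t)) : LineConv hJ φ F₂ := by
  refine Integrable.congr h ?_
  filter_upwards [ae_ne_zero] with t ht
  rw [lineIntegrand, lineIntegrand, he t ht]

theorem lineInt_congr (hJ : J ∈ imSphere) (he : ∀ t ≠ 0, F₁ (gammaC φ t) = F₂ (gammaC φ t)) :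
    lineInt hJ φ F₁ = lineInt hJ φ F₂ := by
  refine integral_congr_ae ?_
  filter_upwards [ae_ne_zero] with t ht
  rw [lineIntegrand, lineIntegrand, he t ht]

/-- An operator that commutes with the integrand and with the plane `ℂ_J` commutes with the
integral. -/
theorem commute_lineInt (hJ : J ∈ imSphere) {X : V →L[ℝ] V} (h : LineConv hJ φ F)
    (hX : ∀ z, Commute X (leftMul (sl hJ z))) (hF : ∀ t ≠ 0, Commute X (F (gammaC φ t))) :
    Commute X (lineInt hJ φ F) := by
  rw [Commute, SemiconjBy, lineInt, ← integral_const_mul_of_integrable h,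
    ← integral_mul_const_of_integrable h]
  refine integral_congr_ae ?_
  filter_upwards [ae_ne_zero] with t ht
  exact ((hF t ht).mul_right (hX _)).eq

/-- A symmetric integral commutes with the left multiplications. -/
theorem commute_leftMul_lineInt (hJ : J ∈ imSphere) (h : LineConv hJ φ F)
    (hcomm : ∀ t ≠ 0, ∀ z, Commute (leftMul (sl hJ z)) (F (gammaC φ t)))
    (hanti : ∀ t ≠ 0, ∀ a, a * J = -(J * a) →
      leftMul a * F (gammaC φ t) = F (conj (gammaC φ t)) * leftMul a) (a : ℍ[ℝ]) :
    Commute (leftMul a) (lineInt hJ φ F) := by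
  obtain ⟨z, b, hb, rfl⟩ := exists_comm_add_anticomm hJ a
  rw [leftMul_add]
  refine Commute.add_left ?_ ?_
  · refine commute_lineInt hJ h (fun w => ?_) fun t ht => hcomm t ht z
    rw [Commute, SemiconjBy, ← leftMul_mul, (commute_sl hJ z w).eq, leftMul_mul]
  -- An anticommuting `b` passes through the integrand at the price of conjugating the contour point
  -- and `ds_J`; the substitution `t ↦ -t` undoes this.
  · rw [Commute, SemiconjBy, lineInt, ← integral_const_mul_of_integrable h,
      ← integral_mul_const_of_integrable h, ← integral_neg_eq_self]
    refine integral_congr_ae ?_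
    filter_upwards [ae_ne_zero] with t ht
    have e : conj (gammaC φ (-t)) = gammaC φ t := by rw [gammaC_neg φ ht, Complex.conj_conj]
    rw [lineIntegrand, ← mul_assoc, hanti (-t) (neg_ne_zero.2 ht) b hb, e, mul_assoc,
      ← leftMul_mul, anticomm_sl hJ hb, dsC_neg φ ht, Complex.conj_conj, leftMul_mul,
      ← mul_assoc, lineIntegrand]

/-- The integral over the ray with argument `ψ`. -/
def rayInt (F : ℂ → V →L[ℝ] V) (ψ : ℝ) : V →L[ℝ] V :=
  ∫ r in Ioi 0, F ⟨(polarPt r ψ).1, (polarPt r ψ).2⟩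

theorem lineIntegrand_mul_inv (hJ : J ∈ imSphere) (t : ℝ) :
    lineIntegrand hJ φ F t * leftMul (sl hJ (dsC φ t)⁻¹) = F (gammaC φ t) := by
  have h : dsC φ t ≠ 0 := by
    rw [← norm_ne_zero_iff, norm_dsC]
    exact one_ne_zero
  rw [lineIntegrand, mul_assoc, ← leftMul_mul, ← map_mul, mul_inv_cancel₀ h, map_one, leftMul_one,
    mul_one]

/-- The halves `t < 0` and `t > 0` run along the rays with arguments `φ` and `-φ`. On each of them
`ds_J` is a constant unit; cancelling it shows that `F` itself is integrable there. -/
theorem lineInt_eq_rayInt (hJ : J ∈ imSphere) (h : LineConv hJ φ F) :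
    lineInt hJ φ F = rayInt F φ * leftMul (sl hJ (I * exp (φ * I))) -
      rayInt F (-φ) * leftMul (sl hJ (I * exp (((-φ : ℝ) : ℂ) * I))) := by
  have hpos : ∫ t in Ioi 0, lineIntegrand hJ φ F t =
      -(rayInt F (-φ) * leftMul (sl hJ (I * exp (((-φ : ℝ) : ℂ) * I)))) := by
    have hds : ∀ t ∈ Ioi (0 : ℝ), dsC φ t = -(I * exp (((-φ : ℝ) : ℂ) * I)) := fun t ht => by
      rw [dsC, if_neg (not_lt.2 (le_of_lt (mem_Ioi.1 ht))), neg_mul, ofReal_neg, neg_mul]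
    have hi : IntegrableOn (fun r : ℝ => F ⟨(polarPt r (-φ)).1, (polarPt r (-φ)).2⟩) (Ioi 0) := by
      refine IntegrableOn.congr_fun (Integrable.mul_const (h.integrableOn (s := Ioi 0))
        (leftMul (sl hJ (-(I * exp (((-φ : ℝ) : ℂ) * I)))⁻¹))) (fun t ht => ?_) measurableSet_Ioi
      rw [← hds t ht, lineIntegrand_mul_inv, gammaC_of_pos φ ht]
    rw [rayInt, ← integral_mul_const_of_integrable hi, ← integral_neg]
    refine setIntegral_congr_fun measurableSet_Ioi fun t ht => ?_
    simp only [lineIntegrand, gammaC_of_pos φ ht, hds t ht]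
    rw [map_neg, leftMul_neg, mul_neg]
  have hneg : ∫ t in Iic 0, lineIntegrand hJ φ F t =
      rayInt F φ * leftMul (sl hJ (I * exp (φ * I))) := by
    have hds : ∀ t ∈ Ioi (0 : ℝ), dsC φ (-t) = I * exp (φ * I) := fun t ht => by
      rw [dsC, if_pos (neg_lt_zero.2 (mem_Ioi.1 ht))]
    have hi : IntegrableOn (fun r : ℝ => F ⟨(polarPt r φ).1, (polarPt r φ).2⟩) (Ioi 0) := by
      refine IntegrableOn.congr_fun (Integrable.mul_const
        ((Integrable.comp_neg h).integrableOn (s := Ioi 0))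
        (leftMul (sl hJ (I * exp (φ * I))⁻¹))) (fun t ht => ?_) measurableSet_Ioi
      rw [← hds t ht, lineIntegrand_mul_inv, gammaC_of_neg φ (neg_lt_zero.2 (mem_Ioi.1 ht)),
        neg_neg]
    rw [rayInt, ← integral_mul_const_of_integrable hi]
    have := integral_comp_neg_Ioi 0 (fun t => lineIntegrand hJ φ F t)
    rw [neg_zero] at this
    rw [← this]
    refine setIntegral_congr_fun measurableSet_Ioi fun t ht => ?_
    simp only [lineIntegrand, gammaC_of_neg φ (neg_lt_zero.2 (mem_Ioi.1 ht)), hds t ht, neg_neg]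
  rw [lineInt, ← integral_add_compl₀ (s := Iic 0) nullMeasurableSet_Iic h, compl_Iic, hpos, hneg,
    sub_eq_add_neg, add_comm]

/-- `F` is differentiable at `z`, and satisfies the Cauchy-Riemann equation with respect to
multiplication by `J` from the right. -/
def HasCR (hJ : J ∈ imSphere) (F : ℂ → V →L[ℝ] V) (z : ℂ) : Prop :=
  ∃ F' : ℂ →L[ℝ] V →L[ℝ] V, HasFDerivAt F F' z ∧ F' I = F' 1 * leftMul (sl hJ I)

/-- Formally, `∫ F dz` along a ray equals the radial integral times `e^{iψ}`, with the scalar acting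
from the right through the slice. It does not depend on `ψ` by Cauchy's theorem with `JJ` equal to
right multiplication by `J`. -/
theorem rayInt_mul_eq (hJ : J ∈ imSphere) {ψ₁ ψ₂ C δ : ℝ} (hψ : ψ₁ ≤ ψ₂) (hδ : 0 < δ)
    (hF : ∀ r > 0, ∀ ψ ∈ Icc ψ₁ ψ₂, HasCR hJ F ⟨(polarPt r ψ).1, (polarPt r ψ).2⟩)
    (hb : ∀ r > 0, ∀ ψ ∈ Icc ψ₁ ψ₂,
      ‖F ⟨(polarPt r ψ).1, (polarPt r ψ).2⟩‖ ≤ C * decayFun δ r) :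
    rayInt F ψ₁ * leftMul (sl hJ (exp (ψ₁ * I))) =
      rayInt F ψ₂ * leftMul (sl hJ (exp (ψ₂ * I))) := by
  classical
  -- The derivatives are chosen point by point; the value `0` where none exists is never used.
  set G' : ℂ → ℂ →L[ℝ] V →L[ℝ] V := fun z => if h : HasCR hJ F z then h.choose else 0 with hG'
  have hG : ∀ z, HasCR hJ F z → HasFDerivAt F (G' z) z ∧ G' z I = G' z 1 * leftMul (sl hJ I) := by
    intro z h
    simp only [hG', dif_pos h]
    exact h.choose_spec
  set JJ : (V →L[ℝ] V) →L[ℝ] V →L[ℝ] V :=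
    (ContinuousLinearMap.mul ℝ (V →L[ℝ] V)).flip (leftMul (sl hJ I)) with hJJ
  have hJJa : ∀ A, JJ A = A * leftMul (sl hJ I) := fun A => rfl
  have key := integral_ray_eq (JJ := JJ) (G := fun p => F (equivRealProdCLM.symm p))
    (G' := fun p => (G' (equivRealProdCLM.symm p)).comp
      (equivRealProdCLM.symm : ℝ × ℝ →L[ℝ] ℂ)) (C := C) (δ := δ) (fun A => by
        rw [hJJa, hJJa, mul_assoc, ← leftMul_mul, ← map_mul, I_mul_I, map_neg, map_one,
          leftMul_neg, leftMul_one, mul_neg, mul_one]) hψ hδ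
    (fun r hr ψ hψ => HasFDerivAt.comp (g := F) (f := equivRealProdCLM.symm)
      (polarPt r ψ) (hG _ (hF r hr ψ hψ)).1 equivRealProdCLM.symm.hasFDerivAt)
    (fun r hr ψ hψ => (hG _ (hF r hr ψ hψ)).2)
    (fun r hr hr1 ψ hψ => by
      have := hb r hr ψ hψ
      rwa [decayFun, abs_of_pos hr, if_pos hr1] at this)
    (fun r hr hr1 ψ hψ => by
      have := hb r hr ψ hψ
      rw [decayFun, abs_of_pos hr] at this
      -- At `r = 1` both hypotheses of the ray theorem apply, while `decayFun` uses its inner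
      -- branch; the two powers agree there.
      split_ifs at this with h
      · obtain rfl : r = 1 := le_antisymm h hr1
        rw [Real.one_rpow] at this ⊢
        exact this
      · exact this)
  have e : ∀ ψ : ℝ, rayInt F ψ * leftMul (sl hJ (exp (ψ * I))) =
      Real.cos ψ • (∫ r in Ioi 0, F (equivRealProdCLM.symm (polarPt r ψ))) +
      Real.sin ψ • JJ (∫ r in Ioi 0, F (equivRealProdCLM.symm (polarPt r ψ))) := by
    intro ψ
    rw [hJJa, exp_mul_I, map_add, leftMul_add, mul_add, map_mul, leftMul_mul, ← ofReal_cos,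
      ← ofReal_sin, sl_ofReal, sl_ofReal, leftMul_coe, leftMul_coe]
    simp only [mul_smul_comm, smul_mul_assoc, mul_one, one_mul]
    rfl
  rw [e, e]
  exact key

/-- Cauchy's theorem for the part of a sector that contains the positive real axis. -/
theorem lineInt_eq_zero_of_right (hJ : J ∈ imSphere) {C δ : ℝ} (hφ : 0 ≤ φ) (hδ : 0 < δ)
    (hF : ∀ r > 0, ∀ ψ ∈ Icc (-φ) φ, HasCR hJ F ⟨(polarPt r ψ).1, (polarPt r ψ).2⟩)
    (hb : ∀ r > 0, ∀ ψ ∈ Icc (-φ) φ,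
      ‖F ⟨(polarPt r ψ).1, (polarPt r ψ).2⟩‖ ≤ C * decayFun δ r)
    (h : LineConv hJ φ F) : lineInt hJ φ F = 0 := by
  have key := rayInt_mul_eq hJ (by linarith) hδ hF hb
  rw [lineInt_eq_rayInt hJ h, mul_comm I, mul_comm I, map_mul, map_mul, leftMul_mul, leftMul_mul,
    ← mul_assoc, ← mul_assoc, key, sub_self]

theorem rayInt_add_two_pi (ψ : ℝ) : rayInt F (ψ + 2 * Real.pi) = rayInt F ψ := by
  simp only [rayInt, polarPt, Real.cos_add_two_pi, Real.sin_add_two_pi]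

theorem exp_add_two_pi_mul_I (ψ : ℝ) :
    exp (((ψ + 2 * Real.pi : ℝ) : ℂ) * I) = exp (ψ * I) := by
  rw [ofReal_add, add_mul, exp_add]
  have : (((2 * Real.pi : ℝ) : ℂ)) * I = 2 * Real.pi * I := by push_cast; ring
  rw [this, exp_two_pi_mul_I, mul_one]

/-- Cauchy's theorem for the part of a sector that contains the negative real axis. -/
theorem lineInt_eq_zero_of_left (hJ : J ∈ imSphere) {C δ : ℝ} (hφ : φ ≤ Real.pi) (hδ : 0 < δ)
    (hF : ∀ r > 0, ∀ ψ ∈ Icc φ (-φ + 2 * Real.pi),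
      HasCR hJ F ⟨(polarPt r ψ).1, (polarPt r ψ).2⟩)
    (hb : ∀ r > 0, ∀ ψ ∈ Icc φ (-φ + 2 * Real.pi),
      ‖F ⟨(polarPt r ψ).1, (polarPt r ψ).2⟩‖ ≤ C * decayFun δ r)
    (h : LineConv hJ φ F) : lineInt hJ φ F = 0 := by
  have key := rayInt_mul_eq hJ (by linarith) hδ hF hb
  rw [rayInt_add_two_pi, exp_add_two_pi_mul_I] at key
  rw [lineInt_eq_rayInt hJ h, mul_comm I, mul_comm I, map_mul, map_mul, leftMul_mul, leftMul_mul,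
    ← mul_assoc, ← mul_assoc, key, sub_self]

/-- The integral does not depend on the angle. -/
theorem lineInt_angle_eq (hJ : J ∈ imSphere) {φ₁ φ₂ C δ : ℝ} (hφ : φ₁ ≤ φ₂) (hδ : 0 < δ)
    (hF : ∀ r > 0, ∀ ψ, |ψ| ∈ Icc φ₁ φ₂ → HasCR hJ F ⟨(polarPt r ψ).1, (polarPt r ψ).2⟩)
    (hb : ∀ r > 0, ∀ ψ, |ψ| ∈ Icc φ₁ φ₂ →
      ‖F ⟨(polarPt r ψ).1, (polarPt r ψ).2⟩‖ ≤ C * decayFun δ r)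
    (h0 : 0 ≤ φ₁) (h₁ : LineConv hJ φ₁ F) (h₂ : LineConv hJ φ₂ F) :
    lineInt hJ φ₁ F = lineInt hJ φ₂ F := by
  have habs : ∀ ψ ∈ Icc φ₁ φ₂, |ψ| ∈ Icc φ₁ φ₂ := fun ψ hψ => by
    rwa [abs_of_nonneg (h0.trans hψ.1)]
  have habs' : ∀ ψ ∈ Icc (-φ₂) (-φ₁), |ψ| ∈ Icc φ₁ φ₂ := fun ψ hψ => by
    rw [abs_of_nonpos (by linarith [hψ.2])]
    exact ⟨by linarith [hψ.2], by linarith [hψ.1]⟩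
  have k1 := rayInt_mul_eq hJ hφ hδ (fun r hr ψ hψ => hF r hr ψ (habs ψ hψ))
    fun r hr ψ hψ => hb r hr ψ (habs ψ hψ)
  have k2 := rayInt_mul_eq hJ (neg_le_neg hφ) hδ (fun r hr ψ hψ => hF r hr ψ (habs' ψ hψ))
    fun r hr ψ hψ => hb r hr ψ (habs' ψ hψ)
  rw [lineInt_eq_rayInt hJ h₁, lineInt_eq_rayInt hJ h₂]
  simp only [mul_comm I, map_mul, leftMul_mul, ← mul_assoc]
  rw [k1, k2]

end LineIntegrals

/-! ### Bounds for all resolvents from the bound for `S_L⁻¹(s, T)`. -/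

section Bounds

open Complex Set Filter Topology

variable {T : V →ₗ.[ℝ] V} {D : Submodule ℝ V} {α β c : ℝ}

/-- The function `r^(-α)` for `r ≤ 1`, and `r^(-β)` for `r > 1`. -/
def powFun (α β r : ℝ) : ℝ := if r ≤ 1 then r ^ (-α) else r ^ (-β)

theorem powFun_nonneg {r : ℝ} (hr : 0 ≤ r) : 0 ≤ powFun α β r := by
  rw [powFun]
  split_ifs <;> positivity

theorem powFun_le {r : ℝ} (hr : 0 ≤ r) : powFun α β r ≤ r ^ (-α) + r ^ (-β) := by
  have h1 : 0 ≤ r ^ (-α) := by positivity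
  have h2 : 0 ≤ r ^ (-β) := by positivity
  rw [powFun]
  split_ifs <;> linarith

theorem powFun_le_one (hβ : 0 ≤ β) {r : ℝ} (hr : 1 ≤ r) : powFun α β r ≤ 1 := by
  rw [powFun]
  split_ifs with h
  · rw [le_antisymm h hr, Real.one_rpow]
  · exact Real.rpow_le_one_of_one_le_of_nonpos hr (neg_nonpos.2 hβ)

/-- The complement of a closed sector, in the quaternions. -/
def wedge (c : ℝ) : Set ℍ[ℝ] := {s | s.re < c * ‖s‖}

/-- The complement of a closed sector, in the complex plane. -/
def cwedge (c : ℝ) : Set ℂ := {z | z.re < c * ‖z‖}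

theorem sl_mem_wedge {J : ℍ[ℝ]} (hJ : J ∈ imSphere) {z : ℂ} : sl hJ z ∈ wedge c ↔ z ∈ cwedge c := by
  rw [wedge, cwedge, mem_ofPred_eq, mem_ofPred_eq, sl_re, norm_sl]

theorem isOpen_cwedge (c : ℝ) : IsOpen (cwedge c) :=
  isOpen_lt continuous_re (continuous_norm.const_mul c)

theorem ne_zero_of_mem_cwedge {z : ℂ} (hz : z ∈ cwedge c) : z ≠ 0 := by
  rintro rfl
  simp [cwedge] at hz

theorem ne_zero_of_mem_wedge {s : ℍ[ℝ]} (hs : s ∈ wedge c) : s ≠ 0 := by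
  rintro rfl
  simp [wedge] at hs

theorem neg_one_mem_wedge (hc : -1 < c) : (-1 : ℍ[ℝ]) ∈ wedge c := by
  simpa [wedge] using hc

theorem re_basisUnit_conj (k : Fin 4) (hk : k ≠ 0) (s : ℍ[ℝ]) :
    (-(basisUnit k * s * basisUnit k)).re = s.re := by
  fin_cases k
  · exact absurd rfl hk
  all_goals
    simp only [basisUnit]
    rw [Quaternion.re_neg, Quaternion.re_mul, Quaternion.re_mul, Quaternion.imI_mul,
      Quaternion.imJ_mul, Quaternion.imK_mul]
    simp

theorem abs_re_le_norm (s : ℍ[ℝ]) : |s.re| ≤ ‖s‖ := by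
  refine abs_le_of_sq_le_sq ?_ (norm_nonneg s)
  rw [pow_two ‖s‖, ← Quaternion.normSq_eq_norm_mul_self, Quaternion.normSq_def']
  nlinarith [sq_nonneg s.imI, sq_nonneg s.imJ, sq_nonneg s.imK]

theorem norm_basisUnit_conj (k : Fin 4) (s : ℍ[ℝ]) :
    ‖-(basisUnit k * s * basisUnit k)‖ = ‖s‖ := by
  rw [norm_neg, norm_mul, norm_mul, norm_basisUnit, one_mul, mul_one]

theorem basisUnit_conj_mem_wedge {k : Fin 4} (hk : k ≠ 0) {s : ℍ[ℝ]} (hs : s ∈ wedge c) :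
    -(basisUnit k * s * basisUnit k) ∈ wedge c := by
  rw [wedge, mem_ofPred_eq, re_basisUnit_conj k hk, norm_basisUnit_conj]
  exact hs

/-- A power bound for the left `S`-resolvent on the complement of a closed sector. -/
structure HasBound (T : V →ₗ.[ℝ] V) (D : Submodule ℝ V) (α β c : ℝ) : Prop where
  adm : IsAdmissible T D
  gt : -1 < c
  mem : ∀ s ∈ wedge c, s ∈ rhoF T D
  bound : ∃ C ≥ 0, ∀ s ∈ wedge c, ‖SL T D s‖ ≤ C * powFun α β ‖s‖

/-- Common bounds for all resolvents. -/
structure BoundedBy (T : V →ₗ.[ℝ] V) (D : Submodule ℝ V) (M b : ℝ) (s : ℍ[ℝ]) : Prop where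
  SL_le : ‖SL T D s‖ ≤ M * b
  SL_conj_le : ‖SL (conj T) D s‖ ≤ M * b
  scalarQ_le : ‖scalarQ T D s‖ ≤ M * b
  compQ_le : ∀ k, k ≠ 0 → ‖compQ T D k s‖ ≤ M * b
  Qinv_le : ‖Qinv T D s‖ ≤ M * b ^ 2
  Qinv_le' : ‖Qinv T D s‖ ≤ M * b * (‖SL T D s‖ + ‖SL (conj T) D s‖)

theorem norm_rotSL_le {k : Fin 4} {s : ℍ[ℝ]} {B : ℝ}
    (h : ‖SL T D (-(basisUnit k * s * basisUnit k))‖ ≤ B) : ‖rotSL T D k s‖ ≤ B := by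
  rw [rotSL, norm_neg, norm_mul_leftMul, norm_basisUnit, mul_one]
  refine (norm_mul_le _ _).trans ((mul_le_of_le_one_left (norm_nonneg _)
    (norm_leftMul_basisUnit_le k)).trans h)

/-- The wedge is invariant under the rotations `s ↦ e_k s e_k⁻¹`, and these preserve `|s|`, so the
assumed bound also holds for all rotated resolvents and for the averages formed from them. The two
estimates of `Q⁻¹` have different uses: the quadratic one near zero, and the one relative to `S_L⁻¹`
at infinity. -/
theorem HasBound.boundedBy (h : HasBound T D α β c) :
    ∃ M ≥ 0, ∀ s ∈ wedge c, BoundedBy T D M (powFun α β ‖s‖) s := by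
  obtain ⟨C, hC, hb⟩ := h.bound
  -- In `Q⁻¹ = A A - B V` the factors satisfy `|A| ≤ C b`, `|B| ≤ 6 C b` and `|V| ≤ 2 C b`, which
  -- gives `13 C² b²`; with `A` and `V` estimated by the two `S`-resolvents instead, the constant is
  -- `C + 6 C = 7 C`.
  refine ⟨13 * C ^ 2 + 7 * C, by positivity, fun s hs => ?_⟩
  set b := powFun α β ‖s‖ with hbdef
  have hb0 : 0 ≤ b := powFun_nonneg (norm_nonneg s)
  have hmem : ∀ k : Fin 4, k ≠ 0 → -(basisUnit k * s * basisUnit k) ∈ wedge c := fun k hk =>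
    basisUnit_conj_mem_wedge hk hs
  have hS := hb s hs
  have hr : ∀ k : Fin 4, k ≠ 0 → ‖rotSL T D k s‖ ≤ C * b := fun k hk => by
    refine norm_rotSL_le ((hb _ (hmem k hk)).trans_eq ?_)
    rw [norm_basisUnit_conj]
  have r1 := hr 1 (by decide)
  have r2 := hr 2 (by decide)
  have r3 := hr 3 (by decide)
  have m1 := h.mem _ (hmem 1 (by decide))
  have m2 := h.mem _ (hmem 2 (by decide))
  have m3 := h.mem _ (hmem 3 (by decide))
  have hsum : ‖SL T D s + rotSL T D 1 s + rotSL T D 2 s + rotSL T D 3 s‖ ≤ 4 * (C * b) := by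
    refine (norm_add₄_le).trans ?_
    linarith
  have hsc : ‖scalarQ T D s‖ ≤ C * b := by
    rw [h.adm.scalarQ_eq (h.mem s hs) m1 m2 m3, norm_smul]
    norm_num
    linarith
  have hcomp : ∀ k : Fin 4, k ≠ 0 → ‖compQ T D k s * leftMul (basisUnit k)‖ ≤ 2 * (C * b) := by
    intro k hk
    rw [norm_mul_leftMul, norm_basisUnit, mul_one, compQ, norm_neg]
    refine (norm_mul_le _ _).trans ((mul_le_of_le_one_left (norm_nonneg _)
      (norm_leftMul_basisUnit_le k)).trans ?_)
    refine (norm_sub_le _ _).trans ?_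
    rw [norm_smul, norm_smul]
    have := norm_add_le (SL T D s) (rotSL T D k s)
    have := hr k hk
    norm_num
    linarith
  have hv : ‖vectorQ T D s‖ ≤ 2 * (C * b) := by
    have e : vectorQ T D s = SL T D s - scalarQ T D s := by rw [SL_eq_add]; abel
    rw [e]
    refine (norm_sub_le _ _).trans ?_
    linarith
  have hSc : ‖SL (conj T) D s‖ ≤ 3 * (C * b) := by
    rw [SL_conj_eq_sub]
    refine (norm_sub_le _ _).trans ?_
    linarith
  have hcs : ‖compQ T D 1 s * leftMul (basisUnit 1) + compQ T D 2 s * leftMul (basisUnit 2) +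
      compQ T D 3 s * leftMul (basisUnit 3)‖ ≤ 6 * (C * b) := by
    refine norm_add₃_le.trans ?_
    linarith [hcomp 1 (by decide), hcomp 2 (by decide), hcomp 3 (by decide)]
  have hQ : ‖Qinv T D s‖ ≤ C * b * ‖scalarQ T D s‖ + 6 * (C * b) * ‖vectorQ T D s‖ := by
    rw [h.adm.Qinv_eq (h.mem s hs) m1 m2 m3]
    refine (norm_sub_le _ _).trans ?_
    refine add_le_add ((norm_mul_le _ _).trans ?_) ((norm_mul_le _ _).trans ?_)
    · gcongr
    · gcongr
  have hCb : 0 ≤ C * b := by positivity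
  have hCC : 0 ≤ C ^ 2 * b := by positivity
  refine ⟨?_, ?_, ?_, fun k hk => ?_, ?_, ?_⟩
  · nlinarith
  · nlinarith
  · nlinarith
  · have := hcomp k hk
    rw [norm_mul_leftMul, norm_basisUnit, mul_one] at this
    nlinarith
  · have : 0 ≤ C * b ^ 2 := by positivity
    nlinarith
  · have v1 : ‖scalarQ T D s‖ ≤ ‖SL T D s‖ + ‖SL (conj T) D s‖ := by
      rw [scalarQ, norm_smul]
      have := norm_add_le (SL T D s) (SL (conj T) D s)
      norm_num
      linarith [norm_nonneg (SL T D s + SL (conj T) D s)]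
    have v2 : ‖vectorQ T D s‖ ≤ ‖SL T D s‖ + ‖SL (conj T) D s‖ := by
      rw [vectorQ, norm_smul]
      have := norm_sub_le (SL T D s) (SL (conj T) D s)
      norm_num
      linarith [norm_nonneg (SL T D s - SL (conj T) D s)]
    have h1 := mul_le_mul_of_nonneg_left v1 hCb
    have h2 := mul_le_mul_of_nonneg_left v2 hCb
    have h3 : 0 ≤ C ^ 2 * b * (‖SL T D s‖ + ‖SL (conj T) D s‖) := by positivity
    nlinarith

/-- The type condition concerns `T` only; its consequence for `T̄` comes from the separation of
components. -/
theorem HasBound.conj_bound (h : HasBound T D α β c) : HasBound (conj T) D α β c := by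
  obtain ⟨M, hM, hb⟩ := h.boundedBy
  refine ⟨h.adm.admissible_conj, h.gt, fun s hs => ?_, M, hM, fun s hs => (hb s hs).SL_conj_le⟩
  rw [rhoF_conj h.adm.kc.twoSided]
  exact h.mem s hs

/-- The classes of operators in the statement satisfy these bounds. -/
theorem IsOfType.hasBound {ω ψ : ℝ} (hω : ω ∈ Ioo 0 Real.pi) (hT : IsOfType T D α β ω)
    (hψ : ψ ∈ Ioo ω Real.pi) : HasBound T D α β (Real.cos ψ) := by
  have hψ0 : 0 ≤ ψ := hω.1.le.trans hψ.1.le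
  have hnot : ∀ s ∈ wedge (Real.cos ψ), s ∉ sector ψ := by
    rintro s hs ⟨h0, h1⟩
    have hp := norm_pos_iff.2 h0
    have h2 : s.re / ‖s‖ ≤ Real.cos ψ := by
      rw [div_le_iff₀ hp]
      exact le_of_lt hs
    have := Real.arccos_le_arccos h2
    rw [Real.arccos_cos hψ0 hψ.2.le] at this
    linarith
  refine ⟨hT.admissible, ?_, fun s hs => ?_, ?_⟩
  · rw [← Real.cos_pi]
    exact Real.cos_lt_cos_of_nonneg_of_le_pi hψ0 le_rfl hψ.2
  · by_contra hs'
    -- The closure of `S_ω` stays in a closed cone, and the wedge with parameter `cos ψ < cos ω`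
    -- does not meet this cone.
    have hcl : closure (sector ω) ⊆ {s | Real.cos ω * ‖s‖ ≤ s.re} := by
      refine closure_minimal ?_ (isClosed_le (continuous_norm.const_mul _) Quaternion.continuous_re)
      rintro p ⟨h0, h1⟩
      have hp := norm_pos_iff.2 h0
      have hle := abs_le.1 (abs_re_le_norm p)
      have h2 := Real.cos_le_cos_of_nonneg_of_le_pi (Real.arccos_nonneg _) hω.2.le h1.le
      rw [Real.cos_arccos, le_div_iff₀ hp] at h2
      · exact h2
      · rw [le_div_iff₀ hp]
        linarith
      · rw [div_le_iff₀ hp]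
        linarith
    have h3 : Real.cos ω * ‖s‖ ≤ s.re := hcl (hT.spectrum_subset hs')
    have h4 : s.re < Real.cos ψ * ‖s‖ := hs
    have h5 := Real.cos_le_cos_of_nonneg_of_le_pi hω.1.le hψ.2.le hψ.1.le
    nlinarith [norm_nonneg s]
  · obtain ⟨C, hC, hb⟩ := hT.resolvent_bound ψ hψ
    refine ⟨C, hC, fun s hs => ?_⟩
    obtain ⟨h1, h2⟩ := hb s (hnot s hs) (ne_zero_of_mem_wedge hs)
    rw [powFun]
    split_ifs with h
    · exact h1 h
    · exact h2 (not_le.1 h).le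

theorem gammaC_mem_cwedge {φ t : ℝ} (h : Real.cos φ < c) (ht : t ≠ 0) :
    gammaC φ t ∈ cwedge c := by
  rw [cwedge, mem_ofPred_eq, gammaC_re, norm_gammaC, mul_comm c]
  exact mul_lt_mul_of_pos_left h (abs_pos.2 ht)

end Bounds

/-! ### Continuity and Cauchy-Riemann equations for the resolvents. -/

section Continuity

open Complex Set Filter Topology

variable {T : V →ₗ.[ℝ] V} {D : Submodule ℝ V} {α β c : ℝ} {J : ℍ[ℝ]} (hJ : J ∈ imSphere)
  {F X : ℂ → V →L[ℝ] V} {z₀ : ℂ}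

theorem eventually_norm_le_of_powFun {z₀ : ℂ} (hz : z₀ ∈ cwedge c) {E : Type*}
    [SeminormedAddCommGroup E] {F : ℂ → E} {M : ℝ} (hM : 0 ≤ M) (k : ℕ)
    (hF : ∀ z ∈ cwedge c, ‖F z‖ ≤ M * powFun α β ‖z‖ ^ k) :
    ∃ M', ∀ᶠ z in 𝓝 z₀, ‖F z‖ ≤ M' := by
  have h0 : ‖z₀‖ ≠ 0 := norm_ne_zero_iff.2 (ne_zero_of_mem_cwedge hz)
  have hc : ContinuousAt (fun z : ℂ => M * (‖z‖ ^ (-α) + ‖z‖ ^ (-β)) ^ k) z₀ := by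
    refine continuousAt_const.mul (ContinuousAt.pow ?_ k)
    exact (continuous_norm.continuousAt.rpow_const (Or.inl h0)).add
      (continuous_norm.continuousAt.rpow_const (Or.inl h0))
  refine ⟨M * (‖z₀‖ ^ (-α) + ‖z₀‖ ^ (-β)) ^ k + 1, ?_⟩
  filter_upwards [hc.eventually_lt continuousAt_const (lt_add_one _),
    (isOpen_cwedge c).mem_nhds hz] with z h1 h2
  refine (hF z h2).trans (le_trans ?_ h1.le)
  gcongr
  · exact powFun_nonneg (norm_nonneg z)
  · exact powFun_le (norm_nonneg z)

/-- A locally bounded difference quotient suffices for continuity. Together with the next lemma this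
is a bootstrap: bounds give continuity of the resolvents, hence of the quotient, hence
differentiability. -/
theorem continuousAt_of_eq_mul_leftMul (hX : ∃ M, ∀ᶠ z in 𝓝 z₀, ‖X z‖ ≤ M)
    (h : ∀ᶠ z in 𝓝 z₀, F z - F z₀ = X z * leftMul (sl hJ (z - z₀))) : ContinuousAt F z₀ := by
  obtain ⟨M, hM⟩ := hX
  rw [ContinuousAt, tendsto_iff_norm_sub_tendsto_zero]
  have h1 : Tendsto (fun z : ℂ => M * ‖z - z₀‖) (𝓝 z₀) (𝓝 0) := by
    have : ContinuousAt (fun z : ℂ => M * ‖z - z₀‖) z₀ := by fun_prop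
    simpa [ContinuousAt] using this
  refine squeeze_zero' (Eventually.of_forall fun _ => norm_nonneg _) ?_ h1
  filter_upwards [hM, h] with z h2 h3
  rw [h3, norm_mul_leftMul, norm_sl]
  gcongr

/-- The derivative is `w ↦ X(z₀) w`, with `w` acting through the slice from the right, and this form
is the Cauchy-Riemann equation. -/
theorem hasCR_of_eq_mul_leftMul (hX : ContinuousAt X z₀)
    (h : ∀ᶠ z in 𝓝 z₀, F z - F z₀ = X z * leftMul (sl hJ (z - z₀))) : HasCR hJ F z₀ := by
  refine ⟨((ContinuousLinearMap.mul ℝ (V →L[ℝ] V)) (X z₀)).comp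
    ((ContinuousLinearMap.lsmul ℝ ℍ[ℝ]).comp (slL hJ)), ?_, ?_⟩
  · refine HasFDerivAt.of_isLittleO ?_
    have e : ∀ w : ℂ, (((ContinuousLinearMap.mul ℝ (V →L[ℝ] V)) (X z₀)).comp
      ((ContinuousLinearMap.lsmul ℝ ℍ[ℝ]).comp (slL hJ))) w = X z₀ * leftMul (sl hJ w) :=
      fun w => rfl
    rw [Asymptotics.isLittleO_iff]
    intro ε hε
    have h1 := Metric.continuousAt_iff'.1 hX ε hε
    filter_upwards [h1, h] with z h2 h3
    rw [h3, e, ← sub_mul, norm_mul_leftMul, norm_sl]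
    gcongr
    rw [← dist_eq_norm]
    exact h2.le
  · have e : ∀ w : ℂ, (((ContinuousLinearMap.mul ℝ (V →L[ℝ] V)) (X z₀)).comp
      ((ContinuousLinearMap.lsmul ℝ ℍ[ℝ]).comp (slL hJ))) w = X z₀ * leftMul (sl hJ w) :=
      fun w => rfl
    rw [e, e, map_one, leftMul_one, mul_one]

theorem continuousAt_leftMul_sub (B C : V →L[ℝ] V) (z₁ : ℂ) :
    ContinuousAt (fun z => B + C * leftMul (sl hJ (z - z₁))) z₀ := by
  have := (continuous_leftMul (V := V)).comp (continuous_sl hJ)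
  refine continuousAt_const.add (continuousAt_const.mul ?_)
  exact (this.comp (continuous_id.sub continuous_const)).continuousAt

theorem eventually_norm_mul_le {A : ℂ → V →L[ℝ] V} {N : ℝ} (hA : ∀ᶠ z in 𝓝 z₀, ‖A z‖ ≤ N)
    (hF : ContinuousAt F z₀) : ∃ M, ∀ᶠ z in 𝓝 z₀, ‖A z * F z‖ ≤ M := by
  refine ⟨N * (‖F z₀‖ + 1), ?_⟩
  filter_upwards [hA, hF.norm.eventually_lt continuousAt_const (lt_add_one _)] with z h1 h2
  exact (norm_mul_le _ _).trans (mul_le_mul h1 h2.le (norm_nonneg _) ((norm_nonneg _).trans h1))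

variable (h : HasBound T D α β c) (hz : z₀ ∈ cwedge c)
include h hz

theorem HasBound.eventually_mem : ∀ᶠ z in 𝓝 z₀, z ∈ cwedge c ∧ sl hJ z ∈ rhoF T D := by
  filter_upwards [(isOpen_cwedge c).mem_nhds hz] with z hz'
  exact ⟨hz', h.mem _ ((sl_mem_wedge hJ).2 hz')⟩

theorem HasBound.continuousAt_Qinv : ContinuousAt (fun z => Qinv T D (sl hJ z)) z₀ := by
  obtain ⟨M, hM, hb⟩ := h.boundedBy
  obtain ⟨N, hN⟩ := eventually_norm_le_of_powFun (α := α) (β := β)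
    (F := fun z => Qinv T D (sl hJ z)) hz hM 2 fun z hz' => by
      rw [← norm_sl hJ z]
      exact (hb _ ((sl_mem_wedge hJ).2 hz')).Qinv_le
  obtain ⟨L, hL⟩ := eventually_norm_mul_le hN (continuousAt_leftMul_sub hJ
    ((2 : ℝ) • scalarQ T D (sl hJ z₀)) (Qinv T D (sl hJ z₀)) z₀)
  refine continuousAt_of_eq_mul_leftMul hJ (X := fun z => -(Qinv T D (sl hJ z) *
    ((2 : ℝ) • scalarQ T D (sl hJ z₀) + Qinv T D (sl hJ z₀) * leftMul (sl hJ (z - z₀)))))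
    ⟨L, ?_⟩ ?_
  · simpa only [norm_neg] using hL
  · filter_upwards [h.eventually_mem hJ hz] with z h1
    rw [map_sub]
    exact h.adm.Qinv_sub (h.mem _ ((sl_mem_wedge hJ).2 hz)) h1.2 (commute_sl hJ _ _)

theorem HasBound.eventually_SL_sub : ∀ᶠ z in 𝓝 z₀,
    SL T D (sl hJ z) - SL T D (sl hJ z₀) = (Qinv T D (sl hJ z₀) - SL T D (sl hJ z) *
      ((2 : ℝ) • scalarQ T D (sl hJ z₀) + Qinv T D (sl hJ z₀) * leftMul (sl hJ (z - z₀)))) *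
        leftMul (sl hJ (z - z₀)) := by
  filter_upwards [h.eventually_mem hJ hz] with z h1
  rw [map_sub]
  exact h.adm.SL_sub (h.mem _ ((sl_mem_wedge hJ).2 hz)) h1.2 (commute_sl hJ _ _)

theorem HasBound.continuousAt_SL : ContinuousAt (fun z => SL T D (sl hJ z)) z₀ := by
  obtain ⟨M, hM, hb⟩ := h.boundedBy
  obtain ⟨N, hN⟩ := eventually_norm_le_of_powFun (α := α) (β := β)
    (F := fun z => SL T D (sl hJ z)) hz hM 1 fun z hz' => by
      rw [← norm_sl hJ z, pow_one]
      exact (hb _ ((sl_mem_wedge hJ).2 hz')).SL_le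
  obtain ⟨L, hL⟩ := eventually_norm_mul_le hN (continuousAt_leftMul_sub hJ
    ((2 : ℝ) • scalarQ T D (sl hJ z₀)) (Qinv T D (sl hJ z₀)) z₀)
  refine continuousAt_of_eq_mul_leftMul hJ ⟨‖Qinv T D (sl hJ z₀)‖ + L, ?_⟩
    (h.eventually_SL_sub hJ hz)
  filter_upwards [hL] with z h1
  exact (norm_sub_le _ _).trans (by gcongr)

theorem HasBound.hasCR_SL : HasCR hJ (fun z => SL T D (sl hJ z)) z₀ :=
  hasCR_of_eq_mul_leftMul hJ (continuousAt_const.sub ((h.continuousAt_SL hJ hz).mul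
    (continuousAt_leftMul_sub hJ _ _ z₀))) (h.eventually_SL_sub hJ hz)

theorem HasBound.continuousAt_SL_conj : ContinuousAt (fun z => SL (conj T) D (sl hJ z)) z₀ :=
  h.conj_bound.continuousAt_SL hJ hz

theorem HasBound.continuousAt_scalarQ : ContinuousAt (fun z => scalarQ T D (sl hJ z)) z₀ :=
  ContinuousAt.const_smul ((h.continuousAt_SL hJ hz).add (h.continuousAt_SL_conj hJ hz)) (2⁻¹ : ℝ)

end Continuity

/-! ### Absolute convergence of all integrals from the defining ones. -/

section Convergence

open Complex Set Filter Topology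

/-- The standing data for the relations between the functional calculi: `g` represents the
regularizer, and all integrals of `g(z) z^k`, `k ≤ n`, are under control. -/
structure RegData {J : ℍ[ℝ]} (hJ : J ∈ imSphere) (T : V →ₗ.[ℝ] V) (D : Submodule ℝ V)
    (α β c θ φ : ℝ) (n : ℕ) (g : ℂ → ℂ) : Prop where
  bd : HasBound T D α β c
  third_le : 1 / 3 ≤ α
  beta_pos : 0 < β
  le_third : β ≤ 1 / 3
  cos_lt : Real.cos φ < c
  angle : φ ∈ Ioo 0 θ
  le_pi : θ ≤ Real.pi
  diff : ∀ z ∈ csec θ, DifferentiableAt ℂ g z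
  map_conj : ∀ z ∈ csec θ, g ((starRingEnd ℂ) z) = (starRingEnd ℂ) (g z)
  small : ∃ δ > 0, ∃ C ≥ 0, ∀ z ∈ csec θ, ‖z‖ ≤ 1 → ‖g z‖ ≤ C * ‖z‖ ^ (3 * α - 1 + δ)
  large : ∃ δ > 0, ∃ C ≥ 0, ∀ z ∈ csec θ, 1 ≤ ‖z‖ → ‖g z * z ^ n‖ ≤ C * ‖z‖ ^ (3 * β - 1 - δ)
  conv : LineConv hJ φ (mulFun hJ (SL T D) g)
  conv_conj : LineConv hJ φ (mulFun hJ (SL (conj T) D) g)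
  conv_mul : LineConv hJ φ (mulFun hJ (SL T D) fun z => g z * z ^ n)
  conv_conj_mul : LineConv hJ φ (mulFun hJ (SL (conj T) D) fun z => g z * z ^ n)

variable {T : V →ₗ.[ℝ] V} {D : Submodule ℝ V} {α β c θ φ : ℝ} {J : ℍ[ℝ]} {hJ : J ∈ imSphere}
  {n : ℕ} {g : ℂ → ℂ} (R : RegData hJ T D α β c θ φ n g)
include R

theorem RegData.mem_wedge {t : ℝ} (ht : t ≠ 0) : gammaC φ t ∈ cwedge c :=
  gammaC_mem_cwedge R.cos_lt ht

theorem RegData.sl_mem {t : ℝ} (ht : t ≠ 0) : sl hJ (gammaC φ t) ∈ wedge c :=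
  (sl_mem_wedge hJ).2 (R.mem_wedge ht)

theorem RegData.mem_csec {t : ℝ} (ht : t ≠ 0) : gammaC φ t ∈ csec θ :=
  gammaC_mem_csec R.angle.1.le (R.angle.2.le.trans R.le_pi) R.angle.2 ht

theorem RegData.continuousAt_mulFun {K : ℍ[ℝ] → V →L[ℝ] V} {t : ℝ} (ht : t ≠ 0)
    (hK : ContinuousAt (fun z => K (sl hJ z)) (gammaC φ t)) (k : ℕ) :
    ContinuousAt (mulFun hJ K fun z => g z * z ^ k) (gammaC φ t) := by
  refine hK.mul (continuous_leftMul.continuousAt.comp ((continuous_sl hJ).continuousAt.comp ?_))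
  exact (R.diff _ (R.mem_csec ht)).continuousAt.mul (continuousAt_id.pow k)

-- Intermediate powers are dominated by the extreme ones, by `z^0` inside the unit disc and by `z^n`
-- outside. Hence only the integrals named in the definition of a regularizer have to be assumed to
-- converge.
omit R in
theorem norm_mul_pow_le {k n : ℕ} (hk : k ≤ n) (w z : ℂ) :
    ‖w * z ^ k‖ ≤ ‖w‖ + ‖w * z ^ n‖ := by
  rw [norm_mul, norm_mul, norm_pow, norm_pow]
  have hw := norm_nonneg w
  rcases le_total ‖z‖ 1 with h | h
  · have h1 : ‖z‖ ^ k ≤ 1 := pow_le_one₀ (norm_nonneg z) h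
    have h2 : 0 ≤ ‖w‖ * ‖z‖ ^ n := by positivity
    nlinarith
  · have h1 : ‖z‖ ^ k ≤ ‖z‖ ^ n := pow_le_pow_right₀ h hk
    nlinarith

theorem RegData.conv_SL {k : ℕ} (hk : k ≤ n) :
    LineConv hJ φ (mulFun hJ (SL T D) fun z => g z * z ^ k) := by
  refine lineConv_of_norm_le hJ (fun t ht => R.continuousAt_mulFun ht
    (R.bd.continuousAt_SL hJ (R.mem_wedge ht)) k) R.conv R.conv_mul (C := 1) fun t ht => ?_
  rw [norm_mulFun, norm_mulFun, norm_mulFun, one_mul, ← mul_add]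
  exact mul_le_mul_of_nonneg_left (norm_mul_pow_le hk _ _) (norm_nonneg _)

theorem RegData.conv_SL_conj {k : ℕ} (hk : k ≤ n) :
    LineConv hJ φ (mulFun hJ (SL (conj T) D) fun z => g z * z ^ k) := by
  refine lineConv_of_norm_le hJ (fun t ht => R.continuousAt_mulFun ht
    (R.bd.continuousAt_SL_conj hJ (R.mem_wedge ht)) k) R.conv_conj R.conv_conj_mul (C := 1)
    fun t ht => ?_
  rw [norm_mulFun, norm_mulFun, norm_mulFun, one_mul, ← mul_add]
  exact mul_le_mul_of_nonneg_left (norm_mul_pow_le hk _ _) (norm_nonneg _)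

/-- Near zero, `|s|^(-3α)` against `|s|^(3α-1+δ)` is integrable, so three resolvent factors are
admissible. At infinity the decay of `g z^n` may be too weak for a single resolvent, and the kernel
is compared with the two `S`-resolvents, whose integrals converge by assumption. -/
theorem RegData.conv_of_bound {K : ℍ[ℝ] → V →L[ℝ] V} {M : ℝ} (hM : 0 ≤ M)
    (hc : ∀ z ∈ cwedge c, ContinuousAt (fun z => K (sl hJ z)) z)
    (hsmall : ∀ s ∈ wedge c, ‖s‖ ≤ 1 → ‖K s‖ ≤ M * powFun α β ‖s‖ ^ 3)
    (hlarge : ∀ s ∈ wedge c, 1 < ‖s‖ → ‖K s‖ ≤ M * (‖SL T D s‖ + ‖SL (conj T) D s‖))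
    {k : ℕ} (hk : k ≤ n) : LineConv hJ φ (mulFun hJ K fun z => g z * z ^ k) := by
  obtain ⟨δ, hδ, C, hC, hb⟩ := R.small
  have hi : Integrable fun t => M * C * decayFun δ t +
      M * (‖lineIntegrand hJ φ (mulFun hJ (SL T D) fun z => g z * z ^ k) t‖ +
        ‖lineIntegrand hJ φ (mulFun hJ (SL (conj T) D) fun z => g z * z ^ k) t‖) :=
    ((integrable_decayFun hδ).const_mul _).add
      (((Integrable.norm (R.conv_SL hk)).add (Integrable.norm (R.conv_SL_conj hk))).const_mul M)
  refine lineConv_of_le hJ (fun t ht => R.continuousAt_mulFun ht (hc _ (R.mem_wedge ht)) k) hi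
    fun t ht => ?_
  rw [norm_lineIntegrand, norm_lineIntegrand, norm_mulFun, norm_mulFun, norm_mulFun]
  set z := gammaC φ t with hz
  have hn : ‖sl hJ z‖ = |t| := by rw [norm_sl, hz, norm_gammaC]
  have hn' : ‖z‖ = |t| := norm_gammaC φ t
  have h0 : 0 < |t| := abs_pos.2 ht
  have hg0 := norm_nonneg (g z * z ^ k)
  have hd : 0 ≤ decayFun δ t := by
    rw [decayFun]
    split_ifs <;> positivity
  rcases le_or_gt |t| 1 with h | h
  · have h1 := hsmall _ (R.sl_mem ht) (hn.trans_le h)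
    have h2 := hb _ (R.mem_csec ht) (hn'.trans_le h)
    have h3 : ‖g z * z ^ k‖ ≤ ‖g z‖ := by
      rw [norm_mul, norm_pow, hn']
      exact mul_le_of_le_one_right (norm_nonneg _) (pow_le_one₀ h0.le h)
    rw [hn, powFun, if_pos h] at h1
    rw [hn'] at h2
    have h4 : ‖K (sl hJ z)‖ * ‖g z * z ^ k‖ ≤ M * C * decayFun δ t := by
      calc ‖K (sl hJ z)‖ * ‖g z * z ^ k‖ ≤
          (M * (|t| ^ (-α)) ^ 3) * (C * |t| ^ (3 * α - 1 + δ)) :=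
            mul_le_mul h1 (h3.trans h2) hg0 (by positivity)
        _ = M * C * (|t| ^ (-α * (3 : ℕ)) * |t| ^ (3 * α - 1 + δ)) := by
            rw [Real.rpow_mul_natCast h0.le]
            ring
        _ = M * C * decayFun δ t := by
            rw [decayFun, if_pos h, ← Real.rpow_add h0]
            congr 2
            push_cast
            ring
    refine h4.trans (le_add_of_nonneg_right ?_)
    positivity
  · have h1 := hlarge _ (R.sl_mem ht) (by rwa [hn])
    have h2 := mul_le_mul_of_nonneg_right h1 hg0
    have h3 : 0 ≤ M * C * decayFun δ t := by positivity
    refine h2.trans ?_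
    nlinarith

omit R in
theorem one_le_powFun (hα : 0 ≤ α) {r : ℝ} (hr : 0 < r) (hr1 : r ≤ 1) : 1 ≤ powFun α β r := by
  rw [powFun, if_pos hr1]
  exact Real.one_le_rpow_of_pos_of_le_one_of_nonpos hr hr1 (neg_nonpos.2 hα)

theorem RegData.alpha_nonneg : 0 ≤ α := by linarith [R.third_le]

theorem RegData.conv_Qinv {k : ℕ} (hk : k ≤ n) :
    LineConv hJ φ (mulFun hJ (Qinv T D) fun z => g z * z ^ k) := by
  obtain ⟨M, hM, hb⟩ := R.bd.boundedBy
  refine R.conv_of_bound hM (fun z hz => R.bd.continuousAt_Qinv hJ hz) (fun s hs h1 => ?_)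
    (fun s hs h1 => ?_) hk
  · have h2 := one_le_powFun (β := β) R.alpha_nonneg (norm_pos_iff.2 (ne_zero_of_mem_wedge hs)) h1
    refine (hb s hs).Qinv_le.trans ?_
    gcongr ?_ * ?_
    exact pow_le_pow_right₀ h2 (by norm_num)
  · refine (hb s hs).Qinv_le'.trans ?_
    have h2 := powFun_le_one (α := α) R.beta_pos.le h1.le
    gcongr
    exact mul_le_of_le_one_right hM h2

/-- Near zero one factor `S_L⁻¹` leaves room for two more, whence `j ≤ 2`; at infinity the bound
makes `K` bounded, and `S_L⁻¹` alone dominates. -/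
theorem RegData.conv_SL_mul {K : ℍ[ℝ] → V →L[ℝ] V} {M : ℝ} (hM : 0 ≤ M) {j : ℕ} (hj : j ≤ 2)
    (hc : ∀ z ∈ cwedge c, ContinuousAt (fun z => K (sl hJ z)) z)
    (hK : ∀ s ∈ wedge c, ‖K s‖ ≤ M * powFun α β ‖s‖ ^ j) {k : ℕ} (hk : k ≤ n) :
    LineConv hJ φ (mulFun hJ (fun s => SL T D s * K s) fun z => g z * z ^ k) := by
  obtain ⟨N, hN, hb⟩ := R.bd.boundedBy
  refine R.conv_of_bound (M := N * M + M) (by positivity)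
    (fun z hz => (R.bd.continuousAt_SL hJ hz).mul (hc z hz)) (fun s hs h1 => ?_)
    (fun s hs h1 => ?_) hk
  · have h2 := one_le_powFun (β := β) R.alpha_nonneg (norm_pos_iff.2 (ne_zero_of_mem_wedge hs)) h1
    have h3 : 0 ≤ powFun α β ‖s‖ := zero_le_one.trans h2
    calc ‖SL T D s * K s‖ ≤ (N * powFun α β ‖s‖) * (M * powFun α β ‖s‖ ^ j) :=
          (norm_mul_le _ _).trans (mul_le_mul (hb s hs).SL_le (hK s hs) (norm_nonneg _)
            (by positivity))
      _ = N * M * powFun α β ‖s‖ ^ (j + 1) := by ring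
      _ ≤ (N * M + M) * powFun α β ‖s‖ ^ 3 := by
          have h4 := pow_le_pow_right₀ h2 (show j + 1 ≤ 3 by omega)
          gcongr ?_ * ?_
          linarith
  · have h2 := powFun_le_one (α := α) R.beta_pos.le h1.le
    have h3 : 0 ≤ powFun α β ‖s‖ := powFun_nonneg (norm_nonneg s)
    have h4 : ‖K s‖ ≤ M := (hK s hs).trans (mul_le_of_le_one_right hM (pow_le_one₀ h3 h2))
    have h5 : 0 ≤ N * M * (‖SL T D s‖ + ‖SL (conj T) D s‖) := by positivity
    have h6 : 0 ≤ M * ‖SL (conj T) D s‖ := by positivity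
    refine (norm_mul_le _ _).trans ?_
    have := mul_le_mul_of_nonneg_left h4 (norm_nonneg (SL T D s))
    nlinarith

theorem RegData.conv_SL_scalarQ {k : ℕ} (hk : k ≤ n) :
    LineConv hJ φ (mulFun hJ (fun s => SL T D s * scalarQ T D s) fun z => g z * z ^ k) := by
  obtain ⟨M, hM, hb⟩ := R.bd.boundedBy
  refine R.conv_SL_mul hM (j := 1) (by norm_num) (fun z hz => R.bd.continuousAt_scalarQ hJ hz)
    (fun s hs => ?_) hk
  rw [pow_one]
  exact (hb s hs).scalarQ_le

theorem RegData.conv_SL_Qinv {k : ℕ} (hk : k ≤ n) :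
    LineConv hJ φ (mulFun hJ (fun s => SL T D s * Qinv T D s) fun z => g z * z ^ k) := by
  obtain ⟨M, hM, hb⟩ := R.bd.boundedBy
  exact R.conv_SL_mul hM (j := 2) le_rfl (fun z hz => R.bd.continuousAt_Qinv hJ hz)
    (fun s hs => (hb s hs).Qinv_le) hk

omit R in
theorem mulFun_smul (c : ℝ) {K : ℍ[ℝ] → V →L[ℝ] V} (g : ℂ → ℂ) :
    mulFun hJ (fun s => c • K s) g = fun z => c • mulFun hJ K g z := by
  ext1 z
  rw [mulFun, mulFun, smul_mul_assoc]

omit R in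
theorem LineConv.smul (c : ℝ) {F : ℂ → V →L[ℝ] V} (h : LineConv hJ φ F) :
    LineConv hJ φ fun z => c • F z := by
  refine (Integrable.smul c h).congr (Eventually.of_forall fun t => ?_)
  simp only [lineIntegrand, smul_mul_assoc, Pi.smul_apply]

omit R in
theorem P2L_eq : P2L T D = fun s => (4 : ℝ) • (SL T D s * scalarQ T D s) := by
  ext1 s
  rw [P2L, scalarQ, mul_smul_comm, smul_smul]
  norm_num

theorem RegData.conv_P2L {k : ℕ} (hk : k ≤ n) :
    LineConv hJ φ (mulFun hJ (P2L T D) fun z => g z * z ^ k) := by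
  rw [P2L_eq, mulFun_smul]
  exact (R.conv_SL_scalarQ hk).smul _

theorem RegData.conv_FL {k : ℕ} (hk : k ≤ n) :
    LineConv hJ φ (mulFun hJ (FL T D) fun z => g z * z ^ k) := by
  have : FL T D = fun s => (-4 : ℝ) • (SL T D s * Qinv T D s) := rfl
  rw [this, mulFun_smul]
  exact (R.conv_SL_Qinv hk).smul _

end Convergence

/-! ### A commutative algebra containing the integrals without imaginary units. -/

section CommutingAlgebra

open Complex Set Filter Topology

variable {T : V →ₗ.[ℝ] V} {D : Submodule ℝ V} {α β c θ φ : ℝ} {J : ℍ[ℝ]}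

/-- The operator `T_i Q_{c,s}(T)⁻¹`. -/
def tQ (T : V →ₗ.[ℝ] V) (D : Submodule ℝ V) (i : Fin 4) (s : ℍ[ℝ]) : V →L[ℝ] V :=
  if i = 0 then leftMul s * Qinv T D s - scalarQ T D s else compQ T D i s

theorem HasBound.tQ_apply (h : HasBound T D α β c) {s : ℍ[ℝ]} (hs : s ∈ wedge c) (i : Fin 4)
    (v : V) : tQ T D i s v = ap (component T i) (Qinv T D s v) := by
  rw [tQ]
  split_ifs with hi
  · rw [sub_apply, mul_apply_eq_comp, leftMul_apply, h.adm.scalarQ_apply (h.mem s hs), hi]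
    abel
  · exact h.adm.compQ_apply (h.mem s hs) (h.mem _ (basisUnit_conj_mem_wedge (by decide) hs))
      (h.mem _ (basisUnit_conj_mem_wedge (by decide) hs))
      (h.mem _ (basisUnit_conj_mem_wedge (by decide) hs)) hi v

theorem scalarQ_eq_sub (s : ℍ[ℝ]) :
    scalarQ T D s = leftMul s * Qinv T D s - tQ T D 0 s := by
  rw [tQ, if_pos rfl]
  abel

theorem HasBound.vectorQ_eq (h : HasBound T D α β c) {s : ℍ[ℝ]} (hs : s ∈ wedge c) :
    vectorQ T D s = leftMul (basisUnit 1) * tQ T D 1 s + leftMul (basisUnit 2) * tQ T D 2 s +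
      leftMul (basisUnit 3) * tQ T D 3 s := by
  ext v
  simp only [h.adm.vectorQ_apply (h.mem s hs), vec, add_apply, mul_apply_eq_comp, leftMul_apply,
    h.tQ_apply hs]

/-- Symmetry of a kernel with respect to left multiplications. -/
def IsSym (c : ℝ) (K : ℍ[ℝ] → V →L[ℝ] V) : Prop :=
  ∀ s ∈ wedge c, ∀ p ∈ wedge c, ∀ a, a * s = p * a → leftMul a * K s = K p * leftMul a

theorem IsSym.mul {K L : ℍ[ℝ] → V →L[ℝ] V} (hK : IsSym c K) (hL : IsSym c L) :
    IsSym c fun s => K s * L s := fun s hs p hp a ha => by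
  rw [← mul_assoc, hK s hs p hp a ha, mul_assoc, hL s hs p hp a ha, mul_assoc]

theorem HasBound.isSym_Qinv (h : HasBound T D α β c) : IsSym c (Qinv T D) :=
  fun s hs p hp _ ha => h.adm.leftMul_Qinv (h.mem s hs) (h.mem p hp) ha

theorem HasBound.isSym_tQ (h : HasBound T D α β c) (i : Fin 4) : IsSym c (tQ T D i) :=
  fun s hs p hp a ha => by
    ext v
    have := congrArg (fun B : V →L[ℝ] V => B v) (h.isSym_Qinv s hs p hp a ha)
    simp only [mul_apply_eq_comp, leftMul_apply] at this
    rw [mul_apply_eq_comp, mul_apply_eq_comp, h.tQ_apply hs, h.tQ_apply hp, leftMul_apply,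
      leftMul_apply, ← this,
      component_smul h.adm.kc.twoSided i a (h.adm.mem_dom (h.adm.Qinv_mem (h.mem s hs) v))]

theorem HasBound.isSym_scalarQ (h : HasBound T D α β c) : IsSym c (scalarQ T D) :=
  fun s hs p hp a ha => by
    rw [scalarQ_eq_sub, scalarQ_eq_sub, mul_sub, sub_mul, h.isSym_tQ 0 s hs p hp a ha,
      ← mul_assoc, ← leftMul_mul, ha, leftMul_mul, mul_assoc, h.isSym_Qinv s hs p hp a ha,
      mul_assoc]

theorem isSym_const_one : IsSym c (fun _ => (1 : V →L[ℝ] V)) := fun _ _ _ _ _ _ => by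
  rw [mul_one, one_mul]

theorem isSym_const {A : V →L[ℝ] V} (hA : ∀ a, leftMul a * A = A * leftMul a) :
    IsSym c (fun _ => A) := fun s _ p _ a _ => hA a

theorem HasBound.tQ_mul_Qinv (h : HasBound T D α β c) {s p : ℍ[ℝ]} (hs : s ∈ wedge c)
    (hp : p ∈ wedge c) (hsp : Commute s p) (i : Fin 4) :
    tQ T D i s * Qinv T D p = Qinv T D p * tQ T D i s := by
  have hc := h.adm.Qinv_comm (h.mem s hs) (h.mem p hp) hsp
  ext v
  have := congrArg (fun B : V →L[ℝ] V => B v) hc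
  simp only [mul_apply_eq_comp] at this
  rw [mul_apply_eq_comp, mul_apply_eq_comp, h.tQ_apply hs, h.tQ_apply hs, this,
    (h.adm.component_Qinv (h.mem p hp) i (h.adm.mem_dom (h.adm.Qinv_mem (h.mem s hs) v))).2]

theorem HasBound.tQ_mul_tQ (h : HasBound T D α β c) {s p : ℍ[ℝ]} (hs : s ∈ wedge c)
    (hp : p ∈ wedge c) (i j : Fin 4) :
    tQ T D i s * tQ T D j p = tQ T D j s * tQ T D i p := by
  ext v
  have hq := h.adm.Qinv_mem (h.mem p hp) v
  have e : ∀ i, Qinv T D s (ap (component T i) (Qinv T D p v)) =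
      ap (component T i) (Qinv T D s (Qinv T D p v)) := fun i =>
    (h.adm.component_Qinv (h.mem s hs) i (h.adm.mem_dom hq)).2.symm
  rw [mul_apply_eq_comp, mul_apply_eq_comp, h.tQ_apply hs, h.tQ_apply hs, h.tQ_apply hp,
    h.tQ_apply hp, e, e, h.adm.component_comm (h.adm.Qinv_mem (h.mem s hs) _)]

theorem HasBound.tQ_mul_tQ' (h : HasBound T D α β c) {s p : ℍ[ℝ]} (hs : s ∈ wedge c)
    (hp : p ∈ wedge c) (hsp : Commute s p) (i j : Fin 4) :
    tQ T D i s * tQ T D j p = tQ T D i p * tQ T D j s := by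
  ext v
  have hc := congrArg (fun B : V →L[ℝ] V => B v) (h.adm.Qinv_comm (h.mem s hs) (h.mem p hp) hsp)
  simp only [mul_apply_eq_comp] at hc
  have e : ∀ s ∈ wedge c, ∀ p ∈ wedge c, Qinv T D s (ap (component T j) (Qinv T D p v)) =
      ap (component T j) (Qinv T D s (Qinv T D p v)) := fun s hs p hp =>
    (h.adm.component_Qinv (h.mem s hs) j (h.adm.mem_dom (h.adm.Qinv_mem (h.mem p hp) v))).2.symm
  rw [mul_apply_eq_comp, mul_apply_eq_comp, h.tQ_apply hs, h.tQ_apply hp, h.tQ_apply hs,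
    h.tQ_apply hp, e s hs p hp, e p hp s hs, hc]

/-- The generators of the resolvents in the plane `ℂ_J`. -/
def gens (hJ : J ∈ imSphere) (T : V →ₗ.[ℝ] V) (D : Submodule ℝ V) (c : ℝ) : Set (V →L[ℝ] V) :=
  {A | (∃ z, A = leftMul (sl hJ z)) ∨ (∃ z ∈ cwedge c, A = Qinv T D (sl hJ z)) ∨
    ∃ z ∈ cwedge c, ∃ i, A = tQ T D i (sl hJ z)}

/-- The operators that commute with the generators, with all left multiplications, and with
everything that commutes with these. -/
def commAlg (hJ : J ∈ imSphere) (T : V →ₗ.[ℝ] V) (D : Submodule ℝ V) (c : ℝ) :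
    Subalgebra ℝ (V →L[ℝ] V) :=
  Subalgebra.centralizer ℝ (gens hJ T D c ∪ range leftMul) ⊓
    Subalgebra.centralizer ℝ
      (Subalgebra.centralizer ℝ (gens hJ T D c ∪ range leftMul) : Set (V →L[ℝ] V))

variable {hJ : J ∈ imSphere}

theorem commute_of_mem_commAlg {A B : V →L[ℝ] V} (hA : A ∈ commAlg hJ T D c)
    (hB : B ∈ commAlg hJ T D c) : Commute A B :=
  (Subalgebra.mem_centralizer_iff ℝ).1 hB.2 A hA.1

theorem commute_leftMul_of_mem {A : V →L[ℝ] V} (hA : A ∈ commAlg hJ T D c) (a : ℍ[ℝ]) :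
    Commute (leftMul a) A :=
  (Subalgebra.mem_centralizer_iff ℝ).1 hA.1 _ (Or.inr ⟨a, rfl⟩)

/-- Points of one slice commute with each other, which is all that the resolvent relations require.
This is why the generators are restricted to `ℂ_J`. -/
theorem HasBound.gens_commute (h : HasBound T D α β c) {A B : V →L[ℝ] V}
    (hA : A ∈ gens hJ T D c) (hB : B ∈ gens hJ T D c) : A * B = B * A := by
  have hw : ∀ z ∈ cwedge c, sl hJ z ∈ wedge c := fun z hz => (sl_mem_wedge hJ).2 hz
  rcases hA with ⟨z, rfl⟩ | ⟨z, hz, rfl⟩ | ⟨z, hz, i, rfl⟩ <;>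
    rcases hB with ⟨w, rfl⟩ | ⟨w, hw', rfl⟩ | ⟨w, hw', j, rfl⟩
  · rw [← leftMul_mul, (commute_sl hJ z w).eq, leftMul_mul]
  · exact h.isSym_Qinv _ (hw w hw') _ (hw w hw') _ (commute_sl hJ z w).eq
  · exact h.isSym_tQ j _ (hw w hw') _ (hw w hw') _ (commute_sl hJ z w).eq
  · exact (h.isSym_Qinv _ (hw z hz) _ (hw z hz) _ (commute_sl hJ w z).eq).symm
  · exact h.adm.Qinv_comm (h.mem _ (hw z hz)) (h.mem _ (hw w hw')) (commute_sl hJ z w)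
  · exact (h.tQ_mul_Qinv (hw w hw') (hw z hz) (commute_sl hJ w z) j).symm
  · exact (h.isSym_tQ i _ (hw z hz) _ (hw z hz) _ (commute_sl hJ w z).eq).symm
  · exact h.tQ_mul_Qinv (hw z hz) (hw w hw') (commute_sl hJ z w) i
  -- First the two component indices are exchanged, then the two points.
  · rw [h.tQ_mul_tQ (hw z hz) (hw w hw'),
      h.tQ_mul_tQ' (hw z hz) (hw w hw') (commute_sl hJ z w)]

/-- The values of a kernel belong to the algebra generated by the resolvents. -/
def InGens (hJ : J ∈ imSphere) (T : V →ₗ.[ℝ] V) (D : Submodule ℝ V) (c : ℝ)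
    (K : ℍ[ℝ] → V →L[ℝ] V) : Prop :=
  ∀ z ∈ cwedge c, K (sl hJ z) ∈ Algebra.adjoin ℝ (gens hJ T D c)

theorem inGens_Qinv : InGens hJ T D c (Qinv T D) := fun z hz =>
  Algebra.subset_adjoin (Or.inr (Or.inl ⟨z, hz, rfl⟩))

theorem inGens_tQ (i : Fin 4) : InGens hJ T D c (tQ T D i) := fun z hz =>
  Algebra.subset_adjoin (Or.inr (Or.inr ⟨z, hz, i, rfl⟩))

theorem leftMul_mem_adjoin_gens (z : ℂ) :
    leftMul (sl hJ z) ∈ Algebra.adjoin ℝ (gens hJ T D c) :=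
  Algebra.subset_adjoin (Or.inl ⟨z, rfl⟩)

theorem inGens_scalarQ : InGens hJ T D c (scalarQ T D) := fun z hz => by
  rw [scalarQ_eq_sub]
  exact sub_mem (mul_mem (leftMul_mem_adjoin_gens z) (inGens_Qinv z hz)) (inGens_tQ 0 z hz)

theorem InGens.mul {K L : ℍ[ℝ] → V →L[ℝ] V} (hK : InGens hJ T D c K) (hL : InGens hJ T D c L) :
    InGens hJ T D c fun s => K s * L s := fun z hz => mul_mem (hK z hz) (hL z hz)

theorem inGens_const {A : V →L[ℝ] V} (hA : A ∈ Algebra.adjoin ℝ (gens hJ T D c)) :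
    InGens hJ T D c (fun _ => A) := fun _ _ => hA

theorem HasBound.commute_adjoin (h : HasBound T D α β c) {A B : V →L[ℝ] V}
    (hA : A ∈ Algebra.adjoin ℝ (gens hJ T D c)) (hB : B ∈ Algebra.adjoin ℝ (gens hJ T D c)) :
    Commute A B :=
  Algebra.commute_of_mem_adjoin_of_forall_mem_commute hB fun _ hb =>
    (Algebra.commute_of_mem_adjoin_of_forall_mem_commute hA fun _ ha =>
      h.gens_commute hb ha).symm

theorem commute_adjoin_of_mem_centralizer {A X : V →L[ℝ] V}
    (hA : A ∈ Algebra.adjoin ℝ (gens hJ T D c))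
    (hX : X ∈ Subalgebra.centralizer ℝ (gens hJ T D c ∪ range leftMul)) : Commute X A :=
  Algebra.commute_of_mem_adjoin_of_forall_mem_commute hA fun b hb =>
    ((Subalgebra.mem_centralizer_iff ℝ).1 hX b (Or.inl hb)).symm

theorem HasBound.mem_commAlg (h : HasBound T D α β c) {A : V →L[ℝ] V}
    (hA : A ∈ Algebra.adjoin ℝ (gens hJ T D c)) (hA' : ∀ a, leftMul a * A = A * leftMul a) :
    A ∈ commAlg hJ T D c := by
  refine ⟨(Subalgebra.mem_centralizer_iff ℝ).2 ?_, (Subalgebra.mem_centralizer_iff ℝ).2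
    fun X hX => commute_adjoin_of_mem_centralizer hA hX⟩
  rintro _ (hB | ⟨a, rfl⟩)
  · exact h.commute_adjoin (Algebra.subset_adjoin hB) hA
  · exact hA' a

/-- The point `-1` of the complex plane. -/
theorem HasBound.neg_one_mem (h : HasBound T D α β c) : (-1 : ℂ) ∈ cwedge c := by
  rw [← sl_mem_wedge basisUnit_one_mem_imSphere, map_neg, map_one]
  exact neg_one_mem_wedge h.gt

theorem HasBound.value_neg_one_mem (h : HasBound T D α β c) {K : ℍ[ℝ] → V →L[ℝ] V}
    (hK : InGens hJ T D c K) : K (-1) ∈ Algebra.adjoin ℝ (gens hJ T D c) := by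
  have := hK (-1) h.neg_one_mem
  rwa [map_neg, map_one] at this

theorem HasBound.leftMul_comm_value (h : HasBound T D α β c) {K : ℍ[ℝ] → V →L[ℝ] V}
    (hs : IsSym c K) (a : ℍ[ℝ]) : leftMul a * K (-1) = K (-1) * leftMul a :=
  hs _ (neg_one_mem_wedge h.gt) _ (neg_one_mem_wedge h.gt) a (by simp)

theorem HasBound.value_mem_commAlg (h : HasBound T D α β c) {K : ℍ[ℝ] → V →L[ℝ] V}
    (hK : InGens hJ T D c K) (hs : IsSym c K) : K (-1) ∈ commAlg hJ T D c :=
  h.mem_commAlg (h.value_neg_one_mem hK) (h.leftMul_comm_value hs)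

/-- The normalized integral of `K(s) g(s) s^k`. -/
def nInt (hJ : J ∈ imSphere) (φ : ℝ) (K : ℍ[ℝ] → V →L[ℝ] V) (g : ℂ → ℂ) (k : ℕ) : V →L[ℝ] V :=
  (1 / (2 * Real.pi)) • lineInt hJ φ (mulFun hJ K fun z => g z * z ^ k)

variable {n : ℕ} {g : ℂ → ℂ} (R : RegData hJ T D α β c θ φ n g) {K : ℍ[ℝ] → V →L[ℝ] V}
include R

/-- The integrand lives in a commutative algebra attached to `ℂ_J`, and commutation relations pass
to the integral. Commutation with left multiplications outside `ℂ_J` holds for the whole integral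
only, not pointwise; it comes from the symmetry of the kernel and of `g` under conjugation. -/
theorem RegData.nInt_mem_commAlg (hs : IsSym c K) (hK : InGens hJ T D c K) {k : ℕ}
    (hc : LineConv hJ φ (mulFun hJ K fun z => g z * z ^ k)) :
    nInt hJ φ K g k ∈ commAlg hJ T D c := by
  refine Subalgebra.smul_mem _ ?_ _
  have hval : ∀ t ≠ 0, mulFun hJ K (fun z => g z * z ^ k) (gammaC φ t) ∈
      Algebra.adjoin ℝ (gens hJ T D c) := fun t ht =>
    mul_mem (hK _ (R.mem_wedge ht)) (leftMul_mem_adjoin_gens _)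
  refine ⟨(Subalgebra.mem_centralizer_iff ℝ).2 ?_, (Subalgebra.mem_centralizer_iff ℝ).2
    fun X hX => commute_lineInt hJ hc (fun z => ?_) fun t ht => ?_⟩
  · rintro _ (hB | ⟨a, rfl⟩)
    · have hB' := Algebra.subset_adjoin (R := ℝ) hB
      exact commute_lineInt hJ hc (fun z => R.bd.commute_adjoin hB' (leftMul_mem_adjoin_gens z))
        fun t ht => R.bd.commute_adjoin hB' (hval t ht)
    · refine commute_leftMul_lineInt hJ hc (fun t ht z => ?_) (fun t ht b hb => ?_) a
      · exact R.bd.commute_adjoin (leftMul_mem_adjoin_gens z) (hval t ht)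
      · have hz := R.mem_csec ht
        have hz' : (starRingEnd ℂ) (gammaC φ t) ∈ cwedge c := by
          rw [← gammaC_neg φ ht]
          exact R.mem_wedge (neg_ne_zero.2 ht)
        rw [mulFun, mulFun, ← mul_assoc, hs _ (R.sl_mem ht) _ ((sl_mem_wedge hJ).2 hz') b
          (anticomm_sl hJ hb _), mul_assoc, mul_assoc, ← leftMul_mul, ← leftMul_mul,
          anticomm_sl hJ hb, map_mul (starRingEnd ℂ), map_pow (starRingEnd ℂ), R.map_conj _ hz]
  · exact commute_adjoin_of_mem_centralizer (leftMul_mem_adjoin_gens z) hX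
  · exact commute_adjoin_of_mem_centralizer (hval t ht) hX

omit R in
theorem mulFun_const_mul (A : V →L[ℝ] V) (K : ℍ[ℝ] → V →L[ℝ] V) (g : ℂ → ℂ) :
    mulFun hJ (fun s => A * K s) g = fun z => A * mulFun hJ K g z := by
  ext1 z
  rw [mulFun, mulFun, mul_assoc]

omit R in
theorem mulFun_add (K L : ℍ[ℝ] → V →L[ℝ] V) (g : ℂ → ℂ) :
    mulFun hJ (fun s => K s + L s) g = mulFun hJ K g + mulFun hJ L g := by
  ext1 z
  rw [Pi.add_apply, mulFun, mulFun, mulFun, add_mul]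

omit R in
theorem nInt_const_mul (A : V →L[ℝ] V) {k : ℕ}
    (hc : LineConv hJ φ (mulFun hJ K fun z => g z * z ^ k)) :
    nInt hJ φ (fun s => A * K s) g k = A * nInt hJ φ K g k := by
  rw [nInt, mulFun_const_mul, lineInt_const_mul hJ A hc, nInt, mul_smul_comm]

omit R in
theorem conv_const_mul (A : V →L[ℝ] V) {g : ℂ → ℂ}
    (hc : LineConv hJ φ (mulFun hJ K g)) :
    LineConv hJ φ (mulFun hJ (fun s => A * K s) g) := by
  rw [mulFun_const_mul]
  exact hc.const_mul hJ A

omit R in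
theorem nInt_add {L : ℍ[ℝ] → V →L[ℝ] V} {k : ℕ}
    (hc : LineConv hJ φ (mulFun hJ K fun z => g z * z ^ k))
    (hc' : LineConv hJ φ (mulFun hJ L fun z => g z * z ^ k)) :
    nInt hJ φ (fun s => K s + L s) g k = nInt hJ φ K g k + nInt hJ φ L g k := by
  rw [nInt, mulFun_add, lineInt_add hJ hc hc', nInt, nInt, smul_add]

omit R in
theorem conv_add {L : ℍ[ℝ] → V →L[ℝ] V} {g : ℂ → ℂ}
    (hc : LineConv hJ φ (mulFun hJ K g)) (hc' : LineConv hJ φ (mulFun hJ L g)) :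
    LineConv hJ φ (mulFun hJ (fun s => K s + L s) g) := by
  rw [mulFun_add]
  exact hc.add hJ hc'

omit R in
theorem nInt_smul (r : ℝ) (k : ℕ) : nInt hJ φ (fun s => r • K s) g k = r • nInt hJ φ K g k := by
  rw [nInt, mulFun_smul, lineInt_smul, nInt, smul_comm]

theorem RegData.conv_congr {L : ℍ[ℝ] → V →L[ℝ] V} {g : ℂ → ℂ} (he : ∀ s ∈ wedge c, K s = L s)
    (hc : LineConv hJ φ (mulFun hJ K g)) : LineConv hJ φ (mulFun hJ L g) :=
  hc.congr hJ fun t ht => by rw [mulFun, mulFun, he _ (R.sl_mem ht)]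

theorem RegData.nInt_congr {L : ℍ[ℝ] → V →L[ℝ] V} (he : ∀ s ∈ wedge c, K s = L s) (k : ℕ) :
    nInt hJ φ K g k = nInt hJ φ L g k := by
  rw [nInt, nInt, lineInt_congr hJ fun t ht => ?_]
  rw [mulFun, mulFun, he _ (R.sl_mem ht)]

end CommutingAlgebra

/-! ### Integrals with imaginary units: commutation and linear relations. -/

section Relations

open Complex Set Filter Topology

variable {T : V →ₗ.[ℝ] V} {D : Submodule ℝ V} {α β c θ φ : ℝ} {J : ℍ[ℝ]} {hJ : J ∈ imSphere}
  {n : ℕ} {g : ℂ → ℂ}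

/-- The operator `T_i` is not bounded, but `T_i Q_{c,-1}(T)⁻¹` is. Factoring it out on the left
reduces continuity in `p` to that of the other resolvents. -/
theorem HasBound.tQ_eq (h : HasBound T D α β c) {p : ℍ[ℝ]} (hp : p ∈ wedge c) (i : Fin 4) :
    tQ T D i p = tQ T D i (-1) * (1 + ((2 : ℝ) • scalarQ T D p +
      Qinv T D p * leftMul (-1 - p)) * leftMul (-1 - p)) := by
  have h1 := neg_one_mem_wedge h.gt
  have hq := h.adm.Qinv_sub (h.mem p hp) (h.mem _ h1) (Commute.neg_one_right p)
  have hq' : Qinv T D p = Qinv T D (-1) * (1 + ((2 : ℝ) • scalarQ T D p +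
      Qinv T D p * leftMul (-1 - p)) * leftMul (-1 - p)) := by
    rw [mul_add, mul_one, ← mul_assoc, ← sub_eq_iff_eq_add', ← neg_sub, hq, neg_mul, neg_neg]
  ext v
  have := congrArg (fun B : V →L[ℝ] V => B v) hq'
  simp only [mul_apply_eq_comp] at this
  rw [mul_apply_eq_comp, h.tQ_apply hp, h.tQ_apply h1, this]

theorem HasBound.continuousAt_tQ (h : HasBound T D α β c) {z₀ : ℂ} (hz : z₀ ∈ cwedge c)
    (i : Fin 4) (hJ : J ∈ imSphere) : ContinuousAt (fun z => tQ T D i (sl hJ z)) z₀ := by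
  have hl : ContinuousAt (fun z => (leftMul (-1 - sl hJ z) : V →L[ℝ] V)) z₀ :=
    (continuous_leftMul.comp (continuous_const.sub (continuous_sl hJ))).continuousAt
  have hc : ContinuousAt (fun z => tQ T D i (-1) * (1 + ((2 : ℝ) • scalarQ T D (sl hJ z) +
      Qinv T D (sl hJ z) * leftMul (-1 - sl hJ z)) * leftMul (-1 - sl hJ z))) z₀ :=
    continuousAt_const.mul (continuousAt_const.add
      ((((h.continuousAt_scalarQ hJ hz).const_smul (2 : ℝ)).add
        ((h.continuousAt_Qinv hJ hz).mul hl)).mul hl))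
  refine hc.congr ?_
  filter_upwards [h.eventually_mem hJ hz] with z h1
  exact (h.tQ_eq ((sl_mem_wedge hJ).2 h1.1) i).symm

theorem HasBound.Qinv_injective (h : HasBound T D α β c) {A B : V →L[ℝ] V}
    (hAB : Qinv T D (-1) * A = Qinv T D (-1) * B) : A = B := by
  have h1 := h.mem _ (neg_one_mem_wedge h.gt)
  ext v
  have := congrArg (fun C : V →L[ℝ] V => quad T (-1) (C v)) hAB
  simpa only [mul_apply_eq_comp, h.adm.quad_Qinv h1] using this

/-- Operators `A` for which `Q_{c,-1}(T)⁻¹ A` has the form `M + (∑ e_k T_k Q_{c,-1}(T)⁻¹) N` with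
`M` and `N` in the commuting algebra. -/
def IsStrong (hJ : J ∈ imSphere) (T : V →ₗ.[ℝ] V) (D : Submodule ℝ V) (c : ℝ)
    (A : V →L[ℝ] V) : Prop :=
  Commute (Qinv T D (-1)) A ∧ ∃ M ∈ commAlg hJ T D c, ∃ N ∈ commAlg hJ T D c,
    Qinv T D (-1) * A = M + vectorQ T D (-1) * N

/-- Operators of the form `M₀ + ∑ e_k M_k`, where `M_k` is formally `T_k N`, with all `M_k` in the
commuting algebra. -/
def IsWeak (hJ : J ∈ imSphere) (T : V →ₗ.[ℝ] V) (D : Submodule ℝ V) (c : ℝ)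
    (A : V →L[ℝ] V) : Prop :=
  Commute (Qinv T D (-1)) A ∧ ∃ M ∈ commAlg hJ T D c, ∃ N : Fin 3 → V →L[ℝ] V,
    (∀ i, N i ∈ commAlg hJ T D c) ∧
    (∀ i j, tQ T D i.succ (-1) * N j = tQ T D j.succ (-1) * N i) ∧
    A = M + ∑ i, leftMul (basisUnit i.succ) * N i

theorem HasBound.vectorQ_eq_sum (h : HasBound T D α β c) {s : ℍ[ℝ]} (hs : s ∈ wedge c) :
    vectorQ T D s = ∑ i : Fin 3, leftMul (basisUnit i.succ) * tQ T D i.succ s := by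
  rw [h.vectorQ_eq hs, Fin.sum_univ_three]
  rfl

theorem HasBound.commute_tQ_of_mem (h : HasBound T D α β c) {A : V →L[ℝ] V}
    (hA : A ∈ commAlg hJ T D c) (i : Fin 4) : Commute (tQ T D i (-1)) A :=
  (commute_adjoin_of_mem_centralizer (h.value_neg_one_mem (inGens_tQ i)) hA.1).symm

theorem HasBound.commute_vectorQ_of_mem (h : HasBound T D α β c) {A : V →L[ℝ] V}
    (hA : A ∈ commAlg hJ T D c) : Commute (vectorQ T D (-1)) A := by
  rw [h.vectorQ_eq_sum (neg_one_mem_wedge h.gt)]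
  exact Commute.sum_left _ _ _ fun i _ =>
    (commute_leftMul_of_mem hA _).mul_left (h.commute_tQ_of_mem hA _)

theorem HasBound.Qinv_mem_commAlg (h : HasBound T D α β c) :
    Qinv T D (-1) ∈ commAlg hJ T D c := h.value_mem_commAlg inGens_Qinv h.isSym_Qinv

/-- The single operator `vectorQ T D (-1)` commutes with the commuting algebra, so `Q A` and `Q B`
commute for `Q = Q_{c,-1}(T)⁻¹`. As `Q` commutes with `A` and `B`, it can be pulled out of both
products and cancelled twice. -/
theorem HasBound.commute_of_isStrong (h : HasBound T D α β c) {A B : V →L[ℝ] V}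
    (hA : IsStrong hJ T D c A) (hB : IsStrong hJ T D c B) : Commute A B := by
  obtain ⟨hA0, M, hM, N, hN, hA⟩ := hA
  obtain ⟨hB0, M', hM', N', hN', hB⟩ := hB
  have key : Commute (Qinv T D (-1) * A) (Qinv T D (-1) * B) := by
    rw [hA, hB]
    have hσ : ∀ {X}, X ∈ commAlg hJ T D c → Commute (vectorQ T D (-1)) X := fun hX =>
      h.commute_vectorQ_of_mem hX
    refine Commute.add_left (Commute.add_right (commute_of_mem_commAlg hM hM')
      ((hσ hM).symm.mul_right (commute_of_mem_commAlg hM hN'))) (Commute.add_right ?_ ?_)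
    · exact (hσ hM').mul_left (commute_of_mem_commAlg hN hM')
    · exact ((Commute.refl _).mul_right (hσ hN')).mul_left
        ((hσ hN).symm.mul_right (commute_of_mem_commAlg hN hN'))
  refine h.Qinv_injective (h.Qinv_injective ?_)
  rw [Commute, SemiconjBy] at key
  have e : ∀ {X Y : V →L[ℝ] V}, Commute (Qinv T D (-1)) X →
      Qinv T D (-1) * X * (Qinv T D (-1) * Y) = Qinv T D (-1) * (Qinv T D (-1) * (X * Y)) := by
    intro X Y hX
    rw [hX.eq, mul_assoc, ← mul_assoc (Qinv T D (-1)), ← mul_assoc (Qinv T D (-1)) (Qinv T D (-1)),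
      ← mul_assoc X, ← (hX.mul_left hX).eq, mul_assoc]
  rwa [e hA0, e hB0] at key

/-- It suffices to multiply `A` by `Q_{c,-1}(T)⁻¹`. The operator `B` stays as it is, because its
explicit form commutes with the commuting algebra and with `vectorQ T D (-1)`. -/
theorem HasBound.commute_of_isWeak (h : HasBound T D α β c) {A B : V →L[ℝ] V}
    (hA : IsStrong hJ T D c A) (hB : IsWeak hJ T D c B) : Commute A B := by
  obtain ⟨hA0, M, hM, N, hN, hA⟩ := hA
  obtain ⟨hB0, M', hM', N', hN', hrel, rfl⟩ := hB
  have hX : ∀ {X}, X ∈ commAlg hJ T D c →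
      Commute X (M' + ∑ i, leftMul (basisUnit i.succ) * N' i) := fun hX =>
    (commute_of_mem_commAlg hX hM').add_right (Commute.sum_right _ _ _ fun i _ =>
      (commute_leftMul_of_mem hX _).symm.mul_right (commute_of_mem_commAlg hX (hN' i)))
  -- Both products are double sums over `e_i e_j`; the coefficients agree term by term, by the
  -- relation that expresses `N_k = T_k N`.
  have hσ : Commute (vectorQ T D (-1)) (M' + ∑ i, leftMul (basisUnit i.succ) * N' i) := by
    refine (h.commute_vectorQ_of_mem hM').add_right ?_
    rw [h.vectorQ_eq_sum (neg_one_mem_wedge h.gt), Commute, SemiconjBy, Finset.sum_mul_sum,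
      Finset.sum_mul_sum]
    refine Finset.sum_congr rfl fun i _ => Finset.sum_congr rfl fun j _ => ?_
    have e1 : ∀ i j, tQ T D i (-1) * leftMul (basisUnit j) =
        leftMul (basisUnit j) * tQ T D i (-1) := fun i j =>
      (h.leftMul_comm_value (h.isSym_tQ i) _).symm
    have e2 : leftMul (basisUnit i.succ) * tQ T D i.succ (-1) *
        (leftMul (basisUnit j.succ) * N' j) = leftMul (basisUnit i.succ) *
          (leftMul (basisUnit j.succ) * (tQ T D i.succ (-1) * N' j)) := by
      rw [mul_assoc, ← mul_assoc (tQ T D _ (-1)), e1, mul_assoc]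
    have e3 : leftMul (basisUnit i.succ) * N' i *
        (leftMul (basisUnit j.succ) * tQ T D j.succ (-1)) = leftMul (basisUnit i.succ) *
          (leftMul (basisUnit j.succ) * (tQ T D j.succ (-1) * N' i)) := by
      rw [mul_assoc, ← mul_assoc (N' i), ← (commute_leftMul_of_mem (hN' i) _).eq, mul_assoc,
        ← (h.commute_tQ_of_mem (hN' i) _).eq]
    rw [e2, e3, hrel]
  refine h.Qinv_injective ?_
  have key : Commute (Qinv T D (-1) * A) (M' + ∑ i, leftMul (basisUnit i.succ) * N' i) := by
    rw [hA]
    exact (hX hM).add_left (hσ.mul_left (hX hN))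
  rw [← mul_assoc, key.eq, ← mul_assoc, ← mul_assoc, hB0.eq]

theorem IsStrong.add {A B : V →L[ℝ] V} (hA : IsStrong hJ T D c A) (hB : IsStrong hJ T D c B) :
    IsStrong hJ T D c (A + B) := by
  obtain ⟨hA0, M, hM, N, hN, hA⟩ := hA
  obtain ⟨hB0, M', hM', N', hN', hB⟩ := hB
  refine ⟨hA0.add_right hB0, _, add_mem hM hM', _, add_mem hN hN', ?_⟩
  rw [mul_add, hA, hB, mul_add]
  abel

theorem IsStrong.smul {A : V →L[ℝ] V} (hA : IsStrong hJ T D c A) (r : ℝ) :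
    IsStrong hJ T D c (r • A) := by
  obtain ⟨hA0, M, hM, N, hN, hA⟩ := hA
  refine ⟨hA0.smul_right r, _, Subalgebra.smul_mem _ hM r, _, Subalgebra.smul_mem _ hN r, ?_⟩
  rw [mul_smul_comm, hA, smul_add, mul_smul_comm]

theorem HasBound.isStrong_of_mem (h : HasBound T D α β c) {A : V →L[ℝ] V}
    (hA : A ∈ commAlg hJ T D c) : IsStrong hJ T D c A :=
  ⟨commute_of_mem_commAlg h.Qinv_mem_commAlg hA, _, mul_mem h.Qinv_mem_commAlg hA, 0, zero_mem _,
    by rw [mul_zero, add_zero]⟩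

theorem HasBound.Qinv_mul_vectorQ (h : HasBound T D α β c) {s : ℍ[ℝ]} (hs : s ∈ wedge c) :
    Qinv T D (-1) * vectorQ T D s = vectorQ T D (-1) * Qinv T D s := by
  have h1 := h.mem _ (neg_one_mem_wedge h.gt)
  ext v
  rw [mul_apply_eq_comp, mul_apply_eq_comp, h.adm.vectorQ_apply (h.mem s hs),
    h.adm.vectorQ_apply h1, h.adm.Qinv_negOne_vec h1 (h.adm.mem_dom (h.adm.Qinv_mem (h.mem s hs) v))]

theorem HasBound.commute_Qinv_SL (h : HasBound T D α β c) {z : ℂ} (hz : z ∈ cwedge c) :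
    Commute (Qinv T D (-1)) (SL T D (sl hJ z)) := by
  rw [SL_eq_add, h.vectorQ_eq_sum ((sl_mem_wedge hJ).2 hz)]
  have hQ := h.value_neg_one_mem (inGens_Qinv (hJ := hJ))
  refine (h.commute_adjoin hQ (inGens_scalarQ z hz)).add_right (Commute.sum_right _ _ _
    fun i _ => Commute.mul_right ?_ (h.commute_adjoin hQ (inGens_tQ _ z hz)))
  exact (h.leftMul_comm_value h.isSym_Qinv _).symm

theorem HasBound.isStrong_negOneRes (h : HasBound T D α β c) :
    IsStrong hJ T D c (negOneRes T D) := by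
  have h1 := neg_one_mem_wedge h.gt
  have hc : Commute (Qinv T D (-1)) (SL T D (-1)) := by
    have := h.commute_Qinv_SL (hJ := hJ) h.neg_one_mem
    rwa [map_neg, map_one] at this
  refine ⟨hc.neg_right, _, neg_mem (mul_mem h.Qinv_mem_commAlg
    (h.value_mem_commAlg inGens_scalarQ h.isSym_scalarQ)), _, neg_mem h.Qinv_mem_commAlg, ?_⟩
  rw [negOneRes, SL_eq_add, mul_neg, mul_add, h.Qinv_mul_vectorQ h1]
  simp only [mul_neg]
  abel

theorem HasBound.isStrong_negOneRes_conj (h : HasBound T D α β c) :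
    IsStrong hJ T D c (negOneRes (conj T) D) := by
  have e : negOneRes (conj T) D = (-2 : ℝ) • scalarQ T D (-1) + (-1 : ℝ) • negOneRes T D := by
    rw [negOneRes, negOneRes, SL_conj_eq_sub, SL_eq_add]
    module
  rw [e]
  exact ((h.isStrong_of_mem (h.value_mem_commAlg inGens_scalarQ h.isSym_scalarQ)).smul _).add
    (h.isStrong_negOneRes.smul _)

theorem HasBound.commute_negOneRes (h : HasBound T D α β c) :
    Commute (negOneRes T D) (negOneRes (conj T) D) :=
  h.commute_of_isStrong (hJ := basisUnit_one_mem_imSphere) h.isStrong_negOneRes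
    h.isStrong_negOneRes_conj

variable (R : RegData hJ T D α β c θ φ n g) {k : ℕ}
include R

/-- The vector part satisfies `Q_{c,-1}⁻¹ (∑ e_k T_k) Q_{c,s}⁻¹ = ((∑ e_k T_k) Q_{c,-1}⁻¹)
Q_{c,s}⁻¹`, so the units are collected in a constant left factor and the remaining kernels contain
none. The price is that `Q⁻¹ X` has to be integrable as well. -/
theorem RegData.isStrong_SL_mul {X : ℍ[ℝ] → V →L[ℝ] V} (hs : IsSym c X) (hX : InGens hJ T D c X)
    (hc : LineConv hJ φ (mulFun hJ (fun s => SL T D s * X s) fun z => g z * z ^ k))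
    (hc' : LineConv hJ φ (mulFun hJ (fun s => Qinv T D s * X s) fun z => g z * z ^ k)) :
    IsStrong hJ T D c (nInt hJ φ (fun s => SL T D s * X s) g k) := by
  have hQ := R.bd.value_neg_one_mem (inGens_Qinv (hJ := hJ))
  have e : ∀ s ∈ wedge c, Qinv T D (-1) * (SL T D s * X s) =
      Qinv T D (-1) * (scalarQ T D s * X s) + vectorQ T D (-1) * (Qinv T D s * X s) := by
    intro s hs
    rw [SL_eq_add, add_mul, mul_add, ← mul_assoc _ (vectorQ T D s), R.bd.Qinv_mul_vectorQ hs,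
      mul_assoc (vectorQ T D (-1))]
  have c1 : LineConv hJ φ (mulFun hJ (fun s => Qinv T D (-1) * (scalarQ T D s * X s))
      fun z => g z * z ^ k) := by
    refine R.conv_congr (K := fun s => Qinv T D (-1) * (SL T D s * X s) +
      (-vectorQ T D (-1)) * (Qinv T D s * X s)) (fun s hs => ?_)
      (conv_add (conv_const_mul _ hc) (conv_const_mul _ hc'))
    rw [e s hs, neg_mul]
    abel
  refine ⟨?_, nInt hJ φ (fun s => Qinv T D (-1) * (scalarQ T D s * X s)) g k,
    R.nInt_mem_commAlg ?_ ?_ c1, nInt hJ φ (fun s => Qinv T D s * X s) g k,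
    R.nInt_mem_commAlg (R.bd.isSym_Qinv.mul hs) (inGens_Qinv.mul hX) hc', ?_⟩
  · refine Commute.smul_right (commute_lineInt hJ hc (fun z => ?_) fun t ht => ?_) _
    · exact R.bd.commute_adjoin hQ (leftMul_mem_adjoin_gens z)
    · exact ((R.bd.commute_Qinv_SL (R.mem_wedge ht)).mul_right (R.bd.commute_adjoin hQ
        (hX _ (R.mem_wedge ht)))).mul_right (R.bd.commute_adjoin hQ (leftMul_mem_adjoin_gens _))
  · exact (isSym_const fun a => R.bd.leftMul_comm_value R.bd.isSym_Qinv a).mul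
      (R.bd.isSym_scalarQ.mul hs)
  · exact (inGens_const hQ).mul (inGens_scalarQ.mul hX)
  · rw [← nInt_const_mul _ hc, R.nInt_congr e, nInt_add c1 (conv_const_mul _ hc'),
      nInt_const_mul _ hc']

theorem RegData.conv_mul_Qinv {K : ℍ[ℝ] → V →L[ℝ] V} {M : ℝ} (hM : 0 ≤ M)
    (hc : ∀ z ∈ cwedge c, ContinuousAt (fun z => K (sl hJ z)) z)
    (hK : ∀ s ∈ wedge c, ‖K s‖ ≤ M * powFun α β ‖s‖) (hk : k ≤ n) :
    LineConv hJ φ (mulFun hJ (fun s => K s * Qinv T D s) fun z => g z * z ^ k) := by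
  obtain ⟨N, hN, hb⟩ := R.bd.boundedBy
  refine R.conv_of_bound (M := M * N) (by positivity)
    (fun z hz => (hc z hz).mul (R.bd.continuousAt_Qinv hJ hz)) (fun s hs h1 => ?_)
    (fun s hs h1 => ?_) hk
  · have h3 : 0 ≤ powFun α β ‖s‖ := powFun_nonneg (norm_nonneg s)
    calc ‖K s * Qinv T D s‖ ≤ (M * powFun α β ‖s‖) * (N * powFun α β ‖s‖ ^ 2) :=
          (norm_mul_le _ _).trans (mul_le_mul (hK s hs) (hb s hs).Qinv_le (norm_nonneg _)
            (by positivity))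
      _ = M * N * powFun α β ‖s‖ ^ 3 := by ring
  · have h2 := powFun_le_one (α := α) R.beta_pos.le h1.le
    have h3 : 0 ≤ powFun α β ‖s‖ := powFun_nonneg (norm_nonneg s)
    have h4 : ‖K s‖ ≤ M := (hK s hs).trans (mul_le_of_le_one_right hM h2)
    have h5 : ‖Qinv T D s‖ ≤ N * (‖SL T D s‖ + ‖SL (conj T) D s‖) := by
      refine (hb s hs).Qinv_le'.trans ?_
      gcongr
      exact mul_le_of_le_one_right hN h2
    rw [mul_assoc]
    exact (norm_mul_le _ _).trans (mul_le_mul h4 h5 (norm_nonneg _) hM)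

theorem RegData.conv_scalarQ_Qinv (hk : k ≤ n) :
    LineConv hJ φ (mulFun hJ (fun s => scalarQ T D s * Qinv T D s) fun z => g z * z ^ k) := by
  obtain ⟨M, hM, hb⟩ := R.bd.boundedBy
  exact R.conv_mul_Qinv hM (fun z hz => R.bd.continuousAt_scalarQ hJ hz)
    (fun s hs => (hb s hs).scalarQ_le) hk

theorem RegData.conv_tQ_Qinv (i : Fin 3) (hk : k ≤ n) :
    LineConv hJ φ (mulFun hJ (fun s => tQ T D i.succ s * Qinv T D s) fun z => g z * z ^ k) := by
  obtain ⟨M, hM, hb⟩ := R.bd.boundedBy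
  refine R.conv_mul_Qinv hM (fun z hz => R.bd.continuousAt_tQ hz _ hJ) (fun s hs => ?_) hk
  rw [tQ, if_neg (Fin.succ_ne_zero i)]
  exact (hb s hs).compQ_le _ (Fin.succ_ne_zero i)

theorem RegData.isStrong_SL (hk : k ≤ n) : IsStrong hJ T D c (nInt hJ φ (SL T D) g k) := by
  have := R.isStrong_SL_mul (k := k) (X := fun _ => 1) isSym_const_one (inGens_const (one_mem _))
  simp only [mul_one] at this
  exact this (R.conv_SL hk) (R.conv_Qinv hk)

theorem RegData.conv_scalarQ (hk : k ≤ n) :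
    LineConv hJ φ (mulFun hJ (scalarQ T D) fun z => g z * z ^ k) := by
  have : scalarQ T D = fun s => (2⁻¹ : ℝ) • (SL T D s + SL (conj T) D s) := rfl
  rw [this, mulFun_smul]
  exact (conv_add (R.conv_SL hk) (R.conv_SL_conj hk)).smul _

theorem RegData.nInt_scalarQ (hk : k ≤ n) : nInt hJ φ (scalarQ T D) g k =
    (2⁻¹ : ℝ) • (nInt hJ φ (SL T D) g k + nInt hJ φ (SL (conj T) D) g k) := by
  rw [← nInt_add (R.conv_SL hk) (R.conv_SL_conj hk), ← nInt_smul]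
  rfl

theorem RegData.isStrong_SL_conj (hk : k ≤ n) :
    IsStrong hJ T D c (nInt hJ φ (SL (conj T) D) g k) := by
  have e : nInt hJ φ (SL (conj T) D) g k = (2 : ℝ) • nInt hJ φ (scalarQ T D) g k +
      (-1 : ℝ) • nInt hJ φ (SL T D) g k := by
    rw [R.nInt_scalarQ hk]
    module
  rw [e]
  exact ((R.bd.isStrong_of_mem (R.nInt_mem_commAlg R.bd.isSym_scalarQ inGens_scalarQ
    (R.conv_scalarQ hk))).smul _).add ((R.isStrong_SL hk).smul _)

theorem RegData.isStrong_Qinv (hk : k ≤ n) : IsStrong hJ T D c (nInt hJ φ (Qinv T D) g k) :=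
  R.bd.isStrong_of_mem (R.nInt_mem_commAlg R.bd.isSym_Qinv inGens_Qinv (R.conv_Qinv hk))

theorem RegData.isStrong_P (hk : k ≤ n) :
    IsStrong hJ T D c (nInt hJ φ (fun s => SL T D s * scalarQ T D s) g k) := by
  refine R.isStrong_SL_mul R.bd.isSym_scalarQ inGens_scalarQ (R.conv_SL_scalarQ hk) ?_
  refine (R.conv_scalarQ_Qinv hk).congr hJ fun t ht => ?_
  have hz := R.mem_wedge ht
  rw [mulFun, mulFun, (R.bd.commute_adjoin (inGens_scalarQ _ hz) (inGens_Qinv _ hz)).eq]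

/-- The strong form would require the integral of `Q⁻¹ Q⁻¹`, of order four in the resolvent bound,
whereas only three orders are controlled near zero. The weak form uses `T_k Q⁻¹ Q⁻¹`, of order
three. -/
theorem RegData.isWeak_F (hk : k ≤ n) :
    IsWeak hJ T D c (nInt hJ φ (fun s => SL T D s * Qinv T D s) g k) := by
  have hQ := R.bd.value_neg_one_mem (inGens_Qinv (hJ := hJ))
  refine ⟨Commute.smul_right (commute_lineInt hJ (R.conv_SL_Qinv hk) (fun z => ?_)
    fun t ht => ?_) _, nInt hJ φ (fun s => scalarQ T D s * Qinv T D s) g k,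
    R.nInt_mem_commAlg (R.bd.isSym_scalarQ.mul R.bd.isSym_Qinv) (inGens_scalarQ.mul inGens_Qinv)
      (R.conv_scalarQ_Qinv hk), fun i => nInt hJ φ (fun s => tQ T D i.succ s * Qinv T D s) g k,
    fun i => R.nInt_mem_commAlg ((R.bd.isSym_tQ _).mul R.bd.isSym_Qinv)
      ((inGens_tQ _).mul inGens_Qinv) (R.conv_tQ_Qinv i hk), fun i j => ?_, ?_⟩
  · exact R.bd.commute_adjoin hQ (leftMul_mem_adjoin_gens z)
  · exact ((R.bd.commute_Qinv_SL (R.mem_wedge ht)).mul_right (R.bd.commute_adjoin hQ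
        (inGens_Qinv _ (R.mem_wedge ht)))).mul_right
          (R.bd.commute_adjoin hQ (leftMul_mem_adjoin_gens _))
  · rw [← nInt_const_mul _ (R.conv_tQ_Qinv j hk), ← nInt_const_mul _ (R.conv_tQ_Qinv i hk)]
    refine R.nInt_congr (fun s hs => ?_) k
    rw [← mul_assoc, ← mul_assoc, R.bd.tQ_mul_tQ (neg_one_mem_wedge R.bd.gt) hs]
  · have c1 := fun i => conv_const_mul (leftMul (basisUnit i.succ)) (R.conv_tQ_Qinv i hk)
    simp only [← nInt_const_mul _ (R.conv_tQ_Qinv _ hk)]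
    rw [Fin.sum_univ_three, ← nInt_add (c1 0) (c1 1), ← nInt_add (conv_add (c1 0) (c1 1)) (c1 2),
      ← nInt_add (R.conv_scalarQ_Qinv hk) (conv_add (conv_add (c1 0) (c1 1)) (c1 2))]
    refine R.nInt_congr (fun s hs => ?_) k
    rw [SL_eq_add, R.bd.vectorQ_eq_sum hs, Fin.sum_univ_three]
    simp only [add_mul, mul_assoc]

omit R in
theorem nInt_mul_leftMul (K : ℍ[ℝ] → V →L[ℝ] V) (k : ℕ) :
    nInt hJ φ (fun s => K s * leftMul s) g k = nInt hJ φ K g (k + 1) := by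
  rw [nInt, nInt]
  congr 2
  ext1 z
  rw [mulFun, mulFun, mul_assoc, ← leftMul_mul, ← map_mul]
  congr 3
  ring

omit R in
theorem conv_mul_leftMul {K : ℍ[ℝ] → V →L[ℝ] V}
    (h : LineConv hJ φ (mulFun hJ K fun z => g z * z ^ (k + 1))) :
    LineConv hJ φ (mulFun hJ (fun s => K s * leftMul s) fun z => g z * z ^ k) := by
  refine h.congr hJ fun t _ => ?_
  rw [mulFun, mulFun, mul_assoc, ← leftMul_mul, ← map_mul]
  congr 3
  ring

/-- All recurrences come from pointwise identities of this shape: a factor `s` at the right of the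
kernel raises the power in the integral by one. -/
theorem RegData.nInt_relation {K₁ K₂ K₃ : ℍ[ℝ] → V →L[ℝ] V} {A₁ A₂ A₃ : V →L[ℝ] V}
    (he : ∀ s ∈ wedge c, A₁ * K₁ s = A₂ * (K₂ s * leftMul s) + A₃ * K₃ s)
    (h₁ : LineConv hJ φ (mulFun hJ K₁ fun z => g z * z ^ k))
    (h₂ : LineConv hJ φ (mulFun hJ K₂ fun z => g z * z ^ (k + 1)))
    (h₃ : LineConv hJ φ (mulFun hJ K₃ fun z => g z * z ^ k)) :
    A₁ * nInt hJ φ K₁ g k = A₂ * nInt hJ φ K₂ g (k + 1) + A₃ * nInt hJ φ K₃ g k := by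
  have h₂' := conv_mul_leftMul h₂
  rw [← nInt_const_mul _ h₁, R.nInt_congr he,
    nInt_add (conv_const_mul _ h₂') (conv_const_mul _ h₃), nInt_const_mul _ h₂',
    nInt_const_mul _ h₃, nInt_mul_leftMul]

end Relations

/-! ### The recurrences in a commutative ring and the removal of denominators. -/

section CommutativeAlgebra

open Finset

/-- Solution of the linear recurrences for the functional calculi of the monomials. -/
theorem recurrence_identities {B : Type*} [CommRing B] {t s : B} {F G Y U W : ℕ → B} {n : ℕ}
    (hF : ∀ k < n, F (k + 1) = t * F k) (hG : ∀ k < n, G (k + 1) = s * G k)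
    (hY : ∀ k < n, Y (k + 1) = F k + s * Y k) (h0 : G 0 - F 0 = (s - t) * Y 0)
    (hU : ∀ k < n, U (k + 1) = t * U k + 2 * F k + 2 * G k)
    (hW : ∀ k < n, W (k + 1) = t * W k + Y k) :
    F 0 * Y n - Y 0 * F n = F 0 * G 0 * ∑ k ∈ range n, s ^ (n - 1 - k) * t ^ k ∧
    F 0 * G 0 * U n - G 0 * U 0 * F n - 2 * F 0 * Y 0 * G n + 2 * G 0 * Y 0 * F n =
      F 0 ^ 2 * G 0 * (2 * n * t ^ (n - 1) + 2 * ∑ k ∈ range n, s ^ (n - 1 - k) * t ^ k) ∧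
    F 0 * G 0 * W n - G 0 * W 0 * F n - F 0 * Y 0 * Y n + Y 0 ^ 2 * F n =
      F 0 ^ 2 * G 0 * ∑ k ∈ range n, k * (s ^ (n - 1 - k) * t ^ (k - 1)) := by
  set S : ℕ → B := fun n => ∑ k ∈ range n, s ^ (n - 1 - k) * t ^ k with hS
  set O : ℕ → B := fun n => ∑ k ∈ range n, k * (s ^ (n - 1 - k) * t ^ (k - 1)) with hO
  have hS1 : ∀ m, S (m + 1) = t ^ m + s * S m := fun m => by
    simp only [hS, sum_range_succ, Nat.add_sub_cancel, Nat.sub_self, pow_zero, one_mul, mul_sum]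
    rw [add_comm]
    congr 1
    refine sum_congr rfl fun k hk => ?_
    have : m - k = m - 1 - k + 1 := by have := mem_range.1 hk; omega
    rw [this, pow_succ]
    ring
  have hS2 : ∀ m, S (m + 1) = s ^ m + t * S m := fun m => by
    simp only [hS, sum_range_succ', Nat.add_sub_cancel, Nat.sub_zero, pow_zero, mul_one, mul_sum]
    rw [add_comm]
    congr 1
    refine sum_congr rfl fun k _ => ?_
    rw [Nat.sub_sub, add_comm 1 k, pow_succ]
    ring
  have hO1 : ∀ m, O (m + 1) = t * O m + S m := fun m => by
    simp only [hS, hO, sum_range_succ', Nat.add_sub_cancel, Nat.cast_zero, zero_mul, add_zero,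
      mul_sum]
    rw [← sum_add_distrib]
    refine sum_congr rfl fun k _ => ?_
    rw [Nat.sub_sub, add_comm 1 k]
    rcases k with _ | k
    · simp
    · rw [Nat.add_sub_cancel, pow_succ]
      push_cast
      ring
  -- The sum can be extended by its last or by its first term; subtracting the two recursions gives
  -- the factorization of `s^m - t^m`.
  have hSt : ∀ m, s ^ m - t ^ m = (s - t) * S m := fun m => by
    have h1 := hS1 m
    have h2 := hS2 m
    linear_combination h1 - h2
  have eF : ∀ m ≤ n, F m = t ^ m * F 0 := fun m => by
    induction m with
    | zero => intro _; simp
    | succ m ih => intro hm; rw [hF m hm, ih (by omega)]; ring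
  have eG : ∀ m ≤ n, G m = s ^ m * G 0 := fun m => by
    induction m with
    | zero => intro _; simp
    | succ m ih => intro hm; rw [hG m hm, ih (by omega)]; ring
  have eY : ∀ m ≤ n, Y m = s ^ m * Y 0 + F 0 * S m := fun m => by
    induction m with
    | zero => intro _; simp [hS]
    | succ m ih => intro hm; rw [hY m hm, ih (by omega), eF m (by omega), hS1]; ring
  have eU : ∀ m ≤ n, U m = t ^ m * U 0 + 2 * m * t ^ (m - 1) * F 0 + 2 * G 0 * S m := fun m => by
    induction m with
    | zero => intro _; simp [hS]
    | succ m ih =>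
      intro hm
      rw [hU m hm, ih (by omega), eF m (by omega), eG m (by omega), hS2, Nat.add_sub_cancel]
      rcases m with _ | m
      · simp [hS]
      · rw [Nat.add_sub_cancel]
        push_cast
        ring
  have eW : ∀ m ≤ n, W m = t ^ m * W 0 + Y 0 * S m + F 0 * O m := fun m => by
    induction m with
    | zero => intro _; simp [hS, hO]
    | succ m ih => intro hm; rw [hW m hm, ih (by omega), eY m (by omega), hO1, hS2]; ring
  have hst := hSt n
  have hFn := eF n le_rfl
  have hGn := eG n le_rfl
  have hYn := eY n le_rfl
  have hUn := eU n le_rfl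
  have hWn := eW n le_rfl
  -- After substitution, the defects are multiples of `s^n - t^n = (s - t) S n` and of `G 0 - F 0 =
  -- (s - t) Y 0`, and these two cancel each other.
  refine ⟨?_, ?_, ?_⟩
  · rw [hYn, hFn]
    linear_combination F 0 * Y 0 * hst - F 0 * S n * h0
  · rw [hUn, hFn, hGn]
    linear_combination (-2) * F 0 * G 0 * Y 0 * hst + 2 * F 0 * G 0 * S n * h0
  · rw [hWn, hFn, hYn]
    linear_combination (-F 0 * Y 0 ^ 2) * hst + F 0 * Y 0 * S n * h0

/-- The denominator free form of `s^a t^b`, where `t = (1 - r) / r` and `s = (1 - r') / r'`. -/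
def clearedPow {A : Type*} [Ring A] (r r' : A) (n a b : ℕ) : A :=
  r ^ (n - b) * r' ^ (n - a) * (1 - r') ^ a * (1 - r) ^ b

/-- The recurrences in denominator free form. -/
theorem cleared_identities {A : Type*} [CommRing A] {r r' : A} (hr : r ∈ nonZeroDivisors A)
    (hr' : r' ∈ nonZeroDivisors A) {F G Y U W : ℕ → A} {n : ℕ}
    (hF : ∀ k < n, (1 - r) * F k = r * F (k + 1))
    (hG : ∀ k < n, (1 - r') * G k = r' * G (k + 1))
    (hY : ∀ k < n, r' * Y (k + 1) = r' * F k + (1 - r') * Y k)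
    (h0 : r * r' * (G 0 - F 0) = (r * (1 - r') - r' * (1 - r)) * Y 0)
    (hU : ∀ k < n, (1 - r) * U k = r * (U (k + 1) - 2 * F k - 2 * G k))
    (hW : ∀ k < n, (1 - r) * W k = r * (W (k + 1) - Y k)) :
    r ^ n * r' ^ n * (F 0 * Y n - Y 0 * F n) =
      F 0 * G 0 * ∑ k ∈ range n, clearedPow r r' n (n - 1 - k) k ∧
    r ^ n * r' ^ n *
        (F 0 * G 0 * U n - G 0 * U 0 * F n - 2 * F 0 * Y 0 * G n + 2 * G 0 * Y 0 * F n) =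
      F 0 ^ 2 * G 0 * (2 * n * clearedPow r r' n 0 (n - 1) +
        2 * ∑ k ∈ range n, clearedPow r r' n (n - 1 - k) k) ∧
    r ^ n * r' ^ n * (F 0 * G 0 * W n - G 0 * W 0 * F n - F 0 * Y 0 * Y n + Y 0 ^ 2 * F n) =
      F 0 ^ 2 * G 0 * ∑ k ∈ range n, k * clearedPow r r' n (n - 1 - k) (k - 1) := by
  -- The ring need not be a domain. `L` inverts all its non-zero-divisors, and `A` still embeds;
  -- there `t = 1/r - 1` and `s = 1/r' - 1` exist.
  set L := FractionRing A
  set ι := algebraMap A L with hι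
  have hinj : Function.Injective ι := IsFractionRing.injective A L
  obtain ⟨u, hu⟩ : ∃ u, ι r * u = 1 := (IsLocalization.map_units L ⟨r, hr⟩).exists_right_inv
  obtain ⟨v, hv⟩ : ∃ v, ι r' * v = 1 := (IsLocalization.map_units L ⟨r', hr'⟩).exists_right_inv
  have ht : 1 - ι r = ι r * (u - 1) := by linear_combination -hu
  have hs : 1 - ι r' = ι r' * (v - 1) := by linear_combination -hv
  have hcl : ∀ a ≤ n, ∀ b ≤ n, ι (clearedPow r r' n a b) =
      ι r ^ n * ι r' ^ n * ((v - 1) ^ a * (u - 1) ^ b) := by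
    intro a ha b hb
    simp only [clearedPow, map_mul, map_pow, map_sub, map_one, ht, hs, mul_pow]
    have e1 : ι r ^ n = ι r ^ (n - b) * ι r ^ b := by rw [← pow_add, Nat.sub_add_cancel hb]
    have e2 : ι r' ^ n = ι r' ^ (n - a) * ι r' ^ a := by rw [← pow_add, Nat.sub_add_cancel ha]
    rw [e1, e2]
    ring
  have key := recurrence_identities (t := u - 1) (s := v - 1) (F := fun k => ι (F k))
    (G := fun k => ι (G k)) (Y := fun k => ι (Y k)) (U := fun k => ι (U k))
    (W := fun k => ι (W k)) (n := n)
    (fun k hk => by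
      have := congrArg ι (hF k hk)
      simp only [map_mul, map_sub, map_one] at this
      linear_combination (-u) * this - (ι (F k) + ι (F (k + 1))) * hu)
    (fun k hk => by
      have := congrArg ι (hG k hk)
      simp only [map_mul, map_sub, map_one] at this
      linear_combination (-v) * this - (ι (G k) + ι (G (k + 1))) * hv)
    (fun k hk => by
      have := congrArg ι (hY k hk)
      simp only [map_mul, map_sub, map_one, map_add] at this
      linear_combination v * this - (ι (Y (k + 1)) - ι (F k) + ι (Y k)) * hv)
    (by
      have := congrArg ι h0
      simp only [map_mul, map_sub, map_one] at this
      linear_combination u * v * this - (ι (G 0) - ι (F 0)) * (ι r' * v * hu + hv) +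
        ι (Y 0) * (v * hu - u * hv))
    (fun k hk => by
      have := congrArg ι (hU k hk)
      simp only [map_mul, map_sub, map_one, map_ofNat] at this
      linear_combination (-u) * this - (ι (U k) + ι (U (k + 1)) - 2 * ι (F k) - 2 * ι (G k)) * hu)
    (fun k hk => by
      have := congrArg ι (hW k hk)
      simp only [map_mul, map_sub, map_one] at this
      linear_combination (-u) * this - (ι (W k) + ι (W (k + 1)) - ι (Y k)) * hu)
  obtain ⟨k1, k2, k3⟩ := key
  have e1 : ι (∑ k ∈ range n, clearedPow r r' n (n - 1 - k) k) = ι r ^ n * ι r' ^ n *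
      ∑ k ∈ range n, (v - 1) ^ (n - 1 - k) * (u - 1) ^ k := by
    rw [map_sum, mul_sum]
    refine sum_congr rfl fun k hk => ?_
    have := mem_range.1 hk
    exact hcl _ (by omega) _ (by omega)
  have e2 : ι (∑ k ∈ range n, k * clearedPow r r' n (n - 1 - k) (k - 1)) = ι r ^ n * ι r' ^ n *
      ∑ k ∈ range n, k * ((v - 1) ^ (n - 1 - k) * (u - 1) ^ (k - 1)) := by
    rw [map_sum, mul_sum]
    refine sum_congr rfl fun k hk => ?_
    have := mem_range.1 hk
    rw [map_mul, map_natCast, hcl _ (by omega) _ (by omega)]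
    ring
  have e3 := hcl 0 (by omega) (n - 1) (by omega)
  rw [pow_zero, one_mul] at e3
  refine ⟨hinj ?_, hinj ?_, hinj ?_⟩
  · simp only [map_mul, map_sub, map_pow, e1]
    linear_combination ι r ^ n * ι r' ^ n * k1
  · simp only [map_mul, map_sub, map_add, map_pow, map_ofNat, map_natCast, e1, e3]
    linear_combination ι r ^ n * ι r' ^ n * k2
  · simp only [map_mul, map_sub, map_add, map_pow, e2]
    linear_combination ι r ^ n * ι r' ^ n * k3

open scoped IsMulCommutative in
/-- Pairwise commuting elements lie in the image of a commutative ring. -/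
theorem exists_commRing_of_commute.{u} {A : Type u} [Ring A] [Algebra ℝ A] {S : Set A}
    (hS : ∀ a ∈ S, ∀ b ∈ S, a * b = b * a) : ∃ (B : Type u) (_ : CommRing B) (j : B →+* A),
      Function.Injective j ∧ ∀ a ∈ S, ∃ b, j b = a := by
  have := Algebra.isMulCommutative_adjoin ℝ hS
  exact ⟨Algebra.adjoin ℝ S, inferInstance, (Algebra.adjoin ℝ S).val.toRingHom,
    Subtype.val_injective, fun a ha => ⟨⟨a, Algebra.subset_adjoin ha⟩, rfl⟩⟩

/-- The same identities for pairwise commuting elements of a noncommutative algebra. -/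
theorem cleared_identities_of_commute {A : Type*} [Ring A] [Algebra ℝ A] {r r' : A}
    (hr : ∀ x, r * x = 0 → x = 0) (hr' : ∀ x, r' * x = 0 → x = 0) {F G Y U W : ℕ → A} {n : ℕ}
    {S : Set A} (hS : ∀ a ∈ S, ∀ b ∈ S, a * b = b * a) (hrS : r ∈ S) (hrS' : r' ∈ S)
    (hFS : ∀ k ≤ n, F k ∈ S) (hGS : ∀ k ≤ n, G k ∈ S) (hYS : ∀ k ≤ n, Y k ∈ S)
    (hUS : ∀ k ≤ n, U k ∈ S) (hWS : ∀ k ≤ n, W k ∈ S)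
    (hF : ∀ k < n, (1 - r) * F k = r * F (k + 1))
    (hG : ∀ k < n, (1 - r') * G k = r' * G (k + 1))
    (hY : ∀ k < n, r' * Y (k + 1) = r' * F k + (1 - r') * Y k)
    (h0 : r * r' * (G 0 - F 0) = (r * (1 - r') - r' * (1 - r)) * Y 0)
    (hU : ∀ k < n, (1 - r) * U k = r * (U (k + 1) - 2 * F k - 2 * G k))
    (hW : ∀ k < n, (1 - r) * W k = r * (W (k + 1) - Y k)) :
    r ^ n * r' ^ n * (F 0 * Y n - Y 0 * F n) =
      F 0 * G 0 * ∑ k ∈ range n, clearedPow r r' n (n - 1 - k) k ∧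
    r ^ n * r' ^ n *
        (F 0 * G 0 * U n - G 0 * U 0 * F n - 2 * F 0 * Y 0 * G n + 2 * G 0 * Y 0 * F n) =
      F 0 ^ 2 * G 0 * (2 * n * clearedPow r r' n 0 (n - 1) +
        2 * ∑ k ∈ range n, clearedPow r r' n (n - 1 - k) k) ∧
    r ^ n * r' ^ n * (F 0 * G 0 * W n - G 0 * W 0 * F n - F 0 * Y 0 * Y n + Y 0 ^ 2 * F n) =
      F 0 ^ 2 * G 0 * ∑ k ∈ range n, k * clearedPow r r' n (n - 1 - k) (k - 1) := by
  obtain ⟨B, _, j, hj, hsurj⟩ := exists_commRing_of_commute hS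
  have lift : ∀ X : ℕ → A, (∀ k ≤ n, X k ∈ S) → ∃ X' : ℕ → B, ∀ k ≤ n, j (X' k) = X k := by
    intro X hX
    have : ∀ k, ∃ b, k ≤ n → j b = X k := fun k => by
      by_cases hk : k ≤ n
      · obtain ⟨b, hb⟩ := hsurj _ (hX k hk)
        exact ⟨b, fun _ => hb⟩
      · exact ⟨0, fun h => absurd h hk⟩
    choose X' hX' using this
    exact ⟨X', hX'⟩
  have hnz : ∀ x : B, (∀ y, j x * y = 0 → y = 0) → x ∈ nonZeroDivisors B := by
    intro x h
    rw [mem_nonZeroDivisors_iff_right]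
    intro y hy
    refine hj ?_
    rw [map_zero]
    refine h _ ?_
    rw [← map_mul, mul_comm, hy, map_zero]
  obtain ⟨r, rfl⟩ := hsurj r hrS
  obtain ⟨r', rfl⟩ := hsurj r' hrS'
  obtain ⟨F', hF'⟩ := lift F hFS
  obtain ⟨G', hG'⟩ := lift G hGS
  obtain ⟨Y', hY'⟩ := lift Y hYS
  obtain ⟨U', hU'⟩ := lift U hUS
  obtain ⟨W', hW'⟩ := lift W hWS
  have key := cleared_identities (hnz r hr) (hnz r' hr') (F := F') (G := G')
    (Y := Y') (U := U') (W := W') (n := n)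
    (fun k hk => hj (by
      simp only [map_mul, map_sub, map_one, hF' k hk.le, hF' (k + 1) hk, hF k hk]))
    (fun k hk => hj (by
      simp only [map_mul, map_sub, map_one, hG' k hk.le, hG' (k + 1) hk, hG k hk]))
    (fun k hk => hj (by
      simp only [map_mul, map_sub, map_add, map_one, hY' k hk.le, hY' (k + 1) hk, hF' k hk.le,
        hY k hk]))
    (hj (by
      simp only [map_mul, map_sub, map_one, hF' 0 (Nat.zero_le n), hG' 0 (Nat.zero_le n),
        hY' 0 (Nat.zero_le n), h0]))
    (fun k hk => hj (by
      simp only [map_mul, map_sub, map_one, map_ofNat, hU' k hk.le, hU' (k + 1) hk, hF' k hk.le,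
        hG' k hk.le, hU k hk]))
    (fun k hk => hj (by
      simp only [map_mul, map_sub, map_one, hW' k hk.le, hW' (k + 1) hk, hY' k hk.le, hW k hk]))
  have hcl : ∀ a b, j (clearedPow r r' n a b) = clearedPow (j r) (j r') n a b := fun a b => by
    simp only [clearedPow, map_mul, map_pow, map_sub, map_one]
  obtain ⟨k1, k2, k3⟩ := key
  have k1' := congrArg j k1
  have k2' := congrArg j k2
  have k3' := congrArg j k3
  simp only [map_mul, map_sub, map_add, map_pow, map_sum, map_ofNat, map_natCast, hcl,
    hF' _ (Nat.zero_le n), hG' _ (Nat.zero_le n), hY' _ (Nat.zero_le n), hU' _ (Nat.zero_le n),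
    hW' _ (Nat.zero_le n), hF' _ le_rfl, hG' _ le_rfl, hY' _ le_rfl, hU' _ le_rfl, hW' _ le_rfl]
    at k1' k2' k3'
  exact ⟨k1', k2', k3'⟩

end CommutativeAlgebra

/-! ### The recurrences for the functional calculi, and their solution. -/

section Identities

open Complex Set Filter Topology

variable {T : V →ₗ.[ℝ] V} {D : Submodule ℝ V} {α β c θ φ : ℝ} {J : ℍ[ℝ]} {hJ : J ∈ imSphere}
  {n : ℕ} {g : ℂ → ℂ}

theorem HasCR.of_differentiableAt (hJ : J ∈ imSphere) {g : ℂ → ℂ} {z : ℂ}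
    (hg : DifferentiableAt ℂ g z) : HasCR (V := V) hJ (fun z => leftMul (sl hJ (g z))) z := by
  set L : ℂ →L[ℝ] V →L[ℝ] V := (ContinuousLinearMap.lsmul ℝ ℍ[ℝ]).comp (slL hJ) with hL
  have hLa : ∀ w, L w = leftMul (sl hJ w) := fun w => rfl
  refine ⟨L.comp ((fderiv ℂ g z).restrictScalars ℝ),
    L.hasFDerivAt.comp z (hg.hasFDerivAt.restrictScalars ℝ), ?_⟩
  have e : fderiv ℂ g z I = fderiv ℂ g z 1 * I := by
    rw [mul_comm, ← smul_eq_mul, ← map_smul, smul_eq_mul, mul_one]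
  change L (fderiv ℂ g z I) = L (fderiv ℂ g z 1) * leftMul (sl hJ I)
  rw [hLa, hLa, e, map_mul, leftMul_mul]

theorem conj_conj_eq (h : HasBound T D α β c) : conj (conj T) = T := conj_conj h.adm.kc.twoSided

variable (R : RegData hJ T D α β c θ φ n g) {k : ℕ}
include R

/-- A regularizer satisfies the same conditions for `T` and `T̄`, so the recurrence for `T̄` is an
instance of the one for `T`. -/
theorem RegData.conj_data : RegData hJ (conj T) D α β c θ φ n g where
  bd := R.bd.conj_bound
  third_le := R.third_le
  beta_pos := R.beta_pos
  le_third := R.le_third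
  cos_lt := R.cos_lt
  angle := R.angle
  le_pi := R.le_pi
  diff := R.diff
  map_conj := R.map_conj
  small := R.small
  large := R.large
  conv := R.conv_conj
  conv_conj := by rw [conj_conj_eq R.bd]; exact R.conv
  conv_mul := R.conv_conj_mul
  conv_conj_mul := by rw [conj_conj_eq R.bd]; exact R.conv_mul

/-- For `k < n` one power of `z` is to spare at infinity. It turns `|z|^(3β-1-δ)` into
`|z|^(3β-2-δ)`, which is integrable because `β ≤ 1/3`. -/
theorem RegData.decay (hk : k < n) : ∃ δ > 0, ∃ C ≥ 0, ∀ z ∈ csec θ,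
    ‖g z * z ^ k‖ ≤ C * decayFun δ ‖z‖ := by
  obtain ⟨δ₁, hδ₁, C₁, hC₁, h₁⟩ := R.small
  obtain ⟨δ₂, hδ₂, C₂, hC₂, h₂⟩ := R.large
  refine ⟨min δ₁ δ₂, lt_min hδ₁ hδ₂, C₁ + C₂, by positivity, fun z hz => ?_⟩
  have h0 : 0 < ‖z‖ := norm_pos_iff.2 hz.1
  have hα := R.third_le
  have hβ := R.le_third
  have m1 := min_le_left δ₁ δ₂
  have m2 := min_le_right δ₁ δ₂
  rw [decayFun, abs_of_pos h0]
  split_ifs with h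
  · calc ‖g z * z ^ k‖ ≤ ‖g z‖ := by
          rw [norm_mul, norm_pow]
          exact mul_le_of_le_one_right (norm_nonneg _) (pow_le_one₀ h0.le h)
      _ ≤ C₁ * ‖z‖ ^ (3 * α - 1 + δ₁) := h₁ z hz h
      _ ≤ (C₁ + C₂) * ‖z‖ ^ (-1 + min δ₁ δ₂) := by
          gcongr ?_ * ?_
          · linarith
          · exact Real.rpow_le_rpow_of_exponent_ge h0 h (by linarith)
  · have h1 : 1 ≤ ‖z‖ := (not_le.1 h).le
    have e : ‖g z * z ^ k‖ * ‖z‖ ≤ ‖g z * z ^ n‖ := by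
      rw [norm_mul, norm_mul, norm_pow, norm_pow, mul_assoc, ← pow_succ]
      gcongr
      exact hk
    have e' : ‖z‖ ^ (-1 - min δ₁ δ₂) * ‖z‖ = ‖z‖ ^ (-min δ₁ δ₂) := by
      rw [← Real.rpow_add_one h0.ne']
      congr 1
      ring
    refine le_of_mul_le_mul_right ?_ h0
    calc ‖g z * z ^ k‖ * ‖z‖ ≤ C₂ * ‖z‖ ^ (3 * β - 1 - δ₂) := e.trans (h₂ z hz h1)
      _ ≤ (C₁ + C₂) * ‖z‖ ^ (-min δ₁ δ₂) := by
          gcongr ?_ * ?_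
          · linarith
          · exact Real.rpow_le_rpow_of_exponent_le h1 (by linarith)
      _ = _ := by rw [← e', mul_assoc]

theorem RegData.conv_one (hk : k < n) :
    LineConv hJ φ (mulFun hJ (fun _ => (1 : V →L[ℝ] V)) fun z => g z * z ^ k) := by
  obtain ⟨δ, hδ, C, hC, hb⟩ := R.decay hk
  refine lineConv_of_le hJ (fun t ht => R.continuousAt_mulFun ht continuousAt_const k)
    (((integrable_decayFun hδ).const_mul C).const_mul ‖(1 : V →L[ℝ] V)‖) fun t ht => ?_
  rw [norm_mulFun]
  have := hb _ (R.mem_csec ht)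
  rw [norm_gammaC] at this
  have e : decayFun δ |t| = decayFun δ t := by simp only [decayFun, abs_abs]
  rw [e] at this
  gcongr

/-- Cauchy's theorem for the functions `g(s) s^k`. -/
theorem RegData.nInt_one (hk : k < n) :
    nInt hJ φ (fun _ => (1 : V →L[ℝ] V)) g k = 0 := by
  obtain ⟨δ, hδ, C, hC, hb⟩ := R.decay hk
  have hmem : ∀ r > 0, ∀ ψ ∈ Icc (-φ) φ,
      (⟨(polarPt r ψ).1, (polarPt r ψ).2⟩ : ℂ) ∈ csec θ := fun r hr ψ hψ =>
    polarPt_mem_csec hr R.le_pi ((abs_le.2 hψ).trans_lt R.angle.2)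
  have e : mulFun hJ (fun _ => (1 : V →L[ℝ] V)) (fun z => g z * z ^ k) =
      fun z => leftMul (sl hJ (g z * z ^ k)) := by
    ext1 z
    rw [mulFun, one_mul]
  rw [nInt, lineInt_eq_zero_of_right hJ (C := ‖(1 : V →L[ℝ] V)‖ * C) R.angle.1.le hδ
    (fun r hr ψ hψ => ?_) (fun r hr ψ hψ => ?_) (R.conv_one hk), smul_zero]
  · rw [e]
    exact HasCR.of_differentiableAt hJ ((R.diff _ (hmem r hr ψ hψ)).mul
      (differentiableAt_id.pow k))
  · have h1 := hb _ (hmem r hr ψ hψ)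
    rw [norm_polarPt hr] at h1
    rw [norm_mulFun, mul_assoc]
    gcongr

/-- The term `-1` of the resolvent equation contributes `∫ g(s) s^k ds`, which vanishes by Cauchy's
theorem. Only `k < n` is available, and no more is needed. -/
theorem RegData.relation_SL (hk : k < n) : (1 - negOneRes T D) * nInt hJ φ (SL T D) g k =
    negOneRes T D * nInt hJ φ (SL T D) g (k + 1) := by
  have := R.nInt_relation (K₁ := SL T D) (K₂ := SL T D) (K₃ := fun _ => 1)
    (A₁ := 1 - negOneRes T D) (A₂ := negOneRes T D) (A₃ := -negOneRes T D) (k := k)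
    (fun s hs => by
      rw [R.bd.adm.resolvent_equation (R.bd.mem _ (neg_one_mem_wedge R.bd.gt)) (R.bd.mem s hs)]
      noncomm_ring) (R.conv_SL hk.le) (R.conv_SL hk) (R.conv_one hk)
  rwa [R.nInt_one hk, mul_zero, add_zero] at this

theorem RegData.relation_Qinv (hk : k < n) :
    negOneRes (conj T) D * nInt hJ φ (Qinv T D) g (k + 1) =
      negOneRes (conj T) D * nInt hJ φ (SL T D) g k +
        (1 - negOneRes (conj T) D) * nInt hJ φ (Qinv T D) g k := by
  have := R.nInt_relation (K₁ := SL T D) (K₂ := Qinv T D) (K₃ := Qinv T D)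
    (A₁ := negOneRes (conj T) D) (A₂ := negOneRes (conj T) D) (A₃ := -(1 - negOneRes (conj T) D))
    (k := k) (fun s hs => by
      rw [R.bd.adm.negOneRes_conj_SL (R.bd.mem _ (neg_one_mem_wedge R.bd.gt)) (R.bd.mem s hs),
        R.bd.isSym_Qinv s hs s hs s rfl, sub_eq_add_neg, neg_mul])
    (R.conv_SL hk.le) (R.conv_Qinv hk) (R.conv_Qinv hk.le)
  rw [this]
  noncomm_ring

theorem RegData.relation_conj (hk : k ≤ n) : negOneRes T D * negOneRes (conj T) D *
    (nInt hJ φ (SL (conj T) D) g k - nInt hJ φ (SL T D) g k) =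
      (negOneRes T D * (1 - negOneRes (conj T) D) -
        negOneRes (conj T) D * (1 - negOneRes T D)) * nInt hJ φ (Qinv T D) g k := by
  have c1 := conv_add (R.conv_SL_conj hk) (conv_const_mul (-1) (R.conv_SL hk))
  have e : nInt hJ φ (SL (conj T) D) g k - nInt hJ φ (SL T D) g k =
      nInt hJ φ (fun s => SL (conj T) D s + (-1) * SL T D s) g k := by
    rw [nInt_add (R.conv_SL_conj hk) (conv_const_mul (-1) (R.conv_SL hk)),
      nInt_const_mul _ (R.conv_SL hk)]
    noncomm_ring
  rw [e, ← nInt_const_mul _ c1, ← nInt_const_mul _ (R.conv_Qinv hk)]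
  refine R.nInt_congr (fun s hs => ?_) k
  rw [← R.bd.adm.SL_conj_sub (R.bd.mem _ (neg_one_mem_wedge R.bd.gt)) (R.bd.mem s hs)
    R.bd.commute_negOneRes.symm.eq]
  noncomm_ring

/-- Multiplying the resolvent equation by `X` on the right keeps its form, since a symmetric kernel
commutes with `s` and lets this factor reach the right end. The inhomogeneous term is now the
integral of `X`. -/
theorem RegData.relation_SL_mul {X : ℍ[ℝ] → V →L[ℝ] V} (hX : IsSym c X)
    (h₁ : LineConv hJ φ (mulFun hJ (fun s => SL T D s * X s) fun z => g z * z ^ k))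
    (h₂ : LineConv hJ φ (mulFun hJ (fun s => SL T D s * X s) fun z => g z * z ^ (k + 1)))
    (h₃ : LineConv hJ φ (mulFun hJ X fun z => g z * z ^ k)) :
    (1 - negOneRes T D) * nInt hJ φ (fun s => SL T D s * X s) g k =
      negOneRes T D * (nInt hJ φ (fun s => SL T D s * X s) g (k + 1) - nInt hJ φ X g k) := by
  have := R.nInt_relation (K₁ := fun s => SL T D s * X s) (K₂ := fun s => SL T D s * X s)
    (K₃ := X) (A₁ := 1 - negOneRes T D) (A₂ := negOneRes T D) (A₃ := -negOneRes T D) (k := k)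
    (fun s hs => by
      rw [← mul_assoc, R.bd.adm.resolvent_equation (R.bd.mem _ (neg_one_mem_wedge R.bd.gt))
        (R.bd.mem s hs), mul_assoc (SL T D s), ← hX s hs s hs s rfl]
      noncomm_ring) h₁ h₂ h₃
  rw [this]
  noncomm_ring

theorem RegData.relation_P (hk : k < n) :
    (1 - negOneRes T D) * nInt hJ φ (P2L T D) g k = negOneRes T D *
      (nInt hJ φ (P2L T D) g (k + 1) - 2 * nInt hJ φ (SL T D) g k -
        2 * nInt hJ φ (SL (conj T) D) g k) := by
  have := R.relation_SL_mul R.bd.isSym_scalarQ (R.conv_SL_scalarQ hk.le) (R.conv_SL_scalarQ hk)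
    (R.conv_scalarQ hk.le)
  rw [P2L_eq, nInt_smul, nInt_smul, mul_smul_comm, this, ← mul_smul_comm, R.nInt_scalarQ hk.le,
    smul_sub, smul_smul, two_mul, two_mul]
  congr 1
  module

theorem RegData.relation_F (hk : k < n) :
    (1 - negOneRes T D) * nInt hJ φ (fun s => SL T D s * Qinv T D s) g k =
      negOneRes T D * (nInt hJ φ (fun s => SL T D s * Qinv T D s) g (k + 1) -
        nInt hJ φ (Qinv T D) g k) :=
  R.relation_SL_mul R.bd.isSym_Qinv (R.conv_SL_Qinv hk.le) (R.conv_SL_Qinv hk) (R.conv_Qinv hk.le)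

theorem RegData.isStrong_P2L (hk : k ≤ n) : IsStrong hJ T D c (nInt hJ φ (P2L T D) g k) := by
  rw [P2L_eq, nInt_smul]
  exact (R.isStrong_P hk).smul _

theorem RegData.eq_zero_of_negOneRes_mul {X : V →L[ℝ] V} (hX : negOneRes T D * X = 0) :
    X = 0 := by
  ext v
  have h1 := R.bd.mem _ (neg_one_mem_wedge R.bd.gt)
  refine R.bd.adm.negOneRes_injective h1 ?_
  have := congrArg (fun B : V →L[ℝ] V => B v) hX
  rw [zero_apply, map_zero]
  exact this

/-- By the recurrence, `R W_{k+1}` is a combination of operators that commute with `X`. As `R` is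
injective and commutes with `X`, so does `W_{k+1}`. -/
theorem RegData.commute_F_of {X : V →L[ℝ] V} (h1 : Commute X (negOneRes T D))
    (h2 : ∀ k ≤ n, Commute X (nInt hJ φ (Qinv T D) g k))
    (h3 : Commute X (nInt hJ φ (fun s => SL T D s * Qinv T D s) g 0)) :
    ∀ k ≤ n, Commute X (nInt hJ φ (fun s => SL T D s * Qinv T D s) g k) := by
  intro k
  induction k with
  | zero => intro _; exact h3
  | succ k ih =>
    intro hk
    have hr := R.relation_F (show k < n from hk)
    set W := fun k => nInt hJ φ (fun s => SL T D s * Qinv T D s) g k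
    have e : negOneRes T D * W (k + 1) =
        (1 - negOneRes T D) * W k + negOneRes T D * nInt hJ φ (Qinv T D) g k := by
      rw [hr]
      noncomm_ring
    have hc : Commute X (negOneRes T D * W (k + 1)) := by
      rw [e]
      exact (((Commute.one_right X).sub_right h1).mul_right (ih (by omega))).add_right
        (h1.mul_right (h2 k (by omega)))
    refine sub_eq_zero.1 (R.eq_zero_of_negOneRes_mul ?_)
    rw [mul_sub, ← mul_assoc, ← h1.eq, mul_assoc, hc.eq, mul_assoc, sub_self]

/-- The operators of the functional calculi. -/
def calcSet (hJ : J ∈ imSphere) (φ : ℝ) (T : V →ₗ.[ℝ] V) (D : Submodule ℝ V) (n : ℕ)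
    (c : ℝ) (g : ℂ → ℂ) : Set (V →L[ℝ] V) :=
  {A | IsStrong hJ T D c A ∨ ∃ k ≤ n, A = nInt hJ φ (fun s => SL T D s * Qinv T D s) g k}

theorem RegData.calcSet_commute : ∀ A ∈ calcSet hJ φ T D n c g, ∀ B ∈ calcSet hJ φ T D n c g,
    A * B = B * A := by
  have key : ∀ A, IsStrong hJ T D c A → ∀ k ≤ n,
      Commute A (nInt hJ φ (fun s => SL T D s * Qinv T D s) g k) := fun A hA k hk =>
    R.bd.commute_of_isWeak hA (R.isWeak_F hk)
  have hR := R.bd.isStrong_negOneRes (hJ := hJ)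
  have hW : ∀ k ≤ n, ∀ l ≤ n, Commute (nInt hJ φ (fun s => SL T D s * Qinv T D s) g k)
      (nInt hJ φ (fun s => SL T D s * Qinv T D s) g l) := by
    intro k hk
    refine R.commute_F_of (key _ hR k hk).symm
      (fun l hl => (key _ (R.isStrong_Qinv hl) k hk).symm) ?_
    -- Two weak operators are not known to commute from their form. The induction starts at the pair
    -- `(0, 0)`, reaches `(0, k)`, and then `(k, l)`.
    refine (R.commute_F_of (key _ hR 0 (Nat.zero_le n)).symm
      (fun l hl => (key _ (R.isStrong_Qinv hl) 0 (Nat.zero_le n)).symm) (Commute.refl _) k hk).symm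
  rintro A (hA | ⟨k, hk, rfl⟩) B (hB | ⟨l, hl, rfl⟩)
  · exact R.bd.commute_of_isStrong hA hB
  · exact key A hA l hl
  · exact (key B hB k hk).symm
  · exact hW k hk l hl

theorem RegData.cleared_calculi :
    negOneRes T D ^ n * negOneRes (conj T) D ^ n *
        (nInt hJ φ (SL T D) g 0 * nInt hJ φ (Qinv T D) g n -
          nInt hJ φ (Qinv T D) g 0 * nInt hJ φ (SL T D) g n) =
      nInt hJ φ (SL T D) g 0 * nInt hJ φ (SL (conj T) D) g 0 * ∑ k ∈ Finset.range n,
        clearedPow (negOneRes T D) (negOneRes (conj T) D) n (n - 1 - k) k ∧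
    negOneRes T D ^ n * negOneRes (conj T) D ^ n *
        (nInt hJ φ (SL T D) g 0 * nInt hJ φ (SL (conj T) D) g 0 * nInt hJ φ (P2L T D) g n -
          nInt hJ φ (SL (conj T) D) g 0 * nInt hJ φ (P2L T D) g 0 * nInt hJ φ (SL T D) g n -
          2 * nInt hJ φ (SL T D) g 0 * nInt hJ φ (Qinv T D) g 0 * nInt hJ φ (SL (conj T) D) g n +
          2 * nInt hJ φ (SL (conj T) D) g 0 * nInt hJ φ (Qinv T D) g 0 *
            nInt hJ φ (SL T D) g n) =
      nInt hJ φ (SL T D) g 0 ^ 2 * nInt hJ φ (SL (conj T) D) g 0 *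
        (2 * n * clearedPow (negOneRes T D) (negOneRes (conj T) D) n 0 (n - 1) +
          2 * ∑ k ∈ Finset.range n,
            clearedPow (negOneRes T D) (negOneRes (conj T) D) n (n - 1 - k) k) ∧
    negOneRes T D ^ n * negOneRes (conj T) D ^ n *
        (nInt hJ φ (SL T D) g 0 * nInt hJ φ (SL (conj T) D) g 0 *
            nInt hJ φ (fun s => SL T D s * Qinv T D s) g n -
          nInt hJ φ (SL (conj T) D) g 0 * nInt hJ φ (fun s => SL T D s * Qinv T D s) g 0 *
            nInt hJ φ (SL T D) g n -
          nInt hJ φ (SL T D) g 0 * nInt hJ φ (Qinv T D) g 0 * nInt hJ φ (Qinv T D) g n +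
          nInt hJ φ (Qinv T D) g 0 ^ 2 * nInt hJ φ (SL T D) g n) =
      nInt hJ φ (SL T D) g 0 ^ 2 * nInt hJ φ (SL (conj T) D) g 0 * ∑ k ∈ Finset.range n,
        k * clearedPow (negOneRes T D) (negOneRes (conj T) D) n (n - 1 - k) (k - 1) :=
  cleared_identities_of_commute (F := nInt hJ φ (SL T D) g) (G := nInt hJ φ (SL (conj T) D) g)
    (Y := nInt hJ φ (Qinv T D) g) (U := nInt hJ φ (P2L T D) g)
    (W := nInt hJ φ (fun s => SL T D s * Qinv T D s) g)
    (fun _ => R.eq_zero_of_negOneRes_mul) (fun _ => R.conj_data.eq_zero_of_negOneRes_mul)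
    R.calcSet_commute (Or.inl R.bd.isStrong_negOneRes) (Or.inl R.bd.isStrong_negOneRes_conj)
    (fun k hk => Or.inl (R.isStrong_SL hk)) (fun k hk => Or.inl (R.isStrong_SL_conj hk))
    (fun k hk => Or.inl (R.isStrong_Qinv hk)) (fun k hk => Or.inl (R.isStrong_P2L hk))
    (fun k hk => Or.inr ⟨k, hk, rfl⟩) (fun k hk => R.relation_SL hk)
    (fun k hk => R.conj_data.relation_SL hk) (fun k hk => R.relation_Qinv hk)
    (R.relation_conj (Nat.zero_le n)) (fun k hk => R.relation_P hk) (fun k hk => R.relation_F hk)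

end Identities

/-! ### Powers of an unbounded operator through its resolvent. -/

section Powers

open Finset

/-- `R = (1 + A)⁻¹` in the sense of graphs. -/
structure IsRes (A : V →ₗ.[ℝ] V) (R : V →L[ℝ] V) : Prop where
  mem : ∀ v, R v ∈ A.domain
  ap_res : ∀ v, ap A (R v) = v - R v
  res_ap : ∀ v ∈ A.domain, R (ap A v) = v - R v

variable {A : V →ₗ.[ℝ] V} {R : V →L[ℝ] V}

theorem IsRes.injective (h : IsRes A R) : Function.Injective R :=
  (injective_iff_map_eq_zero _).2 fun v hv => by
    have := h.ap_res v
    rwa [hv, ap_zero_vec, sub_zero, eq_comm] at this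

theorem pow_apply_succ (B : V →L[ℝ] V) (n : ℕ) (v : V) : (B ^ (n + 1)) v = (B ^ n) (B v) := by
  rw [pow_succ, mul_apply_eq_comp]

theorem pow_apply_succ' (B : V →L[ℝ] V) (n : ℕ) (v : V) : (B ^ (n + 1)) v = B ((B ^ n) v) := by
  rw [pow_succ', mul_apply_eq_comp]

theorem injective_pow {B : V →L[ℝ] V} (h : Function.Injective B) (n : ℕ) :
    Function.Injective (B ^ n) := by
  induction n with
  | zero => exact fun v w h => h
  | succ n ih =>
    intro v w hvw
    rw [pow_apply_succ, pow_apply_succ] at hvw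
    exact h (ih hvw)

theorem commute_one_sub (B : V →L[ℝ] V) : Commute B (1 - B) :=
  (Commute.one_right B).sub_right (Commute.refl B)

theorem _root_.Commute.apply_apply {B C : V →L[ℝ] V} (h : Commute B C) (v : V) : B (C v) = C (B v) :=
  congrArg (fun X : V →L[ℝ] V => X v) h.eq

theorem IsRes.pow_of_mem (h : IsRes A R) {n : ℕ} {v : V} (hv : v ∈ (opPow A n).domain) :
    ((1 - R) ^ n) v = (R ^ n) (ap (opPow A n) v) := by
  induction n with
  | zero => exact (ap_total (ContinuousLinearMap.id ℝ V) v).symm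
  | succ n ih =>
    have hv' := mem_opComp.1 hv
    have e : ap (opPow A (n + 1)) v = ap A (ap (opPow A n) v) := ap_opComp hv
    have hr := h.res_ap _ hv'.2
    rw [e, pow_apply_succ R, hr, pow_apply_succ', ih hv'.1, map_sub, sub_apply, one_apply_eq_self,
      ← pow_apply_succ', ← pow_apply_succ]

theorem IsRes.ap_pow (h : IsRes A R) (n : ℕ) (v : V) :
    (R ^ n) v ∈ (opPow A n).domain ∧ ap (opPow A n) ((R ^ n) v) = ((1 - R) ^ n) v := by
  induction n generalizing v with
  | zero => exact ⟨trivial, ap_total (ContinuousLinearMap.id ℝ V) v⟩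
  | succ n ih =>
    obtain ⟨h1, h2⟩ := ih (R v)
    have e : ((1 - R) ^ n) (R v) = R (((1 - R) ^ n) v) :=
      ((commute_one_sub R).pow_right n).symm.apply_apply v
    have hm : (R ^ (n + 1)) v ∈ (opPow A (n + 1)).domain := by
      rw [pow_apply_succ]
      refine mem_opComp.2 ⟨h1, ?_⟩
      rw [h2, e]
      exact h.mem _
    refine ⟨hm, ?_⟩
    have e' : ap (opPow A (n + 1)) ((R ^ (n + 1)) v) = ap A (ap (opPow A n) ((R ^ (n + 1)) v)) :=
      ap_opComp hm
    rw [e', pow_apply_succ, h2, e, h.ap_res, pow_apply_succ', sub_apply, one_apply_eq_self]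

/-- The graph of `A^n` in terms of bounded operators. -/
theorem IsRes.of_pow (h : IsRes A R) {n : ℕ} {v w : V} (hvw : ((1 - R) ^ n) v = (R ^ n) w) :
    v ∈ (opPow A n).domain ∧ ap (opPow A n) v = w := by
  -- Bézout: `a X^n + b (1 - X)^n = 1` at `R`, together with `(1 - R)^n v = R^n w`, gives `v = R^n
  -- (a(R) v + b(R) w)`. So `v` lies in the range of `R^n`, and hence in the domain of `A^n`.
  have hc : IsCoprime (Polynomial.X ^ n : Polynomial ℝ) ((1 - Polynomial.X) ^ n) :=
    IsCoprime.pow ⟨1, 1, by ring⟩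
  obtain ⟨a, b, hab⟩ := hc
  have hab' := congrArg (fun p => (Polynomial.aeval R p : V →L[ℝ] V) v) hab
  set a' := Polynomial.aeval R a
  set b' := Polynomial.aeval R b
  have ha : Commute R a' := by
    simpa using (Polynomial.commute_X a).map (Polynomial.aeval R)
  have hb : Commute R b' := by
    simpa using (Polynomial.commute_X b).map (Polynomial.aeval R)
  simp only [map_add, map_mul, map_pow, map_sub, map_one, Polynomial.aeval_X, add_apply,
    mul_apply_eq_comp, one_apply_eq_self] at hab'
  rw [hvw, ← (ha.pow_left n).apply_apply, ← (hb.pow_left n).apply_apply, ← map_add] at hab'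
  rw [← hab'] at hvw ⊢
  obtain ⟨h1, h2⟩ := h.ap_pow n (a' v + b' w)
  refine ⟨h1, h2.trans (injective_pow h.injective n ?_)⟩
  rw [← hvw]
  exact (((commute_one_sub R).pow_right n).pow_left n).apply_apply _

variable {A' : V →ₗ.[ℝ] V} {R' : V →L[ℝ] V}

/-- On the domain of `A'^a A^b` each power of `1 - R` or `1 - R'` can be traded for a power of the
operator times the same power of its resolvent; both resolvent exponents fill up to `n`. -/
theorem IsRes.clearedPow_apply (h : IsRes A R) (h' : IsRes A' R') (hc : Commute R R') {n a b : ℕ}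
    (ha : a ≤ n) (hb : b ≤ n) {v : V} (hv : v ∈ (opPow A b).domain)
    (hv' : ap (opPow A b) v ∈ (opPow A' a).domain) :
    clearedPow R R' n a b v = (R ^ n * R' ^ n) (ap (opPow A' a) (ap (opPow A b) v)) := by
  have h1 := h.pow_of_mem hv
  have h2 := h'.pow_of_mem hv'
  set u := ap (opPow A b) v
  set w := ap (opPow A' a) u
  have hc' : Commute ((1 - R') ^ a) (R ^ b) :=
    (((Commute.one_right R).sub_right hc).pow_pow b a).symm
  have e1 : R ^ n = R ^ (n - b) * R ^ b := by rw [← pow_add, Nat.sub_add_cancel hb]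
  have e2 : R' ^ n = R' ^ (n - a) * R' ^ a := by rw [← pow_add, Nat.sub_add_cancel ha]
  rw [clearedPow, mul_apply_eq_comp, h1, mul_apply_eq_comp, hc'.apply_apply, h2,
    mul_apply_eq_comp, mul_apply_eq_comp, e1, e2, mul_apply_eq_comp, mul_apply_eq_comp,
    (hc.pow_pow b (n - a)).symm.apply_apply]

theorem ker_total_eq_bot {M : V →L[ℝ] V} (hM : Function.Injective M) :
    LinearMap.ker (total M).toFun = ⊥ :=
  LinearMap.ker_eq_bot.2 fun v w hvw => Subtype.ext (hM hvw)

theorem ap_inverse_comp {M Z : V →L[ℝ] V} (hM : Function.Injective M) {v w : V}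
    (hvw : M w = Z v) : v ∈ (opComp (total M).inverse (total Z)).domain ∧
      ap (opComp (total M).inverse (total Z)) v = w := by
  have hd : v ∈ (opComp (total M).inverse (total Z)).domain := by
    refine mem_opComp.2 ⟨trivial, mem_inverse_domain.2 ⟨w, trivial, ?_⟩⟩
    rw [ap_total, ap_total, hvw]
  refine ⟨hd, ?_⟩
  rw [ap_opComp hd, ap_total, ← hvw, ← ap_total M w]
  exact ap_inverse (ker_total_eq_bot hM) trivial

theorem exists_of_mem_inverse_comp {M Z : V →L[ℝ] V} {v : V}
    (hv : v ∈ (opComp (total M).inverse (total Z)).domain) : ∃ w, M w = Z v := by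
  obtain ⟨w, -, hw⟩ := mem_inverse_domain.1 (mem_opComp.1 hv).2
  rw [ap_total, ap_total] at hw
  exact ⟨w, hw⟩

/-- A quotient of bounded operators is a power. -/
theorem IsRes.inverse_comp_eq_opPow (h : IsRes A R) {M Z : V →L[ℝ] V} {n : ℕ}
    (hM : Function.Injective M) (hc : Commute R M) (he : (1 - R) ^ n * M = R ^ n * Z) :
    opComp (total M).inverse (total Z) = opPow A n := by
  have key : ∀ v w, M w = Z v ↔ ((1 - R) ^ n) v = (R ^ n) w := by
    intro v w
    have e1 : M (((1 - R) ^ n) v) = (R ^ n) (Z v) := by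
      have hc' : Commute M ((1 - R) ^ n) := ((Commute.one_right M).sub_right hc.symm).pow_right n
      rw [hc'.apply_apply]
      exact congrArg (fun X : V →L[ℝ] V => X v) he
    constructor
    · intro hw
      refine hM ?_
      rw [e1, ← hw, (hc.pow_left n).apply_apply]
    · intro hw
      refine injective_pow h.injective n ?_
      rw [← e1, hw, (hc.pow_left n).apply_apply]
  have hd : ∀ v ∈ (opComp (total M).inverse (total Z)).domain, v ∈ (opPow A n).domain ∧
      ap (opPow A n) v = ap (opComp (total M).inverse (total Z)) v := by
    intro v hv
    obtain ⟨w, hw⟩ := exists_of_mem_inverse_comp hv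
    rw [(ap_inverse_comp hM hw).2]
    exact h.of_pow ((key v w).1 hw)
  refine ext_ap (le_antisymm (fun v hv => (hd v hv).1) fun v hv => ?_) fun v hv => (hd v hv).2.symm
  exact (ap_inverse_comp hM ((key v _).2 (h.pow_of_mem hv))).1

/-- An operator below a quotient of bounded operators. -/
theorem le_inverse_comp {B : V →ₗ.[ℝ] V} {M Z N H : V →L[ℝ] V} (hM : Function.Injective M)
    (hN : Function.Injective N) (hc : Commute N M) (he : N * Z = M * H)
    (hB : ∀ v ∈ B.domain, H v = N (ap B v)) : B ≤ opComp (total M).inverse (total Z) := by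
  refine le_of_ap fun v hv => ?_
  have hvw : M (ap B v) = Z v := by
    refine hN ?_
    rw [hc.apply_apply, ← hB v hv]
    exact (congrArg (fun X : V →L[ℝ] V => X v) he).symm
  obtain ⟨h1, h2⟩ := ap_inverse_comp hM hvw
  exact ⟨h1, h2.symm⟩

theorem IsAdmissible.isRes {T : V →ₗ.[ℝ] V} {D : Submodule ℝ V} (hT : IsAdmissible T D)
    (h : (-1 : ℍ[ℝ]) ∈ rhoF T D) : IsRes T (negOneRes T D) where
  mem := hT.negOneRes_mem h
  ap_res := hT.ap_negOneRes h
  res_ap _ := hT.negOneRes_ap h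

section Sums

variable (h : IsRes A R) (h' : IsRes A' R') (hc : Commute R R') (n : ℕ)
include h h' hc

theorem IsRes.sum_clearedPow_apply {ι : Type*} {s : Finset ι} (a b : ι → ℕ) (x : ι → ℝ)
    (ha : ∀ i ∈ s, a i ≤ n) (hb : ∀ i ∈ s, b i ≤ n) {v : V}
    (hv : v ∈ (∑ i ∈ s, x i • opComp (opPow A' (a i)) (opPow A (b i))).domain) :
    (∑ i ∈ s, x i • clearedPow R R' n (a i) (b i)) v =
      (R ^ n * R' ^ n) (ap (∑ i ∈ s, x i • opComp (opPow A' (a i)) (opPow A (b i))) v) := by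
  have hv' := mem_sum_domain.1 hv
  rw [ap_sum hv', map_sum, _root_.sum_apply]
  refine sum_congr rfl fun i hi => ?_
  have hm : v ∈ (opComp (opPow A' (a i)) (opPow A (b i))).domain := hv' i hi
  rw [ap_smul, map_smul, smul_apply, ap_opComp hm,
    h.clearedPow_apply h' hc (ha i hi) (hb i hi) (mem_opComp.1 hm).1 (mem_opComp.1 hm).2]

end Sums

end Powers

/-! ### From identities of bounded operators to the four calculi. -/

section Calculi

open Complex Set Filter Topology

variable {T : V →ₗ.[ℝ] V} {D : Submodule ℝ V} {α β θ φ ω c : ℝ} {J : ℍ[ℝ]} {n : ℕ}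
  {e : ℍ[ℝ] → ℍ[ℝ]} {g : ℂ → ℂ}

theorem cos_half_lt (hω : ω ∈ Ioo 0 Real.pi) (hφ : φ ∈ Ioo ω Real.pi) :
    (ω + φ) / 2 ∈ Ioo ω Real.pi ∧ Real.cos φ < Real.cos ((ω + φ) / 2) := by
  obtain ⟨h1, h2⟩ := hφ
  refine ⟨⟨by linarith, by linarith⟩,
    Real.cos_lt_cos_of_nonneg_of_le_pi (by linarith [hω.1]) h2.le (by linarith)⟩

/-- The wedge is taken at the middle angle between `ω` and `φ`: it stays away from the spectrum and
contains the contour in its interior. -/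
theorem IsRegularizer.regData (hα : 1 / 3 ≤ α) (hβ : β ∈ Ioc 0 (1 / 3)) (hω : ω ∈ Ioo 0 Real.pi)
    (hT : IsOfType T D α β ω) (hθ : θ ∈ Ioo ω Real.pi) (hφ : φ ∈ Ioo ω θ) (hJ : J ∈ imSphere)
    (he : IsRegularizer T D φ J α β θ e (fun s => s ^ n)) (hg : Represents θ e g) :
    RegData hJ T D α β (Real.cos ((ω + φ) / 2)) θ φ n g := by
  have hφ' : φ ∈ Ioo 0 θ := ⟨hω.1.trans hφ.1, hφ.2⟩
  obtain ⟨h1, h2⟩ := cos_half_lt hω ⟨hφ.1, hφ.2.trans hθ.2⟩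
  have hgn := hg.mul (represents_pow θ n)
  refine ⟨hT.hasBound hω h1, hα, hβ.1, hβ.2, h2, hφ', hθ.2.le, hg.diff, hg.map_conj, ?_, ?_,
    (converges_iff hJ hφ' hθ.2.le hg).1 he.converges,
    (converges_iff hJ hφ' hθ.2.le hg).1 he.converges_conj,
    (converges_iff hJ hφ' hθ.2.le hgn).1 he.converges_mul,
    (converges_iff hJ hφ' hθ.2.le hgn).1 he.converges_mul_conj⟩
  · obtain ⟨δ, hδ, C, hC, h⟩ := he.mem_psi.2
    refine ⟨δ, hδ, C, hC, fun z hz hz1 => ?_⟩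
    have := (h _ ((sl_mem_sector hJ).2 hz)).1
    rw [hg.eq J hJ z hz, norm_sl, norm_sl] at this
    exact this hz1
  · obtain ⟨δ, hδ, C, hC, h⟩ := he.mul_mem_psiL.2
    refine ⟨δ, hδ, C, hC, fun z hz hz1 => ?_⟩
    have := (h _ ((sl_mem_sector hJ).2 hz)).2
    rw [hgn.eq J hJ z hz, norm_sl, norm_sl] at this
    exact this hz1

theorem smul_pathIntegral_eq (hJ : J ∈ imSphere) (hφ : φ ∈ Ioo 0 θ) (hθ : θ ≤ Real.pi)
    (hg : Represents θ e g) (K : ℍ[ℝ] → V →L[ℝ] V) :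
    (1 / (2 * Real.pi)) • pathIntegral K φ J e = nInt hJ φ K g 0 := by
  have : (fun z => g z * z ^ 0) = g := by
    ext1 z
    rw [pow_zero, mul_one]
  rw [pathIntegral_eq hJ hφ hθ hg, nInt, this]

theorem smul_pathIntegral_mul_eq (hJ : J ∈ imSphere) (hφ : φ ∈ Ioo 0 θ) (hθ : θ ≤ Real.pi)
    (hg : Represents θ e g) (K : ℍ[ℝ] → V →L[ℝ] V) (n : ℕ) :
    (1 / (2 * Real.pi)) • pathIntegral K φ J (e * fun s => s ^ n) = nInt hJ φ K g n := by
  rw [pathIntegral_eq hJ hφ hθ (hg.mul (represents_pow θ n)), nInt]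
  rfl

theorem neg_one_div_pi_smul {E : Type*} [AddCommGroup E] [Module ℝ E] (x : E) :
    (-1 / Real.pi) • x = (-2 : ℝ) • (1 / (2 * Real.pi)) • x := by
  rw [smul_smul]
  congr 1
  field_simp

theorem RegData.isRes {hJ : J ∈ imSphere} (R : RegData hJ T D α β c θ φ n g) :
    IsRes T (negOneRes T D) :=
  R.bd.adm.isRes (R.bd.mem _ (neg_one_mem_wedge R.bd.gt))

theorem RegData.pow_relation_SL {hJ : J ∈ imSphere} (R : RegData hJ T D α β c θ φ n g) :
    ∀ k ≤ n, (1 - negOneRes T D) ^ k * nInt hJ φ (SL T D) g 0 =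
      negOneRes T D ^ k * nInt hJ φ (SL T D) g k := by
  intro k
  induction k with
  | zero => intro _; rw [pow_zero, pow_zero]
  | succ k ih =>
    intro hk
    rw [pow_succ', mul_assoc, ih (by omega), ← mul_assoc,
      ((commute_one_sub _).symm.pow_right k).eq, mul_assoc, R.relation_SL (by omega), ← mul_assoc,
      ← pow_succ]

/-- The functional calculi of the monomials. -/
theorem hinf_pow (hα : 1 / 3 ≤ α) (hβ : β ∈ Ioc 0 (1 / 3)) (hω : ω ∈ Ioo 0 Real.pi)
    (hT : IsOfType T D α β ω) (hθ : θ ∈ Ioo ω Real.pi) (hφ : φ ∈ Ioo ω θ) (hJ : J ∈ imSphere)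
    (he : IsRegularizer T D φ J α β θ e (fun s => s ^ n)) :
    (∀ K ∈ [Qinv T D, P2L T D, FL T D],
      Converges K φ J e ∧ Converges K φ J (e * fun s => s ^ n)) ∧
    hinfS T D φ J e (fun s => s ^ n) = opPow T n ∧
    (-2 : ℝ) • ∑ k ∈ Finset.range n, opComp (opPow (conj T) (n - 1 - k)) (opPow T k) ≤
      hinfQ T D φ J e (fun s => s ^ n) ∧
    (2 * n : ℝ) • opPow T (n - 1) +
        (2 : ℝ) • ∑ k ∈ Finset.range n, opComp (opPow (conj T) (n - 1 - k)) (opPow T k) ≤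
      hinfP T D φ J e (fun s => s ^ n) ∧
    (-4 : ℝ) • ∑ k ∈ Finset.Icc 1 (n - 1), (k : ℝ) •
        opComp (opPow (conj T) (n - 1 - k)) (opPow T (k - 1)) ≤
      hinfF T D φ J e (fun s => s ^ n) := by
  obtain ⟨g, hg⟩ := exists_represents he.mem_psi.1
  have R := he.regData hα hβ hω hT hθ hφ hJ hg
  have hφ' := R.angle
  have hθ' := R.le_pi
  have hgn := hg.mul (represents_pow θ n)
  have hg0 : (fun z => g z * z ^ 0) = g := by
    ext1 z
    rw [pow_zero, mul_one]
  have hr := R.isRes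
  have hr' := R.conj_data.isRes
  have hrc : Commute (negOneRes T D) (negOneRes (conj T) D) := R.bd.commute_negOneRes
  have hinjN := (injective_pow hr.injective n).comp (injective_pow hr'.injective n)
  have hinjE := he.injective
  have hinjE' := he.injective_conj
  obtain ⟨k1, k2, k3⟩ := R.cleared_calculi
  have cE : ∀ x ∈ [negOneRes T D, negOneRes (conj T) D],
      ∀ y ∈ [nInt hJ φ (SL T D) g 0, nInt hJ φ (SL (conj T) D) g 0], Commute x y := by
    have h1 := R.bd.isStrong_negOneRes (hJ := hJ)
    have h2 := R.bd.isStrong_negOneRes_conj (hJ := hJ)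
    have h3 := R.isStrong_SL (Nat.zero_le n)
    have h4 := R.isStrong_SL_conj (Nat.zero_le n)
    intro x hx y hy
    simp only [List.mem_cons, List.not_mem_nil, or_false] at hx hy
    rcases hx with rfl | rfl <;> rcases hy with rfl | rfl
    exacts [R.bd.commute_of_isStrong h1 h3, R.bd.commute_of_isStrong h1 h4,
      R.bd.commute_of_isStrong h2 h3, R.bd.commute_of_isStrong h2 h4]
  simp only [calcS, smul_pathIntegral_eq hJ hφ' hθ' hg] at hinjE hinjE'
  simp only [hinfS, hinfQ, hinfP, hinfF, calcS, calcQ, calcP, calcF, neg_one_div_pi_smul,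
    smul_pathIntegral_eq hJ hφ' hθ' hg, smul_pathIntegral_mul_eq hJ hφ' hθ' hg]
  set r := negOneRes T D with hrdef
  set r' := negOneRes (conj T) D with hrdef'
  set E := nInt hJ φ (SL T D) g 0 with hE
  set E' := nInt hJ φ (SL (conj T) D) g 0 with hE'
  have c1 : Commute r E := cE _ (by simp) _ (by simp)
  have c2 : Commute r E' := cE _ (by simp) _ (by simp)
  have c3 : Commute r' E := cE _ (by simp) _ (by simp)
  have c4 : Commute r' E' := cE _ (by simp) _ (by simp)
  -- The clearing factor `R^n R'^n` must commute with the regularizing factor, so that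
  -- `le_inverse_comp` can cancel it.
  have cN : ∀ X, Commute r X → Commute r' X → Commute (r ^ n * r' ^ n) X := fun X h1 h2 =>
    (h1.pow_left n).mul_left (h2.pow_left n)
  refine ⟨?_, ?_, ?_, ?_, ?_⟩
  · have hconv : ∀ K : ℍ[ℝ] → V →L[ℝ] V,
        (∀ k ≤ n, LineConv hJ φ (mulFun hJ K fun z => g z * z ^ k)) →
        Converges K φ J e ∧ Converges K φ J (e * fun s => s ^ n) := fun K hK => by
      refine ⟨(converges_iff hJ hφ' hθ' hg).2 ?_, (converges_iff hJ hφ' hθ' hgn).2 (hK n le_rfl)⟩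
      rw [← hg0]
      exact hK 0 (Nat.zero_le n)
    intro K hK
    simp only [List.mem_cons, List.not_mem_nil, or_false] at hK
    rcases hK with rfl | rfl | rfl
    exacts [hconv _ fun k hk => R.conv_Qinv hk, hconv _ fun k hk => R.conv_P2L hk,
      hconv _ fun k hk => R.conv_FL hk]
  · exact hr.inverse_comp_eq_opPow hinjE c1 (R.pow_relation_SL n le_rfl)
  · refine le_inverse_comp (N := r ^ n * r' ^ n) (H := (-2 : ℝ) • ∑ k ∈ Finset.range n,
      clearedPow r r' n (n - 1 - k) k) (hinjE.comp hinjE') hinjN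
      (cN _ (c1.mul_right c2) (c3.mul_right c4)) ?_ fun v hv => ?_
    · rw [mul_smul_comm (-2 : ℝ) (E * E'), ← k1, mul_smul_comm, smul_mul_assoc, ← smul_sub,
        mul_smul_comm]
    · have := hr.sum_clearedPow_apply hr' hrc n (s := Finset.range n) (fun k => n - 1 - k)
        (fun k => k) (fun _ => 1) (fun k _ => by omega)
        (fun k hk => (Finset.mem_range.1 hk).le) (v := v)
      simp only [one_smul] at this
      rw [smul_apply, this hv, ap_smul, map_smul]
  · refine le_inverse_comp (N := r ^ n * r' ^ n) (H := (2 * n * clearedPow r r' n 0 (n - 1) +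
      2 * ∑ k ∈ Finset.range n, clearedPow r r' n (n - 1 - k) k))
      ((injective_pow hinjE 2).comp hinjE') hinjN
      (cN _ ((c1.pow_right 2).mul_right c2) ((c3.pow_right 2).mul_right c4)) ?_ fun v hv => ?_
    · rw [← k2]
      congr 1
      have two : (2 : V →L[ℝ] V) = (2 : ℝ) • 1 := by
        rw [two_smul]
        norm_num
      simp only [two, smul_mul_assoc, mul_smul_comm, neg_smul, one_mul, neg_mul, mul_neg]
      abel
    · have := hr.sum_clearedPow_apply hr' hrc n (s := Finset.range n) (fun k => n - 1 - k)
        (fun k => k) (fun _ => 1) (fun k _ => by omega)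
        (fun k hk => (Finset.mem_range.1 hk).le) (v := v)
      simp only [one_smul] at this
      have hv' := mem_add_domain.1 hv
      have h0 := hr.clearedPow_apply hr' hrc (n := n) (a := 0) (b := n - 1) (Nat.zero_le n)
        (by omega) (v := v) hv'.1 trivial
      have hid : ∀ w, ap (opPow (conj T) 0) w = w := fun w =>
        ap_total (ContinuousLinearMap.id ℝ V) w
      rw [hid] at h0
      have e2 : (2 * n * clearedPow r r' n 0 (n - 1) +
          2 * ∑ k ∈ Finset.range n, clearedPow r r' n (n - 1 - k) k) =
          (2 * n : ℝ) • clearedPow r r' n 0 (n - 1) +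
          (2 : ℝ) • ∑ k ∈ Finset.range n, clearedPow r r' n (n - 1 - k) k := by
        have hn : (n : V →L[ℝ] V) = (n : ℝ) • 1 := by
          rw [Nat.cast_smul_eq_nsmul, nsmul_one]
        rw [hn, two_mul, two_mul, two_mul, add_smul, two_smul]
        simp only [← add_smul, smul_mul_assoc, one_mul]
      rw [e2, add_apply, smul_apply, smul_apply, this hv'.2, h0, ap_add hv'.1 hv'.2, ap_smul,
        ap_smul, map_add, map_smul, map_smul]
  -- The term `k = 0` of the algebraic sum has coefficient zero. It is dropped here because a zero
  -- multiple of an unbounded operator would still restrict the domain.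
  · have esum : ∑ k ∈ Finset.range n, k * clearedPow r r' n (n - 1 - k) (k - 1) =
        ∑ k ∈ Finset.Icc 1 (n - 1), (k : ℝ) • clearedPow r r' n (n - 1 - k) (k - 1) := by
      symm
      have hk : ∀ k : ℕ, (k : ℝ) • clearedPow r r' n (n - 1 - k) (k - 1) =
          k * clearedPow r r' n (n - 1 - k) (k - 1) := fun k => by
        rw [Nat.cast_smul_eq_nsmul, nsmul_eq_mul]
      simp only [hk]
      refine Finset.sum_subset (fun k hk => ?_) fun k hk hk' => ?_
      · have := Finset.mem_Icc.1 hk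
        exact Finset.mem_range.2 (by omega)
      · have : k = 0 := by
          rw [Finset.mem_range] at hk
          rw [Finset.mem_Icc] at hk'
          omega
        rw [this, Nat.cast_zero, zero_mul]
    rw [esum] at k3
    refine le_inverse_comp (N := r ^ n * r' ^ n) (H := (-4 : ℝ) • ∑ k ∈ Finset.Icc 1 (n - 1),
      (k : ℝ) • clearedPow r r' n (n - 1 - k) (k - 1)) ((injective_pow hinjE 2).comp hinjE') hinjN
      (cN _ ((c1.pow_right 2).mul_right c2) ((c3.pow_right 2).mul_right c4)) ?_ fun v hv => ?_
    · have eF : ∀ k, nInt hJ φ (FL T D) g k =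
          (-4 : ℝ) • nInt hJ φ (fun s => SL T D s * Qinv T D s) g k := fun k => nInt_smul _ _
      rw [mul_smul_comm (-4 : ℝ) (E ^ 2 * E'), ← k3, ← mul_smul_comm]
      congr 1
      rw [eF, eF, sq, sq]
      simp only [smul_mul_assoc, mul_smul_comm, smul_sub, smul_add]
      module
    · rw [smul_apply, hr.sum_clearedPow_apply hr' hrc n (fun k => n - 1 - k) (fun k => k - 1)
        (fun k => (k : ℝ)) (fun k _ => by omega) (fun k hk => ?_) hv, ap_smul, map_smul]
      have := Finset.mem_Icc.1 hk
      omega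

end Calculi

/-! ### Rational functions on the contour. -/

section Elementary

open Complex Set Filter Topology

/-- The constant is optimal in form: `1 + 2 c r + r² - (1 + c)/2 (1 + r)² = (1 - c)/2 (1 - r)²`. -/
theorem sqrt_mul_one_add_le {c r x q : ℝ} (hc : -1 ≤ c) (hc' : c ≤ 1) (hr : 0 ≤ r) (hq : 0 ≤ q)
    (e : q ^ 2 = 1 + 2 * x + r ^ 2) (h : c * r ≤ x) : √((1 + c) / 2) * (1 + r) ≤ q := by
  refine le_of_sq_le_sq ?_ hq
  rw [mul_pow, Real.sq_sqrt (by linarith), e]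
  nlinarith [mul_nonneg (sub_nonneg.2 hc') (sq_nonneg (1 - r))]

theorem le_norm_one_add {c : ℝ} (hc : -1 ≤ c) (hc' : c ≤ 1) {z : ℂ} (h : c * ‖z‖ ≤ z.re) :
    √((1 + c) / 2) * (1 + ‖z‖) ≤ ‖1 + z‖ := by
  refine sqrt_mul_one_add_le hc hc' (norm_nonneg z) (norm_nonneg _) ?_ h
  rw [Complex.sq_norm, Complex.sq_norm, normSq_apply, normSq_apply]
  simp only [add_re, one_re, add_im, one_im, zero_add]
  ring

theorem le_norm_one_sub {c : ℝ} (hc : -1 ≤ c) (hc' : c ≤ 1) {z : ℂ} (h : z.re ≤ c * ‖z‖) :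
    √((1 - c) / 2) * (1 + ‖z‖) ≤ ‖1 - z‖ := by
  have := le_norm_one_add (c := -c) (z := -z) (by linarith) (by linarith)
    (by rw [norm_neg, neg_re]; linarith)
  rwa [norm_neg, ← sub_eq_add_neg, ← sub_eq_add_neg] at this

theorem le_norm_one_add_quaternion {c : ℝ} (hc : -1 ≤ c) (hc' : c ≤ 1) {s : ℍ[ℝ]}
    (h : c * ‖s‖ ≤ s.re) : √((1 + c) / 2) * (1 + ‖s‖) ≤ ‖1 + s‖ := by
  refine sqrt_mul_one_add_le hc hc' (norm_nonneg s) (norm_nonneg _) ?_ h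
  rw [sq, sq, ← Quaternion.normSq_eq_norm_mul_self, ← Quaternion.normSq_eq_norm_mul_self,
    Quaternion.normSq_def', Quaternion.normSq_def']
  simp only [Quaternion.re_add, Quaternion.imI_add, Quaternion.imJ_add, Quaternion.imK_add,
    Quaternion.re_one, Quaternion.imI_one, Quaternion.imJ_one, Quaternion.imK_one, zero_add]
  ring

theorem pow_mul_inv_le_of_le_one {κ r q : ℝ} (hκ : 0 < κ) (hr : 0 ≤ r) (hq : κ * (1 + r) ≤ q)
    (b k : ℕ) : r ^ b * (q ^ k)⁻¹ ≤ (κ ^ k)⁻¹ * r ^ b := by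
  rw [mul_comm]
  gcongr
  nlinarith

theorem pow_mul_inv_le_of_one_le {κ r q : ℝ} (hκ : 0 < κ) (hr : 1 ≤ r) (hq : κ * (1 + r) ≤ q)
    {b k i : ℕ} (h : b + i ≤ k) : r ^ b * (q ^ k)⁻¹ ≤ (κ ^ k)⁻¹ * (r ^ i)⁻¹ := by
  have h0 : 0 < r := by linarith
  calc r ^ b * (q ^ k)⁻¹ ≤ r ^ b * ((κ * r) ^ k)⁻¹ := by
        gcongr
        nlinarith
    _ = (κ ^ k)⁻¹ * (r ^ b * (r ^ k)⁻¹) := by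
        rw [mul_pow, mul_inv]
        ring
    _ ≤ (κ ^ k)⁻¹ * (r ^ i)⁻¹ := by
        gcongr
        rw [← div_eq_mul_inv, div_le_iff₀ (by positivity), inv_mul_eq_div,
          le_div_iff₀ (by positivity), ← pow_add]
        exact pow_le_pow_right₀ hr h

variable {J : ℍ[ℝ]} {φ : ℝ} {F F₁ F₂ : ℂ → V →L[ℝ] V}

theorem lineInt_relation (hJ : J ∈ imSphere) {A B : V →L[ℝ] V} (h₁ : LineConv hJ φ F₁)
    (h₂ : LineConv hJ φ F₂)
    (he : ∀ t ≠ 0, F (gammaC φ t) = A * F₁ (gammaC φ t) + B * F₂ (gammaC φ t)) :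
    lineInt hJ φ F = A * lineInt hJ φ F₁ + B * lineInt hJ φ F₂ := by
  rw [← lineInt_const_mul hJ A h₁, ← lineInt_const_mul hJ B h₂,
    ← lineInt_add hJ (h₁.const_mul hJ A) (h₂.const_mul hJ B)]
  exact lineInt_congr hJ he

theorem norm_leftMul_sl_le (hJ : J ∈ imSphere) (z : ℂ) :
    ‖(leftMul (sl hJ z) : V →L[ℝ] V)‖ ≤ ‖(1 : V →L[ℝ] V)‖ * ‖z‖ := by
  have := norm_mulFun (V := V) (K := fun _ => 1) (g := fun z => z) hJ z
  rw [mulFun, one_mul] at this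
  exact this.le

theorem continuousAt_leftMul_sl (hJ : J ∈ imSphere) {g : ℂ → ℂ} {z : ℂ} (hg : ContinuousAt g z) :
    ContinuousAt (fun z => (leftMul (sl hJ (g z)) : V →L[ℝ] V)) z :=
  continuous_leftMul.continuousAt.comp ((continuous_sl hJ).continuousAt.comp hg)

theorem decayFun_one_of_le {r : ℝ} (hr : 0 < r) (h : r ≤ 1) : decayFun 1 r = 1 := by
  rw [decayFun, abs_of_pos hr, if_pos h]
  norm_num

theorem decayFun_one_of_ge {r : ℝ} (h : 1 ≤ r) : decayFun 1 r = (r ^ 2)⁻¹ := by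
  have h0 : 0 < r := by linarith
  rw [decayFun, abs_of_pos h0]
  split_ifs with h'
  · obtain rfl := le_antisymm h' h
    norm_num
  · rw [← Real.rpow_natCast, ← Real.rpow_neg h0.le]
    norm_num

theorem decayFun_abs (δ t : ℝ) : decayFun δ |t| = decayFun δ t := by
  simp only [decayFun, abs_abs]

/-- The scalar functions of the construction are integrable, and satisfy Cauchy's theorem. -/
theorem rational_bound {κ : ℝ} (hκ : 0 < κ) {b k : ℕ} (h : b + 2 ≤ k) {z : ℂ} (hz : 0 < ‖z‖)
    (hq : κ * (1 + ‖z‖) ≤ ‖1 + z‖) :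
    ‖z ^ b * ((1 + z) ^ k)⁻¹‖ ≤ (κ ^ k)⁻¹ * decayFun 1 ‖z‖ := by
  rw [norm_mul, norm_inv, norm_pow, norm_pow]
  rcases le_total ‖z‖ 1 with h1 | h1
  · rw [decayFun_one_of_le hz h1, mul_one]
    refine (pow_mul_inv_le_of_le_one hκ hz.le hq b k).trans ?_
    exact mul_le_of_le_one_right (by positivity) (pow_le_one₀ hz.le h1)
  · rw [decayFun_one_of_ge h1]
    exact pow_mul_inv_le_of_one_le hκ h1 hq h

theorem one_add_ne_zero_of_bound {κ : ℝ} (hκ : 0 < κ) {z : ℂ} (hq : κ * (1 + ‖z‖) ≤ ‖1 + z‖) :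
    1 + z ≠ 0 := by
  have : 0 < κ * (1 + ‖z‖) := by positivity
  exact norm_pos_iff.1 (this.trans_le hq)

theorem polarPt_re (r ψ : ℝ) : (⟨(polarPt r ψ).1, (polarPt r ψ).2⟩ : ℂ).re = Real.cos ψ * r := by
  rw [mul_comm]
  rfl

theorem differentiableAt_rational {z : ℂ} (hz : 1 + z ≠ 0) (b k : ℕ) :
    DifferentiableAt ℂ (fun z : ℂ => z ^ b * ((1 + z) ^ k)⁻¹) z :=
  (differentiableAt_id.pow b).mul
    ((((differentiableAt_const 1).add differentiableAt_id).pow k).inv (pow_ne_zero k hz))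

variable (hJ : J ∈ imSphere) (hφ : φ ∈ Ioo 0 Real.pi)
include hφ

theorem neg_one_lt_cos : -1 < Real.cos φ := by
  rw [← Real.cos_pi]
  exact Real.cos_lt_cos_of_nonneg_of_le_pi hφ.1.le le_rfl hφ.2

theorem cos_lt_one : Real.cos φ < 1 := by
  rw [← Real.cos_zero]
  exact Real.cos_lt_cos_of_nonneg_of_le_pi le_rfl hφ.2.le hφ.1

theorem sqrt_cos_pos : 0 < √((1 + Real.cos φ) / 2) := by
  have := neg_one_lt_cos hφ
  exact Real.sqrt_pos.2 (by linarith)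

theorem le_norm_one_add_gammaC (t : ℝ) :
    √((1 + Real.cos φ) / 2) * (1 + ‖gammaC φ t‖) ≤ ‖1 + gammaC φ t‖ := by
  refine le_norm_one_add (neg_one_lt_cos hφ).le (cos_lt_one hφ).le ?_
  rw [gammaC_re, norm_gammaC, mul_comm]

theorem lineConv_rational {b k : ℕ} (h : b + 2 ≤ k) :
    LineConv hJ φ (fun z => (leftMul (sl hJ (z ^ b * ((1 + z) ^ k)⁻¹)) : V →L[ℝ] V)) := by
  have hκ := sqrt_cos_pos hφ
  refine lineConv_of_le hJ (fun t ht => continuousAt_leftMul_sl hJ (differentiableAt_rational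
    (one_add_ne_zero_of_bound hκ (le_norm_one_add_gammaC hφ t)) b k).continuousAt)
    (((integrable_decayFun one_pos).const_mul (√((1 + Real.cos φ) / 2) ^ k)⁻¹).const_mul
      ‖(1 : V →L[ℝ] V)‖) fun t ht => (norm_leftMul_sl_le hJ _).trans ?_
  have := rational_bound hκ h (z := gammaC φ t) (by rw [norm_gammaC]; exact abs_pos.2 ht)
    (le_norm_one_add_gammaC hφ t)
  rw [norm_gammaC, decayFun_abs] at this
  gcongr

theorem lineInt_rational {b k : ℕ} (h : b + 2 ≤ k) :
    lineInt hJ φ (fun z => (leftMul (sl hJ (z ^ b * ((1 + z) ^ k)⁻¹)) : V →L[ℝ] V)) = 0 := by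
  have hκ := sqrt_cos_pos hφ
  have hq : ∀ r > 0, ∀ ψ ∈ Icc (-φ) φ, √((1 + Real.cos φ) / 2) *
      (1 + ‖(⟨(polarPt r ψ).1, (polarPt r ψ).2⟩ : ℂ)‖) ≤
      ‖1 + (⟨(polarPt r ψ).1, (polarPt r ψ).2⟩ : ℂ)‖ := fun r hr ψ hψ => by
    refine le_norm_one_add (neg_one_lt_cos hφ).le (cos_lt_one hφ).le ?_
    rw [polarPt_re, norm_polarPt hr, ← Real.cos_abs ψ]
    gcongr
    exact Real.cos_le_cos_of_nonneg_of_le_pi (abs_nonneg ψ) hφ.2.le (abs_le.2 hψ)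
  refine lineInt_eq_zero_of_right hJ
    (C := ‖(1 : V →L[ℝ] V)‖ * (√((1 + Real.cos φ) / 2) ^ k)⁻¹) hφ.1.le one_pos
    (fun r hr ψ hψ => HasCR.of_differentiableAt hJ (differentiableAt_rational
      (one_add_ne_zero_of_bound hκ (hq r hr ψ hψ)) b k))
    (fun r hr ψ hψ => (norm_leftMul_sl_le hJ _).trans ?_) (lineConv_rational hJ hφ h)
  have := rational_bound hκ h (by rw [norm_polarPt hr]; exact hr) (hq r hr ψ hψ)
  rw [norm_polarPt hr] at this
  rw [mul_assoc]
  gcongr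

omit hφ in
theorem two_pole_bound {c : ℝ} (hc : 0 ≤ c) (hc' : c < 1) {z : ℂ} (hz : 0 < ‖z‖)
    (h : |z.re| ≤ c * ‖z‖) : 1 + z ≠ 0 ∧ 1 - z ≠ 0 ∧
      ‖2 * ((1 + z)⁻¹ * (1 - z)⁻¹)‖ ≤ 2 * (√((1 - c) / 2) ^ 2)⁻¹ * decayFun 1 ‖z‖ := by
  have hκ : 0 < √((1 - c) / 2) := Real.sqrt_pos.2 (by linarith)
  have h' := abs_le.1 h
  have h1 : √((1 - c) / 2) * (1 + ‖z‖) ≤ ‖1 + z‖ :=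
    le_norm_one_add (c := -c) (by linarith) (by linarith) (by linarith)
  have h2 : √((1 - c) / 2) * (1 + ‖z‖) ≤ ‖1 - z‖ := le_norm_one_sub (by linarith) hc'.le h'.2
  have hp : 0 < √((1 - c) / 2) * (1 + ‖z‖) := by positivity
  refine ⟨norm_pos_iff.1 (hp.trans_le h1), norm_pos_iff.1 (hp.trans_le h2), ?_⟩
  rw [norm_mul, norm_mul, norm_inv, norm_inv, Complex.norm_two, mul_assoc]
  gcongr 2 * ?_
  calc ‖1 + z‖⁻¹ * ‖1 - z‖⁻¹ ≤ (√((1 - c) / 2) * (1 + ‖z‖))⁻¹ * (√((1 - c) / 2) * (1 + ‖z‖))⁻¹ := by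
        gcongr
    _ = (√((1 - c) / 2) ^ 2)⁻¹ * ((1 + ‖z‖) ^ 2)⁻¹ := by
        rw [← mul_inv, ← mul_inv]
        congr 1
        ring
    _ ≤ (√((1 - c) / 2) ^ 2)⁻¹ * decayFun 1 ‖z‖ := by
        gcongr
        rcases le_total ‖z‖ 1 with h1 | h1
        · rw [decayFun_one_of_le hz h1]
          exact inv_le_one_of_one_le₀ (one_le_pow₀ (by linarith))
        · rw [decayFun_one_of_ge h1]
          gcongr
          linarith

omit hφ in
theorem differentiableAt_two_pole {z : ℂ} (h1 : 1 + z ≠ 0) (h2 : 1 - z ≠ 0) :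
    DifferentiableAt ℂ (fun z : ℂ => 2 * ((1 + z)⁻¹ * (1 - z)⁻¹)) z :=
  (differentiableAt_const 2).mul
    ((((differentiableAt_const 1).add differentiableAt_id).inv h1).mul
      (((differentiableAt_const 1).sub differentiableAt_id).inv h2))

omit hφ in
theorem lineConv_two_pole {c : ℝ} (hc' : c < 1) (h : |Real.cos φ| ≤ c) :
    LineConv hJ φ (fun z => (leftMul (sl hJ (2 * ((1 + z)⁻¹ * (1 - z)⁻¹))) : V →L[ℝ] V)) := by
  have hb : ∀ t ≠ 0, |(gammaC φ t).re| ≤ c * ‖gammaC φ t‖ := fun t ht => by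
    rw [gammaC_re, norm_gammaC, abs_mul, abs_abs, mul_comm]
    gcongr
  have hc := (abs_nonneg _).trans h
  have hpos : ∀ t ≠ 0, 0 < ‖gammaC φ t‖ := fun t ht => by rw [norm_gammaC]; exact abs_pos.2 ht
  refine lineConv_of_le hJ (fun t ht => ?_)
    (((integrable_decayFun one_pos).const_mul (2 * (√((1 - c) / 2) ^ 2)⁻¹)).const_mul
      ‖(1 : V →L[ℝ] V)‖) fun t ht => (norm_leftMul_sl_le hJ _).trans ?_
  · obtain ⟨h1, h2, -⟩ := two_pole_bound hc hc' (hpos t ht) (hb t ht)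
    exact continuousAt_leftMul_sl hJ (differentiableAt_two_pole h1 h2).continuousAt
  · have := (two_pole_bound hc hc' (hpos t ht) (hb t ht)).2.2
    rw [norm_gammaC, decayFun_abs] at this
    gcongr

-- On the imaginary axis the function becomes `2 / (1 + t²)` and `ds_J` is `-1`, so the integral is
-- elementary.
omit hφ in
theorem lineInt_two_pole_pi_div_two :
    lineInt hJ (Real.pi / 2)
      (fun z => (leftMul (sl hJ (2 * ((1 + z)⁻¹ * (1 - z)⁻¹))) : V →L[ℝ] V)) =
      (-(2 * Real.pi)) • (1 : V →L[ℝ] V) := by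
  have he : exp (((Real.pi / 2 : ℝ) : ℂ) * I) = I := by
    push_cast
    exact exp_pi_div_two_mul_I
  have h : ∀ t : ℝ, lineIntegrand hJ (Real.pi / 2)
      (fun z => (leftMul (sl hJ (2 * ((1 + z)⁻¹ * (1 - z)⁻¹))) : V →L[ℝ] V)) t =
      (-2 * (1 + t ^ 2)⁻¹) • (1 : V →L[ℝ] V) := by
    intro t
    have hg : gammaC (Real.pi / 2) t = -(t * I) := by
      rw [gammaC]
      split_ifs
      · rw [he]
        push_cast
        ring
      · rw [exp_neg, he, inv_I]
        ring
    have hd : dsC (Real.pi / 2) t = -1 := by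
      rw [dsC]
      split_ifs
      · rw [he, I_mul_I]
      · rw [exp_neg, he, inv_I, neg_mul_neg, I_mul_I]
    have e : (2 * ((1 + -(t * I))⁻¹ * (1 - -(t * I))⁻¹)) * (-1) =
        ((-2 * (1 + t ^ 2)⁻¹ : ℝ) : ℂ) := by
      have : (1 + -(t * I)) * (1 - -(t * I)) = 1 + (t : ℂ) ^ 2 := by
        linear_combination (-(t : ℂ) ^ 2) * I_sq
      rw [← mul_inv, this]
      push_cast
      ring
    rw [lineIntegrand, hg, hd, ← leftMul_mul, ← map_mul, e, sl_ofReal, leftMul_coe]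
  rw [lineInt]
  simp only [h]
  rw [integral_smul_const, integral_const_mul, integral_univ_inv_one_add_sq, neg_mul]

theorem abs_cos_le {ψ : ℝ} (h1 : min φ (Real.pi / 2) ≤ ψ) (h2 : ψ ≤ max φ (Real.pi / 2)) :
    |Real.cos ψ| ≤ |Real.cos φ| := by
  rcases le_total φ (Real.pi / 2) with h | h
  · rw [min_eq_left h] at h1
    rw [max_eq_right h] at h2
    have k1 := Real.cos_nonneg_of_mem_Icc ⟨by linarith [hφ.1], h2⟩
    rw [abs_of_nonneg k1, abs_of_nonneg (Real.cos_nonneg_of_mem_Icc ⟨by linarith [hφ.1], h⟩)]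
    exact Real.cos_le_cos_of_nonneg_of_le_pi hφ.1.le (by linarith [Real.pi_pos]) h1
  · rw [min_eq_right h] at h1
    rw [max_eq_left h] at h2
    have k1 := Real.cos_nonpos_of_pi_div_two_le_of_le h1 (by linarith [hφ.2])
    rw [abs_of_nonpos k1,
      abs_of_nonpos (Real.cos_nonpos_of_pi_div_two_le_of_le h (by linarith [hφ.2]))]
    exact neg_le_neg (Real.cos_le_cos_of_nonneg_of_le_pi (by linarith [Real.pi_pos]) hφ.2.le h2)

/-- Between the angles `φ` and `π/2` one has `|cos ψ| ≤ |cos φ| < 1`, which keeps the contour away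
from the poles `±1`, so it can be turned onto the imaginary axis. -/
theorem lineInt_two_pole :
    lineInt hJ φ (fun z => (leftMul (sl hJ (2 * ((1 + z)⁻¹ * (1 - z)⁻¹))) : V →L[ℝ] V)) =
      (-(2 * Real.pi)) • (1 : V →L[ℝ] V) := by
  have hc' : |Real.cos φ| < 1 := abs_lt.2 ⟨neg_one_lt_cos hφ, cos_lt_one hφ⟩
  have hc := abs_nonneg (Real.cos φ)
  rw [← lineInt_two_pole_pi_div_two hJ]
  have key := lineInt_angle_eq (V := V) hJ (φ₁ := min φ (Real.pi / 2))
    (φ₂ := max φ (Real.pi / 2))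
    (F := fun z => (leftMul (sl hJ (2 * ((1 + z)⁻¹ * (1 - z)⁻¹))) : V →L[ℝ] V))
    (C := ‖(1 : V →L[ℝ] V)‖ * (2 * (√((1 - |Real.cos φ|) / 2) ^ 2)⁻¹)) (δ := 1) min_le_max one_pos
  have hb : ∀ r > 0, ∀ ψ, |ψ| ∈ Icc (min φ (Real.pi / 2)) (max φ (Real.pi / 2)) →
      |(⟨(polarPt r ψ).1, (polarPt r ψ).2⟩ : ℂ).re| ≤
      |Real.cos φ| * ‖(⟨(polarPt r ψ).1, (polarPt r ψ).2⟩ : ℂ)‖ := fun r hr ψ hψ => by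
    rw [polarPt_re, norm_polarPt hr, abs_mul, abs_of_pos hr, ← Real.cos_abs ψ]
    exact mul_le_mul_of_nonneg_right (abs_cos_le hφ hψ.1 hψ.2) hr.le
  have hpos : ∀ r > 0, ∀ ψ, 0 < ‖(⟨(polarPt r ψ).1, (polarPt r ψ).2⟩ : ℂ)‖ := fun r hr ψ => by
    rw [norm_polarPt hr]
    exact hr
  have h1 : LineConv hJ φ
      (fun z => (leftMul (sl hJ (2 * ((1 + z)⁻¹ * (1 - z)⁻¹))) : V →L[ℝ] V)) :=
    lineConv_two_pole hJ hc' le_rfl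
  have h2 : LineConv hJ (Real.pi / 2)
      (fun z => (leftMul (sl hJ (2 * ((1 + z)⁻¹ * (1 - z)⁻¹))) : V →L[ℝ] V)) :=
    lineConv_two_pole hJ hc' (by rw [Real.cos_pi_div_two, abs_zero]; exact hc)
  have key' := key
    (fun r hr ψ hψ => by
      obtain ⟨h1, h2, -⟩ := two_pole_bound hc hc' (hpos r hr ψ) (hb r hr ψ hψ)
      exact HasCR.of_differentiableAt hJ (differentiableAt_two_pole h1 h2))
    (fun r hr ψ hψ => by
      have := (two_pole_bound hc hc' (hpos r hr ψ) (hb r hr ψ hψ)).2.2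
      rw [norm_polarPt hr] at this
      refine (norm_leftMul_sl_le hJ _).trans ?_
      rw [mul_assoc]
      gcongr)
    (le_min hφ.1.le (by positivity))
  rcases le_total φ (Real.pi / 2) with h | h
  · rw [min_eq_left h, max_eq_right h] at key'
    exact key' h1 h2
  · rw [min_eq_right h, max_eq_left h] at key'
    exact (key' h2 h1).symm

end Elementary

/-! ### The `S`-calculus of `z^j (1 + z)^(-j-n-2)`. -/

section RationalCalculus

open Complex Set Filter Topology

variable {T : V →ₗ.[ℝ] V} {D : Submodule ℝ V} {α β c φ : ℝ} {J : ℍ[ℝ]}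

theorem HasCR.const_mul (hJ : J ∈ imSphere) {F : ℂ → V →L[ℝ] V} {z : ℂ} (h : HasCR hJ F z)
    (A : V →L[ℝ] V) : HasCR hJ (fun z => A * F z) z := by
  obtain ⟨F', h1, h2⟩ := h
  refine ⟨(ContinuousLinearMap.mul ℝ (V →L[ℝ] V) A).comp F',
    (ContinuousLinearMap.mul ℝ (V →L[ℝ] V) A).hasFDerivAt.comp z h1, ?_⟩
  change A * F' I = A * F' 1 * leftMul (sl hJ I)
  rw [h2, mul_assoc]

theorem HasCR.add (hJ : J ∈ imSphere) {F G : ℂ → V →L[ℝ] V} {z : ℂ} (h : HasCR hJ F z)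
    (h' : HasCR hJ G z) : HasCR hJ (fun z => F z + G z) z := by
  obtain ⟨F', h1, h2⟩ := h
  obtain ⟨G', h1', h2'⟩ := h'
  refine ⟨F' + G', h1.add h1', ?_⟩
  rw [add_apply, add_apply, h2, h2', add_mul]

/-- `P^a S_L⁻¹(z, T) z^b (1 + z)^(-k)`, where `P = T (1 + T)⁻¹`. -/
def resFun (hJ : J ∈ imSphere) (T : V →ₗ.[ℝ] V) (D : Submodule ℝ V) (a b k : ℕ) (z : ℂ) :
    V →L[ℝ] V :=
  (1 - negOneRes T D) ^ a * mulFun hJ (SL T D) (fun z => z ^ b * ((1 + z) ^ k)⁻¹) z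

variable (h : HasBound T D α β c)
include h

/-- The resolvent equation trades one factor `P = T (1 + T)⁻¹` for `(1 + T)⁻¹` on the left and `s`
on the right, up to a constant operator. -/
theorem HasBound.pow_succ_mul_SL (a : ℕ) {s : ℍ[ℝ]} (hs : s ∈ wedge c) :
    (1 - negOneRes T D) ^ (a + 1) * SL T D s =
      negOneRes T D * ((1 - negOneRes T D) ^ a * SL T D s) * leftMul s -
        negOneRes T D * (1 - negOneRes T D) ^ a := by
  have hc := ((commute_one_sub (negOneRes T D)).pow_right a).eq
  rw [pow_succ, mul_assoc, h.adm.resolvent_equation (h.mem _ (neg_one_mem_wedge h.gt)) (h.mem s hs),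
    ← mul_assoc, ← hc]
  noncomm_ring

/-- Each factor `P` gains one power of `|s|` near zero, up to a bounded remainder. Hence `P^a S_L⁻¹`
is bounded once `a ≥ α`, and Cauchy's formula can be used without a power of `z` in the integrand.
-/
theorem HasBound.norm_pow_mul_SL_le (a : ℕ) : ∃ C ≥ 0, ∀ s ∈ wedge c,
    (‖s‖ ≤ 1 → ‖(1 - negOneRes T D) ^ a * SL T D s‖ ≤ C * (‖s‖ ^ (a - α) + 1)) ∧
    (1 ≤ ‖s‖ → ‖(1 - negOneRes T D) ^ a * SL T D s‖ ≤ C * ‖s‖ ^ (-β)) := by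
  obtain ⟨C, hC, hb⟩ := h.bound
  have hlarge : ∀ s ∈ wedge c, 1 ≤ ‖s‖ → ‖SL T D s‖ ≤ C * ‖s‖ ^ (-β) := fun s hs h1 => by
    have := hb s hs
    rw [powFun] at this
    split_ifs at this with h2
    · have e := le_antisymm h2 h1
      rw [e, Real.one_rpow] at this ⊢
      exact this
    · exact this
  have hsmall : ∃ C' ≥ 0, ∀ s ∈ wedge c, ‖s‖ ≤ 1 →
      ‖(1 - negOneRes T D) ^ a * SL T D s‖ ≤ C' * (‖s‖ ^ (a - α) + 1) := by
    induction a with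
    | zero =>
      refine ⟨C, hC, fun s hs h1 => ?_⟩
      have := hb s hs
      rw [powFun, if_pos h1] at this
      rw [pow_zero, one_mul, Nat.cast_zero, zero_sub]
      nlinarith
    | succ a ih =>
      obtain ⟨C', hC', hb'⟩ := ih
      refine ⟨‖negOneRes T D‖ * C' + ‖negOneRes T D * (1 - negOneRes T D) ^ a‖, by positivity,
        fun s hs h1 => ?_⟩
      have h0 : 0 < ‖s‖ := norm_pos_iff.2 (ne_zero_of_mem_wedge hs)
      have e : ‖s‖ ^ (((a + 1 : ℕ) : ℝ) - α) = ‖s‖ ^ ((a : ℝ) - α) * ‖s‖ := by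
        rw [← Real.rpow_add_one h0.ne']
        congr 1
        push_cast
        ring
      have hp : 0 ≤ ‖s‖ ^ ((a : ℝ) - α) := by positivity
      rw [h.pow_succ_mul_SL a hs, e]
      refine (norm_sub_le _ _).trans ?_
      rw [norm_mul_leftMul]
      have h2 : ‖negOneRes T D * ((1 - negOneRes T D) ^ a * SL T D s)‖ * ‖s‖ ≤
          ‖negOneRes T D‖ * C' * (‖s‖ ^ ((a : ℝ) - α) * ‖s‖ + 1) := by
        calc _ ≤ ‖negOneRes T D‖ * (C' * (‖s‖ ^ ((a : ℝ) - α) + 1)) * ‖s‖ := by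
              gcongr
              refine (norm_mul_le _ _).trans ?_
              gcongr
              exact hb' s hs h1
          _ = ‖negOneRes T D‖ * C' * (‖s‖ ^ ((a : ℝ) - α) * ‖s‖ + ‖s‖) := by ring
          _ ≤ _ := by gcongr
      have h3 : 0 ≤ ‖negOneRes T D * (1 - negOneRes T D) ^ a‖ * (‖s‖ ^ ((a : ℝ) - α) * ‖s‖) := by
        positivity
      linarith
  obtain ⟨C', hC', hb'⟩ := hsmall
  refine ⟨C' + ‖(1 - negOneRes T D) ^ a‖ * C, by positivity, fun s hs => ⟨fun h1 => ?_,
    fun h1 => ?_⟩⟩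
  · refine (hb' s hs h1).trans ?_
    gcongr
    have : 0 ≤ ‖(1 - negOneRes T D) ^ a‖ * C := by positivity
    linarith
  · calc _ ≤ ‖(1 - negOneRes T D) ^ a‖ * ‖SL T D s‖ := norm_mul_le _ _
      _ ≤ ‖(1 - negOneRes T D) ^ a‖ * (C * ‖s‖ ^ (-β)) := by
          gcongr
          exact hlarge s hs h1
      _ ≤ _ := by
          have : 0 ≤ C' * ‖s‖ ^ (-β) := by positivity
          linarith

/-- Bounds with a power that compensates the singularity at zero. -/
theorem HasBound.norm_pow_mul_SL_mul_le {a b : ℕ} (hab : α ≤ a + b) : ∃ C ≥ 0, ∀ s ∈ wedge c,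
    (‖s‖ ≤ 1 → ‖(1 - negOneRes T D) ^ a * SL T D s‖ * ‖s‖ ^ b ≤ C) ∧
    (1 ≤ ‖s‖ → ‖(1 - negOneRes T D) ^ a * SL T D s‖ ≤ C * ‖s‖ ^ (-β)) := by
  obtain ⟨C, hC, hb⟩ := h.norm_pow_mul_SL_le a
  refine ⟨2 * C, by positivity, fun s hs => ⟨fun h1 => ?_, fun h1 => ?_⟩⟩
  · have h0 : 0 < ‖s‖ := norm_pos_iff.2 (ne_zero_of_mem_wedge hs)
    have e1 : ‖s‖ ^ ((a : ℝ) - α) * ‖s‖ ^ b ≤ 1 := by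
      rw [← Real.rpow_natCast, ← Real.rpow_add h0]
      exact Real.rpow_le_one h0.le h1 (by linarith)
    have e2 : ‖s‖ ^ b ≤ 1 := pow_le_one₀ h0.le h1
    calc _ ≤ C * (‖s‖ ^ ((a : ℝ) - α) + 1) * ‖s‖ ^ b := by
          gcongr
          exact (hb s hs).1 h1
      _ = C * (‖s‖ ^ ((a : ℝ) - α) * ‖s‖ ^ b + ‖s‖ ^ b) := by ring
      _ ≤ C * (1 + 1) := by gcongr
      _ = 2 * C := by ring
  · refine ((hb s hs).2 h1).trans ?_
    have : 0 ≤ C * ‖s‖ ^ (-β) := by positivity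
    linarith

theorem HasBound.remainder_eq (hJ : J ∈ imSphere) (a : ℕ) {z : ℂ} (hz : z ∈ cwedge c) :
    negOneRes T D * ((1 - negOneRes T D) ^ a * SL T D (sl hJ z)) * leftMul (sl hJ (1 + z)) =
      (1 - negOneRes T D) ^ a * SL T D (sl hJ z) + negOneRes T D * (1 - negOneRes T D) ^ a := by
  have e3 := h.pow_succ_mul_SL a ((sl_mem_wedge hJ).2 hz)
  rw [pow_succ', mul_assoc, sub_mul, one_mul, sub_eq_iff_eq_add] at e3
  rw [map_add, map_one, leftMul_add, leftMul_one, mul_add, mul_one]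
  conv_rhs => rw [e3]
  abel

variable (hJ : J ∈ imSphere) (hφ : φ ∈ Ioo 0 Real.pi) (hcφ : Real.cos φ < c) (hβ : 0 < β)
include hφ hcφ hβ

theorem HasBound.lineConv_resFun {a b k : ℕ} (hab : α ≤ a + b) (hk : b + 1 ≤ k) :
    LineConv hJ φ (resFun hJ T D a b k) := by
  obtain ⟨C, hC, hb⟩ := h.norm_pow_mul_SL_mul_le hab
  have hκ := sqrt_cos_pos hφ
  set κ := √((1 + Real.cos φ) / 2) with hκdef
  have hm : ∀ t ≠ 0, gammaC φ t ∈ cwedge c := fun t ht => gammaC_mem_cwedge hcφ ht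
  refine lineConv_of_le hJ (fun t ht => ?_)
    ((integrable_decayFun (δ := min β 1) (lt_min hβ one_pos)).const_mul (C * (κ ^ k)⁻¹))
    fun t ht => ?_
  · refine continuousAt_const.mul ((h.continuousAt_SL hJ (hm t ht)).mul
      (continuousAt_leftMul_sl hJ (differentiableAt_rational
        (one_add_ne_zero_of_bound hκ (le_norm_one_add_gammaC hφ t)) b k).continuousAt))
  · have hq := le_norm_one_add_gammaC hφ t
    have hbt := hb _ ((sl_mem_wedge hJ).2 (hm t ht))
    rw [resFun, mulFun, ← mul_assoc, norm_mul_leftMul, norm_sl,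
      norm_mul (gammaC φ t ^ b), norm_inv, norm_pow, norm_pow]
    rw [norm_sl, norm_gammaC] at hbt
    rw [norm_gammaC] at hq ⊢
    have h0 : 0 < |t| := abs_pos.2 ht
    set X := ‖(1 - negOneRes T D) ^ a * SL T D (sl hJ (gammaC φ t))‖
    have hX : 0 ≤ X := norm_nonneg _
    have hCk : 0 ≤ C * (κ ^ k)⁻¹ := by positivity
    rw [decayFun]
    split_ifs with h1
    · have e := pow_mul_inv_le_of_le_one hκ h0.le hq b k
      calc _ ≤ X * ((κ ^ k)⁻¹ * |t| ^ b) := by gcongr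
        _ = (X * |t| ^ b) * (κ ^ k)⁻¹ := by ring
        _ ≤ C * (κ ^ k)⁻¹ := by
            gcongr
            exact hbt.1 h1
        _ ≤ _ := le_mul_of_one_le_right hCk
            (Real.one_le_rpow_of_pos_of_le_one_of_nonpos h0 h1 (by linarith [min_le_right β 1]))
    · have h1' := (not_le.1 h1).le
      have e := pow_mul_inv_le_of_one_le hκ h1' hq (i := 1) hk
      rw [pow_one] at e
      calc _ ≤ (C * |t| ^ (-β)) * ((κ ^ k)⁻¹ * |t|⁻¹) := by
            gcongr
            exact hbt.2 h1'
        _ = C * (κ ^ k)⁻¹ * (|t| ^ (-1 - β)) := by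
            have : |t| ^ (-1 - β) = |t| ^ (-β) * |t|⁻¹ := by
              rw [← Real.rpow_neg_one, ← Real.rpow_add h0]
              congr 1
              ring
            rw [this]
            ring
        _ ≤ _ := by
            gcongr
            exact min_le_left _ _

/-- A factor `P` in front is exchanged for a factor `z` in the integrand; the constant term
integrates a scalar rational function without poles in the sector, which gives zero. -/
theorem HasBound.lineInt_resFun_succ {a b k : ℕ} (hab : α ≤ a + 1 + b) (hk : b + 2 ≤ k) :
    lineInt hJ φ (resFun hJ T D (a + 1) b k) =
      negOneRes T D * lineInt hJ φ (resFun hJ T D a (b + 1) k) := by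
  have := lineInt_relation (V := V) hJ (φ := φ) (F := resFun hJ T D (a + 1) b k)
    (A := negOneRes T D) (B := -(negOneRes T D * (1 - negOneRes T D) ^ a))
    (h.lineConv_resFun hJ hφ hcφ hβ (a := a) (b := b + 1) (k := k)
      (by push_cast; linarith) (by omega)) (lineConv_rational hJ hφ hk) fun t ht => by
      rw [resFun, resFun, mulFun, mulFun, ← mul_assoc,
        h.pow_succ_mul_SL a ((sl_mem_wedge hJ).2 (gammaC_mem_cwedge hcφ ht)), sub_mul, mul_assoc _
        (leftMul _) (leftMul _), ← leftMul_mul, ← map_mul, pow_succ' _ b, mul_assoc _ (_ ^ b)]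
      noncomm_ring
  rw [this, lineInt_rational hJ hφ hk, mul_zero, add_zero]

/-- The identity `R P^a S_L⁻¹ (1 + z) = P^a S_L⁻¹ + R P^a` lowers the power of `1 + z`, again up to
a vanishing scalar integral. -/
theorem HasBound.lineInt_resFun_denom {a k : ℕ} (ha : α ≤ a) (hk : 1 ≤ k) :
    lineInt hJ φ (resFun hJ T D a 0 (k + 1)) =
      negOneRes T D * lineInt hJ φ (resFun hJ T D a 0 k) := by
  have hk' : 0 + 2 ≤ k + 1 := by omega
  have := lineInt_relation (V := V) hJ (φ := φ) (F := resFun hJ T D a 0 (k + 1))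
    (A := negOneRes T D) (B := -(negOneRes T D * (1 - negOneRes T D) ^ a))
    (h.lineConv_resFun hJ hφ hcφ hβ (a := a) (b := 0) (k := k)
      (by push_cast; linarith) (by omega)) (lineConv_rational hJ hφ hk') fun t ht => by
      have hz := one_add_ne_zero_of_bound (sqrt_cos_pos hφ) (le_norm_one_add_gammaC hφ t)
      have hs := (sl_mem_wedge hJ).2 (gammaC_mem_cwedge hcφ ht)
      set z := gammaC φ t
      have e1 : z ^ 0 * ((1 + z) ^ k)⁻¹ = (1 + z) * (z ^ 0 * ((1 + z) ^ (k + 1))⁻¹) := by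
        field_simp
        ring
      have e2 := eq_sub_of_add_eq (h.remainder_eq hJ a (gammaC_mem_cwedge hcφ ht)).symm
      rw [resFun, resFun, mulFun, mulFun, e1]
      generalize z ^ 0 * ((1 + z) ^ (k + 1))⁻¹ = w
      rw [map_mul, leftMul_mul, ← mul_assoc, e2]
      generalize (leftMul (sl hJ (1 + z)) : V →L[ℝ] V) = u
      generalize (leftMul (sl hJ w) : V →L[ℝ] V) = u'
      noncomm_ring
  rw [this, lineInt_rational hJ hφ hk', mul_zero, add_zero]

omit h hβ hcφ in
theorem cos_le_cos_of_mem_left {ψ : ℝ} (hψ : ψ ∈ Icc φ (-φ + 2 * Real.pi)) :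
    Real.cos ψ ≤ Real.cos φ := by
  rcases le_total ψ Real.pi with h | h
  · exact Real.cos_le_cos_of_nonneg_of_le_pi hφ.1.le h hψ.1
  · rw [← Real.cos_two_pi_sub ψ]
    exact Real.cos_le_cos_of_nonneg_of_le_pi hφ.1.le (by linarith) (by linarith [hψ.2])

omit h hφ hcφ hβ in
theorem inv_add_inv_eq {z : ℂ} (h1 : 1 + z ≠ 0) (h2 : 1 - z ≠ 0) :
    2 * ((1 + z)⁻¹ * (1 - z)⁻¹) = (1 + z)⁻¹ + (1 - z)⁻¹ := by
  field_simp
  ring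

/-- The integrand without its singularity at `-1`. -/
def regPart (hJ : J ∈ imSphere) (T : V →ₗ.[ℝ] V) (D : Submodule ℝ V) (a : ℕ) (z : ℂ) : V →L[ℝ] V :=
  negOneRes T D * ((1 - negOneRes T D) ^ a * SL T D (sl hJ z)) +
    negOneRes T D * (1 - negOneRes T D) ^ a * leftMul (sl hJ (1 - z)⁻¹)

omit hβ in
theorem HasBound.resFun_eq (a : ℕ) {t : ℝ} (ht : t ≠ 0) :
    resFun hJ T D a 0 1 (gammaC φ t) = 1 * regPart hJ T D a (gammaC φ t) +
      -(negOneRes T D * (1 - negOneRes T D) ^ a) *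
        leftMul (sl hJ (2 * ((1 + gammaC φ t)⁻¹ * (1 - gammaC φ t)⁻¹))) := by
  have hz := one_add_ne_zero_of_bound (sqrt_cos_pos hφ) (le_norm_one_add_gammaC hφ t)
  have hz' : 1 - gammaC φ t ≠ 0 := by
    have hp : 0 < ‖gammaC φ t‖ := by rw [norm_gammaC]; exact abs_pos.2 ht
    refine (two_pole_bound (c := |Real.cos φ|) (abs_nonneg _)
      (abs_lt.2 ⟨neg_one_lt_cos hφ, cos_lt_one hφ⟩) hp ?_).2.1
    rw [gammaC_re, norm_gammaC, abs_mul, abs_abs, mul_comm]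
  have hm : gammaC φ t ∈ cwedge c := gammaC_mem_cwedge hcφ ht
  have e := h.remainder_eq hJ a hm
  generalize gammaC φ t = z at hz hz' hm e ⊢
  have hy : (leftMul (sl hJ (1 + z)) : V →L[ℝ] V) * leftMul (sl hJ (1 + z)⁻¹) = 1 := by
    rw [← leftMul_mul, ← map_mul, mul_inv_cancel₀ hz, map_one, leftMul_one]
  rw [resFun, mulFun, regPart, inv_add_inv_eq hz hz', map_add, leftMul_add, pow_zero, one_mul,
    pow_one, ← mul_assoc]
  set X := (1 - negOneRes T D) ^ a * SL T D (sl hJ z)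
  set B := negOneRes T D * (1 - negOneRes T D) ^ a
  have e2 : negOneRes T D * X = (X + B) * leftMul (sl hJ (1 + z)⁻¹) := by
    rw [← e, mul_assoc _ (leftMul _), hy, mul_one]
  rw [e2]
  generalize (leftMul (sl hJ (1 + z)⁻¹) : V →L[ℝ] V) = u
  generalize (leftMul (sl hJ (1 - z)⁻¹) : V →L[ℝ] V) = u'
  noncomm_ring

omit hφ hcφ hβ in
theorem HasBound.hasCR_regPart (a : ℕ) {z : ℂ} (hz : z ∈ cwedge c) (hz' : 1 - z ≠ 0) :
    HasCR hJ (regPart hJ T D a) z :=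
  (((h.hasCR_SL hJ hz).const_mul hJ _).const_mul hJ _).add hJ
    ((HasCR.of_differentiableAt hJ (g := fun z => (1 - z)⁻¹)
      (((differentiableAt_const 1).sub differentiableAt_id).inv hz')).const_mul hJ _)

-- The sum behaves better than its terms, whose decay need not be integrable. Multiplication by `1 +
-- z` turns it into `P^a S_L⁻¹` plus a multiple of `(1 - z)⁻¹`, which is of order `|z|^(-β)` or
-- smaller.
omit hcφ hφ in
theorem HasBound.norm_regPart_le {a : ℕ} (ha : α ≤ a) {κ : ℝ} (hκ : 0 < κ) :
    ∃ C ≥ 0, ∀ z ∈ cwedge c, κ * (1 + ‖z‖) ≤ ‖1 - z‖ →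
      ‖regPart hJ T D a z‖ ≤ C * decayFun (min β 1) ‖z‖ := by
  obtain ⟨C, hC, hb⟩ := h.norm_pow_mul_SL_mul_le (a := a) (b := 0) (by simpa using ha)
  set B := negOneRes T D * (1 - negOneRes T D) ^ a with hB
  set C₁ := ‖negOneRes T D‖ * C + ‖B‖ * κ⁻¹ with hC₁
  set C₂ := C + 2 * (‖B‖ * κ⁻¹) with hC₂
  have hC₁0 : 0 ≤ C₁ := by positivity
  have hC₂0 : 0 ≤ C₂ := by positivity
  refine ⟨2 * C₂ + 4 * C₁, by positivity, fun z hz hq => ?_⟩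
  have h0 : 0 < ‖z‖ := norm_pos_iff.2 (ne_zero_of_mem_cwedge hz)
  have hbz := hb _ ((sl_mem_wedge hJ).2 hz)
  have e := h.remainder_eq hJ a hz
  have hp : 0 < κ * (1 + ‖z‖) := by positivity
  have hz' : 1 - z ≠ 0 := norm_pos_iff.1 (hp.trans_le hq)
  have hinv : ‖(1 - z)⁻¹‖ ≤ κ⁻¹ * (1 + ‖z‖)⁻¹ := by
    rw [norm_inv, ← mul_inv]
    gcongr
  rw [norm_sl, pow_zero, mul_one] at hbz
  set X := (1 - negOneRes T D) ^ a * SL T D (sl hJ z) with hX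
  have hXC : ‖X‖ ≤ C := by
    rcases le_total ‖z‖ 1 with h1 | h1
    · exact hbz.1 h1
    · refine (hbz.2 h1).trans (mul_le_of_le_one_right hC ?_)
      exact Real.rpow_le_one_of_one_le_of_nonpos h1 (by linarith)
  have hG : ‖regPart hJ T D a z‖ ≤ C₁ := by
    refine (norm_add_le _ _).trans (add_le_add ((norm_mul_le _ _).trans ?_) ?_)
    · gcongr
    · rw [norm_mul_leftMul, norm_sl]
      gcongr
      refine hinv.trans (mul_le_of_le_one_right (by positivity) ?_)
      exact inv_le_one_of_one_le₀ (by linarith)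
  have hC₁' : C₁ ≤ 2 * C₂ + 4 * C₁ := by linarith
  rw [decayFun, abs_of_pos h0]
  split_ifs with h1
  · refine (hG.trans hC₁').trans (le_mul_of_one_le_right (by positivity) ?_)
    exact Real.one_le_rpow_of_pos_of_le_one_of_nonpos h0 h1 (by linarith [min_le_right β 1])
  · have h1' := (not_le.1 h1).le
    set δ := min β 1 with hδ
    have hδ1 : δ ≤ 1 := min_le_right _ _
    have hδβ : δ ≤ β := min_le_left _ _
    have e1 : regPart hJ T D a z * leftMul (sl hJ (1 + z)) =
        X + (2 : ℝ) • (B * leftMul (sl hJ (1 - z)⁻¹)) := by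
      have e3 : (leftMul (sl hJ (1 - z)⁻¹) : V →L[ℝ] V) * leftMul (sl hJ (1 + z)) =
          (2 : ℝ) • leftMul (sl hJ (1 - z)⁻¹) - 1 := by
        have : (1 - z)⁻¹ * (1 + z) = (1 - z)⁻¹ + (1 - z)⁻¹ - 1 := by
          field_simp
          ring
        rw [← leftMul_mul, ← map_mul, this, map_sub, map_add, map_one, leftMul_sub, leftMul_add,
          leftMul_one, two_smul]
      rw [regPart, add_mul, e, mul_assoc _ (leftMul _), e3, mul_sub, mul_one, mul_smul_comm]
      abel
    have e2 : ‖regPart hJ T D a z‖ * ‖1 + z‖ ≤ C₂ * ‖z‖ ^ (-δ) := by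
      rw [← norm_sl hJ (1 + z), ← norm_mul_leftMul, e1]
      refine (norm_add_le _ _).trans ?_
      rw [norm_smul, norm_mul_leftMul, norm_sl, Real.norm_ofNat, hC₂, add_mul]
      refine add_le_add ((hbz.2 h1').trans ?_) ?_
      · gcongr
      · rw [mul_assoc 2, mul_assoc]
        gcongr
        refine hinv.trans ?_
        gcongr
        rw [← Real.rpow_neg_one]
        calc (1 + ‖z‖) ^ (-1 : ℝ) ≤ ‖z‖ ^ (-1 : ℝ) :=
              Real.rpow_le_rpow_of_nonpos h0 (by linarith) (by norm_num)
          _ ≤ ‖z‖ ^ (-δ) := Real.rpow_le_rpow_of_exponent_le h1' (by linarith)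
    have e4 : ‖z‖ - 1 ≤ ‖1 + z‖ := by
      have := norm_sub_norm_le z (-1)
      rw [norm_neg, norm_one, sub_neg_eq_add, add_comm z] at this
      exact this
    have hGn := norm_nonneg (regPart hJ T D a z)
    have hpz : 0 ≤ ‖z‖ ^ (-δ) := by positivity
    have e5 : ‖regPart hJ T D a z‖ * ‖z‖ ≤ (2 * C₂ + 4 * C₁) * ‖z‖ ^ (-δ) := by
      -- Division by `1 + z` is harmless only away from `-1`; for `1 < |z| ≤ 2` the uniform bound
      -- `C₁` is used instead.
      rcases le_total ‖z‖ 2 with h2 | h2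
      · have k1 : (1 / 2 : ℝ) ≤ ‖z‖ ^ (-δ) := by
          calc (1 / 2 : ℝ) ≤ ‖z‖⁻¹ := by
                rw [one_div]
                gcongr
            _ = ‖z‖ ^ (-1 : ℝ) := (Real.rpow_neg_one _).symm
            _ ≤ ‖z‖ ^ (-δ) := Real.rpow_le_rpow_of_exponent_le h1' (by linarith)
        calc _ ≤ C₁ * 2 := by gcongr
          _ ≤ (2 * C₂ + 4 * C₁) * (1 / 2) := by linarith
          _ ≤ _ := by gcongr
      · have k1 : ‖regPart hJ T D a z‖ * ‖z‖ ≤ 2 * (‖regPart hJ T D a z‖ * ‖1 + z‖) := by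
          have := mul_le_mul_of_nonneg_left e4 hGn
          nlinarith
        refine k1.trans ((mul_le_mul_of_nonneg_left e2 two_pos.le).trans ?_)
        have := mul_nonneg hC₁0 hpz
        nlinarith
    refine le_of_mul_le_mul_right (e5.trans_eq ?_) h0
    have e6 : ‖z‖ ^ (-δ) = ‖z‖ ^ (-1 - δ) * ‖z‖ := by
      rw [← Real.rpow_add_one h0.ne']
      congr 1
      ring
    rw [e6, mul_assoc]

/-- Cauchy's formula at the point `-1`. -/
theorem HasBound.lineInt_resFun_one {a : ℕ} (ha : α ≤ a) :
    lineInt hJ φ (resFun hJ T D a 0 1) =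
      (2 * Real.pi) • (negOneRes T D * (1 - negOneRes T D) ^ a) := by
  have hcos : |Real.cos φ| < 1 := abs_lt.2 ⟨neg_one_lt_cos hφ, cos_lt_one hφ⟩
  have c1 := h.lineConv_resFun hJ hφ hcφ hβ (a := a) (b := 0) (k := 1) (by simpa using ha) le_rfl
  have c2 : LineConv hJ φ
      (fun z => (leftMul (sl hJ (2 * ((1 + z)⁻¹ * (1 - z)⁻¹))) : V →L[ℝ] V)) :=
    lineConv_two_pole hJ hcos le_rfl
  have c3 : LineConv hJ φ (regPart hJ T D a) := by
    refine (c1.add hJ (c2.const_mul hJ (negOneRes T D * (1 - negOneRes T D) ^ a))).congr hJ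
      fun t ht => ?_
    rw [Pi.add_apply, h.resFun_eq hJ hφ hcφ a ht]
    noncomm_ring
  have hκ : 0 < √((1 - Real.cos φ) / 2) := by
    have := cos_lt_one hφ
    exact Real.sqrt_pos.2 (by linarith)
  obtain ⟨C, hC, hb⟩ := h.norm_regPart_le hJ hβ ha hκ
  have hre : ∀ r > 0, ∀ ψ ∈ Icc φ (-φ + 2 * Real.pi),
      (⟨(polarPt r ψ).1, (polarPt r ψ).2⟩ : ℂ).re ≤
        Real.cos φ * ‖(⟨(polarPt r ψ).1, (polarPt r ψ).2⟩ : ℂ)‖ := fun r hr ψ hψ => by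
    rw [polarPt_re, norm_polarPt hr]
    exact mul_le_mul_of_nonneg_right (cos_le_cos_of_mem_left hφ hψ) (le_of_lt hr)
  have hm : ∀ r > 0, ∀ ψ ∈ Icc φ (-φ + 2 * Real.pi),
      (⟨(polarPt r ψ).1, (polarPt r ψ).2⟩ : ℂ) ∈ cwedge c := fun r hr ψ hψ => by
    refine (hre r hr ψ hψ).trans_lt ?_
    rw [norm_polarPt hr]
    exact mul_lt_mul_of_pos_right hcφ hr
  have hq : ∀ r > 0, ∀ ψ ∈ Icc φ (-φ + 2 * Real.pi), √((1 - Real.cos φ) / 2) *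
      (1 + ‖(⟨(polarPt r ψ).1, (polarPt r ψ).2⟩ : ℂ)‖) ≤
      ‖1 - (⟨(polarPt r ψ).1, (polarPt r ψ).2⟩ : ℂ)‖ := fun r hr ψ hψ =>
    le_norm_one_sub (neg_one_lt_cos hφ).le (cos_lt_one hφ).le (hre r hr ψ hψ)
  -- The regular part has no singularity to the left of the contour, so its integral is closed
  -- around the negative axis. The value comes from the two-pole function alone.
  have hzero : lineInt hJ φ (regPart hJ T D a) = 0 := by
    refine lineInt_eq_zero_of_left hJ (C := C) (δ := min β 1) hφ.2.le (lt_min hβ one_pos)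
      (fun r hr ψ hψ => h.hasCR_regPart hJ a (hm r hr ψ hψ) ?_) (fun r hr ψ hψ => ?_) c3
    · have hp : 0 < √((1 - Real.cos φ) / 2) *
          (1 + ‖(⟨(polarPt r ψ).1, (polarPt r ψ).2⟩ : ℂ)‖) := by positivity
      exact norm_pos_iff.1 (hp.trans_le (hq r hr ψ hψ))
    · have := hb _ (hm r hr ψ hψ) (hq r hr ψ hψ)
      rwa [norm_polarPt hr] at this
  rw [lineInt_relation hJ c3 c2 fun t ht => h.resFun_eq hJ hφ hcφ a ht, hzero, mul_zero, zero_add,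
    lineInt_two_pole hJ hφ, mul_smul_comm, mul_one, smul_neg, neg_smul, neg_neg]

/-- The functional calculus of `z^j (1 + z)^(-j-n-2)`. -/
theorem HasBound.lineInt_regularizer {j : ℕ} (hj : α ≤ j) (n : ℕ) :
    lineInt hJ φ (mulFun hJ (SL T D) fun z => z ^ j * ((1 + z) ^ (j + n + 2))⁻¹) =
      (2 * Real.pi) • (negOneRes T D ^ (n + 2) * (1 - negOneRes T D) ^ j) := by
  set R := negOneRes T D with hR
  have hinj : Function.Injective (R ^ j) :=
    injective_pow (h.adm.negOneRes_injective (h.mem _ (neg_one_mem_wedge h.gt))) j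
  -- The integral of `P^j S_L⁻¹ (1 + z)^(-j-n-2)` is computed in two ways. Here all factors `P` are
  -- exchanged for powers of `z`.
  have e1 : ∀ i ≤ j, lineInt hJ φ (resFun hJ T D j 0 (j + n + 2)) =
      R ^ i * lineInt hJ φ (resFun hJ T D (j - i) i (j + n + 2)) := by
    intro i
    induction i with
    | zero => intro _; rw [pow_zero, one_mul, Nat.sub_zero]
    | succ i ih =>
      intro hi
      have e : j - i = j - (i + 1) + 1 := by omega
      have e' : ((j - (i + 1) : ℕ) : ℝ) + 1 + i = j := by
        rw [← Nat.cast_add_one, ← Nat.cast_add]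
        congr 1
        omega
      rw [ih (by omega), e, h.lineInt_resFun_succ hJ hφ hcφ hβ (by rw [e']; exact hj) (by omega),
        ← mul_assoc, ← pow_succ]
  -- Here the power of `1 + z` is lowered to one, where Cauchy's formula applies.
  have e2 : ∀ k, lineInt hJ φ (resFun hJ T D j 0 (k + 1)) =
      R ^ k * lineInt hJ φ (resFun hJ T D j 0 1) := by
    intro k
    induction k with
    | zero => rw [pow_zero, one_mul, zero_add]
    | succ k ih =>
      rw [h.lineInt_resFun_denom hJ hφ hcφ hβ hj (by omega), ih, ← mul_assoc, ← pow_succ']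
  have e3 : lineInt hJ φ (resFun hJ T D 0 j (j + n + 2)) =
      lineInt hJ φ (mulFun hJ (SL T D) fun z => z ^ j * ((1 + z) ^ (j + n + 2))⁻¹) := by
    refine lineInt_congr hJ fun t _ => ?_
    rw [resFun, pow_zero, one_mul]
  have e4 := e1 j le_rfl
  rw [Nat.sub_self, e3, e2 (j + n + 1), h.lineInt_resFun_one hJ hφ hcφ hβ hj, mul_smul_comm,
    ← mul_assoc, ← pow_succ, ← hR] at e4
  ext v
  -- Comparing the two evaluations and cancelling the injective `R^j` leaves the claim.
  refine hinj ?_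
  have e5 : R ^ (j + n + 1 + 1) = R ^ j * R ^ (n + 2) := by rw [← pow_add]; congr 1
  rw [e5, mul_assoc, ← mul_smul_comm] at e4
  exact (congrArg (fun X : V →L[ℝ] V => X v) e4).symm

end RationalCalculus

/-! ### Existence of regularizers. -/

section Existence

open Complex Set Filter Topology

variable {T : V →ₗ.[ℝ] V} {D : Submodule ℝ V} {α β θ φ ω c : ℝ} {J : ℍ[ℝ]}

theorem cos_mul_norm_le_of_mem_sector (hθ : θ ≤ Real.pi) {s : ℍ[ℝ]} (hs : s ∈ sector θ) :
    Real.cos θ * ‖s‖ ≤ s.re := by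
  obtain ⟨h0, h1⟩ := hs
  have hp := norm_pos_iff.2 h0
  have hle := abs_le.1 (abs_re_le_norm s)
  have h2 := Real.cos_le_cos_of_nonneg_of_le_pi (Real.arccos_nonneg _) hθ h1.le
  rw [Real.cos_arccos, le_div_iff₀ hp] at h2
  · exact h2
  · rw [le_div_iff₀ hp]
    linarith
  · rw [div_le_iff₀ hp]
    linarith

/-- The regularizers `s^j (1 + s)^(-m)`. -/
def rationalFun (j m : ℕ) (s : ℍ[ℝ]) : ℍ[ℝ] := s ^ j * ((1 + s) ^ m)⁻¹

theorem one_add_ne_zero_of_mem_csec (hθ : θ ∈ Ioo 0 Real.pi) {z : ℂ} (hz : z ∈ csec θ) :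
    1 + z ≠ 0 := by
  have h := cos_mul_norm_le_of_mem_sector hθ.2.le ((sl_mem_sector basisUnit_one_mem_imSphere).2 hz)
  rw [norm_sl, sl_re] at h
  exact one_add_ne_zero_of_bound (sqrt_cos_pos hθ)
    (le_norm_one_add (neg_one_lt_cos hθ).le (cos_lt_one hθ).le h)

theorem represents_rationalFun (hθ : θ ∈ Ioo 0 Real.pi) (j m : ℕ) :
    Represents θ (rationalFun j m) (fun z => z ^ j * ((1 + z) ^ m)⁻¹) where
  diff z hz := differentiableAt_rational (one_add_ne_zero_of_mem_csec hθ hz) j m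
  map_conj z _ := by
    simp only [map_mul, map_inv₀, map_pow, map_add, map_one]
  eq J hJ z _ := by
    simp only [rationalFun, map_mul, map_inv₀, map_pow, map_add, map_one]

theorem hasDecay_rationalFun (hθ : θ ∈ Ioo 0 Real.pi) (hβ : 0 < β) {j k m : ℕ} (hj : 3 * α ≤ j)
    (hm : j + k + 2 ≤ m) :
    HasDecay (3 * α) (3 * β) θ (rationalFun j m * fun s => s ^ k) := by
  have hκ := sqrt_cos_pos hθ
  set κ := √((1 + Real.cos θ) / 2)
  -- The function is `O(|s|^(j+k))` at zero and `O(|s|^(-2))` at infinity, so `δ = 1` works with `j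
  -- ≥ 3α` and `β > 0`.
  refine ⟨1, one_pos, (κ ^ m)⁻¹, by positivity, fun s hs => ?_⟩
  have h0 : 0 < ‖s‖ := norm_pos_iff.2 hs.1
  have hq := le_norm_one_add_quaternion (neg_one_lt_cos hθ).le (cos_lt_one hθ).le
    (cos_mul_norm_le_of_mem_sector hθ.2.le hs)
  have e : ‖(rationalFun j m * fun s => s ^ k : ℍ[ℝ] → ℍ[ℝ]) s‖ = ‖s‖ ^ (j + k) * (‖1 + s‖ ^ m)⁻¹ := by
    rw [Pi.mul_apply, rationalFun, norm_mul, norm_mul, norm_inv, norm_pow, norm_pow, norm_pow,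
      pow_add]
    ring
  rw [e]
  refine ⟨fun h1 => ?_, fun h1 => ?_⟩
  · refine (pow_mul_inv_le_of_le_one hκ h0.le hq (j + k) m).trans ?_
    gcongr
    rw [← Real.rpow_natCast]
    refine Real.rpow_le_rpow_of_exponent_ge h0 h1 ?_
    push_cast
    have : (0 : ℝ) ≤ k := k.cast_nonneg
    linarith
  · refine (pow_mul_inv_le_of_one_le hκ h1 hq hm).trans ?_
    gcongr
    rw [← Real.rpow_natCast, ← Real.rpow_neg h0.le]
    refine Real.rpow_le_rpow_of_exponent_le h1 ?_
    push_cast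
    linarith

/-- The operator is `R^(n+2) (1 - R)^j`, a product of injective factors. -/
theorem HasBound.injective_calcS (h : HasBound T D α β c) (hJ : J ∈ imSphere)
    (hφ : φ ∈ Ioo 0 θ) (hθ : θ ∈ Ioo 0 Real.pi) (hcφ : Real.cos φ < c) (hβ : 0 < β) {j : ℕ}
    (hj : α ≤ j) (n : ℕ) (hinj : Function.Injective T) :
    Function.Injective (calcS T D φ J (rationalFun j (j + n + 2))) := by
  have h1 := h.mem _ (neg_one_mem_wedge h.gt)
  have hR := h.adm.negOneRes_injective h1
  -- If `v = R v`, then `v` lies in `dom T` and `R T v = v - R v = 0`; so `T v = 0`, and `v = 0` by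
  -- injectivity of `T`.
  have hP : Function.Injective (1 - negOneRes T D : V →L[ℝ] V) := by
    refine (injective_iff_map_eq_zero _).2 fun v hv => ?_
    rw [sub_apply, one_apply_eq_self, sub_eq_zero] at hv
    have hd : v ∈ T.domain := by
      rw [hv]
      exact h.adm.negOneRes_mem h1 v
    have e := h.adm.negOneRes_ap h1 hd
    rw [← hv, sub_self] at e
    have e0 : ap T v = 0 := hR (by rw [e, map_zero])
    rw [ap_of_mem hd] at e0
    have := hinj (e0.trans T.map_zero.symm)
    exact congrArg Subtype.val this
  have hφ' : φ ∈ Ioo 0 Real.pi := ⟨hφ.1, hφ.2.trans hθ.2⟩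
  rw [calcS, pathIntegral_eq hJ hφ hθ.2.le (represents_rationalFun hθ j _),
    h.lineInt_regularizer hJ hφ' hcφ hβ hj, smul_smul, one_div_mul_cancel (by positivity), one_smul]
  exact (injective_pow hR (n + 2)).comp (injective_pow hP j)

theorem HasBound.converges_rationalFun (h : HasBound T D α β c) (hJ : J ∈ imSphere)
    (hφ : φ ∈ Ioo 0 θ) (hθ : θ ∈ Ioo 0 Real.pi) (hcφ : Real.cos φ < c) (hβ : 0 < β) {j k m : ℕ}
    (hj : α ≤ j) (hm : j + k + 2 ≤ m) :
    Converges (SL T D) φ J (rationalFun j m * fun s => s ^ k) := by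
  have hφ' : φ ∈ Ioo 0 Real.pi := ⟨hφ.1, hφ.2.trans hθ.2⟩
  rw [converges_iff hJ hφ hθ.2.le ((represents_rationalFun hθ j m).mul (represents_pow θ k))]
  have hk : (0 : ℝ) ≤ k := k.cast_nonneg
  refine (h.lineConv_resFun hJ hφ' hcφ hβ (a := 0) (b := j + k) (k := m)
    (by push_cast; linarith) (by omega)).congr hJ fun t _ => ?_
  rw [resFun, pow_zero, one_mul]
  congr 1
  ext1 z
  rw [Pi.mul_apply, pow_add]
  ring

/-- The monomials have regularizers. -/
theorem isRegularizer_rationalFun (hα : 1 / 3 ≤ α) (hβ : 0 < β) (hω : ω ∈ Ioo 0 Real.pi)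
    (hT : IsOfType T D α β ω) (hinj : Function.Injective T)
    (hinj_conj : Function.Injective (conj T)) (hθ : θ ∈ Ioo ω Real.pi) (hφ : φ ∈ Ioo ω θ)
    (hJ : J ∈ imSphere) {j : ℕ} (hj : 3 * α ≤ j) (n : ℕ) :
    IsRegularizer T D φ J α β θ (rationalFun j (j + n + 2)) (fun s => s ^ n) := by
  obtain ⟨h1, h2⟩ := cos_half_lt hω ⟨hφ.1, hφ.2.trans hθ.2⟩
  have h := hT.hasBound hω h1
  have hθ' : θ ∈ Ioo 0 Real.pi := ⟨hω.1.trans hθ.1, hθ.2⟩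
  have hφ' : φ ∈ Ioo 0 θ := ⟨hω.1.trans hφ.1, hφ.2⟩
  have hj' : α ≤ j := by linarith
  have hrep := represents_rationalFun hθ' j (j + n + 2)
  have e0 : rationalFun j (j + n + 2) = rationalFun j (j + n + 2) * fun s => s ^ 0 := by
    ext1 s
    rw [Pi.mul_apply, pow_zero, mul_one]
  refine ⟨⟨hrep.isIntrinsic, ?_⟩,
    ⟨(hrep.mul (represents_pow θ n)).isIntrinsic.isLeftSliceHyperholomorphic,
      hasDecay_rationalFun hθ' hβ hj le_rfl⟩, ?_, ?_,
    h.converges_rationalFun hJ hφ' hθ' h2 hβ hj' le_rfl,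
    h.conj_bound.converges_rationalFun hJ hφ' hθ' h2 hβ hj' le_rfl,
    h.injective_calcS hJ hφ' hθ' h2 hβ hj' n hinj,
    h.conj_bound.injective_calcS hJ hφ' hθ' h2 hβ hj' n hinj_conj⟩
  · rw [e0]
    exact hasDecay_rationalFun hθ' hβ hj (by omega)
  · rw [e0]
    exact h.converges_rationalFun hJ hφ' hθ' h2 hβ hj' (by omega)
  · rw [e0]
    exact h.conj_bound.converges_rationalFun hJ hφ' hθ' h2 hβ hj' (by omega)

end Existence

end

end FineStructure

theorem mainTheorem5 {V : Type*} [NormedAddCommGroup V] [NormedSpace ℝ V] [CompleteSpace V]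
    [Module ℍ[ℝ] V] [Module ℍ[ℝ]ᵐᵒᵖ V] [SMulCommClass ℍ[ℝ] ℍ[ℝ]ᵐᵒᵖ V]
    [IsScalarTower ℝ ℍ[ℝ] V] [IsScalarTower ℝ ℍ[ℝ]ᵐᵒᵖ V]
    [NormSMulClass ℍ[ℝ] V] [NormSMulClass ℍ[ℝ]ᵐᵒᵖ V]
    (T : V →ₗ.[ℝ] V) (D : Submodule ℝ V) (α β ω : ℝ)
    (hα : 1 / 3 ≤ α) (hβ : β ∈ Set.Ioc 0 (1 / 3)) (hω : ω ∈ Set.Ioo 0 Real.pi)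
    (hT : FineStructure.IsOfType T D α β ω)
    (hinj : Function.Injective T) (hinj_conj : Function.Injective (FineStructure.conj T))
    (n : ℕ) (θ : ℝ) (hθ : θ ∈ Set.Ioo ω Real.pi) :
    (fun s => s ^ n) ∈ FineStructure.GrowL θ ∧
    (∃ e, ∀ φ ∈ Set.Ioo ω θ, ∀ J ∈ FineStructure.imSphere,
      FineStructure.IsRegularizer T D φ J α β θ e (fun s => s ^ n)) ∧
    ∀ φ ∈ Set.Ioo ω θ, ∀ J ∈ FineStructure.imSphere, ∀ e,
      FineStructure.IsRegularizer T D φ J α β θ e (fun s => s ^ n) →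
      (∀ K ∈ [FineStructure.Qinv T D, FineStructure.P2L T D, FineStructure.FL T D],
        FineStructure.Converges K φ J e ∧ FineStructure.Converges K φ J (e * fun s => s ^ n)) ∧
      FineStructure.hinfS T D φ J e (fun s => s ^ n) = FineStructure.opPow T n ∧
      (-2 : ℝ) • ∑ k ∈ Finset.range n,
          FineStructure.opComp (FineStructure.opPow (FineStructure.conj T) (n - 1 - k))
            (FineStructure.opPow T k) ≤
        FineStructure.hinfQ T D φ J e (fun s => s ^ n) ∧
      (2 * n : ℝ) • FineStructure.opPow T (n - 1) + (2 : ℝ) • ∑ k ∈ Finset.range n,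
          FineStructure.opComp (FineStructure.opPow (FineStructure.conj T) (n - 1 - k))
            (FineStructure.opPow T k) ≤
        FineStructure.hinfP T D φ J e (fun s => s ^ n) ∧
      (-4 : ℝ) • ∑ k ∈ Finset.Icc 1 (n - 1), (k : ℝ) •
          FineStructure.opComp (FineStructure.opPow (FineStructure.conj T) (n - 1 - k))
            (FineStructure.opPow T (k - 1)) ≤
        FineStructure.hinfF T D φ J e (fun s => s ^ n) := by
  -- The regularizer takes `j = ⌈3α⌉₊` and depends on neither `φ` nor `J`; the exponent of its
  -- denominator is `j + n + 2`.
  refine ⟨FineStructure.pow_mem_growL θ n, ⟨FineStructure.rationalFun ⌈3 * α⌉₊ _,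
    fun φ hφ J hJ => FineStructure.isRegularizer_rationalFun hα hβ.1 hω hT hinj hinj_conj hθ hφ hJ
      (Nat.le_ceil _) n⟩, fun φ hφ J hJ e he =>
    FineStructure.hinf_pow hα hβ hω hT hθ hφ hJ he⟩
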